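/- **Model.** Let $d\in\mathbb N$. For $i=1,\dots,d$ let $P_i\subseteq\mathbb R^{K_i}$ be a parameter set, let $(F_{i,\vartheta})_{\vartheta\in P_i}$ be distributions on $\mathbb N_0$, and let $\theta_i\in P_i$; put $\theta=(\theta_1,\dots,\theta_d)$ and $K=\max_iK_i$. Let $(Z_t)_{t\in\mathbb Z}$ be a stationary $d$-dimensional Gaussian series with $\mathbb E Z_{t,i}=0$, $\mathbb E Z_{t,i}^2=1$, and let $X_{t,i}=G_{i}(Z_{t,i})$ with $G_{i}=F_{i,\theta_i}^{-1}\circ\Phi$, where $\Phi$ is the standard normal distribution function and $F^{-1}(u)=\inf\{n: F(n)\ge u\}$. Write $\Gamma_Z(h)=\mathbb E[Z_hZ_0']$, $\Gamma_X(h)=\mathrm{Cov}(X_h,X_0)$. For parameters $\vartheta$ let $c_{i,k}(\vartheta_i)=\mathbb E[F_{i,\vartheta_i}^{-1}(\Phi(\xi))H_k(\xi)]$, $\xi\sim N(0,1)$, with the probabilists' Hermite polynomials $H_k$, and $$\ell_{ij;\vartheta}(u)=\sum_{k\ge1}\frac{c_{i,k}(\vartheta_i)c_{j,k}(\vartheta_j)}{k!}u^k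 ,\qquad u\in[-1,1].$$ Let $g_{ij;\vartheta}$ be the inverse of $\ell_{ij;\vartheta}$, extended by $-1$ below and by $+1$ above the range of $\ell_{ij;\vartheta}$. **Estimators.** Let $L<T$, $N=T-L\ge 1$, $s\in\mathbb N_0$, $q=Ld^2$. Let $\mathbf\Gamma_Z$, $\mathbf\Gamma_X$ be the $Ld\times Ld$ covariance matrices of $(Z_t',\dots,Z_{t-L+1}')'$ and $(X_t',\dots,X_{t-L+1}')'$. With $\tilde X_t=X_t-\mathbb E X_t$ let $$\widehat{\mathbf\Gamma}_X=\frac1N\sum_{t=L}^{T-1}\tilde{\mathbf X}_t\tilde{\mathbf X}_t',\qquad \tilde{\mathbf X}_t=(\tilde X_t',\dots,\tilde X_{t-L+1}')' .$$ Let $\widehat\theta$ be any measurable estimator of $\theta$, and let $\widehat{\mathbf\Gamma}_Z$ be obtained from $\widehat{\mathbf\Gamma}_X$ by applying $g_{ij;\widehat\theta}$ to each entry that belongs to the components $i,j$. For a matrix $A$ let $\|A\|_s=\sup\{|v'Av| : v\in\mathcal K(2s)\}$, $\mathcal K(2s)=\{v\in\mathbb R^{Ld}:\|v\|_2\le1,\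 \|v\|_0\le2s\}$. **Assumptions.** Let $C_{i,n}(\vartheta)=F_{i,\vartheta}(n)$. * There is $\mathbf c_Z\in(0,1)$ with $|\Gamma_{Z,ij}(h)|<\mathbf c_Z$ for $h\ne0$ and all $i,j$, and for $h=0$ and $i\ne j$. * Each $C_{i,n}$ is differentiable on $P_i$, and each $\vartheta\in P_i$ has open neighbourhoods $S\subseteq P_i$ (possibly different ones) with: $\sup_{S}\sum_n n^p F_{i,\cdot}(\{n\})<\infty$ for some $p>2$; $\sup_{S}\sum_n(1-C_{i,n})^{-1/2}\|\nabla C_{i,n}\|_1<\infty$ (with $0^{-1/2}\cdot0=0$); $\inf_SC_{i,n}>0$ for some $n$. * For some $c_0=c_0(s)\ge1$: $\mathbb P[|v'(\widehat{\mathbf\Gamma}_X-\mathbf\Gamma_X)v|>c_0x]\le a_1e^{-a_2N\min\{x,x^2\}}$ for all $v\in\mathcal K(2s)$, $x>0$. * $\mathbb P[\|\widehat\theta-\theta\|_{\max}>x]\le b_1dKe^{-b_2T\min\{x,x^2\}}$ for all $x>0$. **The factor $Q$.** Let $Q_{i,n}=\Phi^{-1}(C_{i,n})$ and, with sums over the $n$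 with $0<C_{i,n}<1$, $$m_i^{(k)}(u)=\tfrac1{\sqrt{2\pi}}\sum_ne^{-Q_{i,n}^2/(2u)}|Q_{i,n}|^k,\quad \mu_i^{(k)}(u)=\tfrac1{\sqrt{2\pi}}\sum_ne^{-Q_{i,n}^2/(2u)}|Q_{i,n}|^k\|\nabla Q_{i,n}\|_1,\quad \Delta_i=\sum_nn\|\nabla C_{i,n}\|_1,$$ as functions of $\vartheta_i$ with values in $[0,\infty]$. Let $\Theta_i(\varepsilon)=\{\vartheta_i:\|\vartheta_i-\theta_i\|_{\max}\le\varepsilon\}$. With suprema over $i$ and $\vartheta_i\in\Theta_i(\varepsilon)$ put $\Delta(\varepsilon)=\sup\Delta_i$, $$M(c,\varepsilon)=\sup\max_{k=0,3}m_i^{(k)}(1+c),\quad \mu(c,\varepsilon)=\sup\max_{k=0,3}\mu_i^{(k)}(1+c),$$ $$M_1(c,\varepsilon)=\sup\frac1{m_i^{(0)}(1-c)^2},\quad M_2(c,\varepsilon)=\sup\max_{k=0,2}\frac{m_i^{(k)}(\frac1{1-c})^2}{m_i^{(0)}(1-c)^4},$$ $$D=2M_1(\tfrac12,\varepsilon)^{1/2}\max\{3\Delta(\varepsilon),1\},\qquad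 R=\Big(8\pi M_1(0,\varepsilon)+\frac{24\pi}{(1-\mathbf c_Z^2)^2}M_2(\mathbf c_Z,\varepsilon)\Big)\|\mathbf\Gamma_Z\|_s,$$ $$S=\frac{12}{(1-\mathbf c_Z^2)^{7/2}}M(\mathbf c_Z,\varepsilon)\mu(\mathbf c_Z,\varepsilon)\|\mathbf\Gamma_Z\|_s,\qquad T_\varepsilon(c)=\frac6{1-c^2}M_1(c,\varepsilon)M_2(c,\varepsilon).$$ For $\rho\geq 0$ say that $c\in(0,1)$ is *admissible for $\rho$* if $|g_{ij;\vartheta}(x)|\le c$ for every off-diagonal position of $\mathbf\Gamma_X$ (with components $i,j$ and entry $\gamma$), every $\vartheta\in\prod_i\Theta_i(\varepsilon)$ and every $x$ with $|x-\gamma|\le2\rho$. Given $\delta,\tilde\delta,\varepsilon,\tilde\varepsilon$ such that $\Theta_i(\varepsilon)\subseteq P_i$ for all $i$, let $\mathbf c_1$ be admissible for $c_0\tilde\delta$ and $\mathbf c_2$ admissible for $\max\{S^2,1\}\tilde\varepsilon$ (so $\tilde\delta,\varepsilon,\tilde\varepsilon$ have to be small enough for such constants to exist), and put $$Q=4\max\{D,\,4R,\,2T_\varepsilon(\mathbf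 c_2),\,T_\varepsilon(\mathbf c_1)\}\max\{S^2,1\}.$$ **Claim.** (1) There are constants $c_{1,1},c_{1,2},c_{2,1},c_{2,2}>0$, depending only on $a_1,a_2,b_1,b_2$, such that for all $\delta,\tilde\delta,\varepsilon,\tilde\varepsilon>0$ and $\mathbf c_1,\mathbf c_2$ as above, with $\nu=\min\{\delta,\tilde\delta,\varepsilon,\tilde\varepsilon\}$, $$\mathbb P\big[\|\widehat{\mathbf\Gamma}_Z-\mathbf\Gamma_Z\|_s>Q\,c_0(s)\,\delta\big]\le c_{1,1}\exp\!\big(-c_{1,2}N\min\{1,\nu^2,\nu/c_0(s)\}+2s\log(Ld)\big)+c_{2,1}\,dK\exp\!\big(-c_{2,2}T\min\{1,\nu^2\}\big).$$ (2) For every $\kappa>0$ there are constants $C_0,C_1,c,c'>0$, depending only on $a_1,a_2,b_1,b_2,\kappa$, such that, if $N\ge C_1s\log q$, $c_0(s)^2\,s\log q\le\kappa N$ and $\log(dK)\le\kappa s\log q$, then with $\delta=\tilde\delta=\varepsilon=\tilde\varepsilon=\eta:=C_0\sqrt{s\log q/N}$ (and $\mathbf c_1,\mathbf c_2$ as above),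 $$\mathbb P\big[\|\widehat{\mathbf\Gamma}_Z-\mathbf\Gamma_Z\|_s>Q\,c_0(s)\,\eta\big]\le c\,q^{-c'} .$$ (Here $\log 0=0$, and $0^{-c'}=0$, which concerns only the empty cases $L=0$ or $d=0$ or $K=0$.) -/

import Mathlib

open MeasureTheory ProbabilityTheory
open scoped ENNReal

universe u

namespace LatentCount

noncomputable section

/-! ## Gaussian and count distribution functions -/

/-- The standard normal distribution function. -/
def stdCDF (z : ℝ) : ℝ := cdf (gaussianReal 0 1) z

/-- The standard normal quantile function; it is only used at levels strictly between 0 and 1. -/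
def stdQuantile (c : ℝ) : ℝ := sInf {x : ℝ | c ≤ stdCDF x}

/-- `C n`, the distribution function at `n` of a law on the counts. -/
def countCDF (p : PMF ℕ) (n : ℕ) : ℝ := ∑ k ∈ Finset.range (n + 1), (p k).toReal

/-- The generalized inverse of the distribution function of a law on the counts. -/
def countQuantile (p : PMF ℕ) (t : ℝ) : ℕ := sInf {n : ℕ | t ≤ countCDF p n}

/-- The transformation `G` that turns a standard normal variable into a count with law `p`. -/
def transform (p : PMF ℕ) (z : ℝ) : ℝ := (countQuantile p (stdCDF z) : ℝ)

/-! ## The link function and its inverse -/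

/-- The Hermite coefficient of order `k` of `G`, for the probabilists' Hermite polynomials. -/
def hermiteCoeff (p : PMF ℕ) (k : ℕ) : ℝ :=
  ∫ z, transform p z * Polynomial.aeval z (Polynomial.hermite k) ∂(gaussianReal 0 1)

/-- The link function: the sum over `k ≥ 1` of `c_k(p) c_k(q) / k! * x ^ k`. -/
def link (p q : PMF ℕ) (x : ℝ) : ℝ :=
  ∑' k : ℕ, hermiteCoeff p (k + 1) * hermiteCoeff q (k + 1) / ((k + 1).factorial : ℝ) * x ^ (k + 1)

/-- The inverse of the link function on `[-1, 1]`, extended by `-1` below the range of the link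
function and by `1` above it. -/
def linkInv (p q : PMF ℕ) (y : ℝ) : ℝ :=
  sSup (insert (-1) {x : ℝ | x ∈ Set.Icc (-1) 1 ∧ link p q x ≤ y})

/-- `linkInv` inverts a strictly increasing link function. -/
theorem linkInv_link (p q : PMF ℕ) (h : StrictMonoOn (link p q) (Set.Icc (-1) 1)) (x : ℝ)
    (hx : x ∈ Set.Icc (-1 : ℝ) 1) : linkInv p q (link p q x) = x := by
  apply IsLUB.csSup_eq _ ⟨-1, Set.mem_insert _ _⟩
  refine ⟨?_, fun b hb => hb (Or.inr ⟨hx, le_rfl⟩)⟩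
  rintro y (rfl | ⟨hy, hyx⟩)
  · exact hx.1
  · exact (h.le_iff_le hy hx).1 hyx

/-! ## The model -/

/-- A stationary vector count series driven by a latent stationary standard Gaussian series. -/
structure Model {Ω : Type u} [MeasurableSpace Ω] (μ : Measure Ω) where
  /-- the dimension of the series -/
  d : ℕ
  /-- the number of parameters of each marginal distribution -/
  K : Fin d → ℕ
  /-- the parameter set of each marginal distribution -/
  paramSet : ∀ i, Set (Fin (K i) → ℝ)
  /-- the marginal distribution with a given parameter (arbitrary outside the parameter set) -/
  law : ∀ i, (Fin (K i) → ℝ) → PMF ℕ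
  /-- the true parameters -/
  param : ∀ i, Fin (K i) → ℝ
  param_mem : ∀ i, param i ∈ paramSet i
  /-- the latent series -/
  Z : ℤ → Fin d → Ω → ℝ
  gaussian : IsGaussianProcess (fun (t : ℤ × Fin d) (ω : Ω) => Z t.1 t.2 ω) μ
  mean_eq_zero : ∀ t i, ∫ ω, Z t i ω ∂μ = 0
  variance_eq_one : ∀ t i, ∫ ω, Z t i ω ^ 2 ∂μ = 1
  stationary : ∀ (t h : ℤ) (i j : Fin d),
    ∫ ω, Z (t + h) i ω * Z t j ω ∂μ = ∫ ω, Z h i ω * Z 0 j ω ∂μ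

variable {Ω : Type u} [MeasurableSpace Ω] {μ : Measure Ω}

namespace Model

/-- The observed count series. -/
def X (M : Model μ) (t : ℤ) (i : Fin M.d) (ω : Ω) : ℝ :=
  transform (M.law i (M.param i)) (M.Z t i ω)

/-- The largest number of parameters of a marginal distribution. -/
def maxK (M : Model μ) : ℕ := Finset.univ.sup M.K

/-- The latent autocovariances `E[Z_{h,i} Z_{0,j}]`. -/
def acvfZ (M : Model μ) (h : ℤ) (i j : Fin M.d) : ℝ := ∫ ω, M.Z h i ω * M.Z 0 j ω ∂μ

/-- The autocovariances `Cov(X_{h,i}, X_{0,j})` of the counts. -/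
def acvfX (M : Model μ) (h : ℤ) (i j : Fin M.d) : ℝ := covariance (M.X h i) (M.X 0 j) μ

end Model

/-- Block matrices with `L × L` blocks of size `d × d`. -/
abbrev BlockMatrix (L d : ℕ) := Matrix (Fin L × Fin d) (Fin L × Fin d) ℝ

/-- The seminorm of `A` on `2s`-sparse vectors: the supremum of `|v' A v|` over all vectors `v` with
Euclidean norm at most 1 and at most `2s` non-zero entries. -/
def sparseNorm {ι : Type} [Fintype ι] (s : ℕ) (A : Matrix ι ι ℝ) : ℝ :=
  ⨆ v : {v : ι → ℝ // ∑ a, v a ^ 2 ≤ 1 ∧ {a | v a ≠ 0}.ncard ≤ 2 * s}, |v.1 ⬝ᵥ A.mulVec v.1|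

namespace Model

/-- The covariance matrix of `(Z_t', Z_{t-1}', ..., Z_{t-L+1}')'`. -/
def bigZ (M : Model μ) (L : ℕ) : BlockMatrix L M.d :=
  Matrix.of fun a b => M.acvfZ ((b.1 : ℤ) - (a.1 : ℤ)) a.2 b.2

/-- The covariance matrix of `(X_t', X_{t-1}', ..., X_{t-L+1}')'`. -/
def bigX (M : Model μ) (L : ℕ) : BlockMatrix L M.d :=
  Matrix.of fun a b => M.acvfX ((b.1 : ℤ) - (a.1 : ℤ)) a.2 b.2

/-- The centered counts. -/
def centeredX (M : Model μ) (t : ℤ) (i : Fin M.d) (ω : Ω) : ℝ := M.X t i ω - ∫ ω', M.X t i ω' ∂μ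

/-- The sample autocovariance matrix `N⁻¹ 𝒳' 𝒳`, where `N = T - L` and the rows of `𝒳` are
`(X_t', ..., X_{t-L+1}')` for `t = L, ..., T - 1`, after centering. -/
def bigXHat (M : Model μ) (L T : ℕ) (ω : Ω) : BlockMatrix L M.d :=
  Matrix.of fun a b => ((T - L : ℕ) : ℝ)⁻¹ * ∑ t ∈ Finset.Ico (L : ℤ) (T : ℤ),
    M.centeredX (t - (a.1 : ℤ)) a.2 ω * M.centeredX (t - (b.1 : ℤ)) b.2 ω

/-- The plug-in estimator of the latent covariance matrix: entrywise, the inverse of the link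
function with the parameters `ϑ`, applied to the sample autocovariance matrix. -/
def bigZHat (M : Model μ) (L T : ℕ) (ϑ : ∀ i, Fin (M.K i) → ℝ) (ω : Ω) : BlockMatrix L M.d :=
  Matrix.of fun a b =>
    linkInv (M.law a.2 (ϑ a.2)) (M.law b.2 (ϑ b.2)) (M.bigXHat L T ω a b)

/-! ## Moment quantities -/

/-- `C n` as a function of the parameter. -/
def C (M : Model μ) (i : Fin M.d) (n : ℕ) (ϑ : Fin (M.K i) → ℝ) : ℝ := countCDF (M.law i ϑ) n

/-- `Q n`, the standard normal quantile of `C n`, as a function of the parameter. -/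
def Q (M : Model μ) (i : Fin M.d) (n : ℕ) (ϑ : Fin (M.K i) → ℝ) : ℝ := stdQuantile (M.C i n ϑ)

end Model

/-- The 1-norm of the gradient of `f` at `x`. -/
def gradNorm {k : ℕ} (f : (Fin k → ℝ) → ℝ) (x : Fin k → ℝ) : ℝ :=
  ∑ j, |fderiv ℝ f x (Pi.single j 1)|

namespace Model

/-- The sum over `n` of `n` times the 1-norm of the gradient of `C n`. -/
def diagMoment (M : Model μ) (i : Fin M.d) (ϑ : Fin (M.K i) → ℝ) : ℝ≥0∞ :=
  ∑' n : ℕ, ENNReal.ofReal (n * gradNorm (M.C i n) ϑ)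

/-- `m^(k)(x)`: the sum over `n` of `exp(-Q_n² / (2x)) |Q_n|^k / √(2π)`. Levels `C n` equal to 0
or 1, where `Q n` is infinite, contribute 0. -/
def moment (M : Model μ) (i : Fin M.d) (ϑ : Fin (M.K i) → ℝ) (k : ℕ) (x : ℝ) : ℝ≥0∞ :=
  ∑' n : ℕ, if 0 < M.C i n ϑ ∧ M.C i n ϑ < 1 then
    ENNReal.ofReal (Real.exp (-(M.Q i n ϑ ^ 2) / (2 * x)) * |M.Q i n ϑ| ^ k / √(2 * Real.pi))
  else 0

/-- The moment with the additional factor `‖∇ Q n‖₁` in each term. -/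
def gradMoment (M : Model μ) (i : Fin M.d) (ϑ : Fin (M.K i) → ℝ) (k : ℕ) (x : ℝ) : ℝ≥0∞ :=
  ∑' n : ℕ, if 0 < M.C i n ϑ ∧ M.C i n ϑ < 1 then
    ENNReal.ofReal (Real.exp (-(M.Q i n ϑ ^ 2) / (2 * x)) * |M.Q i n ϑ| ^ k
      * gradNorm (M.Q i n) ϑ / √(2 * Real.pi))
  else 0

/-- The parameters of dimension `i` within maximum-norm distance `ε` of the true one. -/
def ball (M : Model μ) (i : Fin M.d) (ε : ℝ) : Set (Fin (M.K i) → ℝ) :=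
  Metric.closedBall (M.param i) ε

/-- `Δ(ε)`. -/
def supDelta (M : Model μ) (ε : ℝ) : ℝ≥0∞ := ⨆ i, ⨆ ϑ ∈ M.ball i ε, M.diagMoment i ϑ

/-- `M(c, ε)`. -/
def supM (M : Model μ) (c ε : ℝ) : ℝ≥0∞ :=
  ⨆ i, ⨆ ϑ ∈ M.ball i ε, max (M.moment i ϑ 0 (1 + c)) (M.moment i ϑ 3 (1 + c))

/-- `μ(c, ε)`. -/
def supMu (M : Model μ) (c ε : ℝ) : ℝ≥0∞ :=
  ⨆ i, ⨆ ϑ ∈ M.ball i ε, max (M.gradMoment i ϑ 0 (1 + c)) (M.gradMoment i ϑ 3 (1 + c))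

/-- `M₁(c, ε)`. -/
def supM1 (M : Model μ) (c ε : ℝ) : ℝ≥0∞ :=
  ⨆ i, ⨆ ϑ ∈ M.ball i ε, 1 / M.moment i ϑ 0 (1 - c) ^ 2

/-- `M₂(c, ε)`. -/
def supM2 (M : Model μ) (c ε : ℝ) : ℝ≥0∞ :=
  ⨆ i, ⨆ ϑ ∈ M.ball i ε,
    max (M.moment i ϑ 0 (1 / (1 - c)) ^ 2 / M.moment i ϑ 0 (1 - c) ^ 4)
      (M.moment i ϑ 2 (1 / (1 - c)) ^ 2 / M.moment i ϑ 0 (1 - c) ^ 4)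

/-! ## The factor in the error bound -/

/-- `D(ε)`. -/
def constD (M : Model μ) (ε : ℝ) : ℝ≥0∞ :=
  M.supM1 (1 / 2) ε ^ (1 / 2 : ℝ) * 2 * max (3 * M.supDelta ε) 1

/-- `R(ε)`. -/
def constR (M : Model μ) (L s : ℕ) (cZ ε : ℝ) : ℝ≥0∞ :=
  (ENNReal.ofReal (8 * Real.pi) * M.supM1 0 ε
    + ENNReal.ofReal (24 * Real.pi * (1 / (1 - cZ ^ 2) ^ 2)) * M.supM2 cZ ε)
    * ENNReal.ofReal (sparseNorm s (M.bigZ L))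

/-- `S(ε)`. -/
def constS (M : Model μ) (L s : ℕ) (cZ ε : ℝ) : ℝ≥0∞ :=
  ENNReal.ofReal (12 / (1 - cZ ^ 2) ^ (7 / 2 : ℝ)) * M.supM cZ ε * M.supMu cZ ε
    * ENNReal.ofReal (sparseNorm s (M.bigZ L))

/-- The constant `T` of the second-order terms; `U` is the same expression with another `c`. -/
def constT (M : Model μ) (c ε : ℝ) : ℝ≥0∞ :=
  ENNReal.ofReal (6 / (1 - c ^ 2)) * M.supM1 c ε * M.supM2 c ε

/-- The factor `Q` in the error bound; `c₁` enters in `T` and `c₂` in `U`. -/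
def constQ (M : Model μ) (L s : ℕ) (cZ ε c₁ c₂ : ℝ) : ℝ≥0∞ :=
  4 * max (max (M.constD ε) (4 * M.constR L s cZ ε)) (max (2 * M.constT c₂ ε) (M.constT c₁ ε))
    * max (M.constS L s cZ ε ^ 2) 1

/-- `c ∈ (0, 1)` bounds the inverse link functions of all off-diagonal entries, for all parameters
within distance `ε` of the true ones, at all arguments within distance `2ρ` of the entry of the
covariance matrix of the counts. -/
def IsInverseBound (M : Model μ) (L : ℕ) (ε : ℝ) (ρ : ℝ≥0∞) (c : ℝ) : Prop :=
  0 < c ∧ c < 1 ∧ ∀ a b : Fin L × Fin M.d, a ≠ b →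
    ∀ ϑ : ∀ i, Fin (M.K i) → ℝ, (∀ i, ϑ i ∈ M.ball i ε) →
      ∀ x : ℝ, ENNReal.ofReal |x - M.bigX L a b| ≤ 2 * ρ →
        |linkInv (M.law a.2 (ϑ a.2)) (M.law b.2 (ϑ b.2)) x| ≤ c

/-- The requirements on the auxiliary radii and on the two constants `c₁ = c(δ')` and `c₂ = c(ε*)`
with `ε* = max {S², 1} ε'`, which enter the factor `Q`: the `ε`-neighbourhoods of the true
parameters lie in the parameter sets, and the inverse link functions stay away from `±1`. -/
def Radii (M : Model μ) (L s : ℕ) (cZ c₀ δ' ε ε' c₁ c₂ : ℝ) : Prop :=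
  (∀ i, M.ball i ε ⊆ M.paramSet i) ∧
    M.IsInverseBound L ε (ENNReal.ofReal (c₀ * δ')) c₁ ∧
    M.IsInverseBound L ε (max (M.constS L s cZ ε ^ 2) 1 * ENNReal.ofReal ε') c₂

/-! ## Assumptions -/

/-- The latent autocorrelations other than the variances are smaller than `cZ < 1`. -/
def BoundedCorrelations (M : Model μ) (cZ : ℝ) : Prop :=
  0 < cZ ∧ cZ < 1 ∧ (∀ (h : ℤ) i j, h ≠ 0 → |M.acvfZ h i j| < cZ) ∧
    ∀ i j, i ≠ j → |M.acvfZ 0 i j| < cZ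

/-- The distribution functions are differentiable in the parameters. -/
def SmoothMarginals (M : Model μ) : Prop :=
  ∀ i, ∀ ϑ ∈ M.paramSet i, ∀ n, DifferentiableAt ℝ (M.C i n) ϑ

/-- Locally uniformly bounded moments of some order larger than 2. -/
def FiniteMoments (M : Model μ) : Prop :=
  ∀ i, ∀ ϑ ∈ M.paramSet i, ∃ S ⊆ M.paramSet i, IsOpen S ∧ ϑ ∈ S ∧ ∃ p : ℝ, 2 < p ∧
    (⨆ ϑ' ∈ S, ∑' n : ℕ, M.law i ϑ' n * ENNReal.ofReal ((n : ℝ) ^ p)) < ∞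

/-- Local uniform boundedness of the sum over `n` of `(1 - C n)^(-1/2) ‖∇ C n‖₁`. -/
def FiniteGradients (M : Model μ) : Prop :=
  ∀ i, ∀ ϑ ∈ M.paramSet i, ∃ S ⊆ M.paramSet i, IsOpen S ∧ ϑ ∈ S ∧
    (⨆ ϑ' ∈ S, ∑' n : ℕ, ENNReal.ofReal (1 - M.C i n ϑ') ^ (-(1 / 2) : ℝ)
      * ENNReal.ofReal (gradNorm (M.C i n) ϑ')) < ∞

/-- Some `C n` is locally bounded away from 0. -/
def PositiveCDF (M : Model μ) : Prop :=
  ∀ i, ∀ ϑ ∈ M.paramSet i, ∃ S ⊆ M.paramSet i, IsOpen S ∧ ϑ ∈ S ∧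
    ∃ n : ℕ, ∃ e : ℝ, 0 < e ∧ ∀ ϑ' ∈ S, e ≤ M.C i n ϑ'

/-- Exponential concentration of the sample autocovariances of the counts along sparse vectors. -/
def ConcentrationX (M : Model μ) (L T s : ℕ) (c₀ a₁ a₂ : ℝ) : Prop :=
  1 ≤ c₀ ∧ ∀ v : Fin L × Fin M.d → ℝ, ∑ a, v a ^ 2 ≤ 1 → {a | v a ≠ 0}.ncard ≤ 2 * s →
    ∀ x : ℝ, 0 < x →
      μ.real {ω | c₀ * x < |v ⬝ᵥ (M.bigXHat L T ω - M.bigX L).mulVec v|}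
        ≤ a₁ * Real.exp (-a₂ * ((T - L : ℕ) : ℝ) * min x (x ^ 2))

/-- Exponential concentration, in the maximum norm, of an estimator of all the parameters. -/
def ConcentrationParam (M : Model μ) (T : ℕ) (θhat : Ω → ∀ i, Fin (M.K i) → ℝ) (b₁ b₂ : ℝ) :
    Prop :=
  ∀ x : ℝ, 0 < x → μ.real {ω | x < ‖θhat ω - M.param‖}
    ≤ b₁ * M.d * M.maxK * Real.exp (-b₂ * T * min x (x ^ 2))

/-- All the assumptions together, with `N = T - L ≥ 1` observations in the sample autocovariances
and a measurable estimator of the parameters. -/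
structure Admissible (M : Model μ) (L T s : ℕ) (cZ c₀ : ℝ) (θhat : Ω → ∀ i, Fin (M.K i) → ℝ)
    (a₁ a₂ b₁ b₂ : ℝ) : Prop where
  lag_lt : L < T
  measurable_estimator : Measurable θhat
  boundedCorrelations : M.BoundedCorrelations cZ
  smoothMarginals : M.SmoothMarginals
  finiteMoments : M.FiniteMoments
  finiteGradients : M.FiniteGradients
  positiveCDF : M.PositiveCDF
  concentrationX : M.ConcentrationX L T s c₀ a₁ a₂
  concentrationParam : M.ConcentrationParam T θhat b₁ b₂

/-- The probability that the estimation error, in the seminorm on `2s`-sparse vectors, exceeds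
`Q c₀ δ`. -/
def errorProb (M : Model μ) (L T s : ℕ) (θhat : Ω → ∀ i, Fin (M.K i) → ℝ)
    (cZ c₀ δ ε c₁ c₂ : ℝ) : ℝ :=
  μ.real {ω | M.constQ L s cZ ε c₁ c₂ * ENNReal.ofReal (c₀ * δ)
    < ENNReal.ofReal (sparseNorm s (M.bigZHat L T (θhat ω) ω - M.bigZ L))}

end Model

end

end LatentCount

/-! The estimator applies, entry by entry, the inverse of an increasing link function ℓ, so
everything rests on lower bounds for ℓ' and upper bounds for ℓ''. Write a count as the sum of the
indicators of {F(n) < Φ(z)}. Mehler's formula (`hasSum_mehler`) then turns the Hermite series of ℓ'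
into the sum, over all pairs of levels (Q_n, Q_m), of the bivariate normal density with correlation
u (`hasSum_pairDensity`). Gaussian bounds on this density are products in the two levels. They bound
ℓ' below by moments at 1 - c, and |ℓ''| above by moments at 1/(1 - c).

Off the diagonal, let u be an entry of the latent matrix Γ, and let D be the sample entry minus ℓ(u)
at the estimated parameters. A second-order expansion of the inverse (`abs_sub_sub_div_le`) gives
the error D/ℓ'(u) + O(D²). Entrywise multiplication by 1/ℓ'(u) need not respect a norm on sparse
vectors. At u = 0, however, ℓ'(0) is the product of the two first Hermite coefficients, so 1/ℓ'(0)
has rank one and only rescales the test vector; what is left of the factor is O(|u|). The Schur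
test, with the row bounds ∑ D_ab² ≤ ‖D‖² and ∑ Γ_ab² ≤ ‖Γ‖ on sparse supports, takes care of this
rest and of the quadratic remainder (`sparseNorm_error_le`). The effect of the estimated parameters
on ℓ(u) is split in the same way at u = 0 (`sparseNorm_offDiag_perturbation_le`).

On the diagonal the true value is 1, the endpoint of the domain of ℓ, and another argument is
needed. Let h be the distance of the estimate from 1, capped at 1/2. Convexity gives V' h ≤ drop,
and ℓ'(v) of order at least (1 - v)^(-1/2) gives √h m(1/(1+h)) ≤ 2 drop. Here drop is the sampling
error plus the increase V' - V of the variance under the estimated parameters. That increase may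
exceed the distance of the distribution functions by a factor of the order of the mean e. But
increments of the distribution function far below the mean are either paid for by the first-moment
distance or bounded through η = F(e/2) (`sum_pos_increments`). In the latter case the concentration
hypothesis itself helps: it bounds the second moment of the sample variance, and since even parts of
functions of Gaussian variables are nonnegatively correlated, it forces √η e² to be at most a
multiple of c₀ (`ConcentrationX.le_mul`). The case analysis is `diagonal_budget`.

Together these give a deterministic statement (`Regular.sparseNorm_bigZHat_sub_le`): if the sample
autocovariances and the parameters are close enough to the truth, with a safety factor α depending
only on a₁ and a₂, the error is at most Q c₀ ν. Nets of unit balls on sparse supports lift the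
concentration along single vectors to the sparse seminorm, and their cardinality is absorbed into
the term 2s log(Ld). For the second claim, C₀ is so large that each exponent beats its prefactor and
still leaves log q. -/

namespace LatentCount

local notation "γ₁" => gaussianReal 0 1

section

/-! ## Hermite polynomials and Mehler's formula -/

/-- The density of the standard normal law. -/
noncomputable def stdPDF (x : ℝ) : ℝ := gaussianPDFReal 0 1 x

theorem stdPDF_eq (x : ℝ) : stdPDF x = (√(2 * Real.pi))⁻¹ * Real.exp (-x ^ 2 / 2) := by
  simp [stdPDF, gaussianPDFReal]

theorem stdPDF_pos (x : ℝ) : 0 < stdPDF x := gaussianPDFReal_pos 0 1 x one_ne_zero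

theorem hasDerivAt_stdPDF (x : ℝ) : HasDerivAt stdPDF (-x * stdPDF x) x := by
  have h : stdPDF = fun x => (√(2 * Real.pi))⁻¹ * Real.exp (-x ^ 2 / 2) := funext stdPDF_eq
  rw [h]
  have h1 : HasDerivAt (fun x : ℝ => -x ^ 2 / 2) (-x) x := by
    have := ((hasDerivAt_pow 2 x).neg).div_const 2
    refine this.congr_deriv ?_
    norm_num
    ring
  refine (h1.exp.const_mul ((√(2 * Real.pi))⁻¹)).congr_deriv ?_
  ring

theorem continuous_stdPDF : Continuous stdPDF :=
  continuous_iff_continuousAt.2 fun x => (hasDerivAt_stdPDF x).continuousAt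

theorem integral_gaussian_eq {E : Type*} [NormedAddCommGroup E] [NormedSpace ℝ E] (f : ℝ → E) :
    ∫ x, f x ∂γ₁ = ∫ x, stdPDF x • f x :=
  integral_gaussianReal_eq_integral_smul one_ne_zero

theorem gaussian_eq_withDensity :
    γ₁ = volume.withDensity (fun x => ENNReal.ofReal (stdPDF x)) :=
  gaussianReal_of_var_ne_zero 0 one_ne_zero

theorem integrable_gaussian_iff {E : Type*} [NormedAddCommGroup E] [NormedSpace ℝ E]
    (f : ℝ → E) : Integrable f γ₁ ↔ Integrable (fun x => stdPDF x • f x) := by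
  rw [gaussian_eq_withDensity,
    integrable_withDensity_iff_integrable_smul' continuous_stdPDF.measurable.ennreal_ofReal (by simp)]
  simp [ENNReal.toReal_ofReal (stdPDF_pos _).le]

theorem integrable_exp_abs_gaussian (t : ℝ) : Integrable (fun w => Real.exp (t * |w|)) γ₁ := by
  refine ((integrable_exp_mul_gaussianReal (μ := 0) (v := 1) t).add
    (integrable_exp_mul_gaussianReal (μ := 0) (v := 1) (-t))).mono' (by fun_prop) ?_
  refine Filter.Eventually.of_forall fun w => ?_
  rw [Real.norm_eq_abs, abs_of_pos (Real.exp_pos _)]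
  simp only [Pi.add_apply]
  rcases abs_cases w with ⟨h, _⟩ | ⟨h, _⟩ <;> rw [h]
  · linarith [Real.exp_pos (-t * w)]
  · have : t * -w = -t * w := by ring
    rw [this]; linarith [Real.exp_pos (t * w)]

theorem integrable_gaussian_of_exp_bound {E : Type*} [NormedAddCommGroup E] {f : ℝ → E}
    (hf : AEStronglyMeasurable f γ₁) (c t : ℝ) (h : ∀ w, ‖f w‖ ≤ c * Real.exp (t * |w|)) :
    Integrable f γ₁ :=
  ((integrable_exp_abs_gaussian t).const_mul c).mono' hf (Filter.Eventually.of_forall h)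

theorem pow_le_factorial_mul_exp {y : ℝ} (hy : 0 ≤ y) (n : ℕ) :
    y ^ n ≤ n.factorial * Real.exp y := by
  have h := Real.pow_div_factorial_le_exp y hy n
  rwa [div_le_iff₀' (by positivity)] at h

theorem norm_add_mul_I_le (x w : ℝ) : ‖(x + w * Complex.I : ℂ)‖ ≤ |x| + |w| := by
  refine (norm_add_le _ _).trans ?_
  simp

theorem integrable_add_mul_I_pow (x : ℝ) (n : ℕ) :
    Integrable (fun w : ℝ => (x + w * Complex.I : ℂ) ^ n) γ₁ := by
  refine integrable_gaussian_of_exp_bound (by fun_prop) (n.factorial * Real.exp |x|) 1 fun w => ?_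
  rw [norm_pow]
  calc ‖(x + w * Complex.I : ℂ)‖ ^ n ≤ (|x| + |w|) ^ n := by
        gcongr; exact norm_add_mul_I_le x w
    _ ≤ n.factorial * Real.exp (|x| + |w|) := pow_le_factorial_mul_exp (by positivity) n
    _ = _ := by rw [Real.exp_add, one_mul, mul_assoc]

theorem integrable_mul_add_mul_I_pow (x : ℝ) (n : ℕ) :
    Integrable (fun w : ℝ => (w : ℂ) * (x + w * Complex.I : ℂ) ^ n) γ₁ := by
  refine integrable_gaussian_of_exp_bound (by fun_prop) (n.factorial * Real.exp |x|) 2 fun w => ?_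
  rw [norm_mul, norm_pow]
  have h0 : ‖(w : ℂ)‖ ≤ Real.exp |w| := by
    rw [Complex.norm_real, Real.norm_eq_abs]
    linarith [Real.add_one_le_exp |w|]
  calc ‖(w : ℂ)‖ * ‖(x + w * Complex.I : ℂ)‖ ^ n ≤ Real.exp |w| * (|x| + |w|) ^ n := by
        gcongr; exact norm_add_mul_I_le x w
    _ ≤ Real.exp |w| * (n.factorial * Real.exp (|x| + |w|)) := by
        gcongr; exact pow_le_factorial_mul_exp (by positivity) n
    _ = _ := by rw [Real.exp_add, two_mul, Real.exp_add]; ring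

/-- Integration by parts for powers of `x + i w` under the standard normal law. -/
theorem integral_mul_add_mul_I_pow (x : ℝ) (n : ℕ) :
    ∫ w : ℝ, (w : ℂ) * (x + w * Complex.I : ℂ) ^ n ∂γ₁
      = n * Complex.I * ∫ w : ℝ, (x + w * Complex.I : ℂ) ^ (n - 1) ∂γ₁ := by
  have hu : ∀ w : ℝ, HasDerivAt (fun w : ℝ => (x + w * Complex.I : ℂ) ^ n)
      (n * (x + w * Complex.I : ℂ) ^ (n - 1) * Complex.I) w := by
    intro w
    have h1 : HasDerivAt (fun w : ℝ => (x + w * Complex.I : ℂ)) Complex.I w := by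
      have := ((Complex.ofRealCLM.hasDerivAt (x := w)).mul_const Complex.I).const_add (x : ℂ)
      simpa using this
    exact h1.pow n
  have hv : ∀ w : ℝ, HasDerivAt (fun w : ℝ => (stdPDF w : ℂ)) ((-w * stdPDF w : ℝ) : ℂ) w :=
    fun w => (hasDerivAt_stdPDF w).ofReal_comp
  have i1 : Integrable (fun w : ℝ => (x + w * Complex.I : ℂ) ^ n * ((-w * stdPDF w : ℝ) : ℂ)) := by
    have := ((integrable_gaussian_iff _).1 (integrable_mul_add_mul_I_pow x n)).neg
    refine this.congr (Filter.Eventually.of_forall fun w => ?_)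
    simp only [Pi.neg_apply, Complex.real_smul]; push_cast; ring
  have i2 : Integrable (fun w : ℝ =>
      (n * (x + w * Complex.I : ℂ) ^ (n - 1) * Complex.I) * (stdPDF w : ℂ)) := by
    have := ((integrable_gaussian_iff _).1 (integrable_add_mul_I_pow x (n - 1))).const_mul
      (n * Complex.I)
    refine this.congr (Filter.Eventually.of_forall fun w => ?_)
    simp only [Complex.real_smul]; ring
  have i3 : Integrable (fun w : ℝ => (x + w * Complex.I : ℂ) ^ n * (stdPDF w : ℂ)) := by
    have := ((integrable_gaussian_iff _).1 (integrable_add_mul_I_pow x n))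
    refine this.congr (Filter.Eventually.of_forall fun w => ?_)
    simp only [Complex.real_smul]; ring
  -- The weight w times the density is minus the derivative of the density, so the factor w is
  -- traded for a derivative of the power.
  have key := integral_mul_deriv_eq_deriv_mul_of_integrable (fun w _ => hu w) (fun w _ => hv w)
    i1 i2 i3
  rw [integral_gaussian_eq, integral_gaussian_eq, ← integral_const_mul]
  have e1 : ∫ w : ℝ, stdPDF w • ((w : ℂ) * (x + w * Complex.I : ℂ) ^ n)
      = -∫ w : ℝ, (x + w * Complex.I : ℂ) ^ n * ((-w * stdPDF w : ℝ) : ℂ) := by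
    rw [← integral_neg]
    congr 1; ext w; simp only [Complex.real_smul]; push_cast; ring
  rw [e1, key, neg_neg]
  congr 1; ext w; simp only [Complex.real_smul]; ring

/-- The probabilists' Hermite polynomials as functions. -/
noncomputable def He (k : ℕ) (x : ℝ) : ℝ := Polynomial.aeval x (Polynomial.hermite k)

theorem derivative_hermite_succ (n : ℕ) :
    Polynomial.derivative (Polynomial.hermite (n + 1))
      = ((n + 1 : ℕ) : Polynomial ℤ) * Polynomial.hermite n := by
  induction n with
  | zero => simp
  | succ n ih =>
    rw [Polynomial.hermite_succ (n + 1)]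
    simp only [Polynomial.derivative_sub, Polynomial.derivative_mul, Polynomial.derivative_X, ih,
      Polynomial.derivative_natCast]
    rw [Polynomial.hermite_succ n]
    push_cast
    ring

theorem hasDerivAt_He (n : ℕ) (x : ℝ) : HasDerivAt (He n) (n * He (n - 1) x) x := by
  have h : HasDerivAt (He n) (Polynomial.aeval x (Polynomial.derivative (Polynomial.hermite n))) x :=
    Polynomial.hasDerivAt_aeval _ x
  cases n with
  | zero => simpa using h
  | succ n => rw [derivative_hermite_succ] at h; simpa [He] using h

theorem He_zero (x : ℝ) : He 0 x = 1 := by simp [He]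

theorem He_succ (n : ℕ) (x : ℝ) : He (n + 1) x = x * He n x - n * He (n - 1) x := by
  have h1 : deriv (He n) x = Polynomial.aeval x (Polynomial.derivative (Polynomial.hermite n)) :=
    (Polynomial.hasDerivAt_aeval _ x).deriv
  rw [(hasDerivAt_He n x).deriv] at h1
  rw [h1, He, Polynomial.hermite_succ]
  simp [He]

theorem continuous_He (n : ℕ) : Continuous (He n) :=
  continuous_iff_continuousAt.2 fun x => (hasDerivAt_He n x).continuousAt

/-- Split off one factor x + iw. Integration by parts on the term with w then reproduces the
three-term recurrence of the Hermite polynomials. The representation as a moment reduces Mehler's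
formula to the integration of an exponential series. -/
theorem He_eq_integral (x : ℝ) (n : ℕ) :
    ∫ w : ℝ, (x + w * Complex.I : ℂ) ^ n ∂γ₁ = (He n x : ℂ) := by
  induction n using Nat.strong_induction_on with
  | _ n ih =>
    cases n with
    | zero => simp [He_zero]
    | succ n =>
      have e : ∀ w : ℝ, (x + w * Complex.I : ℂ) ^ (n + 1)
          = x * (x + w * Complex.I : ℂ) ^ n + Complex.I * (w * (x + w * Complex.I : ℂ) ^ n) := by
        intro w; ring
      simp_rw [e]
      rw [integral_add ((integrable_add_mul_I_pow x n).const_mul _)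
        ((integrable_mul_add_mul_I_pow x n).const_mul _), integral_const_mul, integral_const_mul,
        integral_mul_add_mul_I_pow, ih n (Nat.lt_succ_self n), ih (n - 1) (by omega), He_succ]
      push_cast
      linear_combination (n * (He (n - 1) x : ℂ)) * Complex.I_mul_I

end

/-! ### Mehler's kernel and Mehler's formula -/

section

/-- Mehler's kernel: the density of a standard bivariate normal law with correlation `u` with
respect to the product of its marginals. -/
noncomputable def mehler (u x y : ℝ) : ℝ :=
  (√(1 - u ^ 2))⁻¹ * Real.exp (-(u ^ 2 * x ^ 2 - 2 * u * x * y + u ^ 2 * y ^ 2) / (2 * (1 - u ^ 2)))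

theorem one_sub_sq_pos {u : ℝ} (hu : |u| < 1) : 0 < 1 - u ^ 2 := by
  have := (sq_lt_one_iff_abs_lt_one u).2 hu
  linarith

theorem integrable_exp_sq_gaussian {a : ℝ} (ha : a < 1) :
    Integrable (fun w => Real.exp (a * w ^ 2 / 2)) γ₁ := by
  rw [integrable_gaussian_iff]
  have := (integrable_exp_neg_mul_sq (b := (1 - a) / 2) (by linarith)).const_mul (√(2 * Real.pi))⁻¹
  refine this.congr (Filter.Eventually.of_forall fun w => ?_)
  simp only [smul_eq_mul, stdPDF_eq, mul_assoc, ← Real.exp_add]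
  congr 2; ring

theorem integral_cexp_mul_add_mul_I (z : ℂ) (y : ℝ) :
    ∫ w : ℝ, Complex.exp (z * (y + w * Complex.I)) ∂γ₁ = Complex.exp (z * y - z ^ 2 / 2) := by
  have h := complexMGF_id_gaussianReal (μ := 0) (v := 1) (z * Complex.I)
  simp only [complexMGF, id] at h
  have e : ∀ w : ℝ, Complex.exp (z * (y + w * Complex.I))
      = Complex.exp (z * y) * Complex.exp (z * Complex.I * w) := by
    intro w; rw [← Complex.exp_add]; congr 1; ring
  simp_rw [e]
  rw [integral_const_mul, h, ← Complex.exp_add]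
  congr 1
  simp only [Complex.ofReal_zero, mul_zero, zero_add, NNReal.coe_one, Complex.ofReal_one, one_mul,
    mul_pow, Complex.I_sq]
  ring

/-- A Gaussian integral with quadratic coefficient (1 - u²)/2, whose positivity is the condition |u|
< 1. It is the outer one of the two integrals in Mehler's formula; the inner one is the preceding
moment generating function. -/
theorem integral_mehler_exponent {u : ℝ} (hu : |u| < 1) (x y : ℝ) :
    ∫ w : ℝ, Complex.exp (u * (x + w * Complex.I) * y - (u * (x + w * Complex.I)) ^ 2 / 2) ∂γ₁
      = (mehler u x y : ℂ) := by
  have h1 := one_sub_sq_pos hu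
  rw [integral_gaussian_eq]
  have e : ∀ w : ℝ, stdPDF w •
      Complex.exp (u * (x + w * Complex.I) * y - (u * (x + w * Complex.I)) ^ 2 / 2)
      = ((√(2 * Real.pi))⁻¹ : ℝ) * Complex.exp ((-((1 - u ^ 2) / 2) : ℝ) * (w : ℂ) ^ 2
        + ((u * (y - u * x) : ℝ) * Complex.I) * w + ((u * x * y - u ^ 2 * x ^ 2 / 2 : ℝ) : ℂ)) := by
    intro w
    rw [stdPDF_eq, Complex.real_smul, Complex.ofReal_mul, mul_assoc, Complex.ofReal_exp,
      ← Complex.exp_add]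
    congr 2
    push_cast
    linear_combination (-(u : ℂ) ^ 2 * w ^ 2 / 2) * Complex.I_sq
  simp_rw [e]
  rw [integral_const_mul, integral_cexp_quadratic
    (by rw [Complex.ofReal_re]; linarith)]
  have e2 : ((u * x * y - u ^ 2 * x ^ 2 / 2 : ℝ) : ℂ)
      - ((u * (y - u * x) : ℝ) * Complex.I) ^ 2 / (4 * (-((1 - u ^ 2) / 2) : ℝ))
      = ((-(u ^ 2 * x ^ 2 - 2 * u * x * y + u ^ 2 * y ^ 2) / (2 * (1 - u ^ 2)) : ℝ) : ℂ) := by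
    rw [mul_pow, Complex.I_sq]
    have : ((1 : ℂ) - (u : ℂ) ^ 2) ≠ 0 := by exact_mod_cast h1.ne'
    push_cast
    field_simp
    ring
  rw [e2, mehler]
  have e3 : ((Real.pi : ℂ) / -((-((1 - u ^ 2) / 2) : ℝ) : ℂ)) ^ (1 / 2 : ℂ)
      = ((√(2 * Real.pi) * (√(1 - u ^ 2))⁻¹ : ℝ) : ℂ) := by
    have : ((Real.pi : ℂ) / -((-((1 - u ^ 2) / 2) : ℝ) : ℂ))
        = ((2 * Real.pi / (1 - u ^ 2) : ℝ) : ℂ) := by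
      push_cast; field_simp
    rw [this, show (1 / 2 : ℂ) = ((1 / 2 : ℝ) : ℂ) by push_cast; rfl,
      ← Complex.ofReal_cpow (by positivity), ← Real.sqrt_eq_rpow, Real.sqrt_div' _ h1.le,
      div_eq_mul_inv]
  rw [e3]
  have : √(2 * Real.pi) ≠ 0 := by positivity
  push_cast
  field_simp

theorem hasSum_pow_div_factorial (z : ℂ) :
    HasSum (fun j : ℕ => z ^ j / j.factorial) (Complex.exp z) := by
  have := NormedSpace.expSeries_div_hasSum_exp (𝔸 := ℂ) z
  rwa [← Complex.exp_eq_exp_ℂ] at this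

/-- **Mehler's formula.** -/
theorem hasSum_mehler {u : ℝ} (hu : |u| < 1) (x y : ℝ) :
    HasSum (fun j : ℕ => He j x * He j y * u ^ j / j.factorial) (mehler u x y) := by
  set F : ℕ → ℝ × ℝ → ℂ := fun j p =>
    (u * (x + p.1 * Complex.I) * (y + p.2 * Complex.I)) ^ j / j.factorial with hF
  set b : ℕ → ℝ × ℝ → ℝ := fun j p =>
    ‖(u * (x + p.1 * Complex.I) * (y + p.2 * Complex.I) : ℂ)‖ ^ j / j.factorial with hb
  have hsum : ∀ p, HasSum (fun j => b j p)
      (Real.exp ‖(u * (x + p.1 * Complex.I) * (y + p.2 * Complex.I) : ℂ)‖) := by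
    intro p
    have := NormedSpace.expSeries_div_hasSum_exp (𝔸 := ℝ)
      ‖(u * (x + p.1 * Complex.I) * (y + p.2 * Complex.I) : ℂ)‖
    rwa [← Real.exp_eq_exp_ℝ] at this
  -- By the inequality of the two means, the norm of the exponent is at most |u|/2 times x² + y² +
  -- w² + w'², and the exponential of |u| w²/2 is integrable against the normal law exactly because
  -- |u| < 1.
  have hbound : Integrable (fun p : ℝ × ℝ =>
      Real.exp ‖(u * (x + p.1 * Complex.I) * (y + p.2 * Complex.I) : ℂ)‖) ((γ₁).prod γ₁) := by
    have i1 := (integrable_exp_sq_gaussian hu).mul_prod (integrable_exp_sq_gaussian hu)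
    have i2 := i1.const_mul (Real.exp (|u| * (x ^ 2 + y ^ 2) / 2))
    refine i2.mono' (by fun_prop) (Filter.Eventually.of_forall fun p => ?_)
    rw [Real.norm_eq_abs, abs_of_pos (Real.exp_pos _), ← Real.exp_add, ← Real.exp_add]
    apply Real.exp_le_exp.2
    have n1 : ∀ a b : ℝ, ‖(a + b * Complex.I : ℂ)‖ ^ 2 = a ^ 2 + b ^ 2 := by
      intro a b
      rw [← Complex.normSq_eq_norm_sq, Complex.normSq_add_mul_I]
    have n2 := n1 x p.1
    have n3 := n1 y p.2
    rw [norm_mul, norm_mul, Complex.norm_real, Real.norm_eq_abs]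
    have := abs_nonneg u
    nlinarith [sq_nonneg (‖(x + p.1 * Complex.I : ℂ)‖ - ‖(y + p.2 * Complex.I : ℂ)‖)]
  have key := hasSum_integral_of_dominated_convergence (μ := (γ₁).prod γ₁) (F := F)
    (f := fun p => Complex.exp (u * (x + p.1 * Complex.I) * (y + p.2 * Complex.I))) b
    (fun j => by
      have : Measurable (F j) := by simp only [hF]; fun_prop
      exact this.aestronglyMeasurable)
    (fun j => Filter.Eventually.of_forall fun p => by simp [hF, hb])
    (Filter.Eventually.of_forall fun p => (hsum p).summable)
    (by simp_rw [fun p => (hsum p).tsum_eq]; exact hbound)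
    (Filter.Eventually.of_forall fun p => hasSum_pow_div_factorial _)
  have e1 : ∀ j, ∫ p, F j p ∂((γ₁).prod γ₁)
      = ((He j x * He j y * u ^ j / j.factorial : ℝ) : ℂ) := by
    intro j
    have : ∀ p, F j p = (u ^ j / j.factorial : ℂ)
        * ((x + p.1 * Complex.I : ℂ) ^ j * (y + p.2 * Complex.I : ℂ) ^ j) := by
      intro p; simp only [hF, mul_pow]; ring
    simp_rw [this]
    rw [integral_const_mul, integral_prod_mul (fun w : ℝ => (x + w * Complex.I : ℂ) ^ j)
      (fun w : ℝ => (y + w * Complex.I : ℂ) ^ j), He_eq_integral, He_eq_integral]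
    push_cast; ring
  have e2 : ∫ p : ℝ × ℝ, Complex.exp (u * (x + p.1 * Complex.I) * (y + p.2 * Complex.I))
      ∂((γ₁).prod γ₁) = (mehler u x y : ℂ) := by
    rw [integral_prod]
    · simp_rw [integral_cexp_mul_add_mul_I]
      exact integral_mehler_exponent hu x y
    · refine hbound.mono' (by fun_prop) (Filter.Eventually.of_forall fun p => ?_)
      rw [Complex.norm_exp]
      exact Real.exp_le_exp.2 (Complex.re_le_norm _)
  rw [e2] at key
  simp_rw [e1] at key
  exact_mod_cast key

end

section

/-! ## Hermite expansions of covariances -/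

theorem hasDerivAt_He_mul_stdPDF (n : ℕ) (x : ℝ) :
    HasDerivAt (fun x => He n x * stdPDF x) (-(He (n + 1) x * stdPDF x)) x := by
  refine ((hasDerivAt_He n x).mul (hasDerivAt_stdPDF x)).congr_deriv ?_
  rw [He_succ]; ring

/-- Exponential growth is read off from the representation as a moment of x + iw; it is enough for
all integrability questions below. -/
theorem abs_He_le (n : ℕ) : ∃ c, ∀ x, |He n x| ≤ c * Real.exp (1 * |x|) := by
  refine ⟨n.factorial * ∫ w, Real.exp (1 * |w|) ∂γ₁, fun x => ?_⟩
  have h : |He n x| = ‖∫ w : ℝ, (x + w * Complex.I : ℂ) ^ n ∂γ₁‖ := by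
    rw [He_eq_integral, Complex.norm_real, Real.norm_eq_abs]
  rw [h]
  refine (norm_integral_le_integral_norm _).trans ?_
  have e : n.factorial * (∫ w, Real.exp (1 * |w|) ∂γ₁) * Real.exp (1 * |x|)
      = ∫ w, (n.factorial * Real.exp |x|) * Real.exp (1 * |w|) ∂γ₁ := by
    rw [integral_const_mul, one_mul]; ring
  rw [e]
  refine integral_mono (integrable_add_mul_I_pow x n).norm
    ((integrable_exp_abs_gaussian 1).const_mul _) fun w => ?_
  simp only [norm_pow]
  calc ‖(x + w * Complex.I : ℂ)‖ ^ n ≤ (|x| + |w|) ^ n := by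
        gcongr; exact norm_add_mul_I_le x w
    _ ≤ n.factorial * Real.exp (|x| + |w|) := pow_le_factorial_mul_exp (by positivity) n
    _ = _ := by rw [Real.exp_add, one_mul, mul_assoc]

theorem integrable_He_mul_He (n m : ℕ) : Integrable (fun x => He n x * He m x) γ₁ := by
  obtain ⟨c, hc⟩ := abs_He_le n
  obtain ⟨d, hd⟩ := abs_He_le m
  refine integrable_gaussian_of_exp_bound
    (((continuous_He n).mul (continuous_He m)).aestronglyMeasurable) (c * d) 2 fun w => ?_
  rw [norm_mul, Real.norm_eq_abs, Real.norm_eq_abs]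
  calc |He n w| * |He m w| ≤ (c * Real.exp (1 * |w|)) * (d * Real.exp (1 * |w|)) :=
        mul_le_mul (hc w) (hd w) (abs_nonneg _) ((abs_nonneg _).trans (hc w))
    _ = _ := by rw [two_mul, Real.exp_add, one_mul]; ring

theorem memLp_He (n : ℕ) : MemLp (He n) 2 γ₁ := by
  rw [memLp_two_iff_integrable_sq (continuous_He n).aestronglyMeasurable]
  simpa [sq] using integrable_He_mul_He n n

/-- Since He (n+1) times the density is minus the derivative of He n times the density, one
integration by parts lowers the degree and produces the factor n + 1. -/
theorem integral_He_sq (n : ℕ) : ∫ x, He n x ^ 2 ∂γ₁ = n.factorial := by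
  induction n with
  | zero => simp [He_zero]
  | succ n ih =>
    have hi : ∀ a b, Integrable (fun x => He a x * (He b x * stdPDF x)) := by
      intro a b
      refine ((integrable_gaussian_iff _).1 (integrable_He_mul_He a b)).congr
        (Filter.Eventually.of_forall fun x => ?_)
      simp only [smul_eq_mul]; ring
    have key := integral_mul_deriv_eq_deriv_mul_of_integrable
      (fun x _ => hasDerivAt_He (n + 1) x) (fun x _ => hasDerivAt_He_mul_stdPDF n x)
      (by
        refine (hi (n + 1) (n + 1)).neg.congr (Filter.Eventually.of_forall fun x => ?_)
        simp)
      (by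
        refine ((hi n n).const_mul (n + 1)).congr (Filter.Eventually.of_forall fun x => ?_)
        simp only [Pi.mul_apply, Nat.add_sub_cancel]; push_cast; ring)
      (hi (n + 1) n)
    rw [integral_gaussian_eq] at ih ⊢
    have e1 : ∫ x, stdPDF x • He (n + 1) x ^ 2
        = -∫ x, He (n + 1) x * -(He (n + 1) x * stdPDF x) := by
      rw [← integral_neg]; congr 1; ext x; simp only [smul_eq_mul]; ring
    rw [e1, key, neg_neg, Nat.factorial_succ, Nat.cast_mul, ← ih, ← integral_const_mul]
    congr 1; ext x
    simp only [smul_eq_mul, Nat.add_sub_cancel]; ring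

theorem integral_abs_mul_le {α : Type*} [MeasurableSpace α] {μ : Measure α} {f g : α → ℝ}
    (hf : MemLp f 2 μ) (hg : MemLp g 2 μ) :
    ∫ a, |f a * g a| ∂μ ≤ √(∫ a, f a ^ 2 ∂μ) * √(∫ a, g a ^ 2 ∂μ) := by
  have h := integral_mul_norm_le_Lp_mul_Lq (μ := μ) (f := f) (g := g) Real.HolderConjugate.two_two
    (by simpa using hf) (by simpa using hg)
  simpa [abs_mul, Real.sqrt_eq_rpow] using h

theorem abs_integral_mul_le {α : Type*} [MeasurableSpace α] {μ : Measure α} {f g : α → ℝ}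
    (hf : MemLp f 2 μ) (hg : MemLp g 2 μ) :
    |∫ a, f a * g a ∂μ| ≤ √(∫ a, f a ^ 2 ∂μ) * √(∫ a, g a ^ 2 ∂μ) :=
  (abs_integral_le_integral_abs).trans (integral_abs_mul_le hf hg)

theorem integrable_mul_of_memLp {α : Type*} [MeasurableSpace α] {μ : Measure α} {f g : α → ℝ}
    (hf : MemLp f 2 μ) (hg : MemLp g 2 μ) : Integrable (fun a => f a * g a) μ :=
  hf.integrable_mul hg

/-- Hermite polynomials grow at most geometrically relative to their norms. -/
theorem abs_He_div_sqrt_factorial_le {r : ℝ} (h0 : 0 ≤ r) (hr : r < 1) (x : ℝ) (j : ℕ) :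
    |He j x| * √(r ^ j) ≤ √(mehler r x x) * √(j.factorial) := by
  have h := hasSum_mehler (u := r) (by rwa [abs_of_nonneg h0]) x x
  have hn : ∀ j : ℕ, 0 ≤ He j x * He j x * r ^ j / j.factorial := fun j => by
    have := mul_self_nonneg (He j x)
    positivity
  -- On the diagonal x = y all terms of Mehler's series are nonnegative, so each is at most the sum.
  have h1 := h.summable.le_tsum j (fun i _ => hn i)
  rw [h.tsum_eq, div_le_iff₀ (by positivity)] at h1
  rw [← Real.sqrt_mul_self_eq_abs, ← Real.sqrt_mul (mul_self_nonneg _), ← Real.sqrt_mul' _ (by positivity)]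
  exact Real.sqrt_le_sqrt h1

/-- The Hermite coefficients of a function. -/
noncomputable def hcoeff (F : ℝ → ℝ) (j : ℕ) : ℝ := ∫ x, F x * He j x ∂γ₁

theorem abs_hcoeff_le {F : ℝ → ℝ} (hF : MemLp F 2 γ₁) (j : ℕ) :
    |hcoeff F j| ≤ √(∫ x, F x ^ 2 ∂γ₁) * √(j.factorial) := by
  rw [← integral_He_sq]; exact abs_integral_mul_le hF (memLp_He j)

theorem integral_abs_mul_He_le {F : ℝ → ℝ} (hF : MemLp F 2 γ₁) (j : ℕ) :
    ∫ x, |F x * He j x| ∂γ₁ ≤ √(∫ x, F x ^ 2 ∂γ₁) * √(j.factorial) := by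
  rw [← integral_He_sq]; exact integral_abs_mul_le hF (memLp_He j)

/-- Mehler's series may be integrated term by term: half of the power |u|^j pays for the growth of
He j at s, and the other half leaves a geometric series. -/
theorem integral_mul_mehler {u : ℝ} (hu : |u| < 1) {F : ℝ → ℝ} (hF : MemLp F 2 γ₁) (s : ℝ) :
    HasSum (fun j : ℕ => He j s * hcoeff F j * u ^ j / j.factorial)
      (∫ t, F t * mehler u s t ∂γ₁) := by
  have hs := hasSum_integral_of_summable_integral_norm (μ := γ₁)
    (F := fun (j : ℕ) t => F t * (He j s * He j t * u ^ j / j.factorial)) (fun j => by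
      have := (integrable_mul_of_memLp hF (memLp_He j)).const_mul (He j s * u ^ j / j.factorial)
      refine this.congr (Filter.Eventually.of_forall fun t => ?_)
      simp only; ring) ?_
  · convert! hs using 1
    · ext j
      rw [hcoeff, ← integral_const_mul, ← integral_mul_const, ← integral_div]
      congr 1; ext t; ring
    · congr 1; ext t
      rw [tsum_mul_left, (hasSum_mehler hu s t).tsum_eq]
  · have hg : Summable fun j : ℕ => √(mehler |u| s s) * √(∫ x, F x ^ 2 ∂γ₁) * (√|u|) ^ j := by
      refine (summable_geometric_of_lt_one (by positivity) ?_).mul_left _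
      rw [Real.sqrt_lt' one_pos]; simpa using hu
    refine hg.of_nonneg_of_le (fun j => integral_nonneg fun t => norm_nonneg _) fun j => ?_
    have e : ∀ t, ‖F t * (He j s * He j t * u ^ j / j.factorial)‖
        = (|He j s| * |u| ^ j / j.factorial) * |F t * He j t| := by
      intro t
      rw [Real.norm_eq_abs]
      simp only [abs_mul, abs_div, abs_pow, Nat.abs_cast]; ring
    simp_rw [e]
    rw [integral_const_mul]
    have hf : (0 : ℝ) < j.factorial := by positivity
    calc |He j s| * |u| ^ j / j.factorial * ∫ t, |F t * He j t| ∂γ₁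
        ≤ |He j s| * |u| ^ j / j.factorial * (√(∫ x, F x ^ 2 ∂γ₁) * √(j.factorial)) := by
          gcongr; exact integral_abs_mul_He_le hF j
      _ = (|He j s| * √(|u| ^ j)) * √(|u| ^ j) * √(∫ x, F x ^ 2 ∂γ₁) * √(j.factorial)
            / j.factorial := by
          rw [mul_assoc |He j s|, Real.mul_self_sqrt (by positivity)]; ring
      _ ≤ (√(mehler |u| s s) * √(j.factorial)) * √(|u| ^ j) * √(∫ x, F x ^ 2 ∂γ₁)
            * √(j.factorial) / j.factorial := by
          have := abs_He_div_sqrt_factorial_le (abs_nonneg u) hu s j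
          gcongr ?_ * _ * _ * _ / _
      _ = √(mehler |u| s s) * √(∫ x, F x ^ 2 ∂γ₁) * (√|u|) ^ j
            * (√(j.factorial) * √(j.factorial)) / j.factorial := by
          rw [show √(|u| ^ j) = √|u| ^ j from (Real.sqrt_eq_iff_eq_sq (by positivity) (by positivity)).2
            (by rw [← pow_mul, mul_comm, pow_mul, Real.sq_sqrt (abs_nonneg u)])]
          ring
      _ = _ := by rw [Real.mul_self_sqrt hf.le]; field_simp

/-- After both integrations Cauchy–Schwarz gives √(j!) for each coefficient, which cancels the
denominator j! and leaves a geometric series. -/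
theorem hasSum_integral_integral_mehler {u : ℝ} (hu : |u| < 1) {F G : ℝ → ℝ} (hF : MemLp F 2 γ₁)
    (hG : MemLp G 2 γ₁) :
    HasSum (fun j : ℕ => hcoeff F j * hcoeff G j * u ^ j / j.factorial)
      (∫ s, F s * ∫ t, G t * mehler u s t ∂γ₁ ∂γ₁) := by
  have hs := hasSum_integral_of_summable_integral_norm (μ := γ₁)
    (F := fun (j : ℕ) s => F s * (He j s * hcoeff G j * u ^ j / j.factorial)) (fun j => by
      have := (integrable_mul_of_memLp hF (memLp_He j)).const_mul (hcoeff G j * u ^ j / j.factorial)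
      refine this.congr (Filter.Eventually.of_forall fun t => ?_)
      simp only; ring) ?_
  · convert! hs using 1
    · ext j
      rw [hcoeff, ← integral_mul_const, ← integral_mul_const, ← integral_div]
      congr 1; ext t; ring
    · congr 1; ext t
      rw [tsum_mul_left, (integral_mul_mehler hu hG t).tsum_eq]
  · have hg : Summable fun j : ℕ => √(∫ x, F x ^ 2 ∂γ₁) * √(∫ x, G x ^ 2 ∂γ₁) * |u| ^ j :=
      (summable_geometric_of_lt_one (by positivity) hu).mul_left _
    refine hg.of_nonneg_of_le (fun j => integral_nonneg fun t => norm_nonneg _) fun j => ?_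
    have e : ∀ t, ‖F t * (He j t * hcoeff G j * u ^ j / j.factorial)‖
        = (|hcoeff G j| * |u| ^ j / j.factorial) * |F t * He j t| := by
      intro t
      rw [Real.norm_eq_abs]
      simp only [abs_mul, abs_div, abs_pow, Nat.abs_cast]; ring
    simp_rw [e]
    rw [integral_const_mul]
    have hf : (0 : ℝ) < j.factorial := by positivity
    calc |hcoeff G j| * |u| ^ j / j.factorial * ∫ t, |F t * He j t| ∂γ₁
        ≤ (√(∫ x, G x ^ 2 ∂γ₁) * √(j.factorial)) * |u| ^ j / j.factorial
          * (√(∫ x, F x ^ 2 ∂γ₁) * √(j.factorial)) := by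
          gcongr
          · exact abs_hcoeff_le hG j
          · exact integral_abs_mul_He_le hF j
      _ = √(∫ x, F x ^ 2 ∂γ₁) * √(∫ x, G x ^ 2 ∂γ₁) * |u| ^ j
            * (√(j.factorial) * √(j.factorial)) / j.factorial := by ring
      _ = _ := by rw [Real.mul_self_sqrt hf.le]; field_simp

/-- The left-hand side is the conditional density of the second coordinate given that the first one
is s; so Mehler's kernel is its ratio to the marginal density. -/
theorem gaussian_pdf_eq_mehler {u : ℝ} (hu : |u| < 1) (s t : ℝ) :
    gaussianPDFReal (u * s) (Real.toNNReal (1 - u ^ 2)) t = stdPDF t * mehler u s t := by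
  have h1 := one_sub_sq_pos hu
  rw [stdPDF_eq, mehler, gaussianPDFReal, Real.coe_toNNReal _ h1.le, Real.sqrt_mul (by positivity),
    mul_inv, mul_mul_mul_comm, ← Real.exp_add]
  congr 2
  field_simp
  ring

theorem integral_comp_eq_integral_mehler {u : ℝ} (hu : |u| < 1) {G : ℝ → ℝ} (hG : Measurable G)
    (s : ℝ) : ∫ w, G (u * s + √(1 - u ^ 2) * w) ∂γ₁ = ∫ t, G t * mehler u s t ∂γ₁ := by
  have h1 := one_sub_sq_pos hu
  have hm : (γ₁).map (fun w => u * s + √(1 - u ^ 2) * w)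
      = gaussianReal (u * s) (Real.toNNReal (1 - u ^ 2)) := by
    have : (fun w : ℝ => u * s + √(1 - u ^ 2) * w)
        = (fun w => u * s + w) ∘ (fun w => √(1 - u ^ 2) * w) := rfl
    rw [this, ← Measure.map_map (by fun_prop) (by fun_prop), gaussianReal_map_const_mul,
      gaussianReal_map_const_add]
    congr 1
    · ring
    · ext
      simp [Real.sq_sqrt h1.le, Real.coe_toNNReal _ h1.le]
  rw [← integral_map (φ := fun w => u * s + √(1 - u ^ 2) * w) (by fun_prop)
    hG.aestronglyMeasurable, hm, integral_gaussianReal_eq_integral_smul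
    (by simpa using h1), integral_gaussian_eq]
  congr 1; ext t
  rw [gaussian_pdf_eq_mehler hu, smul_eq_mul, smul_eq_mul]; ring

end

/-! ### Reduction of a correlated normal pair to independent variables -/

section

theorem map_eq_std_of_hasGaussianLaw {Ω : Type*} [MeasurableSpace Ω] {P : Measure Ω} {X : Ω → ℝ}
    (h : HasGaussianLaw X P) (h0 : ∫ ω, X ω ∂P = 0) (h1 : ∫ ω, X ω ^ 2 ∂P = 1) :
    P.map X = γ₁ := by
  have := h.isProbabilityMeasure
  rw [h.map_eq_gaussianReal, h0]
  congr 1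
  rw [variance_of_integral_eq_zero h.aemeasurable h0, h1]
  simp

/-- A standard bivariate normal vector with correlation `u` in `(-1, 1)` is the image of a pair of
independent standard normal variables. -/
theorem exists_indep_of_hasGaussianLaw {Ω : Type*} [MeasurableSpace Ω] {P : Measure Ω}
    {X Y : Ω → ℝ} (h : HasGaussianLaw (fun ω => (X ω, Y ω)) P) (hX0 : ∫ ω, X ω ∂P = 0)
    (hY0 : ∫ ω, Y ω ∂P = 0) (hX1 : ∫ ω, X ω ^ 2 ∂P = 1) (hY1 : ∫ ω, Y ω ^ 2 ∂P = 1) {u : ℝ}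
    (hu : |u| < 1) (hXY : ∫ ω, X ω * Y ω ∂P = u) :
    ∃ W : Ω → ℝ, AEMeasurable W P ∧ P.map (fun ω => (X ω, W ω)) = (γ₁).prod γ₁ ∧
      ∀ ω, Y ω = u * X ω + √(1 - u ^ 2) * W ω := by
  have hP := h.isProbabilityMeasure
  have h1 := one_sub_sq_pos hu
  have hr : √(1 - u ^ 2) ≠ 0 := (Real.sqrt_pos.2 h1).ne'
  have mX : MemLp X 2 P := h.fst.memLp_two
  have mY : MemLp Y 2 P := h.snd.memLp_two
  have iX := mX.integrable one_le_two
  have iY := mY.integrable one_le_two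
  have iXX : Integrable (fun ω => X ω ^ 2) P := mX.integrable_sq
  have iYY : Integrable (fun ω => Y ω ^ 2) P := mY.integrable_sq
  have iXY : Integrable (fun ω => X ω * Y ω) P := mX.integrable_mul mY
  set W : Ω → ℝ := fun ω => (√(1 - u ^ 2))⁻¹ * (Y ω - u * X ω) with hW
  have hL : HasGaussianLaw (fun ω => (X ω, W ω)) P := by
    let L : ℝ × ℝ →L[ℝ] ℝ × ℝ := (ContinuousLinearMap.fst ℝ ℝ ℝ).prod
      ((√(1 - u ^ 2))⁻¹ • (ContinuousLinearMap.snd ℝ ℝ ℝ - u • ContinuousLinearMap.fst ℝ ℝ ℝ))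
    have := h.map_fun L
    simpa [L, hW] using this
  have hW0 : ∫ ω, W ω ∂P = 0 := by
    simp only [hW]
    rw [integral_const_mul, integral_sub iY (iX.const_mul u), integral_const_mul, hX0, hY0]; simp
  have hW1 : ∫ ω, W ω ^ 2 ∂P = 1 := by
    have e : ∀ ω, W ω ^ 2
        = (1 - u ^ 2)⁻¹ * (Y ω ^ 2 - 2 * u * (X ω * Y ω) + u ^ 2 * X ω ^ 2) := by
      intro ω; simp only [hW, mul_pow, inv_pow, Real.sq_sqrt h1.le]; ring
    simp_rw [e]
    have i1 : Integrable (fun ω => Y ω ^ 2 - 2 * u * (X ω * Y ω)) P := iYY.sub (iXY.const_mul _)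
    rw [integral_const_mul, integral_add i1 (iXX.const_mul _),
      integral_sub iYY (iXY.const_mul _), integral_const_mul, integral_const_mul, hX1, hY1, hXY]
    field_simp; ring
  -- W is the normalized residual of the regression of Y on X; for jointly Gaussian variables zero
  -- covariance gives independence.
  have hXW : cov[X, W; P] = 0 := by
    rw [covariance_eq_sub mX hL.snd.memLp_two, hX0, zero_mul, sub_zero]
    have e : ∀ ω, (X * W) ω = (√(1 - u ^ 2))⁻¹ * (X ω * Y ω - u * X ω ^ 2) := by
      intro ω; simp only [Pi.mul_apply, hW]; ring
    simp_rw [e]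
    rw [integral_const_mul, integral_sub iXY (iXX.const_mul _), integral_const_mul, hX1, hXY]
    simp
  have hi := hL.indepFun_of_covariance_eq_zero hXW
  refine ⟨W, hL.snd.aemeasurable, ?_, fun ω => ?_⟩
  · rw [(indepFun_iff_map_prod_eq_prod_map_map h.fst.aemeasurable hL.snd.aemeasurable).1 hi,
      map_eq_std_of_hasGaussianLaw h.fst hX0 hX1, map_eq_std_of_hasGaussianLaw hL.snd hW0 hW1]
  · simp only [hW]; field_simp; ring

theorem measurePreserving_rotation {u : ℝ} (hu : |u| < 1) :
    MeasurePreserving (fun p : ℝ × ℝ => u * p.1 + √(1 - u ^ 2) * p.2) ((γ₁).prod γ₁) γ₁ := by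
  have h1 := one_sub_sq_pos hu
  refine ⟨by fun_prop, ?_⟩
  have hi : IndepFun (fun p : ℝ × ℝ => u * p.1) (fun p : ℝ × ℝ => √(1 - u ^ 2) * p.2)
      ((γ₁).prod γ₁) :=
    indepFun_prod (X := fun x : ℝ => u * x) (Y := fun x : ℝ => √(1 - u ^ 2) * x)
      (by fun_prop) (by fun_prop)
  have hA : ((γ₁).prod γ₁).map (fun p : ℝ × ℝ => u * p.1) = gaussianReal 0 (Real.toNNReal (u ^ 2)) := by
    have : (fun p : ℝ × ℝ => u * p.1) = (fun x => u * x) ∘ Prod.fst := rfl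
    rw [this, ← Measure.map_map (by fun_prop) measurable_fst, measurePreserving_fst.map_eq,
      gaussianReal_map_const_mul]
    congr 1
    · simp
    · ext; simp [sq_nonneg]
  have hB : ((γ₁).prod γ₁).map (fun p : ℝ × ℝ => √(1 - u ^ 2) * p.2)
      = gaussianReal 0 (Real.toNNReal (1 - u ^ 2)) := by
    have : (fun p : ℝ × ℝ => √(1 - u ^ 2) * p.2) = (fun x => √(1 - u ^ 2) * x) ∘ Prod.snd := rfl
    rw [this, ← Measure.map_map (by fun_prop) measurable_snd, measurePreserving_snd.map_eq,
      gaussianReal_map_const_mul]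
    congr 1
    · simp
    · ext; simp [Real.sq_sqrt h1.le, h1.le]
  have := gaussianReal_add_gaussianReal_of_indepFun hi hA hB
  refine Eq.trans this ?_
  rw [add_zero, ← Real.toNNReal_add (sq_nonneg u) h1.le]
  simp

theorem hasSum_integral_rotation {u : ℝ} (hu : |u| < 1) {F G : ℝ → ℝ} (hGm : Measurable G)
    (hF : MemLp F 2 γ₁) (hG : MemLp G 2 γ₁) :
    HasSum (fun j : ℕ => hcoeff F j * hcoeff G j * u ^ j / j.factorial)
      (∫ p : ℝ × ℝ, F p.1 * G (u * p.1 + √(1 - u ^ 2) * p.2) ∂((γ₁).prod γ₁)) := by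
  have hi : Integrable (fun p : ℝ × ℝ => F p.1 * G (u * p.1 + √(1 - u ^ 2) * p.2))
      ((γ₁).prod γ₁) :=
    integrable_mul_of_memLp (hF.comp_measurePreserving measurePreserving_fst)
      (hG.comp_measurePreserving (measurePreserving_rotation hu))
  rw [integral_prod _ hi]
  simp_rw [integral_const_mul, integral_comp_eq_integral_mehler hu hGm]
  exact hasSum_integral_integral_mehler hu hF hG

/-- The Hermite expansion of `E[F(X) G(Y)]` for a standard bivariate normal vector `(X, Y)`. -/
theorem hasSum_integral_of_hasGaussianLaw {Ω : Type*} [MeasurableSpace Ω] {P : Measure Ω}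
    {X Y : Ω → ℝ} (h : HasGaussianLaw (fun ω => (X ω, Y ω)) P) (hX0 : ∫ ω, X ω ∂P = 0)
    (hY0 : ∫ ω, Y ω ∂P = 0) (hX1 : ∫ ω, X ω ^ 2 ∂P = 1) (hY1 : ∫ ω, Y ω ^ 2 ∂P = 1) {u : ℝ}
    (hu : |u| < 1) (hXY : ∫ ω, X ω * Y ω ∂P = u) {F G : ℝ → ℝ} (hFm : Measurable F)
    (hGm : Measurable G) (hF : MemLp F 2 γ₁) (hG : MemLp G 2 γ₁) :
    HasSum (fun j : ℕ => hcoeff F j * hcoeff G j * u ^ j / j.factorial)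
      (∫ ω, F (X ω) * G (Y ω) ∂P) := by
  obtain ⟨W, hWm, hmap, hY⟩ := exists_indep_of_hasGaussianLaw h hX0 hY0 hX1 hY1 hu hXY
  have := hasSum_integral_rotation hu hGm hF hG
  rw [← hmap, integral_map (h.fst.aemeasurable.prodMk hWm)
    (by
      have : Measurable fun p : ℝ × ℝ => F p.1 * G (u * p.1 + √(1 - u ^ 2) * p.2) := by fun_prop
      exact this.aestronglyMeasurable)] at this
  simp_rw [hY]
  exact this

end

section

/-! ## The normal distribution function and its inverse -/

theorem integrable_stdPDF : Integrable stdPDF := integrable_gaussianPDFReal 0 1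

theorem stdCDF_eq_integral (x : ℝ) : stdCDF x = ∫ t in Set.Iic x, stdPDF t := by
  rw [stdCDF, cdf_eq_real, measureReal_def, gaussianReal_apply_eq_integral 0 one_ne_zero,
    ENNReal.toReal_ofReal]
  · rfl
  · exact integral_nonneg fun t => gaussianPDFReal_nonneg _ _ _

theorem stdCDF_sub (a b : ℝ) : stdCDF b - stdCDF a = ∫ t in a..b, stdPDF t := by
  rw [stdCDF_eq_integral, stdCDF_eq_integral]
  exact intervalIntegral.integral_Iic_sub_Iic integrable_stdPDF.integrableOn
    integrable_stdPDF.integrableOn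

theorem hasDerivAt_stdCDF (x : ℝ) : HasDerivAt stdCDF (stdPDF x) x := by
  have h := intervalIntegral.integral_hasDerivAt_right (a := 0) (b := x)
    (continuous_stdPDF.intervalIntegrable 0 x)
    (continuous_stdPDF.stronglyMeasurableAtFilter _ _) continuous_stdPDF.continuousAt
  have e : stdCDF = fun x => stdCDF 0 + ∫ t in (0 : ℝ)..x, stdPDF t := by
    ext x; rw [← stdCDF_sub]; ring
  rw [e]
  exact h.const_add _

theorem continuous_stdCDF : Continuous stdCDF :=
  continuous_iff_continuousAt.2 fun x => (hasDerivAt_stdCDF x).continuousAt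

theorem strictMono_stdCDF : StrictMono stdCDF :=
  strictMono_of_deriv_pos fun x => by rw [(hasDerivAt_stdCDF x).deriv]; exact stdPDF_pos x

theorem stdCDF_pos (x : ℝ) : 0 < stdCDF x :=
  (cdf_nonneg (γ₁) (x - 1)).trans_lt (strictMono_stdCDF (by linarith))

theorem stdCDF_lt_one (x : ℝ) : stdCDF x < 1 :=
  (strictMono_stdCDF (by linarith)).trans_le (cdf_le_one (γ₁) (x + 1))

theorem exists_stdCDF_eq {c : ℝ} (h0 : 0 < c) (h1 : c < 1) : ∃ x, stdCDF x = c := by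
  obtain ⟨a, ha⟩ := ((tendsto_cdf_atBot (γ₁)).eventually (gt_mem_nhds h0)).exists
  obtain ⟨b, hb⟩ := ((tendsto_cdf_atTop (γ₁)).eventually (lt_mem_nhds h1)).exists
  exact mem_range_of_exists_le_of_exists_ge continuous_stdCDF ⟨a, ha.le⟩ ⟨b, hb.le⟩

theorem stdQuantile_stdCDF (x : ℝ) : stdQuantile (stdCDF x) = x := by
  have : {y : ℝ | stdCDF x ≤ stdCDF y} = Set.Ici x := by
    ext y; simp [strictMono_stdCDF.le_iff_le]
  rw [stdQuantile, this, csInf_Ici]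

theorem stdCDF_stdQuantile {c : ℝ} (h0 : 0 < c) (h1 : c < 1) : stdCDF (stdQuantile c) = c := by
  obtain ⟨x, rfl⟩ := exists_stdCDF_eq h0 h1
  rw [stdQuantile_stdCDF]

theorem stdQuantile_le_iff {c : ℝ} (h0 : 0 < c) (h1 : c < 1) (x : ℝ) :
    stdQuantile c ≤ x ↔ c ≤ stdCDF x := by
  rw [← strictMono_stdCDF.le_iff_le, stdCDF_stdQuantile h0 h1]

theorem hasDerivAt_stdQuantile {c : ℝ} (h0 : 0 < c) (h1 : c < 1) :
    HasDerivAt stdQuantile (stdPDF (stdQuantile c))⁻¹ c := by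
  refine HasDerivAt.of_local_left_inverse ?_ (hasDerivAt_stdCDF _) (stdPDF_pos _).ne' ?_
  -- Continuity of the quantile function comes from monotonicity: it maps (0, 1) onto the whole line
  -- and so has no jumps.
  · have hopen : Set.Ioo (0 : ℝ) 1 ∈ nhds c := Ioo_mem_nhds h0 h1
    have hmono : StrictMonoOn stdQuantile (Set.Ioo 0 1) := by
      intro a ha b hb hab
      rw [← strictMono_stdCDF.lt_iff_lt, stdCDF_stdQuantile ha.1 ha.2, stdCDF_stdQuantile hb.1 hb.2]
      exact hab
    refine hmono.continuousAt_of_image_mem_nhds hopen ?_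
    have : stdQuantile '' Set.Ioo 0 1 = Set.univ := by
      ext x; simp only [Set.mem_image, Set.mem_univ, iff_true]
      exact ⟨stdCDF x, ⟨stdCDF_pos x, stdCDF_lt_one x⟩, stdQuantile_stdCDF x⟩
    rw [this]; exact Filter.univ_mem
  · filter_upwards [Ioo_mem_nhds h0 h1] with y hy using stdCDF_stdQuantile hy.1 hy.2

/-! ## Laws on the counts -/

theorem PMF_summable (p : PMF ℕ) : Summable fun n => (p n).toReal :=
  ENNReal.summable_toReal (by rw [p.tsum_coe]; simp)

theorem PMF_tsum (p : PMF ℕ) : ∑' n, (p n).toReal = 1 := by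
  rw [← ENNReal.tsum_toReal_eq (fun n => p.apply_ne_top n), p.tsum_coe]; simp

theorem countCDF_mono (p : PMF ℕ) : Monotone (countCDF p) := fun a b h =>
  Finset.sum_le_sum_of_subset_of_nonneg (Finset.range_mono (by omega)) fun _ _ _ =>
    ENNReal.toReal_nonneg

theorem countCDF_nonneg (p : PMF ℕ) (n : ℕ) : 0 ≤ countCDF p n :=
  Finset.sum_nonneg fun _ _ => ENNReal.toReal_nonneg

theorem countCDF_le_one (p : PMF ℕ) (n : ℕ) : countCDF p n ≤ 1 := by
  rw [← PMF_tsum p]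
  exact (PMF_summable p).sum_le_tsum _ fun _ _ => ENNReal.toReal_nonneg

theorem tendsto_countCDF (p : PMF ℕ) : Filter.Tendsto (countCDF p) Filter.atTop (nhds 1) := by
  have h := (PMF_summable p).hasSum.tendsto_sum_nat
  rw [PMF_tsum] at h
  exact h.comp (Filter.tendsto_add_atTop_nat 1)

theorem lt_countQuantile_iff (p : PMF ℕ) {t : ℝ} (ht : t < 1) (n : ℕ) :
    n < countQuantile p t ↔ countCDF p n < t := by
  -- Here t < 1 makes the defining set nonempty, so that its infimum belongs to it; on an empty set
  -- `sInf` would return 0.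
  obtain ⟨N, hN⟩ := ((tendsto_countCDF p).eventually (lt_mem_nhds ht)).exists
  have hne : {n : ℕ | t ≤ countCDF p n}.Nonempty := ⟨N, hN.le⟩
  constructor
  · intro h
    by_contra hc
    exact absurd (Nat.sInf_le (s := {n : ℕ | t ≤ countCDF p n}) (not_lt.1 hc)) (not_le.2 h)
  · intro h
    by_contra hc
    have h1 : t ≤ countCDF p (countQuantile p t) := Nat.sInf_mem hne
    exact absurd (h1.trans (countCDF_mono p (not_lt.1 hc))) (not_le.2 h)

theorem lt_countQuantile_stdCDF_iff (p : PMF ℕ) (z : ℝ) (n : ℕ) :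
    n < countQuantile p (stdCDF z) ↔ countCDF p n < stdCDF z :=
  lt_countQuantile_iff p (stdCDF_lt_one z) n

theorem monotone_countQuantile_stdCDF (p : PMF ℕ) :
    Monotone fun z => countQuantile p (stdCDF z) := by
  intro a b hab
  by_contra hc
  rw [not_le] at hc
  have := (lt_countQuantile_stdCDF_iff p a _).1 hc
  have h2 := this.trans_le (strictMono_stdCDF.monotone hab)
  exact lt_irrefl _ ((lt_countQuantile_stdCDF_iff p b _).2 h2)

theorem monotone_transform (p : PMF ℕ) : Monotone (transform p) := fun _ _ h =>
  Nat.cast_le.2 (monotone_countQuantile_stdCDF p h)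

theorem measurable_transform (p : PMF ℕ) : Measurable (transform p) :=
  (monotone_transform p).measurable

theorem transform_nonneg (p : PMF ℕ) (z : ℝ) : 0 ≤ transform p z := Nat.cast_nonneg _

/-- The level `C n` is neither 0 nor 1. -/
def IsLevel (p : PMF ℕ) (n : ℕ) : Prop := 0 < countCDF p n ∧ countCDF p n < 1

/-- The level `Q n`. -/
noncomputable def level (p : PMF ℕ) (n : ℕ) : ℝ := stdQuantile (countCDF p n)

/-- The set on which the transformed variable exceeds `n`. -/
def exceed (p : PMF ℕ) (n : ℕ) : Set ℝ := {z | countCDF p n < stdCDF z}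

theorem measurableSet_exceed (p : PMF ℕ) (n : ℕ) : MeasurableSet (exceed p n) :=
  measurableSet_lt measurable_const continuous_stdCDF.measurable

theorem exceed_of_isLevel {p : PMF ℕ} {n : ℕ} (h : IsLevel p n) :
    exceed p n = Set.Ioi (level p n) := by
  ext z
  rw [exceed, Set.mem_ofPred_eq, Set.mem_Ioi, level, ← not_le, ← not_le]
  exact not_congr (by
    rw [← strictMono_stdCDF.le_iff_le (a := z), stdCDF_stdQuantile h.1 h.2])

theorem exceed_of_zero {p : PMF ℕ} {n : ℕ} (h : countCDF p n = 0) : exceed p n = Set.univ := by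
  ext z; simp [exceed, h, stdCDF_pos z]

theorem exceed_of_one {p : PMF ℕ} {n : ℕ} (h : countCDF p n = 1) : exceed p n = ∅ := by
  ext z; simp [exceed, h, (stdCDF_lt_one z).le]

theorem level_cases (p : PMF ℕ) (n : ℕ) : countCDF p n = 0 ∨ countCDF p n = 1 ∨ IsLevel p n := by
  rcases (countCDF_nonneg p n).eq_or_lt with h | h
  · exact Or.inl h.symm
  · rcases (countCDF_le_one p n).eq_or_lt with h' | h'
    · exact Or.inr (Or.inl h')
    · exact Or.inr (Or.inr ⟨h, h'⟩)

theorem gaussian_real_Ioi (x : ℝ) : (γ₁).real (Set.Ioi x) = 1 - stdCDF x := by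
  rw [← Set.compl_Iic, probReal_compl_eq_one_sub measurableSet_Iic, stdCDF, cdf_eq_real]

theorem measureReal_exceed (p : PMF ℕ) (n : ℕ) : (γ₁).real (exceed p n) = 1 - countCDF p n := by
  rcases level_cases p n with h | h | h
  · rw [exceed_of_zero h, h]; simp
  · rw [exceed_of_one h, h]; simp
  · rw [exceed_of_isLevel h, gaussian_real_Ioi, level, stdCDF_stdQuantile h.1 h.2]

/-- Layer-cake representation of a function of the transformed variable. -/
theorem hasSum_layer (p : PMF ℕ) (f : ℕ → ℝ) (z : ℝ) :
    HasSum (fun n => Set.indicator (exceed p n) (fun _ => f (n + 1) - f n) z)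
      (f (countQuantile p (stdCDF z)) - f 0) := by
  have e : ∀ n, Set.indicator (exceed p n) (fun _ => f (n + 1) - f n) z
      = if n ∈ Finset.range (countQuantile p (stdCDF z)) then f (n + 1) - f n else 0 := by
    intro n
    simp only [Set.indicator, Finset.mem_range, lt_countQuantile_stdCDF_iff]; rfl
  rw [← Finset.sum_range_sub]
  have h := hasSum_sum_of_ne_finset_zero (L := SummationFilter.unconditional ℕ)
    (f := fun n => if n ∈ Finset.range (countQuantile p (stdCDF z)) then f (n + 1) - f n else 0)
    (s := Finset.range (countQuantile p (stdCDF z))) (fun n hn => if_neg hn)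
  rw [Finset.sum_ite_mem, Finset.inter_self] at h
  simpa only [e] using h

theorem hasSum_transform (p : PMF ℕ) (z : ℝ) :
    HasSum (fun n => Set.indicator (exceed p n) (fun _ => (1 : ℝ)) z) (transform p z) := by
  simpa [transform] using hasSum_layer p (fun n => (n : ℝ)) z

/-- The transformed normal variable has law `p`. -/
theorem map_countQuantile (p : PMF ℕ) :
    (γ₁).map (fun z => countQuantile p (stdCDF z)) = p.toMeasure := by
  have hm : Measurable fun z => countQuantile p (stdCDF z) :=
    (monotone_countQuantile_stdCDF p).measurable
  refine Measure.ext_of_singleton fun n => ?_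
  have h0 : ∀ n, (γ₁).real {z | countQuantile p (stdCDF z) ≤ n} = countCDF p n := by
    intro n
    have : {z | countQuantile p (stdCDF z) ≤ n} = (exceed p n)ᶜ := by
      ext z
      rw [Set.mem_ofPred_eq, ← not_lt, lt_countQuantile_stdCDF_iff]; rfl
    rw [this, probReal_compl_eq_one_sub (measurableSet_exceed p n), measureReal_exceed]; ring
  rw [Measure.map_apply hm (measurableSet_singleton n), PMF.toMeasure_apply_singleton _ _
    (measurableSet_singleton n), ← ENNReal.toReal_eq_toReal_iff' (measure_ne_top _ _)
    (p.apply_ne_top n)]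
  change (γ₁).real _ = _
  cases n with
  | zero =>
    have : (fun z => countQuantile p (stdCDF z)) ⁻¹' {0} = {z | countQuantile p (stdCDF z) ≤ 0} := by
      ext z; simp
    rw [this, h0]; simp [countCDF]
  | succ n =>
    have : (fun z => countQuantile p (stdCDF z)) ⁻¹' {n + 1}
        = {z | countQuantile p (stdCDF z) ≤ n + 1} \ {z | countQuantile p (stdCDF z) ≤ n} := by
      ext z; simp only [Set.mem_preimage, Set.mem_singleton_iff, Set.mem_sdiff, Set.mem_ofPred_eq]
      omega
    rw [this, measureReal_sdiff (by intro z hz; simp only [Set.mem_ofPred_eq] at hz ⊢; omega)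
      (measurableSet_le hm measurable_const), h0, h0]
    simp [countCDF, Finset.sum_range_succ _ (n + 1)]

theorem lintegral_comp_transform (p : PMF ℕ) (f : ℕ → ℝ≥0∞) :
    ∫⁻ z, f (countQuantile p (stdCDF z)) ∂γ₁ = ∑' n, p n * f n := by
  rw [← lintegral_map (measurable_of_countable f) (monotone_countQuantile_stdCDF p).measurable,
    map_countQuantile, lintegral_countable']
  congr 1; ext n
  rw [PMF.toMeasure_apply_singleton _ _ (measurableSet_singleton n), mul_comm]

/-- A law on the counts has finite second moment. -/
def SecondMoment (p : PMF ℕ) : Prop := MemLp (transform p) 2 γ₁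

theorem secondMoment_of_moment {p : PMF ℕ} {r : ℝ} (hr : 2 < r)
    (h : ∑' n : ℕ, p n * ENNReal.ofReal ((n : ℝ) ^ r) < ∞) : SecondMoment p := by
  rw [SecondMoment, memLp_two_iff_integrable_sq (measurable_transform p).aestronglyMeasurable]
  refine ⟨((measurable_transform p).pow_const 2).aestronglyMeasurable, ?_⟩
  rw [hasFiniteIntegral_iff_ofReal (Filter.Eventually.of_forall fun z => sq_nonneg _)]
  refine lt_of_le_of_lt ?_ h
  rw [← lintegral_comp_transform p (fun n => ENNReal.ofReal ((n : ℝ) ^ r))]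
  refine lintegral_mono fun z => ENNReal.ofReal_le_ofReal ?_
  rw [transform, ← Real.rpow_natCast]
  -- The count 0 is separate, since powers increase with the exponent only for bases at least 1.
  rcases Nat.eq_zero_or_pos (countQuantile p (stdCDF z)) with h0 | h0
  · rw [h0]; simp [Real.zero_rpow (by linarith : r ≠ 0)]
  · exact Real.rpow_le_rpow_of_exponent_le (by exact_mod_cast h0) (by push_cast; linarith)

end

section

/-! ## Hermite coefficients of the transformation -/

theorem integrable_He_mul_stdPDF (k : ℕ) : Integrable fun x => He k x * stdPDF x := by
  have h := (integrable_gaussian_iff _).1 ((memLp_He k).integrable one_le_two)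
  simpa [mul_comm] using h

/-- Minus He k times the density is an antiderivative that vanishes at infinity. -/
theorem setIntegral_He_Ioi (k : ℕ) (x : ℝ) :
    ∫ z in Set.Ioi x, He (k + 1) z ∂γ₁ = He k x * stdPDF x := by
  have hd : ∀ z, HasDerivAt (fun z => -(He k z * stdPDF z)) (He (k + 1) z * stdPDF z) z := fun z =>
    ((hasDerivAt_He_mul_stdPDF k z).neg).congr_deriv (neg_neg _)
  have h := integral_Ioi_of_hasDerivAt_of_tendsto (a := x) (m := 0)
    (hd x).continuousAt.continuousWithinAt (fun z _ => hd z)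
    (integrable_He_mul_stdPDF (k + 1)).integrableOn
    (tendsto_zero_of_hasDerivAt_of_integrableOn_Ioi (a := x) (fun z _ => hd z)
      (integrable_He_mul_stdPDF (k + 1)).integrableOn (integrable_He_mul_stdPDF k).neg.integrableOn)
  rw [sub_neg_eq_add, zero_add] at h
  rw [← h, ← integral_indicator measurableSet_Ioi, integral_gaussian_eq,
    ← integral_indicator measurableSet_Ioi]
  congr 1; ext z
  by_cases hz : z ∈ Set.Ioi x <;> simp [hz, mul_comm]

theorem integral_He_succ (k : ℕ) : ∫ z, He (k + 1) z ∂γ₁ = 0 := by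
  have h := integral_eq_zero_of_hasDerivAt_of_integrable (hasDerivAt_He_mul_stdPDF k)
    (integrable_He_mul_stdPDF (k + 1)).neg (integrable_He_mul_stdPDF k)
  rw [integral_neg, neg_eq_zero] at h
  rw [integral_gaussian_eq, ← h]
  congr 1; ext z; simp [mul_comm]

open Classical in
/-- The contribution of the level `n` to the Hermite coefficient of order `k + 1`. -/
noncomputable def lcoef (p : PMF ℕ) (k n : ℕ) : ℝ :=
  if IsLevel p n then He k (level p n) * stdPDF (level p n) else 0

theorem integral_indicator_exceed_He (p : PMF ℕ) (k n : ℕ) :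
    ∫ z, Set.indicator (exceed p n) (fun _ => (1 : ℝ)) z * He (k + 1) z ∂γ₁ = lcoef p k n := by
  have e : ∀ z, Set.indicator (exceed p n) (fun _ => (1 : ℝ)) z * He (k + 1) z
      = Set.indicator (exceed p n) (He (k + 1)) z := by
    intro z; by_cases hz : z ∈ exceed p n <;> simp [hz]
  simp_rw [e]
  rw [integral_indicator (measurableSet_exceed p n), lcoef]
  split_ifs with h
  · rw [exceed_of_isLevel h, setIntegral_He_Ioi]
  · rcases level_cases p n with h0 | h0 | h0
    · rw [exceed_of_zero h0, setIntegral_univ, integral_He_succ]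
    · rw [exceed_of_one h0, setIntegral_empty]
    · exact absurd h0 h

/-- A count is the sum of the indicators of exceeding n, and the integrals may be summed because the
dominating series adds up to the integrable function G |g|. -/
theorem hasSum_integral_exceed {p : PMF ℕ} (hp : SecondMoment p) (g : ℝ → ℝ)
    (hg : MemLp g 2 γ₁) :
    HasSum (fun n => ∫ z, Set.indicator (exceed p n) (fun _ => (1 : ℝ)) z * g z ∂γ₁)
      (∫ z, transform p z * g z ∂γ₁) := by
  refine hasSum_integral_of_dominated_convergence
    (fun n z => Set.indicator (exceed p n) (fun _ => (1 : ℝ)) z * |g z|) (fun n =>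
      ((measurable_const.indicator (measurableSet_exceed p n)).aestronglyMeasurable).mul hg.1)
    (fun n => Filter.Eventually.of_forall fun z => ?_)
    (Filter.Eventually.of_forall fun z => ((hasSum_transform p z).mul_right _).summable) ?_
    (Filter.Eventually.of_forall fun z => (hasSum_transform p z).mul_right _)
  · rw [norm_mul, Real.norm_eq_abs, Real.norm_eq_abs,
      abs_of_nonneg (Set.indicator_nonneg (fun _ _ => zero_le_one) z)]
  · have : ∀ z, ∑' n, Set.indicator (exceed p n) (fun _ => (1 : ℝ)) z * |g z|
        = transform p z * |g z| := fun z => ((hasSum_transform p z).mul_right _).tsum_eq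
    simp_rw [this]
    exact integrable_mul_of_memLp hp hg.abs

theorem hasSum_lcoef {p : PMF ℕ} (hp : SecondMoment p) (k : ℕ) :
    HasSum (lcoef p k) (hermiteCoeff p (k + 1)) := by
  have h := hasSum_integral_exceed hp _ (memLp_He (k + 1))
  simp_rw [integral_indicator_exceed_He] at h
  exact h

/-- The second moment of a law on the counts. -/
noncomputable def sqMoment (p : PMF ℕ) : ℝ := ∫ z, transform p z ^ 2 ∂γ₁

theorem sqMoment_nonneg (p : PMF ℕ) : 0 ≤ sqMoment p := integral_nonneg fun _ => sq_nonneg _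

/-- With |He| in place of He the layers add up to the integral of G |He|, to which Cauchy–Schwarz
applies. The absolute bound is what permits the exchange of summations over levels and orders. -/
theorem summable_abs_lcoef {p : PMF ℕ} (hp : SecondMoment p) (k : ℕ) :
    Summable (fun n => |lcoef p k n|) ∧
      ∑' n, |lcoef p k n| ≤ √(sqMoment p) * √((k + 1).factorial) := by
  have h := hasSum_integral_exceed hp _ (memLp_He (k + 1)).abs
  have hle : ∀ n, |lcoef p k n|
      ≤ ∫ z, Set.indicator (exceed p n) (fun _ => (1 : ℝ)) z * |He (k + 1)| z ∂γ₁ := by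
    intro n
    rw [← integral_indicator_exceed_He]
    refine abs_integral_le_integral_abs.trans (le_of_eq ?_)
    congr 1; ext z
    rw [abs_mul, abs_of_nonneg (Set.indicator_nonneg (fun _ _ => zero_le_one) z)]; rfl
  have hs := h.summable.of_nonneg_of_le (fun n => abs_nonneg _) hle
  refine ⟨hs, (hs.tsum_le_tsum hle h.summable).trans ?_⟩
  rw [h.tsum_eq]
  refine le_trans (le_of_eq ?_) (integral_abs_mul_He_le hp (k + 1))
  congr 1; ext z
  rw [abs_mul, abs_of_nonneg (transform_nonneg p z)]; rfl

theorem abs_hermiteCoeff_le {p : PMF ℕ} (hp : SecondMoment p) (k : ℕ) :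
    |hermiteCoeff p k| ≤ √(sqMoment p) * √(k.factorial) := abs_hcoeff_le hp k

theorem abs_lcoef_le {p : PMF ℕ} (hp : SecondMoment p) (k n : ℕ) :
    |lcoef p k n| ≤ √(sqMoment p) * √((k + 1).factorial) :=
  ((summable_abs_lcoef hp k).1.le_tsum n fun _ _ => abs_nonneg _).trans (summable_abs_lcoef hp k).2

/-! ## Power series -/

theorem summable_linear_mul_pow {x : ℝ} (hx : |x| < 1) :
    Summable fun j : ℕ => ((j : ℝ) + 1) * |x| ^ j := by
  have h1 := summable_pow_mul_geometric_of_norm_lt_one 1 (r := |x|) (by simpa using hx)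
  have h0 := summable_geometric_of_lt_one (abs_nonneg x) hx
  refine (h1.add h0).congr fun j => ?_
  simp only [pow_one]; ring

theorem summable_quadratic_mul_pow {x : ℝ} (hx : |x| < 1) :
    Summable fun j : ℕ => ((j : ℝ) + 1) * (j + 2) * |x| ^ j := by
  have h2 := summable_pow_mul_geometric_of_norm_lt_one 2 (r := |x|) (by simpa using hx)
  have h1 := summable_pow_mul_geometric_of_norm_lt_one 1 (r := |x|) (by simpa using hx)
  have h0 := summable_geometric_of_lt_one (abs_nonneg x) hx
  refine ((h2.add (h1.mul_left 3)).add (h0.mul_left 2)).congr fun j => ?_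
  simp only [pow_one]; ring

/-- Linear growth of the coefficients is allowed because one derivative of the link function already
costs a factor j + 1. The differentiated series converges uniformly on a ball of radius between |x|
and 1. -/
theorem hasDerivAt_tsum_pow {a : ℕ → ℝ} {C : ℝ} (ha : ∀ j, |a j| ≤ C * (j + 1)) {x : ℝ}
    (hx : |x| < 1) :
    HasDerivAt (fun x => ∑' j, a j * x ^ j) (∑' j : ℕ, ((j : ℝ) + 1) * a (j + 1) * x ^ j) x := by
  have hC : 0 ≤ C := by simpa using (abs_nonneg _).trans (ha 0)
  obtain ⟨r, hxr, hr1⟩ := exists_between hx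
  have hr0 : 0 ≤ r := (abs_nonneg x).trans hxr.le
  have hr : |r| < 1 := by rwa [abs_of_nonneg hr0]
  have hu : Summable fun j : ℕ => (j : ℝ) * (C * (j + 1)) * r ^ (j - 1) := by
    rw [← summable_nat_add_iff 1]
    refine ((summable_quadratic_mul_pow hr).mul_left C).congr fun j => ?_
    rw [abs_of_nonneg hr0, Nat.add_sub_cancel]; push_cast; ring
  have key := hasDerivAt_tsum_of_isPreconnected (g := fun (j : ℕ) (y : ℝ) => a j * y ^ j)
    (g' := fun j y => a j * (j * y ^ (j - 1))) (t := Metric.ball 0 r) (y₀ := 0) (y := x) hu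
    Metric.isOpen_ball (convex_ball 0 r).isPreconnected
    (fun j y _ => (hasDerivAt_pow j y).const_mul (a j))
    (fun j y hy => by
      rw [Metric.mem_ball, dist_zero_right, Real.norm_eq_abs] at hy
      rw [norm_mul, norm_mul, norm_pow, Real.norm_eq_abs, Real.norm_eq_abs, Real.norm_eq_abs,
        Nat.abs_cast]
      calc |a j| * (j * |y| ^ (j - 1)) ≤ (C * (j + 1)) * (j * r ^ (j - 1)) := by
            gcongr; exact ha j
        _ = _ := by ring)
    (Metric.mem_ball_self ((abs_nonneg x).trans_lt hxr))
    (by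
      refine summable_of_ne_finset_zero (s := {0}) fun j hj => ?_
      simp only [Finset.mem_singleton] at hj; simp [hj])
    (by rwa [Metric.mem_ball, dist_zero_right, Real.norm_eq_abs])
  refine key.congr_deriv ?_
  have hs : Summable fun j : ℕ => a j * (j * x ^ (j - 1)) := by
    refine hu.of_norm_bounded fun j => ?_
    rw [norm_mul, norm_mul, norm_pow, Real.norm_eq_abs, Real.norm_eq_abs, Real.norm_eq_abs,
        Nat.abs_cast]
    calc |a j| * (j * |x| ^ (j - 1)) ≤ (C * (j + 1)) * (j * r ^ (j - 1)) := by
            gcongr; exact ha j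
        _ = _ := by ring
  rw [hs.tsum_eq_zero_add]
  simp only [Nat.cast_zero, zero_mul, mul_zero, zero_add, Nat.add_sub_cancel]
  congr 1; ext j; push_cast; ring

/-- Fubini for the triple sum over orders and pairs of levels: absolute summability is checked with
the orders outermost, and the orders are then summed first. -/
theorem hasSum_swap {a b : ℕ → ℕ → ℝ} {A B ω : ℕ → ℝ} {κ : ℕ × ℕ → ℝ}
    (ha : ∀ j, Summable (fun n => |a j n|) ∧ ∑' n, |a j n| ≤ A j)
    (hb : ∀ j, Summable (fun n => |b j n|) ∧ ∑' n, |b j n| ≤ B j)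
    (hω : Summable fun j => |ω j| * (A j * B j))
    (hκ : ∀ nm : ℕ × ℕ, HasSum (fun j => a j nm.1 * b j nm.2 * ω j) (κ nm)) :
    HasSum κ (∑' j, (∑' n, a j n) * (∑' n, b j n) * ω j) := by
  set f : ℕ × (ℕ × ℕ) → ℝ := fun x => a x.1 x.2.1 * b x.1 x.2.2 * ω x.1 with hf
  have habs : ∀ j, HasSum (fun nm : ℕ × ℕ => |a j nm.1 * b j nm.2 * ω j|)
      ((∑' n, |a j n|) * (∑' n, |b j n|) * |ω j|) := by
    intro j
    have hs := summable_mul_of_summable_norm (f := fun n => |a j n|) (g := fun n => |b j n|)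
      (by simpa using (ha j).1) (by simpa using (hb j).1)
    have ht := tsum_mul_tsum_of_summable_norm (f := fun n => |a j n|) (g := fun n => |b j n|)
      (by simpa using (ha j).1) (by simpa using (hb j).1)
    rw [ht]
    simpa [abs_mul] using hs.hasSum.mul_right |ω j|
  have hsum : Summable f := by
    rw [← summable_abs_iff]
    rw [summable_prod_of_nonneg (fun _ => abs_nonneg _)]
    refine ⟨fun j => (habs j).summable, ?_⟩
    refine hω.of_nonneg_of_le (fun j => tsum_nonneg fun _ => abs_nonneg _) fun j => ?_
    rw [(habs j).tsum_eq, mul_comm]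
    gcongr
    · exact (tsum_nonneg fun _ => abs_nonneg _).trans (ha j).2
    · exact (ha j).2
    · exact (hb j).2
  have hj : ∀ j, HasSum (fun nm : ℕ × ℕ => f (j, nm)) ((∑' n, a j n) * (∑' n, b j n) * ω j) := by
    intro j
    have hs := summable_mul_of_summable_norm (f := a j) (g := b j)
      (by simpa using (ha j).1) (by simpa using (hb j).1)
    have ht := tsum_mul_tsum_of_summable_norm (f := a j) (g := b j)
      (by simpa using (ha j).1) (by simpa using (hb j).1)
    rw [ht]
    exact hs.hasSum.mul_right (ω j)
  have h1 : HasSum (fun j => (∑' n, a j n) * (∑' n, b j n) * ω j) (∑' x, f x) :=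
    hsum.hasSum.prod_fiberwise hj
  rw [h1.tsum_eq]
  have h2 : HasSum (fun x : (ℕ × ℕ) × ℕ => f x.swap) (∑' x, f x) :=
    (Equiv.prodComm (ℕ × ℕ) ℕ).hasSum_iff.2 hsum.hasSum
  exact h2.prod_fiberwise hκ

end

section

/-! ## The derivatives of the link function -/

/-- The standard bivariate normal density with correlation `u`. -/
noncomputable def biPDF (u x y : ℝ) : ℝ := stdPDF x * stdPDF y * mehler u x y

/-- The logarithmic derivative of the bivariate normal density in the correlation. -/
noncomputable def logDer (u x y : ℝ) : ℝ :=
  u / (1 - u ^ 2) + ((1 + u ^ 2) * (x * y) - u * (x ^ 2 + y ^ 2)) / (1 - u ^ 2) ^ 2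

theorem mehler_pos {u : ℝ} (hu : |u| < 1) (x y : ℝ) : 0 < mehler u x y := by
  have := one_sub_sq_pos hu
  rw [mehler]; positivity

theorem biPDF_pos {u : ℝ} (hu : |u| < 1) (x y : ℝ) : 0 < biPDF u x y :=
  mul_pos (mul_pos (stdPDF_pos x) (stdPDF_pos y)) (mehler_pos hu x y)

theorem hasDerivAt_mehler {u : ℝ} (hu : |u| < 1) (x y : ℝ) :
    HasDerivAt (fun u => mehler u x y) (mehler u x y * logDer u x y) u := by
  have h1 := one_sub_sq_pos hu
  have hd : HasDerivAt (fun u : ℝ => 1 - u ^ 2) (-(2 * u)) u := by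
    refine ((hasDerivAt_pow 2 u).const_sub 1).congr_deriv ?_
    norm_num
  have hs : HasDerivAt (fun u : ℝ => (√(1 - u ^ 2))⁻¹) (-(-(2 * u) / (2 * √(1 - u ^ 2)))
      / (√(1 - u ^ 2)) ^ 2) u := (hd.sqrt h1.ne').inv (Real.sqrt_pos.2 h1).ne'
  have hn : HasDerivAt (fun u : ℝ => -(u ^ 2 * x ^ 2 - 2 * u * x * y + u ^ 2 * y ^ 2))
      (-(2 * u * x ^ 2 - 2 * x * y + 2 * u * y ^ 2)) u := by
    have e : (fun u : ℝ => -(u ^ 2 * x ^ 2 - 2 * u * x * y + u ^ 2 * y ^ 2))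
        = fun u => u ^ 2 * (-x ^ 2 - y ^ 2) + u * (2 * x * y) := by ext u; ring
    rw [e]
    refine (((hasDerivAt_pow 2 u).mul_const _).add ((hasDerivAt_id u).mul_const _)).congr_deriv ?_
    norm_num; ring
  have hq := (hn.div (hd.const_mul 2) (by positivity)).exp
  refine (hs.mul hq).congr_deriv ?_
  have hr : √(1 - u ^ 2) ≠ 0 := (Real.sqrt_pos.2 h1).ne'
  have hr2 : √(1 - u ^ 2) ^ 2 = 1 - u ^ 2 := Real.sq_sqrt h1.le
  rw [mehler, logDer, hr2]
  have h1' := h1.ne'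
  generalize Real.exp (-(u ^ 2 * x ^ 2 - 2 * u * x * y + u ^ 2 * y ^ 2) / (2 * (1 - u ^ 2))) = E
  generalize √(1 - u ^ 2) = r at *
  field_simp
  ring

open Classical in
/-- The bivariate density at a pair of levels. -/
noncomputable def pairDensity (p q : PMF ℕ) (u : ℝ) (nm : ℕ × ℕ) : ℝ :=
  if IsLevel p nm.1 ∧ IsLevel q nm.2 then biPDF u (level p nm.1) (level q nm.2) else 0

open Classical in
/-- The derivative in the correlation of the bivariate density at a pair of levels. -/
noncomputable def pairDensityDeriv (p q : PMF ℕ) (u : ℝ) (nm : ℕ × ℕ) : ℝ :=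
  if IsLevel p nm.1 ∧ IsLevel q nm.2 then
    biPDF u (level p nm.1) (level q nm.2) * logDer u (level p nm.1) (level q nm.2) else 0

/-- The derivative of the link function. -/
noncomputable def linkDeriv (p q : PMF ℕ) (u : ℝ) : ℝ := ∑' nm, pairDensity p q u nm

/-- The second derivative of the link function. -/
noncomputable def linkDeriv2 (p q : PMF ℕ) (u : ℝ) : ℝ := ∑' nm, pairDensityDeriv p q u nm

theorem pairDensity_nonneg (p q : PMF ℕ) {u : ℝ} (hu : |u| < 1) (nm : ℕ × ℕ) :
    0 ≤ pairDensity p q u nm := by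
  rw [pairDensity]; split_ifs
  · exact (biPDF_pos hu _ _).le
  · exact le_rfl

/-- Mehler's formula at a fixed pair of levels. If one of the two is not a genuine level, its
contribution to every Hermite coefficient of positive order vanishes. -/
theorem hasSum_pairDensity_pow (p q : PMF ℕ) {u : ℝ} (hu : |u| < 1) (nm : ℕ × ℕ) :
    HasSum (fun j : ℕ => lcoef p j nm.1 * lcoef q j nm.2 / j.factorial * u ^ j)
      (pairDensity p q u nm) := by
  rw [pairDensity]
  split_ifs with h
  · refine ((hasSum_mehler hu (level p nm.1) (level q nm.2)).mul_left
      (stdPDF (level p nm.1) * stdPDF (level q nm.2))).congr_fun fun j => ?_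
    simp only [lcoef, h.1, h.2, if_true]; ring
  · have : ∀ j, lcoef p j nm.1 * lcoef q j nm.2 = 0 := by
      intro j
      rw [not_and_or] at h
      rcases h with h | h <;> simp [lcoef, h]
    simp [this]

theorem sqrt_factorial_mul (n : ℕ) (a b : ℝ) :
    (a * √(n.factorial)) * (b * √(n.factorial)) = a * b * n.factorial := by
  have : √(n.factorial : ℝ) * √(n.factorial) = n.factorial := Real.mul_self_sqrt (by positivity)
  linear_combination (a * b) * this

variable {p q : PMF ℕ}

/-- The level contribution with index j belongs to the order j + 1, so two factors √((j+1)!) meet j!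
and leave j + 1. -/
theorem abs_lcoef_mul_le (hp : SecondMoment p) (hq : SecondMoment q) (n m j : ℕ) :
    |lcoef p j n * lcoef q j m / j.factorial| ≤ √(sqMoment p) * √(sqMoment q) * (j + 1) := by
  rw [abs_div, abs_mul, Nat.abs_cast, div_le_iff₀ (by positivity)]
  calc |lcoef p j n| * |lcoef q j m|
      ≤ (√(sqMoment p) * √((j + 1).factorial)) * (√(sqMoment q) * √((j + 1).factorial)) := by
        gcongr
        · exact abs_lcoef_le hp j n
        · exact abs_lcoef_le hq j m
    _ = _ := by rw [sqrt_factorial_mul, Nat.factorial_succ]; push_cast; ring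

theorem abs_hermiteCoeff_mul_le (hp : SecondMoment p) (hq : SecondMoment q) (k : ℕ) :
    |hermiteCoeff p k * hermiteCoeff q k / k.factorial| ≤ √(sqMoment p) * √(sqMoment q) := by
  rw [abs_div, abs_mul, Nat.abs_cast, div_le_iff₀ (by positivity)]
  calc |hermiteCoeff p k| * |hermiteCoeff q k|
      ≤ (√(sqMoment p) * √(k.factorial)) * (√(sqMoment q) * √(k.factorial)) := by
        gcongr
        · exact abs_hermiteCoeff_le hp k
        · exact abs_hermiteCoeff_le hq k
    _ = _ := sqrt_factorial_mul _ _ _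

/-- The Hermite series of the derivative of the link function is expanded over the levels. Summing
the orders first, Mehler's formula leaves a bivariate density for each pair of levels, which makes
the derivative visibly nonnegative. -/
theorem hasSum_pairDensity (hp : SecondMoment p) (hq : SecondMoment q) {u : ℝ} (hu : |u| < 1) :
    HasSum (pairDensity p q u)
      (∑' j : ℕ, hermiteCoeff p (j + 1) * hermiteCoeff q (j + 1) * (u ^ j / j.factorial)) := by
  have key := hasSum_swap (a := lcoef p) (b := lcoef q) (ω := fun j => u ^ j / j.factorial)
    (κ := pairDensity p q u) (summable_abs_lcoef hp) (summable_abs_lcoef hq) ?_ ?_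
  · simpa only [(hasSum_lcoef hp _).tsum_eq, (hasSum_lcoef hq _).tsum_eq] using key
  · refine ((summable_linear_mul_pow hu).mul_left (√(sqMoment p) * √(sqMoment q))).congr fun j => ?_
    rw [sqrt_factorial_mul, abs_div, abs_pow, Nat.abs_cast, Nat.factorial_succ]
    push_cast; field_simp
  · intro nm
    exact (hasSum_pairDensity_pow p q hu nm).congr_fun fun j => by ring

theorem hasDerivAt_pairDensity (p q : PMF ℕ) {u : ℝ} (hu : |u| < 1) (nm : ℕ × ℕ) :
    HasDerivAt (fun u => pairDensity p q u nm) (pairDensityDeriv p q u nm) u := by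
  unfold pairDensity pairDensityDeriv
  split_ifs with h
  · refine ((hasDerivAt_mehler hu _ _).const_mul _).congr_deriv ?_
    rw [biPDF]; ring
  · exact hasDerivAt_const _ _

theorem eventually_abs_lt_one {u : ℝ} (hu : |u| < 1) : ∀ᶠ v in nhds u, |v| < 1 :=
  continuous_abs.continuousAt.eventually (gt_mem_nhds hu)

/-- At a fixed pair of levels the power series and the closed form of the density are the same
function near u, so their derivatives agree. -/
theorem hasSum_pairDensityDeriv_pow (hp : SecondMoment p) (hq : SecondMoment q) {u : ℝ}
    (hu : |u| < 1) (nm : ℕ × ℕ) :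
    HasSum (fun j : ℕ => lcoef p (j + 1) nm.1 * lcoef q (j + 1) nm.2 * (u ^ j / j.factorial))
      (pairDensityDeriv p q u nm) := by
  have hb := abs_lcoef_mul_le hp hq nm.1 nm.2
  have h1 := hasDerivAt_tsum_pow hb hu
  have h2 : HasDerivAt (fun x : ℝ => ∑' j : ℕ, lcoef p j nm.1 * lcoef q j nm.2 / j.factorial * x ^ j)
      (pairDensityDeriv p q u nm) u := by
    refine (hasDerivAt_pairDensity p q hu nm).congr_of_eventuallyEq ?_
    filter_upwards [eventually_abs_lt_one hu] with v hv
    exact (hasSum_pairDensity_pow p q hv nm).tsum_eq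
  rw [← h1.unique h2]
  have hs : Summable fun j : ℕ => ((j : ℝ) + 1)
      * (lcoef p (j + 1) nm.1 * lcoef q (j + 1) nm.2 / (j + 1).factorial) * u ^ j := by
    refine ((summable_quadratic_mul_pow hu).mul_left (√(sqMoment p) * √(sqMoment q))).of_norm_bounded
      fun j => ?_
    rw [norm_mul, norm_mul, Real.norm_eq_abs, Real.norm_eq_abs, Real.norm_eq_abs, abs_pow,
      abs_of_nonneg (by positivity : (0 : ℝ) ≤ (j : ℝ) + 1)]
    have := hb (j + 1)
    push_cast at this
    calc ((j : ℝ) + 1) * |lcoef p (j + 1) nm.1 * lcoef q (j + 1) nm.2 / (j + 1).factorial| * |u| ^ j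
        ≤ ((j : ℝ) + 1) * (√(sqMoment p) * √(sqMoment q) * (j + 1 + 1)) * |u| ^ j := by gcongr
      _ = _ := by ring
  refine hs.hasSum.congr_fun fun j => ?_
  rw [Nat.factorial_succ]; push_cast; field_simp

theorem hasSum_pairDensityDeriv (hp : SecondMoment p) (hq : SecondMoment q) {u : ℝ}
    (hu : |u| < 1) :
    HasSum (pairDensityDeriv p q u)
      (∑' j : ℕ, hermiteCoeff p (j + 2) * hermiteCoeff q (j + 2) * (u ^ j / j.factorial)) := by
  have key := hasSum_swap (a := fun j => lcoef p (j + 1)) (b := fun j => lcoef q (j + 1))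
    (ω := fun j => u ^ j / j.factorial)
    (κ := pairDensityDeriv p q u) (fun j => summable_abs_lcoef hp (j + 1))
    (fun j => summable_abs_lcoef hq (j + 1)) ?_ (hasSum_pairDensityDeriv_pow hp hq hu)
  · simpa only [(hasSum_lcoef hp _).tsum_eq, (hasSum_lcoef hq _).tsum_eq] using key
  · refine ((summable_quadratic_mul_pow hu).mul_left (√(sqMoment p) * √(sqMoment q))).congr
      fun j => ?_
    rw [sqrt_factorial_mul, abs_div, abs_pow, Nat.abs_cast, Nat.factorial_succ, Nat.factorial_succ]
    push_cast; field_simp; ring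

/-- The coefficients of the power series of the link function. -/
noncomputable def linkCoeff (p q : PMF ℕ) (j : ℕ) : ℝ :=
  if j = 0 then 0 else hermiteCoeff p j * hermiteCoeff q j / j.factorial

theorem abs_linkCoeff_le (hp : SecondMoment p) (hq : SecondMoment q) (j : ℕ) :
    |linkCoeff p q j| ≤ √(sqMoment p) * √(sqMoment q) := by
  rw [linkCoeff]; split_ifs
  · rw [abs_zero]; positivity
  · exact abs_hermiteCoeff_mul_le hp hq j

theorem link_eq_tsum (p q : PMF ℕ) (u : ℝ) : link p q u = ∑' j, linkCoeff p q j * u ^ j := by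
  have h : Function.support (fun j => linkCoeff p q j * u ^ j) ⊆ Set.range Nat.succ := by
    intro j hj
    cases j with
    | zero => simp [linkCoeff] at hj
    | succ j => exact ⟨j, rfl⟩
  rw [← Function.Injective.tsum_eq Nat.succ_injective h]
  rfl

theorem hasDerivAt_link (hp : SecondMoment p) (hq : SecondMoment q) {u : ℝ} (hu : |u| < 1) :
    HasDerivAt (link p q) (linkDeriv p q u) u := by
  have h := hasDerivAt_tsum_pow (a := linkCoeff p q) (C := √(sqMoment p) * √(sqMoment q))
    (fun j => (abs_linkCoeff_le hp hq j).trans (le_mul_of_one_le_right (by positivity) (by simp))) hu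
  rw [show link p q = _ from funext (link_eq_tsum p q)]
  refine h.congr_deriv ?_
  rw [linkDeriv, (hasSum_pairDensity hp hq hu).tsum_eq]
  congr 1; ext j
  rw [linkCoeff, if_neg (Nat.succ_ne_zero j), Nat.factorial_succ]; push_cast; field_simp

theorem hasDerivAt_linkDeriv (hp : SecondMoment p) (hq : SecondMoment q) {u : ℝ} (hu : |u| < 1) :
    HasDerivAt (linkDeriv p q) (linkDeriv2 p q u) u := by
  have h := hasDerivAt_tsum_pow
    (a := fun j : ℕ => hermiteCoeff p (j + 1) * hermiteCoeff q (j + 1) / j.factorial)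
    (C := √(sqMoment p) * √(sqMoment q)) (fun j => by
      have := abs_hermiteCoeff_mul_le hp hq (j + 1)
      rw [Nat.factorial_succ, abs_div, Nat.abs_cast, div_le_iff₀ (by positivity)] at this
      rw [abs_div, Nat.abs_cast, div_le_iff₀ (by positivity)]
      refine this.trans (le_of_eq ?_)
      push_cast; ring) hu
  refine (h.congr_deriv ?_).congr_of_eventuallyEq ?_
  · rw [linkDeriv2, (hasSum_pairDensityDeriv hp hq hu).tsum_eq]
    congr 1; ext j
    rw [Nat.factorial_succ]; push_cast; field_simp
  · filter_upwards [eventually_abs_lt_one hu] with v hv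
    rw [linkDeriv, (hasSum_pairDensity hp hq hv).tsum_eq]
    congr 1; ext j; ring

theorem link_zero (p q : PMF ℕ) : link p q 0 = 0 := by simp [link]

theorem link_comm (p q : PMF ℕ) (u : ℝ) : link p q u = link q p u := by
  rw [link, link]; congr 1; ext k; rw [mul_comm (hermiteCoeff p _)]

theorem linkDeriv_nonneg (p q : PMF ℕ) {u : ℝ} (hu : |u| < 1) : 0 ≤ linkDeriv p q u :=
  tsum_nonneg (pairDensity_nonneg p q hu)

/-! ## Covariances of transformed normal variables -/

theorem integral_transform_mul_of_hasGaussianLaw {Ω : Type*} [MeasurableSpace Ω] {P : Measure Ω}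
    {X Y : Ω → ℝ} (h : HasGaussianLaw (fun ω => (X ω, Y ω)) P) (hX0 : ∫ ω, X ω ∂P = 0)
    (hY0 : ∫ ω, Y ω ∂P = 0) (hX1 : ∫ ω, X ω ^ 2 ∂P = 1) (hY1 : ∫ ω, Y ω ^ 2 ∂P = 1) {u : ℝ}
    (hu : |u| < 1) (hXY : ∫ ω, X ω * Y ω ∂P = u) (hp : SecondMoment p) (hq : SecondMoment q) :
    ∫ ω, transform p (X ω) * transform q (Y ω) ∂P
      = (∫ z, transform p z ∂γ₁) * (∫ z, transform q z ∂γ₁) + link p q u := by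
  have key := hasSum_integral_of_hasGaussianLaw h hX0 hY0 hX1 hY1 hu hXY (measurable_transform p)
    (measurable_transform q) hp hq
  rw [← key.tsum_eq, key.summable.tsum_eq_zero_add]
  congr 1
  · simp [hcoeff, He_zero]
  · rw [link]; congr 1; ext j; rw [mul_div_right_comm]; rfl

end

section

/-! ## The link function at the endpoints -/

variable {p q : PMF ℕ}

theorem hcoeff_transform (p : PMF ℕ) (j : ℕ) : hcoeff (transform p) j = hermiteCoeff p j := rfl

/-- Both coordinates are standard normal, so Cauchy–Schwarz bounds the mixed moment by the second
moment. -/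
theorem integral_rotation_le (hp : SecondMoment p) {u : ℝ} (hu : |u| < 1) :
    ∫ z : ℝ × ℝ, transform p z.1 * transform p (u * z.1 + √(1 - u ^ 2) * z.2) ∂((γ₁).prod γ₁)
      ≤ sqMoment p := by
  have h1 : MemLp (fun z : ℝ × ℝ => transform p z.1) 2 ((γ₁).prod γ₁) :=
    hp.comp_measurePreserving measurePreserving_fst
  have h2 : MemLp (fun z : ℝ × ℝ => transform p (u * z.1 + √(1 - u ^ 2) * z.2)) 2
      ((γ₁).prod γ₁) := hp.comp_measurePreserving (measurePreserving_rotation hu)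
  have e1 : ∫ z : ℝ × ℝ, transform p z.1 ^ 2 ∂((γ₁).prod γ₁) = sqMoment p := by
    rw [integral_fun_fst (fun x => transform p x ^ 2)]; simp [sqMoment]
  have e2 : ∫ z : ℝ × ℝ, transform p (u * z.1 + √(1 - u ^ 2) * z.2) ^ 2 ∂((γ₁).prod γ₁)
      = sqMoment p := by
    have := integral_map (μ := (γ₁).prod γ₁) (measurePreserving_rotation hu).measurable.aemeasurable
      (f := fun x => transform p x ^ 2)
      (((measurable_transform p).pow_const 2).aestronglyMeasurable)
    rw [(measurePreserving_rotation hu).map_eq] at this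
    exact this.symm
  have := abs_integral_mul_le h1 h2
  rw [e1, e2, Real.mul_self_sqrt (sqMoment_nonneg p)] at this
  exact (le_abs_self _).trans this

/-- Bessel's inequality, by letting u increase to 1 in the expansion of the mixed moment with
correlation u. -/
theorem sum_range_hermiteCoeff_sq_le (hp : SecondMoment p) (n : ℕ) :
    ∑ j ∈ Finset.range n, hermiteCoeff p j ^ 2 / j.factorial ≤ sqMoment p := by
  have hc : Filter.Tendsto (fun u : ℝ => ∑ j ∈ Finset.range n,
      hermiteCoeff p j ^ 2 / j.factorial * u ^ j) (nhdsWithin 1 (Set.Iio 1))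
      (nhds (∑ j ∈ Finset.range n, hermiteCoeff p j ^ 2 / j.factorial)) := by
    have : Continuous (fun u : ℝ => ∑ j ∈ Finset.range n,
      hermiteCoeff p j ^ 2 / j.factorial * u ^ j) := by fun_prop
    have := (this.tendsto 1).mono_left (nhdsWithin_le_nhds (s := Set.Iio 1))
    simpa using this
  refine le_of_tendsto hc ?_
  filter_upwards [Ioo_mem_nhdsLT (show (0 : ℝ) < 1 by norm_num)] with u hu
  have hu1 : |u| < 1 := by rw [abs_of_pos hu.1]; exact hu.2
  have hs := hasSum_integral_rotation hu1 (measurable_transform p) hp hp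
  refine le_trans ?_ (integral_rotation_le hp hu1)
  rw [← hs.tsum_eq]
  refine le_trans (le_of_eq ?_) (hs.summable.sum_le_tsum (Finset.range n) fun j _ => ?_)
  · refine Finset.sum_congr rfl fun j _ => ?_
    rw [hcoeff_transform]; ring
  · have := mul_self_nonneg (hcoeff (transform p) j)
    have := hu.1
    positivity

theorem summable_hermiteCoeff_sq (hp : SecondMoment p) :
    Summable (fun j : ℕ => hermiteCoeff p j ^ 2 / j.factorial) :=
  summable_of_sum_range_le (fun j => by positivity) (sum_range_hermiteCoeff_sq_le hp)

/-- Parseval's identity without completeness of the Hermite polynomials. For the lower bound, u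
tends to 1 in the mixed moment with correlation u and Fatou's lemma is applied: the transformation
is monotone, hence continuous outside a countable null set, and the rotated argument converges to
the first coordinate. -/
theorem tsum_hermiteCoeff_sq (hp : SecondMoment p) :
    ∑' j : ℕ, hermiteCoeff p j ^ 2 / j.factorial = sqMoment p := by
  have hpart : ∀ u : ℝ, 0 < u → u < 1 →
      (∫ z : ℝ × ℝ, transform p z.1 * transform p (u * z.1 + √(1 - u ^ 2) * z.2) ∂((γ₁).prod γ₁))
        ≤ ∑' j : ℕ, hermiteCoeff p j ^ 2 / j.factorial := by
    intro u h0 h1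
    have hu1 : |u| < 1 := by rwa [abs_of_pos h0]
    have hs := hasSum_integral_rotation hu1 (measurable_transform p) hp hp
    rw [← hs.tsum_eq]
    refine hs.summable.tsum_le_tsum (fun j => ?_) (summable_hermiteCoeff_sq hp)
    rw [hcoeff_transform, div_eq_mul_inv, div_eq_mul_inv]
    have := pow_le_one₀ h0.le h1.le (n := j)
    have hb : 0 ≤ hermiteCoeff p j ^ 2 * ((j.factorial : ℝ))⁻¹ := by positivity
    nlinarith
  apply le_antisymm
  · exact (summable_hermiteCoeff_sq hp).tsum_le_of_sum_range_le (sum_range_hermiteCoeff_sq_le hp)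
  · set A := ∑' j : ℕ, hermiteCoeff p j ^ 2 / j.factorial with hA
    have hA0 : 0 ≤ A := tsum_nonneg fun j => by positivity
    let u : ℕ → ℝ := fun n => 1 - 1 / ((n : ℝ) + 2)
    have hu0 : ∀ n, 0 < u n := fun n => by
      have : 1 / ((n : ℝ) + 2) < 1 := by rw [div_lt_one (by positivity)]; linarith [n.cast_nonneg (α := ℝ)]
      simp only [u]; linarith
    have hu1 : ∀ n, u n < 1 := fun n => by
      have : 0 < 1 / ((n : ℝ) + 2) := by positivity
      simp only [u]; linarith
    have hut : Filter.Tendsto u Filter.atTop (nhds 1) := by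
      have h : Filter.Tendsto (fun n : ℕ => 1 / ((n : ℝ) + 2)) Filter.atTop (nhds 0) :=
        tendsto_const_nhds.div_atTop
          (Filter.tendsto_atTop_add_const_right _ _ tendsto_natCast_atTop_atTop)
      simpa [u] using h.const_sub 1
    let f : ℕ → ℝ × ℝ → ℝ≥0∞ := fun n z =>
      ENNReal.ofReal (transform p z.1 * transform p (u n * z.1 + √(1 - u n ^ 2) * z.2))
    have hfm : ∀ n, Measurable (f n) := fun n => by
      have := measurable_transform p
      fun_prop
    have hlim : ∀ᵐ z ∂((γ₁).prod γ₁),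
        ENNReal.ofReal (transform p z.1 ^ 2) = Filter.liminf (fun n => f n z) Filter.atTop := by
      have hcount := (monotone_transform p).countable_not_continuousAt
      have h0 : ∀ᵐ x ∂γ₁, ContinuousAt (transform p) x := by
        have hna : NullSingletonClass γ₁ := nullSingletonClass_gaussianReal one_ne_zero
        simpa using hcount.ae_notMem (μ := γ₁)
      have h1 : ∀ᵐ z ∂((γ₁).prod γ₁), ContinuousAt (transform p) z.1 :=
        measurePreserving_fst.quasiMeasurePreserving.ae h0
      filter_upwards [h1] with z hz
      have ht : Filter.Tendsto (fun n => u n * z.1 + √(1 - u n ^ 2) * z.2) Filter.atTop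
          (nhds z.1) := by
        have := (hut.mul_const z.1).add
          (((Real.continuous_sqrt.tendsto _).comp ((hut.pow 2).const_sub 1)).mul_const z.2)
        simpa using this
      have := (ENNReal.continuous_ofReal.tendsto _).comp
        ((hz.tendsto.comp ht).const_mul (transform p z.1))
      rw [sq]
      exact this.liminf_eq.symm
    have hF := lintegral_liminf_le (μ := (γ₁).prod γ₁) (u := Filter.atTop) hfm
    rw [← lintegral_congr_ae hlim] at hF
    have hL : ∫⁻ z : ℝ × ℝ, ENNReal.ofReal (transform p z.1 ^ 2) ∂((γ₁).prod γ₁)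
        = ENNReal.ofReal (sqMoment p) := by
      have hsq : Integrable (fun z : ℝ × ℝ => transform p z.1 ^ 2) ((γ₁).prod γ₁) :=
        (hp.comp_measurePreserving (measurePreserving_fst (μ := γ₁) (ν := γ₁))).integrable_sq
      rw [← ofReal_integral_eq_lintegral_ofReal hsq (Filter.Eventually.of_forall fun _ => sq_nonneg _),
        integral_fun_fst (fun x => transform p x ^ 2)]
      simp [sqMoment]
    have hR : ∀ n, ∫⁻ z, f n z ∂((γ₁).prod γ₁) ≤ ENNReal.ofReal A := by
      intro n
      have hun : |u n| < 1 := by rw [abs_of_pos (hu0 n)]; exact hu1 n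
      have hi : Integrable (fun z : ℝ × ℝ =>
          transform p z.1 * transform p (u n * z.1 + √(1 - u n ^ 2) * z.2)) ((γ₁).prod γ₁) :=
        integrable_mul_of_memLp (hp.comp_measurePreserving measurePreserving_fst)
          (hp.comp_measurePreserving (measurePreserving_rotation hun))
      simp only [f]
      rw [← ofReal_integral_eq_lintegral_ofReal hi (Filter.Eventually.of_forall fun _ =>
        mul_nonneg (transform_nonneg _ _) (transform_nonneg _ _))]
      exact ENNReal.ofReal_le_ofReal (hpart _ (hu0 n) (hu1 n))
    rw [hL] at hF
    have : Filter.liminf (fun n => ∫⁻ z, f n z ∂((γ₁).prod γ₁)) Filter.atTop ≤ ENNReal.ofReal A :=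
      Filter.liminf_le_of_le (by isBoundedDefault) fun b hb => by
        obtain ⟨n, hn⟩ := hb.exists
        exact hn.trans (hR n)
    exact (ENNReal.ofReal_le_ofReal_iff hA0).1 (hF.trans this)

/-- The mean of a count with law `p`. -/
noncomputable def countMean (p : PMF ℕ) : ℝ := ∫ z, transform p z ∂γ₁

theorem hermiteCoeff_zero (p : PMF ℕ) : hermiteCoeff p 0 = countMean p := by
  simp [hermiteCoeff, countMean]

theorem linkCoeff_self_nonneg (p : PMF ℕ) (j : ℕ) : 0 ≤ linkCoeff p p j := by
  rw [linkCoeff]; split_ifs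
  · exact le_rfl
  · exact div_nonneg (mul_self_nonneg _) (by positivity)

theorem summable_abs_linkCoeff (hp : SecondMoment p) (hq : SecondMoment q) :
    Summable (fun j => |linkCoeff p q j|) := by
  refine Summable.of_nonneg_of_le (fun _ => abs_nonneg _) (fun j => ?_)
    ((summable_hermiteCoeff_sq hp).add (summable_hermiteCoeff_sq hq))
  rw [linkCoeff, ← add_div]; split_ifs
  · rw [abs_zero]; positivity
  · rw [abs_div, Nat.abs_cast]
    gcongr
    rw [abs_mul]
    nlinarith [sq_nonneg (|hermiteCoeff p j| - |hermiteCoeff q j|), sq_abs (hermiteCoeff p j),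
      sq_abs (hermiteCoeff q j), abs_nonneg (hermiteCoeff p j), abs_nonneg (hermiteCoeff q j)]

theorem link_self_one (hp : SecondMoment p) : link p p 1 = sqMoment p - countMean p ^ 2 := by
  have h := tsum_hermiteCoeff_sq hp
  rw [(summable_hermiteCoeff_sq hp).tsum_eq_zero_add, hermiteCoeff_zero] at h
  rw [← h, link]
  simp [sq]

theorem continuousOn_link (hp : SecondMoment p) (hq : SecondMoment q) :
    ContinuousOn (link p q) (Set.Icc (-1) 1) := by
  rw [show link p q = _ from funext (link_eq_tsum p q)]
  refine continuousOn_tsum (u := fun j => |linkCoeff p q j|) (fun j => by fun_prop)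
    (summable_abs_linkCoeff hp hq) fun j u hu => ?_
  rw [Real.norm_eq_abs, abs_mul, abs_pow]
  exact mul_le_of_le_one_right (abs_nonneg _) (pow_le_one₀ (abs_nonneg _) (abs_le.2 hu))

theorem summable_linkCoeff_mul_pow (hp : SecondMoment p) (hq : SecondMoment q) {u : ℝ}
    (hu : |u| ≤ 1) : Summable (fun j => linkCoeff p q j * u ^ j) := by
  refine Summable.of_norm_bounded (summable_abs_linkCoeff hp hq) fun j => ?_
  rw [Real.norm_eq_abs, abs_mul, abs_pow]
  exact mul_le_of_le_one_right (abs_nonneg _) (pow_le_one₀ (abs_nonneg _) hu)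

/-- The autocovariance link function lies below its chord on the positive half-axis. -/
theorem link_self_le (hp : SecondMoment p) {u : ℝ} (h0 : 0 ≤ u) (h1 : u ≤ 1) :
    link p p u ≤ u * link p p 1 := by
  rw [link_eq_tsum, link_eq_tsum, ← tsum_mul_left]
  refine (summable_linkCoeff_mul_pow hp hp (by rwa [abs_of_nonneg h0])).tsum_le_tsum (fun j => ?_)
    ((summable_linkCoeff_mul_pow hp hp (by simp)).mul_left u)
  cases j with
  | zero => simp [linkCoeff]
  | succ j =>
    have := linkCoeff_self_nonneg p (j + 1)
    have h2 := pow_le_one₀ h0 h1 (n := j)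
    rw [pow_succ, one_pow]
    have : u ^ j * u ≤ 1 * u := by gcongr
    nlinarith

theorem linkDeriv_pos (hp : SecondMoment p) (hq : SecondMoment q) {u : ℝ} (hu : |u| < 1) {n m : ℕ}
    (hn : IsLevel p n) (hm : IsLevel q m) : 0 < linkDeriv p q u := by
  refine (hasSum_pairDensity hp hq hu).summable.tsum_pos (pairDensity_nonneg p q hu) (n, m) ?_
  rw [pairDensity, if_pos ⟨hn, hm⟩]
  exact biPDF_pos hu _ _

theorem monotoneOn_link (hp : SecondMoment p) (hq : SecondMoment q) :
    MonotoneOn (link p q) (Set.Icc (-1) 1) := by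
  refine monotoneOn_of_hasDerivWithinAt_nonneg (convex_Icc _ _) (continuousOn_link hp hq)
    (f' := linkDeriv p q) (fun x hx => ?_) fun x hx => ?_
  all_goals rw [interior_Icc] at hx
  · exact (hasDerivAt_link hp hq (abs_lt.2 hx)).hasDerivWithinAt
  · exact linkDeriv_nonneg p q (abs_lt.2 hx)

theorem strictMonoOn_link (hp : SecondMoment p) (hq : SecondMoment q) {n m : ℕ}
    (hn : IsLevel p n) (hm : IsLevel q m) : StrictMonoOn (link p q) (Set.Icc (-1) 1) := by
  refine strictMonoOn_of_hasDerivWithinAt_pos (convex_Icc _ _) (continuousOn_link hp hq)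
    (f' := linkDeriv p q) (fun x hx => ?_) fun x hx => ?_
  all_goals rw [interior_Icc] at hx
  · exact (hasDerivAt_link hp hq (abs_lt.2 hx)).hasDerivWithinAt
  · exact linkDeriv_pos hp hq (abs_lt.2 hx) hn hm

theorem bddAbove_linkInv_set (p q : PMF ℕ) (y : ℝ) :
    BddAbove (insert (-1) {x : ℝ | x ∈ Set.Icc (-1) 1 ∧ link p q x ≤ y}) := by
  refine ⟨1, ?_⟩
  rintro x (rfl | hx)
  · norm_num
  · exact hx.1.2

theorem linkInv_mem_Icc (p q : PMF ℕ) (y : ℝ) : linkInv p q y ∈ Set.Icc (-1 : ℝ) 1 := by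
  refine ⟨le_csSup (bddAbove_linkInv_set p q y) (Set.mem_insert _ _), csSup_le ⟨_, Set.mem_insert _ _⟩ ?_⟩
  rintro x (rfl | hx)
  · norm_num
  · exact hx.1.2

/-- Points to the right of the supremum violate the defining inequality, and the link function is
continuous from the right there. The case where the inverse is -1 because y lies below the range is
included. -/
theorem le_link_linkInv (hp : SecondMoment p) (hq : SecondMoment q) {y : ℝ}
    (h : linkInv p q y < 1) : y ≤ link p q (linkInv p q y) := by
  have hm := linkInv_mem_Icc p q y
  have hc := (continuousOn_link hp hq _ hm).mono
    (show Set.Ioc (linkInv p q y) 1 ⊆ Set.Icc (-1) 1 from fun x hx => ⟨hm.1.trans hx.1.le, hx.2⟩)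
  have hne : (nhdsWithin (linkInv p q y) (Set.Ioc (linkInv p q y) 1)).NeBot := by
    rw [nhdsWithin_Ioc_eq_nhdsGT h]; infer_instance
  refine ge_of_tendsto hc.tendsto ?_
  filter_upwards [self_mem_nhdsWithin] with x hx
  by_contra! hlt
  exact absurd (le_csSup (bddAbove_linkInv_set p q y)
    (Or.inr ⟨⟨hm.1.trans hx.1.le, hx.2⟩, hlt.le⟩)) (not_le.2 hx.1)

/-- The sublevel set is closed, so its supremum belongs to it; the hypothesis excludes the case
where only the inserted point -1 remains. -/
theorem link_linkInv_le (hp : SecondMoment p) (hq : SecondMoment q) {y : ℝ}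
    (h : -1 < linkInv p q y) : link p q (linkInv p q y) ≤ y := by
  set S := {x : ℝ | x ∈ Set.Icc (-1) 1 ∧ link p q x ≤ y} with hS
  have hne : S.Nonempty := by
    by_contra hne
    rw [Set.not_nonempty_iff_eq_empty] at hne
    rw [linkInv, ← hS, hne] at h
    simp at h
  have hclosed : IsClosed S :=
    ContinuousOn.preimage_isClosed_of_isClosed (continuousOn_link hp hq) isClosed_Icc isClosed_Iic
  have hbdd : BddAbove S := ⟨1, fun x hx => hx.1.2⟩
  have hmem := hclosed.csSup_mem hne hbdd
  have : linkInv p q y = sSup S := by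
    rw [linkInv, csSup_insert hbdd hne]
    exact sup_eq_right.2 hmem.1.1
  rw [this]; exact hmem.2

theorem link_linkInv (hp : SecondMoment p) (hq : SecondMoment q) {y : ℝ}
    (h : |linkInv p q y| < 1) : link p q (linkInv p q y) = y :=
  le_antisymm (link_linkInv_le hp hq (abs_lt.1 h).1) (le_link_linkInv hp hq (abs_lt.1 h).2)

end

section

/-! ## Sums over the levels -/

open Classical in
/-- The sum of a function over the levels of a law. -/
noncomputable def levelSum (p : PMF ℕ) (f : ℝ → ℝ) : ℝ≥0∞ :=
  ∑' n, if IsLevel p n then ENNReal.ofReal (f (level p n)) else 0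

/-- The moments of the levels. -/
noncomputable def levelMoment (p : PMF ℕ) (k : ℕ) (x : ℝ) : ℝ≥0∞ :=
  levelSum p fun y => Real.exp (-(y ^ 2) / (2 * x)) * |y| ^ k / √(2 * Real.pi)

theorem levelSum_mono {p : PMF ℕ} {f g : ℝ → ℝ} (h : ∀ x, f x ≤ g x) :
    levelSum p f ≤ levelSum p g := by
  refine ENNReal.tsum_le_tsum fun n => ?_
  split_ifs
  · exact ENNReal.ofReal_le_ofReal (h _)
  · exact le_rfl

theorem levelSum_add {p : PMF ℕ} {f g : ℝ → ℝ} (hf : ∀ x, 0 ≤ f x) (hg : ∀ x, 0 ≤ g x) :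
    levelSum p (fun x => f x + g x) = levelSum p f + levelSum p g := by
  rw [levelSum, levelSum, levelSum, ← ENNReal.tsum_add]
  congr 1; ext n
  split_ifs
  · exact ENNReal.ofReal_add (hf _) (hg _)
  · simp

theorem levelSum_const_mul {p : PMF ℕ} {f : ℝ → ℝ} {a : ℝ} (ha : 0 ≤ a) :
    levelSum p (fun x => a * f x) = ENNReal.ofReal a * levelSum p f := by
  rw [levelSum, levelSum, ← ENNReal.tsum_mul_left]
  congr 1; ext n
  split_ifs
  · exact ENNReal.ofReal_mul ha
  · simp

open Classical in
theorem tsum_pair_levels (p q : PMF ℕ) {f g : ℝ → ℝ} (hf : ∀ x, 0 ≤ f x) :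
    ∑' nm : ℕ × ℕ, (if IsLevel p nm.1 ∧ IsLevel q nm.2 then
        ENNReal.ofReal (f (level p nm.1) * g (level q nm.2)) else 0)
      = levelSum p f * levelSum q g := by
  rw [ENNReal.tsum_prod', levelSum, ← ENNReal.tsum_mul_right]
  congr 1; ext n
  rw [levelSum, ← ENNReal.tsum_mul_left]
  congr 1; ext m
  by_cases h1 : IsLevel p n <;> by_cases h2 : IsLevel q m <;>
    simp [h1, h2, ENNReal.ofReal_mul (hf _)]

theorem levelMoment_mono (p : PMF ℕ) (k : ℕ) {x y : ℝ} (hx : 0 < x) (hxy : x ≤ y) :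
    levelMoment p k x ≤ levelMoment p k y := by
  refine levelSum_mono fun z => ?_
  gcongr ?_ * _ / _
  rw [Real.exp_le_exp, neg_div, neg_div, neg_le_neg_iff]
  gcongr

theorem sqrt_two_pi_sq : √(2 * Real.pi) * √(2 * Real.pi) = 2 * Real.pi :=
  Real.mul_self_sqrt (by positivity)

theorem inv_two_pi : (2 * Real.pi)⁻¹ = (√(2 * Real.pi))⁻¹ * (√(2 * Real.pi))⁻¹ := by
  rw [← mul_inv, sqrt_two_pi_sq]

theorem biPDF_eq {u : ℝ} (hu : |u| < 1) (x y : ℝ) :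
    biPDF u x y = (√(1 - u ^ 2))⁻¹ * (2 * Real.pi)⁻¹
      * Real.exp (-(x ^ 2 - 2 * u * x * y + y ^ 2) / (2 * (1 - u ^ 2))) := by
  have h1 := one_sub_sq_pos hu
  rw [biPDF, stdPDF_eq, stdPDF_eq, mehler, inv_two_pi]
  have : Real.exp (-(x ^ 2 - 2 * u * x * y + y ^ 2) / (2 * (1 - u ^ 2)))
      = Real.exp (-x ^ 2 / 2) * Real.exp (-y ^ 2 / 2)
        * Real.exp (-(u ^ 2 * x ^ 2 - 2 * u * x * y + u ^ 2 * y ^ 2) / (2 * (1 - u ^ 2))) := by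
    rw [← Real.exp_add, ← Real.exp_add]
    congr 1
    field_simp; ring
  rw [this]; ring

theorem two_mul_mul_le_abs (u x y : ℝ) : |2 * u * x * y| ≤ |u| * (x ^ 2 + y ^ 2) := by
  rw [show 2 * u * x * y = u * (2 * (x * y)) by ring, abs_mul]
  gcongr
  rw [abs_le]; constructor <;> nlinarith [sq_nonneg (x + y), sq_nonneg (x - y)]

/-- The quadratic form x² - 2uxy + y² is at least (1 - |u|)(x² + y²); division by 2(1 - u²) leaves
1/(2(1 + |u|)). The point is that the bound is a product in x and y. -/
theorem biPDF_le {u c : ℝ} (hc : c < 1) (huc : |u| ≤ c) (x y : ℝ) :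
    biPDF u x y ≤ (√(1 - u ^ 2))⁻¹ * ((Real.exp (-(x ^ 2) / (2 * (1 + c))) / √(2 * Real.pi))
      * (Real.exp (-(y ^ 2) / (2 * (1 + c))) / √(2 * Real.pi))) := by
  have hu : |u| < 1 := huc.trans_lt hc
  have h1 := one_sub_sq_pos hu
  have hc0 : 0 ≤ c := (abs_nonneg u).trans huc
  rw [biPDF_eq hu, inv_two_pi, mul_assoc]
  gcongr ?_ * ?_
  rw [div_mul_div_comm, ← Real.exp_add, ← mul_inv, ← div_eq_inv_mul]
  gcongr
  rw [← add_div, div_le_div_iff₀ (by positivity) (by positivity)]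
  have h2 := (abs_le.1 (two_mul_mul_le_abs u x y)).2
  have h3 : (1 - |u|) * (1 + |u|) = 1 - u ^ 2 := by rw [← sq_abs u]; ring
  rw [← h3]
  have h4 : (1 - |u|) * (x ^ 2 + y ^ 2) ≤ x ^ 2 - 2 * u * x * y + y ^ 2 := by linarith
  have h5 : 0 ≤ x ^ 2 + y ^ 2 := by positivity
  have h6 : 0 < 1 - |u| := by linarith
  nlinarith [mul_le_mul_of_nonneg_right h4 (show 0 ≤ 2 * (1 + c) by positivity),
    mul_nonneg (mul_nonneg h6.le h5) (sub_nonneg.2 huc)]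

/-- Now the quadratic form is at most (1 + |u|)(x² + y²), and division by 2(1 - u²) leaves 1/(2(1 -
|u|)). -/
theorem le_biPDF {u c : ℝ} (hc : c < 1) (huc : |u| ≤ c) (x y : ℝ) :
    (√(1 - u ^ 2))⁻¹ * ((Real.exp (-(x ^ 2) / (2 * (1 - c))) / √(2 * Real.pi))
      * (Real.exp (-(y ^ 2) / (2 * (1 - c))) / √(2 * Real.pi))) ≤ biPDF u x y := by
  have hu : |u| < 1 := huc.trans_lt hc
  have h1 := one_sub_sq_pos hu
  have hc1 : 0 < 1 - c := by linarith
  rw [biPDF_eq hu, inv_two_pi, mul_assoc]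
  gcongr ?_ * ?_
  rw [div_mul_div_comm, ← Real.exp_add, div_eq_inv_mul, mul_inv]
  gcongr ?_ * Real.exp ?_
  rw [← add_div, div_le_div_iff₀ (by positivity) (by positivity)]
  have h2 := (abs_le.1 (two_mul_mul_le_abs u x y)).1
  have h3 : (1 - |u|) * (1 + |u|) = 1 - u ^ 2 := by rw [← sq_abs u]; ring
  rw [← h3]
  have h4 : x ^ 2 - 2 * u * x * y + y ^ 2 ≤ (1 + |u|) * (x ^ 2 + y ^ 2) := by linarith
  have h5 : 0 ≤ x ^ 2 + y ^ 2 := by positivity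
  have h6 : 0 ≤ 1 + |u| := by positivity
  nlinarith [mul_le_mul_of_nonneg_right h4 (show 0 ≤ 2 * (1 - c) by positivity),
    mul_nonneg (mul_nonneg h6 h5) (sub_nonneg.2 huc)]

theorem abs_logDer_le {u : ℝ} (hu : |u| < 1) (x y : ℝ) :
    |logDer u x y| ≤ 2 * (1 + x ^ 2 + y ^ 2) / (1 - u ^ 2) ^ 2 := by
  have h1 := one_sub_sq_pos hu
  have e : logDer u x y
      = (u * (1 - u ^ 2) + ((1 + u ^ 2) * (x * y) - u * (x ^ 2 + y ^ 2))) / (1 - u ^ 2) ^ 2 := by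
    rw [logDer]; field_simp
  rw [e, abs_div, abs_of_pos (pow_pos h1 2)]
  gcongr
  obtain ⟨h2, h3⟩ := abs_lt.1 hu
  have hu2 : u ^ 2 ≤ 1 := by linarith
  have ha : |u * (1 - u ^ 2)| ≤ 1 := by
    rw [abs_mul, abs_of_pos h1]
    exact mul_le_one₀ hu.le h1.le (by nlinarith)
  have hb : |(1 + u ^ 2) * (x * y)| ≤ 2 * ((x ^ 2 + y ^ 2) / 2) := by
    rw [abs_mul, abs_of_pos (by positivity)]
    gcongr
    · linarith
    · rw [abs_le]; constructor <;> nlinarith [sq_nonneg (x + y), sq_nonneg (x - y)]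
  have hd : |u * (x ^ 2 + y ^ 2)| ≤ 1 * (x ^ 2 + y ^ 2) := by
    rw [abs_mul, abs_of_nonneg (show 0 ≤ x ^ 2 + y ^ 2 by positivity)]
    gcongr
  have := abs_add_le (u * (1 - u ^ 2)) ((1 + u ^ 2) * (x * y) - u * (x ^ 2 + y ^ 2))
  have := abs_sub ((1 + u ^ 2) * (x * y)) (u * (x ^ 2 + y ^ 2))
  linarith

variable {p q : PMF ℕ}

/-- The pointwise lower bound on the density is a product, so the double sum over the levels splits
into two moments. -/
theorem ofReal_linkDeriv_ge (hp : SecondMoment p) (hq : SecondMoment q) {u c : ℝ} (hc : c < 1)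
    (huc : |u| ≤ c) :
    ENNReal.ofReal (√(1 - u ^ 2))⁻¹ * (levelMoment p 0 (1 - c) * levelMoment q 0 (1 - c))
      ≤ ENNReal.ofReal (linkDeriv p q u) := by
  have hu : |u| < 1 := huc.trans_lt hc
  rw [linkDeriv, ENNReal.ofReal_tsum_of_nonneg (pairDensity_nonneg p q hu)
    (hasSum_pairDensity hp hq hu).summable, levelMoment, levelMoment,
    ← tsum_pair_levels p q (fun x => by positivity), ← ENNReal.tsum_mul_left]
  refine ENNReal.tsum_le_tsum fun nm => ?_
  rw [pairDensity]
  split_ifs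
  · rw [← ENNReal.ofReal_mul (by positivity)]
    refine ENNReal.ofReal_le_ofReal ?_
    simpa using le_biPDF hc huc (level p nm.1) (level q nm.2)
  · simp

theorem ofReal_abs_linkDeriv2_le (hp : SecondMoment p) (hq : SecondMoment q) {u c : ℝ} (hc : c < 1)
    (huc : |u| ≤ c) :
    ENNReal.ofReal |linkDeriv2 p q u| ≤ ENNReal.ofReal (2 * (√(1 - u ^ 2))⁻¹ / (1 - u ^ 2) ^ 2)
      * (levelMoment p 0 (1 + c) * levelMoment q 0 (1 + c)
        + levelMoment p 2 (1 + c) * levelMoment q 0 (1 + c)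
        + levelMoment p 0 (1 + c) * levelMoment q 2 (1 + c)) := by
  have hu : |u| < 1 := huc.trans_lt hc
  have hs := (hasSum_pairDensityDeriv hp hq hu).summable.abs
  have h1 := one_sub_sq_pos hu
  calc ENNReal.ofReal |linkDeriv2 p q u|
      ≤ ENNReal.ofReal (∑' nm, |pairDensityDeriv p q u nm|) := by
        refine ENNReal.ofReal_le_ofReal ?_
        exact norm_tsum_le_tsum_norm (f := pairDensityDeriv p q u) hs
    _ = ∑' nm, ENNReal.ofReal |pairDensityDeriv p q u nm| :=
        ENNReal.ofReal_tsum_of_nonneg (fun _ => abs_nonneg _) hs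
    _ ≤ _ := by
        simp only [levelMoment]
        rw [← tsum_pair_levels p q (fun x => by positivity),
          ← tsum_pair_levels p q (fun x => by positivity),
          ← tsum_pair_levels p q (fun x => by positivity), ← ENNReal.tsum_add, ← ENNReal.tsum_add,
          ← ENNReal.tsum_mul_left]
        refine ENNReal.tsum_le_tsum fun nm => ?_
        rw [pairDensityDeriv]
        split_ifs
        · set x := level p nm.1
          set y := level q nm.2
          rw [← ENNReal.ofReal_add (by positivity) (by positivity),
            ← ENNReal.ofReal_add (by positivity) (by positivity),
            ← ENNReal.ofReal_mul (by positivity)]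
          refine ENNReal.ofReal_le_ofReal ?_
          rw [abs_mul, abs_of_pos (biPDF_pos hu _ _)]
          refine (mul_le_mul (biPDF_le hc huc x y) (abs_logDer_le hu x y) (abs_nonneg _)
            (by positivity)).trans (le_of_eq ?_)
          simp only [sq_abs]
          ring
        · simp

/-- At x = 1 the weight of a level is the normal density itself. This gives finiteness of the
moments of order 0 for all x in (0, 1]. -/
theorem levelMoment_zero_one (hp : SecondMoment p) :
    levelMoment p 0 1 = ENNReal.ofReal (hermiteCoeff p 1) := by
  have h := hasSum_lcoef hp 0
  have hn : ∀ n, 0 ≤ lcoef p 0 n := fun n => by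
    rw [lcoef]; split_ifs
    · rw [He_zero, one_mul]; exact (stdPDF_pos _).le
    · exact le_rfl
  rw [← h.tsum_eq, ENNReal.ofReal_tsum_of_nonneg hn h.summable, levelMoment, levelSum]
  congr 1; ext n
  rw [lcoef]
  split_ifs
  · rw [He_zero, stdPDF_eq, one_mul, pow_zero, mul_one, mul_one, div_eq_inv_mul]
  · simp

theorem levelMoment_ne_top (hp : SecondMoment p) {x : ℝ} (h0 : 0 < x) (h1 : x ≤ 1) :
    levelMoment p 0 x ≠ ∞ :=
  ne_top_of_le_ne_top (by rw [levelMoment_zero_one hp]; simp) (levelMoment_mono p 0 h0 h1)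

theorem exists_isLevel (h : levelMoment p 0 x ≠ 0) : ∃ n, IsLevel p n := by
  by_contra! hn
  exact h (by simp [levelMoment, levelSum, hn])

/-- The real version of a moment of the levels. -/
noncomputable def realMoment (p : PMF ℕ) (k : ℕ) (x : ℝ) : ℝ := (levelMoment p k x).toReal

theorem realMoment_nonneg (p : PMF ℕ) (k : ℕ) (x : ℝ) : 0 ≤ realMoment p k x := ENNReal.toReal_nonneg

theorem linkDeriv_ge (hp : SecondMoment p) (hq : SecondMoment q) {u c : ℝ} (hc : c < 1)
    (huc : |u| ≤ c) :
    (√(1 - u ^ 2))⁻¹ * (realMoment p 0 (1 - c) * realMoment q 0 (1 - c)) ≤ linkDeriv p q u := by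
  have h := ofReal_linkDeriv_ge hp hq hc huc
  have h2 := ENNReal.toReal_mono ENNReal.ofReal_ne_top h
  rwa [ENNReal.toReal_mul, ENNReal.toReal_mul, ENNReal.toReal_ofReal (by positivity),
    ENNReal.toReal_ofReal (linkDeriv_nonneg p q (huc.trans_lt hc))] at h2

theorem abs_linkDeriv2_le (hp : SecondMoment p) (hq : SecondMoment q) {u c x : ℝ} (hc : c < 1)
    (huc : |u| ≤ c) (hx : 1 + c ≤ x) (hp0 : levelMoment p 0 x ≠ ∞) (hp2 : levelMoment p 2 x ≠ ∞)
    (hq0 : levelMoment q 0 x ≠ ∞) (hq2 : levelMoment q 2 x ≠ ∞) :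
    |linkDeriv2 p q u| ≤ 2 * (√(1 - u ^ 2))⁻¹ / (1 - u ^ 2) ^ 2
      * (realMoment p 0 x * realMoment q 0 x + realMoment p 2 x * realMoment q 0 x
        + realMoment p 0 x * realMoment q 2 x) := by
  have hc0 : 0 < 1 + c := by have := (abs_nonneg u).trans huc; linarith
  have h : ENNReal.ofReal |linkDeriv2 p q u| ≤ ENNReal.ofReal (2 * (√(1 - u ^ 2))⁻¹ / (1 - u ^ 2) ^ 2)
      * (levelMoment p 0 x * levelMoment q 0 x + levelMoment p 2 x * levelMoment q 0 x
        + levelMoment p 0 x * levelMoment q 2 x) := by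
    refine (ofReal_abs_linkDeriv2_le hp hq hc huc).trans ?_
    gcongr <;> exact levelMoment_mono _ _ hc0 hx
  have h2 := ENNReal.toReal_mono (by finiteness) h
  rw [ENNReal.toReal_mul, ENNReal.toReal_add (by finiteness) (by finiteness),
    ENNReal.toReal_add (by finiteness) (by finiteness), ENNReal.toReal_mul, ENNReal.toReal_mul,
    ENNReal.toReal_mul, ENNReal.toReal_ofReal (abs_nonneg _),
    ENNReal.toReal_ofReal (by positivity)] at h2
  exact h2

end

section

/-! ## Expansions of inverse functions -/

/-- A second-order expansion of the inverse of an increasing function. -/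
theorem abs_sub_sub_div_le {f f' f'' : ℝ → ℝ} {c K : ℝ} {u v : ℝ} (hu : |u| ≤ c) (hv : |v| ≤ c)
    (hf : ∀ x, |x| ≤ c → HasDerivAt f (f' x) x) (hf' : ∀ x, |x| ≤ c → HasDerivAt f' (f'' x) x)
    (hpos : ∀ x, |x| ≤ c → 0 < f' x) (hK : ∀ x, |x| ≤ c → |f'' x| ≤ K * f' x ^ 3) :
    |v - u - (f v - f u) / f' u| ≤ K / 2 * (f v - f u) ^ 2 := by
  have hK0 : 0 ≤ K := by
    have h1 := (abs_nonneg _).trans (hK u hu)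
    exact nonneg_of_mul_nonneg_left h1 (pow_pos (hpos u hu) 3)
  have hmono : StrictMonoOn f (Set.Icc (-c) c) :=
    strictMonoOn_of_hasDerivWithinAt_pos (convex_Icc _ _)
      (fun x hx => (hf x (abs_le.2 hx)).continuousAt.continuousWithinAt) (f' := f')
      (fun x hx => (hf x (abs_le.2 (Set.mem_Icc.1 (interior_subset hx)))).hasDerivWithinAt)
      (fun x hx => hpos x (abs_le.2 (Set.mem_Icc.1 (interior_subset hx))))
  have hseg : ∀ x ∈ Set.uIcc u v, |x| ≤ c := fun x hx =>
    abs_le.2 (Set.uIcc_subset_Icc (abs_le.1 hu) (abs_le.1 hv) hx)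
  -- the reciprocal of the derivative is Lipschitz as a function of the value
  have hrec : ∀ x ∈ Set.uIcc u v, |1 / f' x - 1 / f' u| ≤ K * |f x - f u| := by
    intro x hx
    -- The derivative of 1/f' is at most |f''|/f'² ≤ K f' in absolute value, so K f plus or minus
    -- 1/f' increases.
    have hm : ∀ σ : ℝ, |σ| = 1 → MonotoneOn (fun t => K * f t + σ * (1 / f' t)) (Set.Icc (-c) c) := by
      intro σ hσ
      refine monotoneOn_of_hasDerivWithinAt_nonneg (convex_Icc _ _)
        (f' := fun t => K * f' t + σ * (-f'' t / f' t ^ 2)) ?_ ?_ ?_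
      · intro t ht
        have h1 := hf' t (abs_le.2 ht)
        have h2 := hpos t (abs_le.2 ht)
        exact (((hf t (abs_le.2 ht)).continuousAt.const_mul K).add
          ((continuousAt_const.div h1.continuousAt h2.ne').const_mul σ)).continuousWithinAt
      · intro t ht
        have ht' := abs_le.2 (Set.mem_Icc.1 (interior_subset ht))
        have h1 := (((hf t ht').const_mul K).add (((hf' t ht').inv (hpos t ht').ne').const_mul σ))
        simp only [one_div]
        exact h1.hasDerivWithinAt
      · intro t ht
        have ht' := abs_le.2 (Set.mem_Icc.1 (interior_subset ht))
        have hp := hpos t ht'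
        have : |σ * (-f'' t / f' t ^ 2)| ≤ K * f' t := by
          rw [abs_mul, hσ, one_mul, abs_div, abs_neg, abs_of_pos (pow_pos hp 2),
            div_le_iff₀ (pow_pos hp 2)]
          exact (hK t ht').trans (le_of_eq (by ring))
        linarith [(abs_le.1 this).1]
    have hxI := abs_le.1 (hseg x hx)
    have huI := abs_le.1 hu
    have h1 := hm 1 (by simp)
    have h2 := hm (-1) (by simp)
    rcases le_total u x with h | h
    · have a1 := h1 huI hxI h
      have a2 := h2 huI hxI h
      have a3 : f u ≤ f x := hmono.monotoneOn huI hxI h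
      simp only at a1 a2
      rw [abs_of_nonneg (sub_nonneg.2 a3), abs_le]
      constructor <;> linarith
    · have a1 := h1 hxI huI h
      have a2 := h2 hxI huI h
      have a3 : f x ≤ f u := hmono.monotoneOn hxI huI h
      simp only at a1 a2
      rw [abs_of_nonpos (sub_nonpos.2 a3), abs_le]
      constructor <;> linarith
  -- The claim for both signs σ says that this function of t, which vanishes at u, is nonnegative at
  -- v. By the bound on the reciprocals its derivative has the sign of t - u.
  have hmain : ∀ σ : ℝ, |σ| = 1 → ∀ x ∈ Set.uIcc u v,
      HasDerivAt (fun t => K / 2 * (f t - f u) ^ 2 + σ * (t - u - (f t - f u) / f' u))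
        (K * (f x - f u) * f' x + σ * (1 - f' x / f' u)) x := by
    intro σ _ x hx
    have h := hf x (hseg x hx)
    have h1 := (((h.sub_const (f u)).pow 2).const_mul (K / 2)).add
      ((((hasDerivAt_id x).sub_const u).sub ((h.sub_const (f u)).div_const (f' u))).const_mul σ)
    refine h1.congr_deriv ?_
    norm_num; ring
  have hcore : ∀ σ : ℝ, |σ| = 1 →
      0 ≤ K / 2 * (f v - f u) ^ 2 + σ * (v - u - (f v - f u) / f' u) := by
    intro σ hσ
    set G := fun t => K / 2 * (f t - f u) ^ 2 + σ * (t - u - (f t - f u) / f' u) with hG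
    have hGu : G u = 0 := by simp [hG]
    have hb : ∀ x ∈ Set.uIcc u v, |σ * (1 - f' x / f' u)| ≤ K * |f x - f u| * f' x := by
      intro x hx
      have hp := hpos x (hseg x hx)
      have hpu := hpos u hu
      rw [abs_mul, hσ, one_mul]
      have : 1 - f' x / f' u = (1 / f' x - 1 / f' u) * f' x := by field_simp
      rw [this, abs_mul, abs_of_pos hp]
      exact mul_le_mul_of_nonneg_right (hrec x hx) hp.le
    have hcont : ContinuousOn G (Set.uIcc u v) := fun x hx =>
      (hmain σ hσ x hx).continuousAt.continuousWithinAt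
    change 0 ≤ G v
    rw [← hGu]
    rcases le_total u v with h | h
    · rw [Set.uIcc_of_le h] at *
      refine monotoneOn_of_hasDerivWithinAt_nonneg (convex_Icc _ _) hcont
        (fun x hx => (hmain σ hσ x (interior_subset hx)).hasDerivWithinAt) (fun x hx => ?_)
        ⟨le_rfl, h⟩ ⟨h, le_rfl⟩ h
      have hx' := interior_subset hx
      have := hb x hx'
      have a3 : f u ≤ f x := hmono.monotoneOn (abs_le.1 hu) (abs_le.1 (hseg x hx')) hx'.1
      rw [abs_of_nonneg (sub_nonneg.2 a3)] at this
      linarith [(abs_le.1 this).1]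
    · rw [Set.uIcc_of_ge h] at *
      refine antitoneOn_of_hasDerivWithinAt_nonpos (convex_Icc _ _) hcont
        (fun x hx => (hmain σ hσ x (interior_subset hx)).hasDerivWithinAt) (fun x hx => ?_)
        ⟨le_rfl, h⟩ ⟨h, le_rfl⟩ h
      have hx' := interior_subset hx
      have := hb x hx'
      have a3 : f x ≤ f u := hmono.monotoneOn (abs_le.1 (hseg x hx')) (abs_le.1 hu) hx'.2
      rw [abs_of_nonpos (sub_nonpos.2 a3)] at this
      linarith [(abs_le.1 this).2]
  have h1 := hcore 1 (by simp)
  have h2 := hcore (-1) (by simp)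
  rw [abs_le]
  constructor <;> linarith

/-- The quadratic bound on f'' says exactly that 1/f' has derivative at most K, so this is the mean
value inequality. -/
theorem abs_inv_sub_inv_le {f' f'' : ℝ → ℝ} {c K : ℝ} {u : ℝ} (hu : |u| ≤ c)
    (hf' : ∀ x, |x| ≤ c → HasDerivAt f' (f'' x) x)
    (hpos : ∀ x, |x| ≤ c → 0 < f' x) (hK : ∀ x, |x| ≤ c → |f'' x| ≤ K * f' x ^ 2) :
    |(f' u)⁻¹ - (f' 0)⁻¹| ≤ K * |u| := by
  have hc : 0 ≤ c := (abs_nonneg u).trans hu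
  have := (convex_Icc (-c) c).norm_image_sub_le_of_norm_hasDerivWithin_le
    (f := fun x => (f' x)⁻¹) (f' := fun x => -f'' x / f' x ^ 2) (C := K) (x := 0) (y := u)
    (fun x hx => ((hf' x (abs_le.2 hx)).inv (hpos x (abs_le.2 hx)).ne').hasDerivWithinAt)
    (fun x hx => by
      have hp := hpos x (abs_le.2 hx)
      rw [Real.norm_eq_abs, abs_div, abs_neg, abs_of_pos (pow_pos hp 2), div_le_iff₀ (pow_pos hp 2)]
      exact hK x (abs_le.2 hx))
    ⟨by linarith, hc⟩ (abs_le.1 hu)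
  simpa using this

/-! ## Bounds on the derivatives of the link function -/

/-- Quantitative bounds on the moments of the levels of a law. -/
structure MomentBound (p : PMF ℕ) (c r₁ r₂ : ℝ) : Prop where
  secondMoment : SecondMoment p
  pos : 0 < realMoment p 0 (1 - c)
  ne_top_zero : levelMoment p 0 (1 / (1 - c)) ≠ ∞
  ne_top_two : levelMoment p 2 (1 / (1 - c)) ≠ ∞
  one_le : 1 ≤ r₁ * realMoment p 0 (1 - c) ^ 2
  sq_le_zero : realMoment p 0 (1 / (1 - c)) ^ 2 ≤ r₂ * realMoment p 0 (1 - c) ^ 4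
  sq_le_two : realMoment p 2 (1 / (1 - c)) ^ 2 ≤ r₂ * realMoment p 0 (1 - c) ^ 4

variable {p q : PMF ℕ} {c r₁ r₂ : ℝ}

theorem mul_le_of_sq_le {a b A B r : ℝ}
    (h1 : a ^ 2 ≤ r * A ^ 4) (h2 : b ^ 2 ≤ r * B ^ 4) (hr : 0 ≤ r) :
    a * b ≤ r * (A * B) ^ 2 := by
  refine abs_le_of_sq_le_sq' ?_ (by positivity) |>.2
  calc (a * b) ^ 2 = a ^ 2 * b ^ 2 := by ring
    _ ≤ (r * A ^ 4) * (r * B ^ 4) := by gcongr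
    _ = _ := by ring

theorem MomentBound.nonneg (hp : MomentBound p c r₁ r₂) : 0 ≤ r₂ :=
  nonneg_of_mul_nonneg_left ((sq_nonneg _).trans hp.sq_le_zero) (pow_pos hp.pos 4)

theorem MomentBound.pos_one (hp : MomentBound p c r₁ r₂) : 0 < r₁ :=
  pos_of_mul_pos_left (zero_lt_one.trans_le hp.one_le) (pow_pos hp.pos 2).le

theorem MomentBound.one_le_mul (hp : MomentBound p c r₁ r₂) (hq : MomentBound q c r₁ r₂) :
    1 ≤ r₁ * (realMoment p 0 (1 - c) * realMoment q 0 (1 - c)) := by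
  have h0 := hp.pos
  have h1 := hq.pos
  have h2 := hp.pos_one
  refine abs_le_of_sq_le_sq' ?_ (by positivity) |>.2
  calc (1 : ℝ) ^ 2 = 1 * 1 := by norm_num
    _ ≤ (r₁ * realMoment p 0 (1 - c) ^ 2) * (r₁ * realMoment q 0 (1 - c) ^ 2) :=
      mul_le_mul hp.one_le hq.one_le zero_le_one (by positivity)
    _ = _ := by ring

theorem MomentBound.linkDeriv_pos (hp : MomentBound p c r₁ r₂) (hq : MomentBound q c r₁ r₂)
    (hc : c < 1) {u : ℝ} (hu : |u| ≤ c) : 0 < linkDeriv p q u := by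
  have := one_sub_sq_pos (hu.trans_lt hc)
  have h0 := hp.pos
  have h1 := hq.pos
  exact lt_of_lt_of_le (by positivity) (linkDeriv_ge hp.secondMoment hq.secondMoment hc hu)

theorem MomentBound.abs_linkDeriv2_le (hp : MomentBound p c r₁ r₂) (hq : MomentBound q c r₁ r₂)
    (hc : c < 1) {u : ℝ} (hu : |u| ≤ c) :
    |linkDeriv2 p q u| ≤ 6 * r₂ * (√(1 - u ^ 2))⁻¹ ^ 5
      * (realMoment p 0 (1 - c) * realMoment q 0 (1 - c)) ^ 2 := by
  have h1 := one_sub_sq_pos (hu.trans_lt hc)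
  have hc0 : 0 ≤ c := (abs_nonneg u).trans hu
  -- The density bounds produce moments at 1 + c, while the constants are stated at the larger
  -- argument 1/(1 - c).
  have hx : 1 + c ≤ 1 / (1 - c) := by
    rw [le_div_iff₀ (by linarith)]; nlinarith
  have h := LatentCount.abs_linkDeriv2_le hp.secondMoment hq.secondMoment hc hu hx hp.ne_top_zero
    hp.ne_top_two hq.ne_top_zero hq.ne_top_two
  refine h.trans ?_
  have a1 := mul_le_of_sq_le hp.sq_le_zero hq.sq_le_zero hp.nonneg
  have a2 := mul_le_of_sq_le hp.sq_le_two hq.sq_le_zero hp.nonneg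
  have a3 := mul_le_of_sq_le hp.sq_le_zero hq.sq_le_two hp.nonneg
  have hs : (1 - u ^ 2) = √(1 - u ^ 2) ^ 2 := (Real.sq_sqrt h1.le).symm
  have e : 2 * (√(1 - u ^ 2))⁻¹ / (1 - u ^ 2) ^ 2 = 2 * (√(1 - u ^ 2))⁻¹ ^ 5 := by
    have h2 : 0 < √(1 - u ^ 2) := Real.sqrt_pos.2 h1
    generalize √(1 - u ^ 2) = s at *
    rw [hs]; field_simp
  rw [e]
  have h5 : 0 ≤ (√(1 - u ^ 2))⁻¹ ^ 5 := by positivity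
  nlinarith [mul_le_mul_of_nonneg_left (add_le_add (add_le_add a1 a2) a3) h5]

theorem inv_sqrt_one_sub_sq_pow_le {u c : ℝ} (hc : c < 1) (hu : |u| ≤ c) :
    (√(1 - u ^ 2))⁻¹ ^ 2 ≤ (1 - c ^ 2)⁻¹ := by
  have h1 := one_sub_sq_pos (hu.trans_lt hc)
  have h2 : u ^ 2 ≤ c ^ 2 := by rw [← sq_abs]; exact pow_le_pow_left₀ (abs_nonneg _) hu 2
  have hc0 : 0 ≤ c := (abs_nonneg u).trans hu
  rw [inv_pow, Real.sq_sqrt h1.le]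
  gcongr
  nlinarith

theorem one_le_inv_sqrt {u : ℝ} (hu : |u| < 1) : 1 ≤ (√(1 - u ^ 2))⁻¹ := by
  have h1 := one_sub_sq_pos hu
  refine (one_le_inv₀ (Real.sqrt_pos.2 h1)).2 (Real.sqrt_le_one.2 (by nlinarith))

/-- Of the five factors s = (1 - u²)^(-1/2), two go into the lower bound s a for the first
derivative; the remaining s³ is at most s⁴ ≤ (1 - c²)⁻². -/
theorem MomentBound.abs_linkDeriv2_le_sq (hp : MomentBound p c r₁ r₂)
    (hq : MomentBound q c r₁ r₂) (hc : c < 1) {u : ℝ} (hu : |u| ≤ c) :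
    |linkDeriv2 p q u| ≤ 6 * r₂ / (1 - c ^ 2) ^ 2 * linkDeriv p q u ^ 2 := by
  refine (hp.abs_linkDeriv2_le hq hc hu).trans ?_
  have h1 := one_le_inv_sqrt (hu.trans_lt hc)
  have h2 := inv_sqrt_one_sub_sq_pow_le hc hu
  have h3 := linkDeriv_ge hp.secondMoment hq.secondMoment hc hu
  have hr := hp.nonneg
  have ha : 0 < realMoment p 0 (1 - c) * realMoment q 0 (1 - c) := mul_pos hp.pos hq.pos
  generalize realMoment p 0 (1 - c) * realMoment q 0 (1 - c) = a at *
  generalize (√(1 - u ^ 2))⁻¹ = s at *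
  calc 6 * r₂ * s ^ 5 * a ^ 2 = 6 * r₂ * s ^ 3 * (s * a) ^ 2 := by ring
    _ ≤ 6 * r₂ * (s ^ 3 * s) * linkDeriv p q u ^ 2 := by
      gcongr
      exact le_mul_of_one_le_right (by positivity) h1
    _ = 6 * r₂ * (s ^ 2) ^ 2 * linkDeriv p q u ^ 2 := by ring
    _ ≤ 6 * r₂ * ((1 - c ^ 2)⁻¹) ^ 2 * linkDeriv p q u ^ 2 := by gcongr
    _ = _ := by rw [inv_pow, div_eq_mul_inv]

/-- A third factor a is supplied by r₁ a ≥ 1, so that three factors s a give the cube of the first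
derivative and only s² ≤ 1/(1 - c²) remains. -/
theorem MomentBound.abs_linkDeriv2_le_cube (hp : MomentBound p c r₁ r₂)
    (hq : MomentBound q c r₁ r₂) (hc : c < 1) {u : ℝ} (hu : |u| ≤ c) :
    |linkDeriv2 p q u| ≤ 6 / (1 - c ^ 2) * r₁ * r₂ * linkDeriv p q u ^ 3 := by
  refine (hp.abs_linkDeriv2_le hq hc hu).trans ?_
  have h1 := one_le_inv_sqrt (hu.trans_lt hc)
  have h2 := inv_sqrt_one_sub_sq_pow_le hc hu
  have h3 := linkDeriv_ge hp.secondMoment hq.secondMoment hc hu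
  have h4 := hp.one_le_mul hq
  have hr := hp.nonneg
  have hr1 := hp.pos_one
  have ha : 0 < realMoment p 0 (1 - c) * realMoment q 0 (1 - c) := mul_pos hp.pos hq.pos
  generalize realMoment p 0 (1 - c) * realMoment q 0 (1 - c) = a at *
  generalize (√(1 - u ^ 2))⁻¹ = s at *
  calc 6 * r₂ * s ^ 5 * a ^ 2 = 6 * r₂ * s ^ 5 * a ^ 2 * 1 := by ring
    _ ≤ 6 * r₂ * s ^ 5 * a ^ 2 * (r₁ * a) := by gcongr
    _ = 6 * r₁ * r₂ * s ^ 2 * (s * a) ^ 3 := by ring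
    _ ≤ 6 * r₁ * r₂ * (1 - c ^ 2)⁻¹ * linkDeriv p q u ^ 3 := by
      have := (sq_nonneg s).trans h2
      gcongr
    _ = _ := by ring

/-- The error of an inverted link function, to the second order. -/
theorem MomentBound.abs_linkInv_sub_le (hp : MomentBound p c r₁ r₂) (hq : MomentBound q c r₁ r₂)
    (hc : c < 1) {u y : ℝ} (hu : |u| ≤ c) (hy : |linkInv p q y| ≤ c) :
    |linkInv p q y - u - (linkDeriv p q u)⁻¹ * (y - link p q u)|
      ≤ 3 / (1 - c ^ 2) * r₁ * r₂ * (y - link p q u) ^ 2 := by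
  have h := abs_sub_sub_div_le (f := link p q) (f' := linkDeriv p q) (f'' := linkDeriv2 p q)
    (K := 6 / (1 - c ^ 2) * r₁ * r₂) hu hy
    (fun x hx => hasDerivAt_link hp.secondMoment hq.secondMoment (hx.trans_lt hc))
    (fun x hx => hasDerivAt_linkDeriv hp.secondMoment hq.secondMoment (hx.trans_lt hc))
    (fun x hx => hp.linkDeriv_pos hq hc hx) (fun x hx => hp.abs_linkDeriv2_le_cube hq hc hx)
  rw [link_linkInv hp.secondMoment hq.secondMoment (hy.trans_lt hc)] at h
  rw [← div_eq_inv_mul]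
  refine h.trans (le_of_eq (by ring))

theorem MomentBound.abs_inv_linkDeriv_sub_le (hp : MomentBound p c r₁ r₂)
    (hq : MomentBound q c r₁ r₂) (hc : c < 1) {u : ℝ} (hu : |u| ≤ c) :
    |(linkDeriv p q u)⁻¹ - (linkDeriv p q 0)⁻¹| ≤ 6 * r₂ / (1 - c ^ 2) ^ 2 * |u| :=
  abs_inv_sub_inv_le hu
    (fun _ hx => hasDerivAt_linkDeriv hp.secondMoment hq.secondMoment (hx.trans_lt hc))
    (fun _ hx => hp.linkDeriv_pos hq hc hx) (fun _ hx => hp.abs_linkDeriv2_le_sq hq hc hx)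

/-- At correlation 0 only the first Hermite order survives. As a matrix in (i, j) the value has rank
one, which the estimates in the sparse seminorm exploit. -/
theorem linkDeriv_zero (hp : SecondMoment p) (hq : SecondMoment q) :
    linkDeriv p q 0 = hermiteCoeff p 1 * hermiteCoeff q 1 := by
  rw [linkDeriv, (hasSum_pairDensity hp hq (by simp)).tsum_eq, tsum_eq_single 0]
  · simp
  · intro j hj; simp [hj]

end

section

/-! ## Variation of sums along a segment of parameters -/

variable {k : ℕ}

theorem gradNorm_nonneg (f : (Fin k → ℝ) → ℝ) (x : Fin k → ℝ) : 0 ≤ gradNorm f x :=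
  Finset.sum_nonneg fun _ _ => abs_nonneg _

theorem abs_fderiv_le (f : (Fin k → ℝ) → ℝ) (x v : Fin k → ℝ) :
    |fderiv ℝ f x v| ≤ ‖v‖ * gradNorm f x := by
  have hv : v = ∑ j, v j • Pi.single (M := fun _ => ℝ) j (1 : ℝ) := by
    ext i; simp [Finset.sum_apply, Pi.single_apply]
  conv_lhs => rw [hv, map_sum]
  rw [gradNorm, Finset.mul_sum]
  refine (Finset.abs_sum_le_sum_abs _ _).trans (Finset.sum_le_sum fun j _ => ?_)
  rw [map_smul, smul_eq_mul, abs_mul]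
  gcongr
  exact norm_le_pi_norm v j

/-- The mean value theorem is applied once, to the sum with the signs of the increments inserted. A
single intermediate parameter then serves all n, so the bound is a supremum of sums and not a sum of
suprema. -/
theorem sum_abs_sub_le_of_fderiv {B : Set (Fin k → ℝ)} (hB : Convex ℝ B) {f : ℕ → (Fin k → ℝ) → ℝ}
    {G : ℕ → (Fin k → ℝ) → ℝ} (hG : ∀ n, ∀ ϑ ∈ B, 0 ≤ G n ϑ)
    (hd : ∀ n, ∀ ϑ ∈ B, DifferentiableAt ℝ (f n) ϑ)
    (hf : ∀ n, ∀ ϑ ∈ B, ∀ v, |fderiv ℝ (f n) ϑ v| ≤ ‖v‖ * G n ϑ) {a b : Fin k → ℝ} (ha : a ∈ B)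
    (hb : b ∈ B) (A : Finset ℕ) :
    ∑ n ∈ A, ENNReal.ofReal |f n b - f n a|
      ≤ ENNReal.ofReal ‖b - a‖ * ⨆ ϑ ∈ B, ∑' n, ENNReal.ofReal (G n ϑ) := by
  let σ : ℕ → ℝ := fun n => SignType.sign (f n b - f n a)
  have hσ : ∀ n, |σ n| ≤ 1 := fun n => by
    simp only [σ]
    rcases lt_trichotomy (f n b - f n a) 0 with h | h | h <;> simp [h]
  let P : ℝ → Fin k → ℝ := fun t => a + t • (b - a)
  have hP : ∀ t ∈ Set.Icc (0 : ℝ) 1, P t ∈ B := fun t ht => by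
    have := hB.add_smul_sub_mem ha hb ht
    simpa [P] using this
  have hPd : ∀ t, HasDerivAt P (b - a) t := fun t => by
    have := ((hasDerivAt_id t).smul_const (b - a)).const_add a
    simpa [P] using this
  let F : ℝ → ℝ := fun t => ∑ n ∈ A, σ n * f n (P t)
  have hF : ∀ t ∈ Set.Icc (0 : ℝ) 1,
      HasDerivAt F (∑ n ∈ A, σ n * fderiv ℝ (f n) (P t) (b - a)) t := fun t ht => by
    have := HasDerivAt.sum (u := A) (A := fun n t => σ n * f n (P t)) (x := t)
      (A' := fun n => σ n * fderiv ℝ (f n) (P t) (b - a)) fun n _ =>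
      (((hd n _ (hP t ht)).hasFDerivAt.comp_hasDerivAt t (hPd t)).const_mul (σ n))
    refine this.congr_of_eventuallyEq (Filter.Eventually.of_forall fun s => ?_)
    simp [F]
  obtain ⟨t, ht, he⟩ := exists_hasDerivAt_eq_slope F
    (fun t => ∑ n ∈ A, σ n * fderiv ℝ (f n) (P t) (b - a)) one_pos
    (fun t ht => (hF t ht).continuousAt.continuousWithinAt)
    (fun t ht => hF t (Set.Ioo_subset_Icc_self ht))
  have htm := hP t (Set.Ioo_subset_Icc_self ht)
  have hsum : ∑ n ∈ A, |f n b - f n a| = F 1 - F 0 := by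
    simp only [F, P]
    rw [← Finset.sum_sub_distrib]
    refine Finset.sum_congr rfl fun n _ => ?_
    rw [← mul_sub]
    simp [σ]
  have hle : ∑ n ∈ A, |f n b - f n a| ≤ ‖b - a‖ * ∑ n ∈ A, G n (P t) := by
    rw [hsum, show F 1 - F 0 = (F 1 - F 0) / (1 - 0) by simp, ← he, Finset.mul_sum]
    refine Finset.sum_le_sum fun n _ => (le_abs_self _).trans ?_
    rw [abs_mul]
    exact (mul_le_of_le_one_left (abs_nonneg _) (hσ n)).trans (hf n _ htm _)
  rw [← ENNReal.ofReal_sum_of_nonneg fun _ _ => abs_nonneg _]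
  refine (ENNReal.ofReal_le_ofReal hle).trans ?_
  rw [ENNReal.ofReal_mul (norm_nonneg _), ENNReal.ofReal_sum_of_nonneg fun n _ => hG n _ htm]
  gcongr
  exact (ENNReal.sum_le_tsum A).trans
    (le_iSup₂ (f := fun ϑ (_ : ϑ ∈ B) => ∑' n, ENNReal.ofReal (G n ϑ)) (P t) htm)

/-! ## The normal quantile function -/

theorem stdCDF_zero : stdCDF 0 = 1 / 2 := by
  have h1 : ∫ t in Set.Iic (0 : ℝ), stdPDF t = ∫ t in Set.Ioi (0 : ℝ), stdPDF t := by
    have := integral_comp_neg_Iic (0 : ℝ) stdPDF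
    rw [neg_zero] at this
    rw [← this]
    congr 1; ext t
    rw [stdPDF_eq, stdPDF_eq, neg_sq]
  have h2 := intervalIntegral.integral_Iic_add_Ioi (b := (0 : ℝ)) (f := stdPDF)
    integrable_stdPDF.integrableOn integrable_stdPDF.integrableOn
  have h3 : ∫ t, stdPDF t = 1 := by
    have := integral_gaussian_eq (fun _ => (1 : ℝ))
    simpa using this.symm
  rw [stdCDF_eq_integral]
  linarith

theorem stdQuantile_half : stdQuantile (1 / 2) = 0 := by
  rw [← stdCDF_zero, stdQuantile_stdCDF]

theorem stdQuantile_mono {s t : ℝ} (hs : 0 < s) (hst : s ≤ t) (ht : t < 1) :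
    stdQuantile s ≤ stdQuantile t := by
  rw [stdQuantile_le_iff hs (hst.trans_lt ht), stdCDF_stdQuantile (hs.trans_le hst) ht]
  exact hst

/-- Along a segment of parameters a distribution function may reach 0 or 1, where its quantile is
infinite. Contracting all levels towards 1/2 keeps the quantiles finite and differentiable; ε tends
to 0 at the end. -/
theorem squeeze_mem {ε t : ℝ} (h0 : 0 < ε) (h1 : ε < 1 / 2) (ht : t ∈ Set.Icc (0 : ℝ) 1) :
    0 < ε + (1 - 2 * ε) * t ∧ ε + (1 - 2 * ε) * t < 1 := by
  have : 0 ≤ (1 - 2 * ε) * t := mul_nonneg (by linarith) ht.1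
  have : (1 - 2 * ε) * t ≤ (1 - 2 * ε) * 1 := mul_le_mul_of_nonneg_left ht.2 (by linarith)
  constructor <;> linarith

/-- The contraction moves a level towards the median, whose quantile is 0. -/
theorem abs_stdQuantile_squeeze_le {ε t : ℝ} (h0 : 0 < ε) (h1 : ε < 1 / 2) (ht0 : 0 < t)
    (ht1 : t < 1) : |stdQuantile (ε + (1 - 2 * ε) * t)| ≤ |stdQuantile t| := by
  have hm := squeeze_mem h0 h1 ⟨ht0.le, ht1.le⟩
  rcases le_total t (1 / 2) with h | h
  · have a1 : t ≤ ε + (1 - 2 * ε) * t := by nlinarith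
    have a2 : ε + (1 - 2 * ε) * t ≤ 1 / 2 := by nlinarith
    have b1 := stdQuantile_mono ht0 a1 hm.2
    have b2 := stdQuantile_mono hm.1 a2 (by norm_num)
    rw [stdQuantile_half] at b2
    rw [abs_of_nonpos b2, abs_of_nonpos (b1.trans b2)]
    linarith
  · have a1 : ε + (1 - 2 * ε) * t ≤ t := by nlinarith
    have a2 : 1 / 2 ≤ ε + (1 - 2 * ε) * t := by nlinarith
    have b1 := stdQuantile_mono hm.1 a1 ht1
    have b2 := stdQuantile_mono (by norm_num) a2 hm.2
    rw [stdQuantile_half] at b2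
    rw [abs_of_nonneg b2, abs_of_nonneg (b2.trans b1)]
    exact b1

open Classical in
/-- A function of the quantile, extended by `0` where the quantile is infinite. -/
noncomputable def quantileFun (g : ℝ → ℝ) (t : ℝ) : ℝ :=
  if 0 < t ∧ t < 1 then g (stdQuantile t) else 0

theorem tendsto_quantileFun_squeeze {g : ℝ → ℝ} (hg : Continuous g)
    (hlim : Filter.Tendsto g (Filter.cocompact ℝ) (nhds 0)) {t : ℝ} (ht : t ∈ Set.Icc (0 : ℝ) 1) :
    Filter.Tendsto (fun ε : ℝ => g (stdQuantile (ε + (1 - 2 * ε) * t)))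
      (nhdsWithin 0 (Set.Ioi 0)) (nhds (quantileFun g t)) := by
  have hsm : ∀ᶠ ε : ℝ in nhdsWithin 0 (Set.Ioi 0), 0 < ε ∧ ε < 1 / 2 :=
    Ioo_mem_nhdsGT (by norm_num)
  rw [quantileFun]
  split_ifs with h
  · have hc : ContinuousAt stdQuantile t := (hasDerivAt_stdQuantile h.1 h.2).continuousAt
    have ha : Filter.Tendsto (fun ε : ℝ => ε + (1 - 2 * ε) * t) (nhdsWithin 0 (Set.Ioi 0))
        (nhds t) := by
      have : Continuous fun ε : ℝ => ε + (1 - 2 * ε) * t := by fun_prop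
      have := (this.tendsto 0).mono_left (nhdsWithin_le_nhds (s := Set.Ioi 0))
      simpa using this
    exact (hg.tendsto _).comp (hc.tendsto.comp ha)
  · rcases eq_or_lt_of_le ht.1 with h0 | h0
    · subst h0
      refine hlim.comp (Filter.Tendsto.mono_right (y := Filter.atBot) ?_ atBot_le_cocompact)
      rw [Filter.tendsto_atBot]
      intro x
      filter_upwards [hsm, Ioo_mem_nhdsGT (stdCDF_pos x)] with ε hε hx
      rw [stdQuantile_le_iff] <;> simp only [mul_zero, add_zero] <;> linarith [hx.1, hx.2]
    · have h1 : t = 1 := le_antisymm ht.2 (not_lt.1 fun h1 => h ⟨h0, h1⟩)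
      subst h1
      refine hlim.comp (Filter.Tendsto.mono_right (y := Filter.atTop) ?_ atTop_le_cocompact)
      rw [Filter.tendsto_atTop]
      intro x
      filter_upwards [hsm, Ioo_mem_nhdsGT (sub_pos.2 (stdCDF_lt_one x))] with ε hε hx
      refine le_of_not_ge fun hle => ?_
      rw [stdQuantile_le_iff] at hle <;> linarith [hx.1, hx.2]

/-- Divided by the normal density, the weight grows with |x|, since the exponent becomes x² c/(2(1 +
c)). So contracted levels may be replaced by the true ones in upper bounds. -/
theorem weight_div_stdPDF_le {c x y : ℝ} (hc : 0 ≤ c) (h : |x| ≤ |y|) :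
    (1 + |x| ^ 3) * Real.exp (-(x ^ 2) / (2 * (1 + c))) * (stdPDF x)⁻¹
      ≤ (1 + |y| ^ 3) * Real.exp (-(y ^ 2) / (2 * (1 + c))) * (stdPDF y)⁻¹ := by
  have e : ∀ x : ℝ, (1 + |x| ^ 3) * Real.exp (-(x ^ 2) / (2 * (1 + c))) * (stdPDF x)⁻¹
      = (1 + |x| ^ 3) * √(2 * Real.pi) * Real.exp (|x| ^ 2 * (c / (2 * (1 + c)))) := by
    intro x
    rw [stdPDF_eq, mul_inv, inv_inv, ← Real.exp_neg]
    have : Real.exp (|x| ^ 2 * (c / (2 * (1 + c))))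
        = Real.exp (-(x ^ 2) / (2 * (1 + c))) * Real.exp (-(-x ^ 2 / 2)) := by
      rw [← Real.exp_add, sq_abs]; congr 1; field_simp; ring
    rw [this]; ring
  rw [e, e]
  gcongr

/-! ## Variation of functions of the levels -/

open Classical in
/-- The moments of the levels, weighted by their gradients in the parameters. -/
noncomputable def gradSum (law : (Fin k → ℝ) → PMF ℕ) (ϑ : Fin k → ℝ) (j : ℕ) (x : ℝ) : ℝ≥0∞ :=
  ∑' n, if IsLevel (law ϑ) n then
    ENNReal.ofReal (Real.exp (-(level (law ϑ) n ^ 2) / (2 * x)) * |level (law ϑ) n| ^ j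
      * gradNorm (fun ϑ => level (law ϑ) n) ϑ / √(2 * Real.pi)) else 0

variable {law : (Fin k → ℝ) → PMF ℕ}

theorem countCDF_mem_Icc (p : PMF ℕ) (n : ℕ) : countCDF p n ∈ Set.Icc (0 : ℝ) 1 :=
  ⟨countCDF_nonneg p n, countCDF_le_one p n⟩

/-- At 0 or 1 the distribution function is at an extreme value of its range, so the gradient
vanishes and infinite quantiles contribute nothing. -/
theorem fderiv_eq_zero_of_not_isLevel {ϑ : Fin k → ℝ} {n : ℕ} (h : ¬IsLevel (law ϑ) n) :
    fderiv ℝ (fun ϑ => countCDF (law ϑ) n) ϑ = 0 := by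
  rcases level_cases (law ϑ) n with h0 | h1 | h2
  · refine IsLocalMin.fderiv_eq_zero (Filter.Eventually.of_forall fun ϑ' => ?_)
    simp only [h0]; exact countCDF_nonneg _ _
  · refine IsLocalMax.fderiv_eq_zero (Filter.Eventually.of_forall fun ϑ' => ?_)
    simp only [h1]; exact countCDF_le_one _ _
  · exact absurd h2 h

theorem gradNorm_level {ϑ : Fin k → ℝ} {n : ℕ}
    (hd : DifferentiableAt ℝ (fun ϑ => countCDF (law ϑ) n) ϑ) (h : IsLevel (law ϑ) n) :
    gradNorm (fun ϑ => level (law ϑ) n) ϑ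
      = (stdPDF (level (law ϑ) n))⁻¹ * gradNorm (fun ϑ => countCDF (law ϑ) n) ϑ := by
  have hf : HasFDerivAt (fun ϑ => level (law ϑ) n) _ ϑ :=
    (hasDerivAt_stdQuantile h.1 h.2).comp_hasFDerivAt ϑ hd.hasFDerivAt
  rw [gradNorm, gradNorm, hf.fderiv, Finset.mul_sum]
  refine Finset.sum_congr rfl fun j _ => ?_
  have := inv_pos.2 (stdPDF_pos (level (law ϑ) n))
  simp only [smul_apply, smul_eq_mul, abs_mul]
  rw [abs_of_pos (inv_pos.2 (stdPDF_pos _))]; rfl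

-- Chain rule and mean value theorem for finitely many contracted levels; the decay of g at infinity
-- lets the contraction disappear even when a level is 0 or 1 at an end of the segment, and the
-- finite sums then give the series.
open Classical in
theorem tsum_abs_quantileFun_sub_le {B : Set (Fin k → ℝ)} (hB : Convex ℝ B)
    (hd : ∀ n, ∀ ϑ ∈ B, DifferentiableAt ℝ (fun ϑ => countCDF (law ϑ) n) ϑ)
    {g g' : ℝ → ℝ} (hg : ∀ x, HasDerivAt g (g' x) x) {κ c : ℝ} (hκ : 0 ≤ κ) (hc : 0 ≤ c)
    (hb : ∀ x, |g' x| ≤ κ * ((1 + |x| ^ 3) * Real.exp (-(x ^ 2) / (2 * (1 + c)))))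
    (hlim : Filter.Tendsto g (Filter.cocompact ℝ) (nhds 0)) {a b : Fin k → ℝ} (ha : a ∈ B)
    (hb' : b ∈ B) :
    ∑' n, ENNReal.ofReal |quantileFun g (countCDF (law b) n) - quantileFun g (countCDF (law a) n)|
      ≤ ENNReal.ofReal (κ * √(2 * Real.pi) * ‖b - a‖)
        * ⨆ ϑ ∈ B, (gradSum law ϑ 0 (1 + c) + gradSum law ϑ 3 (1 + c)) := by
  have hgc : Continuous g := continuous_iff_continuousAt.2 fun x => (hg x).continuousAt
  let G : ℕ → (Fin k → ℝ) → ℝ := fun n ϑ => if IsLevel (law ϑ) n then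
    κ * ((1 + |level (law ϑ) n| ^ 3) * Real.exp (-(level (law ϑ) n ^ 2) / (2 * (1 + c))))
      * gradNorm (fun ϑ => level (law ϑ) n) ϑ else 0
  have hG : ∀ n, ∀ ϑ ∈ B, 0 ≤ G n ϑ := fun n ϑ _ => by
    simp only [G]; split_ifs
    · have := gradNorm_nonneg (fun ϑ => level (law ϑ) n) ϑ
      positivity
    · exact le_rfl
  have hsum : ∀ ϑ, ∑' n, ENNReal.ofReal (G n ϑ)
      = ENNReal.ofReal (κ * √(2 * Real.pi)) * (gradSum law ϑ 0 (1 + c) + gradSum law ϑ 3 (1 + c)) := by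
    intro ϑ
    rw [gradSum, gradSum, ← ENNReal.tsum_add, ← ENNReal.tsum_mul_left]
    congr 1; ext n
    simp only [G]
    have := gradNorm_nonneg (fun ϑ => level (law ϑ) n) ϑ
    split_ifs
    · rw [← ENNReal.ofReal_add (by positivity) (by positivity), ← ENNReal.ofReal_mul (by positivity)]
      congr 1
      have : √(2 * Real.pi) ≠ 0 := by positivity
      field_simp
    · simp
  have hstep : ∀ A : Finset ℕ, ∑ n ∈ A,
      ENNReal.ofReal |quantileFun g (countCDF (law b) n) - quantileFun g (countCDF (law a) n)|
      ≤ ENNReal.ofReal ‖b - a‖ * ⨆ ϑ ∈ B, ∑' n, ENNReal.ofReal (G n ϑ) := by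
    intro A
    have ht : Filter.Tendsto (fun ε : ℝ => ∑ n ∈ A,
        ENNReal.ofReal |g (stdQuantile (ε + (1 - 2 * ε) * countCDF (law b) n))
          - g (stdQuantile (ε + (1 - 2 * ε) * countCDF (law a) n))|)
        (nhdsWithin 0 (Set.Ioi 0)) (nhds (∑ n ∈ A,
          ENNReal.ofReal |quantileFun g (countCDF (law b) n)
            - quantileFun g (countCDF (law a) n)|)) :=
      tendsto_finsetSum _ fun n _ => (ENNReal.continuous_ofReal.tendsto _).comp
        ((tendsto_quantileFun_squeeze hgc hlim (countCDF_mem_Icc _ n)).sub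
          (tendsto_quantileFun_squeeze hgc hlim (countCDF_mem_Icc _ n))).abs
    refine le_of_tendsto ht ?_
    have hsm : ∀ᶠ ε : ℝ in nhdsWithin 0 (Set.Ioi 0), 0 < ε ∧ ε < 1 / 2 :=
      Ioo_mem_nhdsGT (by norm_num)
    filter_upwards [hsm] with ε hε
    -- The contraction contributes the factor 1 - 2ε, which is later bounded by 1.
    have hder : ∀ n, ∀ ϑ ∈ B, HasFDerivAt
        (fun ϑ => g (stdQuantile (ε + (1 - 2 * ε) * countCDF (law ϑ) n)))
        ((g' (stdQuantile (ε + (1 - 2 * ε) * countCDF (law ϑ) n))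
          * ((stdPDF (stdQuantile (ε + (1 - 2 * ε) * countCDF (law ϑ) n)))⁻¹ * (1 - 2 * ε)))
          • fderiv ℝ (fun ϑ => countCDF (law ϑ) n) ϑ) ϑ := by
      intro n ϑ hϑ
      have hm := squeeze_mem hε.1 hε.2 (countCDF_mem_Icc (law ϑ) n)
      have h1 : HasDerivAt (fun t : ℝ => ε + (1 - 2 * ε) * t) (1 - 2 * ε) (countCDF (law ϑ) n) := by
        simpa using ((hasDerivAt_id (countCDF (law ϑ) n)).const_mul (1 - 2 * ε)).const_add ε
      have h2 := (hg _).comp (countCDF (law ϑ) n)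
        ((hasDerivAt_stdQuantile hm.1 hm.2).comp (countCDF (law ϑ) n) h1)
      have h3 := h2.comp_hasFDerivAt ϑ (hd n ϑ hϑ).hasFDerivAt
      exact h3
    refine sum_abs_sub_le_of_fderiv hB hG (fun n ϑ hϑ => (hder n ϑ hϑ).differentiableAt) ?_ ha hb' A
    intro n ϑ hϑ v
    rw [(hder n ϑ hϑ).fderiv]
    by_cases hl : IsLevel (law ϑ) n
    · simp only [G, if_pos hl]
      rw [gradNorm_level (hd n ϑ hϑ) hl, smul_apply, smul_eq_mul, abs_mul]
      have hq := abs_stdQuantile_squeeze_le hε.1 hε.2 hl.1 hl.2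
      have hw := weight_div_stdPDF_le hc hq
      change _ ≤ (1 + |level (law ϑ) n| ^ 3) * Real.exp (-(level (law ϑ) n ^ 2) / (2 * (1 + c)))
        * (stdPDF (level (law ϑ) n))⁻¹ at hw
      set x := stdQuantile (ε + (1 - 2 * ε) * countCDF (law ϑ) n)
      set y := level (law ϑ) n
      have hfd := abs_fderiv_le (fun ϑ => countCDF (law ϑ) n) ϑ v
      have hgn := gradNorm_nonneg (fun ϑ => countCDF (law ϑ) n) ϑ
      have h1 : |g' x * ((stdPDF x)⁻¹ * (1 - 2 * ε))|
          ≤ κ * ((1 + |y| ^ 3) * Real.exp (-(y ^ 2) / (2 * (1 + c))) * (stdPDF y)⁻¹) := by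
        have hx := inv_pos.2 (stdPDF_pos x)
        rw [abs_mul, abs_of_nonneg (mul_nonneg hx.le (by linarith [hε.2]))]
        calc |g' x| * ((stdPDF x)⁻¹ * (1 - 2 * ε))
            ≤ (κ * ((1 + |x| ^ 3) * Real.exp (-(x ^ 2) / (2 * (1 + c))))) * ((stdPDF x)⁻¹ * 1) := by
              gcongr
              · exact mul_nonneg hx.le (by linarith [hε.2])
              · exact hb x
              · linarith [hε.1]
          _ = κ * ((1 + |x| ^ 3) * Real.exp (-(x ^ 2) / (2 * (1 + c))) * (stdPDF x)⁻¹) := by ring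
          _ ≤ _ := by gcongr
      have hy := inv_pos.2 (stdPDF_pos y)
      calc _ ≤ (κ * ((1 + |y| ^ 3) * Real.exp (-(y ^ 2) / (2 * (1 + c))) * (stdPDF y)⁻¹))
            * (‖v‖ * gradNorm (fun ϑ => countCDF (law ϑ) n) ϑ) := by gcongr
        _ = _ := by ring
    · rw [fderiv_eq_zero_of_not_isLevel hl]
      simp [G, hl]
  rw [ENNReal.tsum_eq_iSup_sum]
  refine iSup_le fun A => (hstep A).trans (le_of_eq ?_)
  simp_rw [hsum, ← ENNReal.mul_iSup]
  rw [← mul_assoc, ← ENNReal.ofReal_mul (norm_nonneg _)]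
  congr 2; ring

/-- Variation of weighted sums of the distribution functions. -/
theorem tsum_abs_countCDF_sub_le {B : Set (Fin k → ℝ)} (hB : Convex ℝ B)
    (hd : ∀ n, ∀ ϑ ∈ B, DifferentiableAt ℝ (fun ϑ => countCDF (law ϑ) n) ϑ)
    {w : ℕ → ℝ} (hw : ∀ n, 0 ≤ w n) {a b : Fin k → ℝ} (ha : a ∈ B) (hb : b ∈ B) :
    ∑' n, ENNReal.ofReal (w n * |countCDF (law b) n - countCDF (law a) n|)
      ≤ ENNReal.ofReal ‖b - a‖
        * ⨆ ϑ ∈ B, ∑' n, ENNReal.ofReal (w n * gradNorm (fun ϑ => countCDF (law ϑ) n) ϑ) := by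
  rw [ENNReal.tsum_eq_iSup_sum]
  refine iSup_le fun A => ?_
  have h := sum_abs_sub_le_of_fderiv hB (f := fun n ϑ => w n * countCDF (law ϑ) n)
    (G := fun n ϑ => w n * gradNorm (fun ϑ => countCDF (law ϑ) n) ϑ)
    (fun n ϑ _ => mul_nonneg (hw n) (gradNorm_nonneg _ _))
    (fun n ϑ hϑ => (hd n ϑ hϑ).const_mul _) (fun n ϑ hϑ v => ?_) ha hb A
  · refine le_trans (le_of_eq (Finset.sum_congr rfl fun n _ => ?_)) h
    rw [← mul_sub, abs_mul, abs_of_nonneg (hw n)]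
  · rw [((hd n ϑ hϑ).hasFDerivAt.const_mul (w n)).fderiv, smul_apply,
      smul_eq_mul, abs_mul, abs_of_nonneg (hw n)]
    have := abs_fderiv_le (fun ϑ => countCDF (law ϑ) n) ϑ v
    have := mul_le_mul_of_nonneg_left this (hw n)
    linarith

end

section

/-! ## Variation of the derivatives of the link function in the parameters -/

variable {k : ℕ} {law : (Fin k → ℝ) → PMF ℕ}

/-- The supremum over a set of parameters of the weighted sums of gradients of the levels. -/
noncomputable def gradSup (law : (Fin k → ℝ) → PMF ℕ) (B : Set (Fin k → ℝ)) (x : ℝ) : ℝ≥0∞ :=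
  ⨆ ϑ ∈ B, (gradSum law ϑ 0 x + gradSum law ϑ 3 x)

theorem tendsto_pow_mul_exp_cocompact {b : ℝ} (hb : 0 < b) (n : ℕ) :
    Filter.Tendsto (fun x : ℝ => |x| ^ n * Real.exp (-(x ^ 2) / b)) (Filter.cocompact ℝ)
      (nhds 0) := by
  have := tendsto_rpow_abs_mul_exp_neg_mul_sq_cocompact (inv_pos.2 hb) n
  refine this.congr fun x => ?_
  rw [Real.rpow_natCast]; congr 2; field_simp

theorem lcoef_zero_eq (p : PMF ℕ) (n : ℕ) : lcoef p 0 n = quantileFun stdPDF (countCDF p n) := by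
  by_cases h : IsLevel p n
  · rw [lcoef, quantileFun, if_pos h, if_pos (show _ ∧ _ from h), He_zero, one_mul]; rfl
  · rw [lcoef, quantileFun, if_neg h, if_neg (show ¬(_ ∧ _) from h)]

theorem ofReal_abs_tsum_le {ι : Type*} {f : ι → ℝ} (hf : Summable fun i => |f i|) :
    ENNReal.ofReal |∑' i, f i| ≤ ∑' i, ENNReal.ofReal |f i| := by
  rw [← ENNReal.ofReal_tsum_of_nonneg (fun _ => abs_nonneg _) hf]
  exact ENNReal.ofReal_le_ofReal (norm_tsum_le_tsum_norm (f := f) hf)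

theorem exp_neg_div_le {c : ℝ} (hc : 0 ≤ c) (x : ℝ) :
    Real.exp (-x ^ 2 / 2) ≤ Real.exp (-(x ^ 2) / (2 * (1 + c))) := by
  rw [Real.exp_le_exp, neg_div, neg_div, neg_le_neg_iff]
  gcongr
  linarith

theorem abs_le_one_add_cube (x : ℝ) : |x| ≤ 1 + |x| ^ 3 := by
  nlinarith [abs_nonneg x, sq_nonneg (|x| - 1), mul_nonneg (abs_nonneg x) (sq_nonneg (|x| - 1))]

theorem ofReal_abs_hermiteCoeff_one_sub_le {B : Set (Fin k → ℝ)} (hB : Convex ℝ B)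
    (hd : ∀ n, ∀ ϑ ∈ B, DifferentiableAt ℝ (fun ϑ => countCDF (law ϑ) n) ϑ)
    (hs : ∀ ϑ ∈ B, SecondMoment (law ϑ)) {c : ℝ} (hc : 0 ≤ c) {a b : Fin k → ℝ} (ha : a ∈ B)
    (hb : b ∈ B) :
    ENNReal.ofReal |hermiteCoeff (law b) 1 - hermiteCoeff (law a) 1|
      ≤ ENNReal.ofReal ‖b - a‖ * gradSup law B (1 + c) := by
  have h1 := hasSum_lcoef (hs b hb) 0
  have h2 := hasSum_lcoef (hs a ha) 0
  have h3 : HasSum (fun n => lcoef (law b) 0 n - lcoef (law a) 0 n) _ := h1.sub h2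
  have hlim : Filter.Tendsto stdPDF (Filter.cocompact ℝ) (nhds 0) := by
    have := (tendsto_pow_mul_exp_cocompact (b := 2) two_pos 0).const_mul (√(2 * Real.pi))⁻¹
    rw [mul_zero] at this
    refine this.congr fun x => ?_
    rw [stdPDF_eq]; simp
  have key := tsum_abs_quantileFun_sub_le hB hd (g := stdPDF) hasDerivAt_stdPDF
    (κ := (√(2 * Real.pi))⁻¹) (by positivity) hc (fun x => ?_) hlim ha hb
  · rw [inv_mul_cancel₀ (by positivity), one_mul] at key
    refine le_trans ?_ key
    rw [← h3.tsum_eq]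
    simp only [← lcoef_zero_eq]
    exact ofReal_abs_tsum_le h3.summable.abs
  · rw [stdPDF_eq, abs_mul, abs_neg, abs_of_nonneg (show 0 ≤ (√(2 * Real.pi))⁻¹
      * Real.exp (-x ^ 2 / 2) by positivity)]
    have := mul_le_mul (abs_le_one_add_cube x) (exp_neg_div_le hc x) (Real.exp_pos _).le
      (by positivity)
    calc |x| * ((√(2 * Real.pi))⁻¹ * Real.exp (-x ^ 2 / 2))
        = (√(2 * Real.pi))⁻¹ * (|x| * Real.exp (-x ^ 2 / 2)) := by ring
      _ ≤ _ := by gcongr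

theorem hasDerivAt_logDer_left (u x y : ℝ) :
    HasDerivAt (fun x => logDer u x y) (((1 + u ^ 2) * y - u * (2 * x)) / (1 - u ^ 2) ^ 2) x := by
  unfold logDer
  have h := ((((hasDerivAt_id x).mul_const y).const_mul (1 + u ^ 2)).sub
    (((hasDerivAt_pow 2 x).add_const (y ^ 2)).const_mul u)).div_const ((1 - u ^ 2) ^ 2)
  refine (h.const_add (u / (1 - u ^ 2))).congr_deriv ?_
  norm_num

theorem hasDerivAt_biPDF_left {u : ℝ} (hu : |u| < 1) (x y : ℝ) :
    HasDerivAt (fun x => biPDF u x y) (biPDF u x y * (-(x - u * y) / (1 - u ^ 2))) x := by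
  have h1 := one_sub_sq_pos hu
  rw [show (fun x => biPDF u x y) = _ from funext fun x => biPDF_eq hu x y, biPDF_eq hu]
  have h : HasDerivAt (fun x : ℝ => -(x ^ 2 - 2 * u * x * y + y ^ 2) / (2 * (1 - u ^ 2)))
      (-(2 * x - 2 * u * y) / (2 * (1 - u ^ 2))) x := by
    have := ((((hasDerivAt_pow 2 x).sub (((hasDerivAt_id x).const_mul (2 * u)).mul_const y)).add_const
      (y ^ 2)).neg).div_const (2 * (1 - u ^ 2))
    refine this.congr_deriv ?_
    norm_num
  refine ((h.exp).const_mul _).congr_deriv ?_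
  field_simp

/-- The expression is the derivative in x of the density times its logarithmic derivative in u,
divided by the density. All monomials of degree at most 3 in |x|, |y| that occur are dominated by (1
+ |x|³)(1 + |y|³), which explains the moments of orders 0 and 3. -/
theorem abs_mixed_deriv_le {u : ℝ} (hu : |u| < 1) (x y : ℝ) :
    |-(x - u * y) / (1 - u ^ 2) * logDer u x y
        + ((1 + u ^ 2) * y - u * (2 * x)) / (1 - u ^ 2) ^ 2|
      ≤ 14 * ((1 + |x| ^ 3) * (1 + |y| ^ 3)) / (1 - u ^ 2) ^ 3 := by
  have h1 := one_sub_sq_pos hu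
  have h1' : 1 - u ^ 2 ≤ 1 := by nlinarith
  have hu2 : u ^ 2 ≤ 1 := by linarith
  have hx := abs_nonneg x
  have hy := abs_nonneg y
  have a1 : |-(x - u * y) / (1 - u ^ 2)| ≤ (|x| + |y|) / (1 - u ^ 2) := by
    rw [abs_div, abs_of_pos h1, abs_neg]
    gcongr
    refine (abs_sub _ _).trans ?_
    rw [abs_mul]
    gcongr
    exact mul_le_of_le_one_left hy hu.le
  have a2 := abs_logDer_le hu x y
  have a3 : |((1 + u ^ 2) * y - u * (2 * x)) / (1 - u ^ 2) ^ 2|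
      ≤ (2 * |y| + 2 * |x|) / (1 - u ^ 2) ^ 3 := by
    rw [abs_div, abs_of_pos (pow_pos h1 2)]
    refine div_le_div₀ (by positivity) ?_ (pow_pos h1 3) ?_
    · refine (abs_sub _ _).trans ?_
      rw [abs_mul, abs_mul, abs_mul, abs_of_pos (show 0 < 1 + u ^ 2 by positivity), abs_two]
      exact add_le_add (mul_le_mul_of_nonneg_right (by linarith) hy)
        (mul_le_of_le_one_left (by positivity) hu.le)
    · rw [pow_succ]; exact mul_le_of_le_one_right (by positivity) h1'
  refine (abs_add_le _ _).trans ?_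
  rw [abs_mul]
  calc _ ≤ (|x| + |y|) / (1 - u ^ 2) * (2 * (1 + x ^ 2 + y ^ 2) / (1 - u ^ 2) ^ 2)
        + (2 * |y| + 2 * |x|) / (1 - u ^ 2) ^ 3 := by gcongr
    _ = ((|x| + |y|) * (4 + 2 * |x| ^ 2 + 2 * |y| ^ 2)) / (1 - u ^ 2) ^ 3 := by
      rw [sq_abs, sq_abs]; field_simp; ring
    _ ≤ _ := by
      gcongr ?_ / _
      generalize |x| = s at *
      generalize |y| = t at *
      have b1 : s ≤ (2 + s ^ 3) / 3 := by nlinarith [sq_nonneg (s - 1), mul_nonneg hx (sq_nonneg (s - 1))]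
      have b2 : t ≤ (2 + t ^ 3) / 3 := by nlinarith [sq_nonneg (t - 1), mul_nonneg hy (sq_nonneg (t - 1))]
      have b3 : s ^ 2 ≤ (1 + 2 * s ^ 3) / 3 := by
        nlinarith [sq_nonneg (s - 1), mul_nonneg hx (sq_nonneg (s - 1))]
      have b4 : t ^ 2 ≤ (1 + 2 * t ^ 3) / 3 := by
        nlinarith [sq_nonneg (t - 1), mul_nonneg hy (sq_nonneg (t - 1))]
      have c1 : s * t ^ 2 ≤ ((2 + s ^ 3) / 3) * ((1 + 2 * t ^ 3) / 3) := by gcongr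
      have c2 : s ^ 2 * t ≤ ((1 + 2 * s ^ 3) / 3) * ((2 + t ^ 3) / 3) := by gcongr
      have d1 := pow_nonneg hx 3
      have d2 := pow_nonneg hy 3
      nlinarith [mul_nonneg d1 d2]

theorem tendsto_biPDF_mul_logDer {u : ℝ} (hu : |u| < 1) (y : ℝ) :
    Filter.Tendsto (fun x => biPDF u x y * logDer u x y) (Filter.cocompact ℝ) (nhds 0) := by
  have h1 := one_sub_sq_pos hu
  have hb : 0 < 2 * (1 + |u|) := by positivity
  have h0 := (tendsto_pow_mul_exp_cocompact hb 0).const_mul (1 + y ^ 2)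
  have h2 := (h0.add (tendsto_pow_mul_exp_cocompact hb 2)).const_mul
    ((√(1 - u ^ 2))⁻¹ * (Real.exp (-(y ^ 2) / (2 * (1 + |u|))) / (√(2 * Real.pi) * √(2 * Real.pi))) * 2 / (1 - u ^ 2) ^ 2)
  rw [mul_zero, add_zero, mul_zero] at h2
  refine squeeze_zero_norm (fun x => ?_) h2
  rw [Real.norm_eq_abs, abs_mul, abs_of_pos (biPDF_pos hu _ _)]
  refine (mul_le_mul (biPDF_le hu le_rfl x y) (abs_logDer_le hu x y) (abs_nonneg _)
    (by positivity)).trans (le_of_eq ?_)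
  rw [sq_abs]
  have : √(2 * Real.pi) ≠ 0 := by positivity
  field_simp
  ring

variable {q : PMF ℕ}

/-- With the second level fixed at Q_m, the variation in the first law is that of a function of its
quantiles with a constant κ depending on Q_m; summing κ over m gives the moments of q. The seventh
power of (1 - u²)^(-1/2) is one factor from the density and six from the mixed derivative. -/
theorem ofReal_abs_linkDeriv2_sub_le {B : Set (Fin k → ℝ)} (hB : Convex ℝ B)
    (hd : ∀ n, ∀ ϑ ∈ B, DifferentiableAt ℝ (fun ϑ => countCDF (law ϑ) n) ϑ)
    (hs : ∀ ϑ ∈ B, SecondMoment (law ϑ)) (hq : SecondMoment q) {u c : ℝ} (hc : c < 1)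
    (hu : |u| ≤ c) {a b : Fin k → ℝ} (ha : a ∈ B) (hb : b ∈ B) :
    ENNReal.ofReal |linkDeriv2 (law b) q u - linkDeriv2 (law a) q u|
      ≤ ENNReal.ofReal (14 * (√(1 - u ^ 2))⁻¹ ^ 7 * ‖b - a‖)
        * (gradSup law B (1 + c) * (levelMoment q 0 (1 + c) + levelMoment q 3 (1 + c))) := by
  have hu1 := hu.trans_lt hc
  have h1 := one_sub_sq_pos hu1
  have hc0 : 0 ≤ c := (abs_nonneg u).trans hu
  have s1 := hasSum_pairDensityDeriv (hs b hb) hq hu1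
  have s2 := hasSum_pairDensityDeriv (hs a ha) hq hu1
  have hsum : Summable fun nm =>
      |pairDensityDeriv (law b) q u nm - pairDensityDeriv (law a) q u nm| :=
    (s1.summable.sub s2.summable).abs
  have hdiff : linkDeriv2 (law b) q u - linkDeriv2 (law a) q u
      = ∑' nm, (pairDensityDeriv (law b) q u nm - pairDensityDeriv (law a) q u nm) :=
    (s1.summable.tsum_sub s2.summable).symm
  rw [hdiff]
  refine (ofReal_abs_tsum_le hsum).trans ?_
  rw [ENNReal.tsum_prod', ENNReal.tsum_comm]
  set κ : ℝ → ℝ := fun y => 14 * (√(1 - u ^ 2))⁻¹ ^ 7 * (2 * Real.pi)⁻¹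
    * ((1 + |y| ^ 3) * Real.exp (-(y ^ 2) / (2 * (1 + c)))) with hκ
  have hlevel : ∀ m, IsLevel q m →
      ∑' n, ENNReal.ofReal |pairDensityDeriv (law b) q u (n, m)
        - pairDensityDeriv (law a) q u (n, m)|
      ≤ ENNReal.ofReal (κ (level q m) * √(2 * Real.pi) * ‖b - a‖) * gradSup law B (1 + c) := by
    intro m hm
    have e : ∀ p n, pairDensityDeriv p q u (n, m)
        = quantileFun (fun x => biPDF u x (level q m) * logDer u x (level q m)) (countCDF p n) := by
      intro p n
      by_cases h : IsLevel p n
      · rw [pairDensityDeriv, quantileFun, if_pos ⟨h, hm⟩, if_pos (show _ ∧ _ from h)]; rfl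
      · rw [pairDensityDeriv, quantileFun, if_neg fun h' => h h'.1, if_neg (show ¬(_ ∧ _) from h)]
    simp only [e]
    refine tsum_abs_quantileFun_sub_le hB hd (fun x =>
      (hasDerivAt_biPDF_left hu1 x (level q m)).mul (hasDerivAt_logDer_left u x (level q m)))
      (by positivity) hc0 (fun x => ?_) (tendsto_biPDF_mul_logDer hu1 _) ha hb
    generalize level q m = y
    have hbi := biPDF_le hc hu x y
    have hmix := abs_mixed_deriv_le hu1 x y
    rw [show biPDF u x y * (-(x - u * y) / (1 - u ^ 2)) * logDer u x y
        + biPDF u x y * (((1 + u ^ 2) * y - u * (2 * x)) / (1 - u ^ 2) ^ 2)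
      = biPDF u x y * (-(x - u * y) / (1 - u ^ 2) * logDer u x y
        + ((1 + u ^ 2) * y - u * (2 * x)) / (1 - u ^ 2) ^ 2) by ring, abs_mul,
      abs_of_pos (biPDF_pos hu1 _ _)]
    refine (mul_le_mul hbi hmix (abs_nonneg _) (by positivity)).trans (le_of_eq ?_)
    have hr2 : 1 - u ^ 2 = √(1 - u ^ 2) ^ 2 := (Real.sq_sqrt h1.le).symm
    have hr : √(1 - u ^ 2) ≠ 0 := (Real.sqrt_pos.2 h1).ne'
    have hp : √(2 * Real.pi) ≠ 0 := by positivity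
    simp only [hκ]
    rw [inv_two_pi, show ((1 - u ^ 2) ^ 3) = √(1 - u ^ 2) ^ 6 by rw [pow_mul _ 2 3, ← hr2]]
    field_simp
  calc _ ≤ ∑' m, (open Classical in if IsLevel q m then
        ENNReal.ofReal (κ (level q m) * √(2 * Real.pi) * ‖b - a‖) * gradSup law B (1 + c) else 0) := by
        refine ENNReal.tsum_le_tsum fun m => ?_
        split_ifs with hm
        · exact hlevel m hm
        · simp [pairDensityDeriv, hm]
    _ = levelSum q (fun y => (14 * (√(1 - u ^ 2))⁻¹ ^ 7 * ‖b - a‖)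
          * (Real.exp (-(y ^ 2) / (2 * (1 + c))) * |y| ^ 0 / √(2 * Real.pi)
            + Real.exp (-(y ^ 2) / (2 * (1 + c))) * |y| ^ 3 / √(2 * Real.pi)))
          * gradSup law B (1 + c) := by
        rw [levelSum, ← ENNReal.tsum_mul_right]
        congr 1; ext m
        split_ifs
        · congr 2
          simp only [hκ]
          rw [inv_two_pi]
          have hp : √(2 * Real.pi) ≠ 0 := by positivity
          field_simp
        · simp
    _ = _ := by
        rw [levelSum_const_mul (by positivity), levelSum_add (fun _ => by positivity)
          (fun _ => by positivity), levelMoment, levelMoment]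
        ring

theorem pairDensityDeriv_comm (p q : PMF ℕ) (u : ℝ) (n m : ℕ) :
    pairDensityDeriv p q u (n, m) = pairDensityDeriv q p u (m, n) := by
  have e1 : ∀ x y, biPDF u x y = biPDF u y x := fun x y => by
    simp only [biPDF, mehler]
    rw [show u ^ 2 * x ^ 2 - 2 * u * x * y + u ^ 2 * y ^ 2
      = u ^ 2 * y ^ 2 - 2 * u * y * x + u ^ 2 * x ^ 2 by ring]
    ring
  have e2 : ∀ x y, logDer u x y = logDer u y x := fun x y => by simp only [logDer]; ring
  rw [pairDensityDeriv, pairDensityDeriv, e1, e2]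
  by_cases h : IsLevel p n ∧ IsLevel q m
  · rw [if_pos h, if_pos h.symm]
  · rw [if_neg h, if_neg fun h' => h h'.symm]

theorem linkDeriv2_comm (p q : PMF ℕ) (u : ℝ) : linkDeriv2 p q u = linkDeriv2 q p u := by
  rw [linkDeriv2, linkDeriv2, ← (Equiv.prodComm ℕ ℕ).tsum_eq]
  congr 1; ext nm
  exact (pairDensityDeriv_comm _ _ _ _ _)

end

section

/-! ## The seminorm on sparse vectors -/

variable {ι : Type} [Fintype ι]

/-- Vectors with at most `2 s` non-zero entries. -/
def IsSparse (s : ℕ) (v : ι → ℝ) : Prop := {a | v a ≠ 0}.ncard ≤ 2 * s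

theorem IsSparse.mono {s : ℕ} {v w : ι → ℝ} (hv : IsSparse s v) (h : ∀ a, v a = 0 → w a = 0) :
    IsSparse s w :=
  (Set.ncard_le_ncard (Set.ofPred_subset_ofPred.2 fun a ha hva => ha (h a hva)) (Set.toFinite _)).trans hv

theorem dotProduct_mulVec_eq_sum (A : Matrix ι ι ℝ) (v w : ι → ℝ) :
    v ⬝ᵥ A.mulVec w = ∑ a, ∑ b, v a * A a b * w b := by
  simp [dotProduct, Matrix.mulVec, Finset.mul_sum, mul_assoc]

theorem bddAbove_sparseNorm (s : ℕ) (A : Matrix ι ι ℝ) :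
    BddAbove (Set.range fun v : {v : ι → ℝ // ∑ a, v a ^ 2 ≤ 1 ∧ {a | v a ≠ 0}.ncard ≤ 2 * s} =>
      |v.1 ⬝ᵥ A.mulVec v.1|) := by
  refine ⟨∑ a, ∑ b, |A a b|, ?_⟩
  rintro _ ⟨⟨v, hv, -⟩, rfl⟩
  have h1 : ∀ a, |v a| ≤ 1 := fun a => by
    have : v a ^ 2 ≤ 1 :=
      (Finset.single_le_sum (f := fun a => v a ^ 2) (fun b _ => sq_nonneg (v b)) (Finset.mem_univ a)).trans hv
    exact abs_le_one_iff_mul_self_le_one.2 (by nlinarith)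
  simp only
  rw [dotProduct_mulVec_eq_sum]
  refine (Finset.abs_sum_le_sum_abs _ _).trans (Finset.sum_le_sum fun a _ =>
    (Finset.abs_sum_le_sum_abs _ _).trans (Finset.sum_le_sum fun b _ => ?_))
  rw [abs_mul, abs_mul]
  calc |v a| * |A a b| * |v b| ≤ 1 * |A a b| * 1 := by gcongr <;> apply h1
    _ = _ := by ring

theorem sparseNorm_nonneg (s : ℕ) (A : Matrix ι ι ℝ) : 0 ≤ sparseNorm s A :=
  Real.iSup_nonneg fun _ => abs_nonneg _

theorem sparseNorm_le {s : ℕ} {A : Matrix ι ι ℝ} {K : ℝ}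
    (h : ∀ v : ι → ℝ, ∑ a, v a ^ 2 ≤ 1 → IsSparse s v → |v ⬝ᵥ A.mulVec v| ≤ K) :
    sparseNorm s A ≤ K := by
  have : Nonempty {v : ι → ℝ // ∑ a, v a ^ 2 ≤ 1 ∧ {a | v a ≠ 0}.ncard ≤ 2 * s} :=
    ⟨⟨0, by simp⟩⟩
  exact ciSup_le fun v => h v.1 v.2.1 v.2.2

theorem abs_form_le_of_le_one {s : ℕ} (A : Matrix ι ι ℝ) {v : ι → ℝ} (hv : ∑ a, v a ^ 2 ≤ 1)
    (hs : IsSparse s v) : |v ⬝ᵥ A.mulVec v| ≤ sparseNorm s A :=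
  le_ciSup (bddAbove_sparseNorm s A) ⟨v, hv, hs⟩

theorem abs_form_le {s : ℕ} (A : Matrix ι ι ℝ) {v : ι → ℝ} (hs : IsSparse s v) :
    |v ⬝ᵥ A.mulVec v| ≤ sparseNorm s A * ∑ a, v a ^ 2 := by
  have h0 : 0 ≤ ∑ a, v a ^ 2 := Finset.sum_nonneg fun _ _ => sq_nonneg _
  rcases eq_or_lt_of_le h0 with h | h
  · have : v = 0 := by
      ext a
      have := (Finset.sum_eq_zero_iff_of_nonneg fun b _ => sq_nonneg (v b)).1 h.symm a
        (Finset.mem_univ a)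
      simpa using this
    simp [this]
  · set r := √(∑ a, v a ^ 2) with hr
    have hr0 : 0 < r := Real.sqrt_pos.2 h
    have hr2 : r ^ 2 = ∑ a, v a ^ 2 := Real.sq_sqrt h0
    have h1 := abs_form_le_of_le_one A (s := s) (v := r⁻¹ • v) (by
      simp only [Pi.smul_apply, smul_eq_mul, mul_pow, ← Finset.mul_sum]
      rw [← hr2]; field_simp; exact le_rfl) (hs.mono fun a ha => by simp [ha])
    rw [Matrix.mulVec_smul, smul_dotProduct, dotProduct_smul, smul_eq_mul, smul_eq_mul, abs_mul,
      abs_mul, abs_of_pos (inv_pos.2 hr0)] at h1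
    rw [← hr2]
    have := mul_le_mul_of_nonneg_left h1 (sq_nonneg r)
    calc _ = r ^ 2 * (r⁻¹ * (r⁻¹ * |v ⬝ᵥ A.mulVec v|)) := by field_simp
      _ ≤ _ := by linarith

theorem sparseNorm_add_le (s : ℕ) (A B : Matrix ι ι ℝ) :
    sparseNorm s (A + B) ≤ sparseNorm s A + sparseNorm s B := by
  refine sparseNorm_le fun v hv hs => ?_
  rw [Matrix.add_mulVec, dotProduct_add]
  exact (abs_add_le _ _).trans
    (add_le_add (abs_form_le_of_le_one A hv hs) (abs_form_le_of_le_one B hv hs))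

theorem sparseNorm_neg (s : ℕ) (A : Matrix ι ι ℝ) : sparseNorm s (-A) = sparseNorm s A := by
  simp [sparseNorm, Matrix.neg_mulVec]

theorem sparseNorm_sub_le (s : ℕ) (A B : Matrix ι ι ℝ) :
    sparseNorm s (A - B) ≤ sparseNorm s A + sparseNorm s B := by
  rw [sub_eq_add_neg, ← sparseNorm_neg s B]; exact sparseNorm_add_le s A (-B)

theorem sparseNorm_le_of_diag {s : ℕ} {A : Matrix ι ι ℝ} {K : ℝ} (hK : 0 ≤ K)
    (h0 : ∀ a b, a ≠ b → A a b = 0) (h : ∀ a, |A a a| ≤ K) : sparseNorm s A ≤ K := by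
  refine sparseNorm_le fun v hv _ => ?_
  rw [dotProduct_mulVec_eq_sum]
  have : ∀ a, ∑ b, v a * A a b * v b = v a ^ 2 * A a a := fun a => by
    rw [Finset.sum_eq_single a (fun b _ hb => by rw [h0 a b hb.symm]; ring) (by simp)]; ring
  simp_rw [this]
  calc |∑ a, v a ^ 2 * A a a| ≤ ∑ a, v a ^ 2 * K := by
        refine (Finset.abs_sum_le_sum_abs _ _).trans (Finset.sum_le_sum fun a _ => ?_)
        rw [abs_mul, abs_of_nonneg (sq_nonneg _)]
        gcongr; exact h a
    _ = (∑ a, v a ^ 2) * K := by rw [Finset.sum_mul]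
    _ ≤ 1 * K := by gcongr
    _ = K := one_mul K

/-- The Schur test on a sparse support. -/
theorem sparseNorm_le_of_schur {s : ℕ} {A W : Matrix ι ι ℝ} {r : ℝ} (hW : W.IsSymm)
    (hAW : ∀ a b, |A a b| ≤ W a b)
    (hr : 0 ≤ r) (h : ∀ S : Finset ι, S.card ≤ 2 * s → ∀ a ∈ S, ∑ b ∈ S, W a b ≤ r) :
    sparseNorm s A ≤ r := by
  classical
  refine sparseNorm_le fun v hv hs => ?_
  set S : Finset ι := Finset.univ.filter fun a => v a ≠ 0 with hSdef
  have hS : S.card ≤ 2 * s := by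
    have : {a | v a ≠ 0}.ncard = S.card := by
      rw [← Set.ncard_coe_finset, hSdef]; congr 1; ext a; simp
    rw [← this]; exact hs
  have hv0 : ∀ a ∉ S, v a = 0 := fun a ha => by simpa [hSdef] using ha
  have hW0 : ∀ a b, 0 ≤ W a b := fun a b => (abs_nonneg _).trans (hAW a b)
  have hsym : ∀ a b, W a b = W b a := fun a b => (congrFun (congrFun hW b) a)
  rw [dotProduct_mulVec_eq_sum]
  -- After 2|v_a v_b| ≤ v_a² + v_b², the symmetry of W makes both halves equal to weighted row sums.
  have h1 : ∀ a b, |v a * A a b * v b| ≤ W a b * v a ^ 2 / 2 + W a b * v b ^ 2 / 2 := by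
    intro a b
    rw [abs_mul, abs_mul]
    have := hAW a b
    have h3 : |v a| * |v b| ≤ (v a ^ 2 + v b ^ 2) / 2 := by
      rw [← sq_abs (v a), ← sq_abs (v b)]; nlinarith [sq_nonneg (|v a| - |v b|)]
    calc |v a| * |A a b| * |v b| = |A a b| * (|v a| * |v b|) := by ring
      _ ≤ W a b * ((v a ^ 2 + v b ^ 2) / 2) := by gcongr; exact hW0 a b
      _ = _ := by ring
  have hrestrict : ∑ a, ∑ b, v a * A a b * v b = ∑ a ∈ S, ∑ b ∈ S, v a * A a b * v b := by
    rw [← Finset.sum_subset (Finset.subset_univ S) fun a _ ha => by simp [hv0 a ha]]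
    refine Finset.sum_congr rfl fun a _ => ?_
    exact (Finset.sum_subset (Finset.subset_univ S) fun b _ hb => by simp [hv0 b hb]).symm
  rw [hrestrict]
  have h2 : ∑ a ∈ S, ∑ b ∈ S, W a b * v a ^ 2 ≤ r := by
    calc ∑ a ∈ S, ∑ b ∈ S, W a b * v a ^ 2 = ∑ a ∈ S, (∑ b ∈ S, W a b) * v a ^ 2 := by
          simp_rw [Finset.sum_mul]
      _ ≤ ∑ a ∈ S, r * v a ^ 2 :=
          Finset.sum_le_sum fun a ha => mul_le_mul_of_nonneg_right (h S hS a ha) (sq_nonneg _)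
      _ = r * ∑ a ∈ S, v a ^ 2 := by rw [Finset.mul_sum]
      _ ≤ r * 1 := by
          gcongr
          exact (Finset.sum_le_univ_sum_of_nonneg fun _ => sq_nonneg _).trans hv
      _ = r := mul_one r
  have h3 : ∑ a ∈ S, ∑ b ∈ S, W a b * v b ^ 2 = ∑ a ∈ S, ∑ b ∈ S, W a b * v a ^ 2 := by
    rw [Finset.sum_comm]
    exact Finset.sum_congr rfl fun a _ => Finset.sum_congr rfl fun b _ => by rw [hsym]
  calc |∑ a ∈ S, ∑ b ∈ S, v a * A a b * v b|
      ≤ ∑ a ∈ S, ∑ b ∈ S, (W a b * v a ^ 2 / 2 + W a b * v b ^ 2 / 2) := by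
        refine (Finset.abs_sum_le_sum_abs _ _).trans (Finset.sum_le_sum fun a _ =>
          (Finset.abs_sum_le_sum_abs _ _).trans (Finset.sum_le_sum fun b _ => h1 a b))
    _ = ∑ a ∈ S, ∑ b ∈ S, W a b * v a ^ 2 := by
        simp_rw [Finset.sum_add_distrib, ← Finset.sum_div]
        rw [h3]; ring
    _ ≤ r := h2

variable [DecidableEq ι]

theorem isSparse_single {s : ℕ} (hs : 1 ≤ s) (a : ι) (t : ℝ) : IsSparse s (Pi.single a t : ι → ℝ) := by
  have : {b | (Pi.single a t : ι → ℝ) b ≠ 0} ⊆ {a} := fun b hb => by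
    by_contra hne
    exact hb (Pi.single_eq_of_ne (M := fun _ => ℝ) hne t)
  refine (Set.ncard_le_ncard this).trans ?_
  simp; omega

theorem abs_diag_le {s : ℕ} (hs : 1 ≤ s) (A : Matrix ι ι ℝ) (a : ι) : |A a a| ≤ sparseNorm s A := by
  have := abs_form_le_of_le_one (s := s) A (v := Pi.single a 1) (by simp [Pi.single_apply])
    (isSparse_single hs a 1)
  simpa using this

/-- The matrix with the diagonal removed. -/
def offDiag (A : Matrix ι ι ℝ) : Matrix ι ι ℝ := Matrix.of fun a b => if a = b then 0 else A a b

theorem sparseNorm_offDiag_le {s : ℕ} (hs : 1 ≤ s) (A : Matrix ι ι ℝ) :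
    sparseNorm s (offDiag A) ≤ 2 * sparseNorm s A := by
  have e : offDiag A = A - Matrix.diagonal fun a => A a a := by
    ext a b
    by_cases h : a = b
    · subst h; simp [offDiag]
    · simp [offDiag, h]
  rw [e, two_mul]
  refine (sparseNorm_sub_le _ _ _).trans (add_le_add le_rfl ?_)
  refine sparseNorm_le_of_diag (sparseNorm_nonneg _ _) (fun a b h => Matrix.diagonal_apply_ne _ h)
    fun a => ?_
  rw [Matrix.diagonal_apply_eq]; exact abs_diag_le hs A a

/-- The bilinear form of a symmetric matrix on vectors with a common sparse support. -/
theorem abs_bilin_le {s : ℕ} {A : Matrix ι ι ℝ} (hA : A.IsSymm) {S : Finset ι}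
    (hS : S.card ≤ 2 * s) {x y : ι → ℝ} (hx : ∀ a ∉ S, x a = 0) (hy : ∀ a ∉ S, y a = 0) :
    |x ⬝ᵥ A.mulVec y| ≤ sparseNorm s A * ((∑ a, x a ^ 2 + ∑ a, y a ^ 2) / 2) := by
  have hsp : ∀ v : ι → ℝ, (∀ a ∉ S, v a = 0) → IsSparse s v := fun v hv => by
    refine le_trans ?_ hS
    rw [← Set.ncard_coe_finset]
    exact Set.ncard_le_ncard fun a ha => by
      by_contra h; exact ha (hv a h)
  -- Polarization: the sum and the difference of x and y have the same sparse support, and the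
  -- parallelogram law adds their norms.
  have h1 := abs_form_le A (hsp (x + y) fun a ha => by simp [hx a ha, hy a ha])
  have h2 := abs_form_le A (hsp (x - y) fun a ha => by simp [hx a ha, hy a ha])
  have hsym : y ⬝ᵥ A.mulVec x = x ⬝ᵥ A.mulVec y := by
    rw [Matrix.dotProduct_mulVec, ← Matrix.mulVec_transpose, hA, dotProduct_comm]
  rw [Matrix.mulVec_add, dotProduct_add, add_dotProduct, add_dotProduct, hsym] at h1
  rw [Matrix.mulVec_sub, dotProduct_sub, sub_dotProduct, sub_dotProduct, hsym] at h2
  have e : ∑ a, (x + y) a ^ 2 + ∑ a, (x - y) a ^ 2 = 2 * (∑ a, x a ^ 2 + ∑ a, y a ^ 2) := by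
    rw [← Finset.sum_add_distrib, ← Finset.sum_add_distrib, Finset.mul_sum]
    refine Finset.sum_congr rfl fun a _ => ?_
    simp only [Pi.add_apply, Pi.sub_apply]; ring
  have e2 : sparseNorm s A * ∑ a, (x + y) a ^ 2 + sparseNorm s A * ∑ a, (x - y) a ^ 2
      = sparseNorm s A * (2 * (∑ a, x a ^ 2 + ∑ a, y a ^ 2)) := by rw [← mul_add, e]
  obtain ⟨a1, a2⟩ := abs_le.1 h1
  obtain ⟨b1, b2⟩ := abs_le.1 h2
  rw [abs_le]; constructor <;> nlinarith

theorem dotProduct_single_mulVec (A : Matrix ι ι ℝ) (a : ι) (t : ℝ) (y : ι → ℝ) :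
    (Pi.single a t : ι → ℝ) ⬝ᵥ A.mulVec y = t * ∑ b, A a b * y b := by
  rw [single_dotProduct]; rfl

/-- The bilinear form is tested on √ρ times the unit vector at a and on the row itself, restricted
to S; both have squared norm ρ. Since a lies in S, the common support has at most 2s elements. -/
theorem sum_row_sq_le {s : ℕ} {A : Matrix ι ι ℝ} (hA : A.IsSymm) {S : Finset ι}
    (hS : S.card ≤ 2 * s) {a : ι} (ha : a ∈ S) :
    ∑ b ∈ S, A a b ^ 2 ≤ sparseNorm s A ^ 2 := by
  set ρ := ∑ b ∈ S, A a b ^ 2 with hρ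
  have hρ0 : 0 ≤ ρ := Finset.sum_nonneg fun _ _ => sq_nonneg _
  rcases eq_or_lt_of_le hρ0 with h0 | h0
  · rw [← h0]; positivity
  let y : ι → ℝ := fun b => if b ∈ S then A a b else 0
  have hy1 : ∑ b, y b ^ 2 = ρ := by
    simp [y, ite_pow, hρ]
  have hy2 : ∑ b, A a b * y b = ρ := by
    simp [y, hρ, sq]
  have h := abs_bilin_le hA hS (x := Pi.single a (√ρ)) (y := y)
    (fun b hb => Pi.single_eq_of_ne (M := fun _ => ℝ) (by rintro rfl; exact hb ha) _) (fun b hb => by simp [y, hb])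
  rw [dotProduct_single_mulVec, hy2, hy1] at h
  have e : ∑ b, (Pi.single a (√ρ) : ι → ℝ) b ^ 2 = ρ := by
    simp [Pi.single_apply, Real.sq_sqrt hρ0]
  rw [e, abs_of_nonneg (by positivity), add_self_div_two] at h
  have h2 : √ρ ≤ sparseNorm s A := le_of_mul_le_mul_right h h0
  calc ρ = √ρ ^ 2 := (Real.sq_sqrt hρ0).symm
    _ ≤ _ := by gcongr

/-- Nonnegativity at ρ times the unit vector minus the restricted row y gives ρ² ≤ y'Ay ≤ ‖A‖ρ. For
a correlation matrix the row bound is thus linear in the seminorm instead of quadratic, and a need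
not belong to S. -/
theorem sum_row_sq_le_of_posSemidef {s : ℕ} {A : Matrix ι ι ℝ} (hA : A.IsSymm)
    (hpos : ∀ v : ι → ℝ, 0 ≤ v ⬝ᵥ A.mulVec v) (hd : ∀ a, A a a = 1) {S : Finset ι}
    (hS : S.card ≤ 2 * s) (a : ι) : ∑ b ∈ S, A a b ^ 2 ≤ sparseNorm s A := by
  set ρ := ∑ b ∈ S, A a b ^ 2 with hρ
  have hρ0 : 0 ≤ ρ := Finset.sum_nonneg fun _ _ => sq_nonneg _
  rcases eq_or_lt_of_le hρ0 with h0 | h0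
  · rw [← h0]; exact sparseNorm_nonneg _ _
  let y : ι → ℝ := fun b => if b ∈ S then A a b else 0
  have hy1 : ∑ b, y b ^ 2 = ρ := by
    simp [y, ite_pow, hρ]
  have hy2 : ∑ b, A a b * y b = ρ := by
    simp [y, hρ, sq]
  have h := hpos (Pi.single a ρ - y)
  have hsym : y ⬝ᵥ A.mulVec (Pi.single a ρ) = (Pi.single a ρ : ι → ℝ) ⬝ᵥ A.mulVec y := by
    rw [Matrix.dotProduct_mulVec, ← Matrix.mulVec_transpose, hA, dotProduct_comm]
  rw [Matrix.mulVec_sub, dotProduct_sub, sub_dotProduct, sub_dotProduct, hsym,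
    dotProduct_single_mulVec, dotProduct_single_mulVec, hy2] at h
  have e : ∑ b, A a b * (Pi.single a ρ : ι → ℝ) b = ρ := by simp [Pi.single_apply, hd]
  rw [e] at h
  have hsp : IsSparse s y := by
    refine le_trans ?_ hS
    rw [← Set.ncard_coe_finset]
    exact Set.ncard_le_ncard fun b hb => by
      by_contra h; exact hb (by simp only [y]; exact if_neg h)
  have h3 := (le_abs_self _).trans (abs_form_le A hsp)
  rw [hy1] at h3
  have : ρ * ρ ≤ sparseNorm s A * ρ := by nlinarith
  exact le_of_mul_le_mul_right this h0

end

/-! ### Entrywise products in the sparse seminorm -/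

section

theorem offDiag_apply_self {ι : Type} [DecidableEq ι] (A : Matrix ι ι ℝ) (a : ι) :
    offDiag A a a = 0 := by simp [offDiag]

theorem offDiag_apply_ne {ι : Type} [DecidableEq ι] (A : Matrix ι ι ℝ) {a b : ι} (h : a ≠ b) :
    offDiag A a b = A a b := by
  simp [offDiag, h]

theorem isSymm_offDiag {ι : Type} [DecidableEq ι] {A : Matrix ι ι ℝ} (hA : A.IsSymm) :
    (offDiag A).IsSymm := by
  ext a b
  rw [Matrix.transpose_apply]
  by_cases h : a = b
  · rw [h]
  · rw [offDiag_apply_ne _ h, offDiag_apply_ne _ (Ne.symm h)]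
    exact congrFun (congrFun hA a) b

theorem sum_mul_sq_le {ι : Type} [Fintype ι] {v w : ι → ℝ} {t : ℝ}
    (hv : ∑ a, v a ^ 2 ≤ 1) (hw : ∀ a, |w a| ≤ t) :
    ∑ a, (w a * v a) ^ 2 ≤ t ^ 2 := by
  calc ∑ a, (w a * v a) ^ 2 ≤ ∑ a, t ^ 2 * v a ^ 2 := by
        refine Finset.sum_le_sum fun a _ => ?_
        rw [mul_pow]
        gcongr ?_ * _
        rw [← sq_abs]
        exact pow_le_pow_left₀ (abs_nonneg _) (hw a) 2
    _ = t ^ 2 * ∑ a, v a ^ 2 := by rw [Finset.mul_sum]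
    _ ≤ t ^ 2 * 1 := by gcongr
    _ = _ := mul_one _

variable {ι : Type} [Fintype ι] [DecidableEq ι]

theorem abs_bilin_le_mul {s : ℕ} {A : Matrix ι ι ℝ} (hA : A.IsSymm) {S : Finset ι}
    (hS : S.card ≤ 2 * s) {x y : ι → ℝ} (hx : ∀ a ∉ S, x a = 0) (hy : ∀ a ∉ S, y a = 0) {p q : ℝ}
    (hp : 0 ≤ p) (hq : 0 ≤ q) (hxp : ∑ a, x a ^ 2 ≤ p ^ 2) (hyq : ∑ a, y a ^ 2 ≤ q ^ 2) :
    |x ⬝ᵥ A.mulVec y| ≤ sparseNorm s A * (p * q) := by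
  have hzero : ∀ z : ι → ℝ, ∑ a, z a ^ 2 ≤ (0 : ℝ) ^ 2 → z = 0 := by
    intro z hz
    ext a
    have h1 : z a ^ 2 ≤ 0 := by
      refine (Finset.single_le_sum (f := fun a => z a ^ 2) (fun b _ => sq_nonneg (z b))
        (Finset.mem_univ a)).trans (hz.trans (by norm_num))
    simpa using h1
  rcases hp.eq_or_lt with rfl | hp
  · rw [hzero x hxp]; simp
  rcases hq.eq_or_lt with rfl | hq
  · rw [hzero y hyq]; simp
  have h := abs_bilin_le hA hS (x := p⁻¹ • x) (y := q⁻¹ • y) (fun a ha => by simp [hx a ha])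
    (fun a ha => by simp [hy a ha])
  rw [Matrix.mulVec_smul, smul_dotProduct, dotProduct_smul, smul_eq_mul, smul_eq_mul, abs_mul,
    abs_mul, abs_of_pos (inv_pos.2 hp), abs_of_pos (inv_pos.2 hq)] at h
  have e : ∀ (z : ι → ℝ) (t : ℝ), 0 < t → ∑ a, z a ^ 2 ≤ t ^ 2 → ∑ a, (t⁻¹ • z) a ^ 2 ≤ 1 := by
    intro z t ht hz
    simp only [Pi.smul_apply, smul_eq_mul, mul_pow, ← Finset.mul_sum]
    rw [inv_pow, ← div_eq_inv_mul]
    exact div_le_one_of_le₀ hz (by positivity)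
  have h1 := e x p hp hxp
  have h2 := e y q hq hyq
  have h3 : p⁻¹ * (q⁻¹ * |x ⬝ᵥ A.mulVec y|) ≤ sparseNorm s A * 1 :=
    h.trans (mul_le_mul_of_nonneg_left (by linarith) (sparseNorm_nonneg s A))
  calc |x ⬝ᵥ A.mulVec y| = p * q * (p⁻¹ * (q⁻¹ * |x ⬝ᵥ A.mulVec y|)) := by field_simp
    _ ≤ p * q * (sparseNorm s A * 1) := by gcongr
    _ = _ := by ring

/-- Perturbation of the rank-one factors in an entrywise product with a correlation matrix. -/
theorem sparseNorm_offDiag_perturbation_le {s : ℕ} (hs : 1 ≤ s) {Γ P : Matrix ι ι ℝ} {e f : ι → ℝ}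
    {κ₂ η m : ℝ} (hΓ : Γ.IsSymm) (hpos : ∀ v : ι → ℝ, 0 ≤ v ⬝ᵥ Γ.mulVec v) (hd : ∀ a, Γ a a = 1)
    (hκ : 0 ≤ κ₂) (hη : 0 ≤ η) (hm : 0 ≤ m)
    (hP : ∀ a b, a ≠ b → |P a b - (e a * e b - f a * f b) * Γ a b| ≤ κ₂ * Γ a b ^ 2)
    (hef : ∀ a, |e a - f a| ≤ η) (he : ∀ a, |e a| ≤ m) (hf : ∀ a, |f a| ≤ m) :
    sparseNorm s (offDiag P) ≤ (4 * (η * m) + κ₂) * sparseNorm s Γ := by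
  -- The leading coefficient splits as (e_a - f_a) e_b + f_a (e_b - f_b), so it acts through two
  -- rescalings of the test vector; the rest is bounded entrywise by κ₂ Γ_ab² and goes to the Schur
  -- test.
  set A : Matrix ι ι ℝ := Matrix.of fun a b => (e a * e b - f a * f b) * offDiag Γ a b with hA
  have hsplit : offDiag P = A + (offDiag P - A) := by abel
  have h1 : sparseNorm s A ≤ 4 * (η * m) * sparseNorm s Γ := by
    refine sparseNorm_le fun v hv hvs => ?_
    classical
    set S : Finset ι := Finset.univ.filter fun a => v a ≠ 0 with hSdef
    have hS : S.card ≤ 2 * s := by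
      have : {a | v a ≠ 0}.ncard = S.card := by
        rw [← Set.ncard_coe_finset, hSdef]; congr 1; ext a; simp
      rw [← this]; exact hvs
    have hv0 : ∀ a ∉ S, v a = 0 := fun a ha => by simpa [hSdef] using ha
    have hsy := isSymm_offDiag hΓ
    have b1 := abs_bilin_le_mul hsy hS (x := fun a => (e a - f a) * v a) (y := fun a => e a * v a)
      (fun a ha => by simp [hv0 a ha]) (fun a ha => by simp [hv0 a ha]) hη hm
      (sum_mul_sq_le hv hef) (sum_mul_sq_le hv he)
    have b2 := abs_bilin_le_mul hsy hS (x := fun a => f a * v a) (y := fun a => (e a - f a) * v a)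
      (fun a ha => by simp [hv0 a ha]) (fun a ha => by simp [hv0 a ha]) hm hη
      (sum_mul_sq_le hv hf) (sum_mul_sq_le hv hef)
    have e1 : v ⬝ᵥ A.mulVec v
        = (fun a => (e a - f a) * v a) ⬝ᵥ (offDiag Γ).mulVec (fun a => e a * v a)
          + (fun a => f a * v a) ⬝ᵥ (offDiag Γ).mulVec (fun a => (e a - f a) * v a) := by
      rw [dotProduct_mulVec_eq_sum, dotProduct_mulVec_eq_sum, dotProduct_mulVec_eq_sum,
        ← Finset.sum_add_distrib]
      refine Finset.sum_congr rfl fun a _ => ?_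
      rw [← Finset.sum_add_distrib]
      refine Finset.sum_congr rfl fun b _ => ?_
      simp only [hA, Matrix.of_apply]; ring
    rw [e1]
    have h2 := sparseNorm_offDiag_le hs Γ
    have h3 : sparseNorm s (offDiag Γ) * (η * m) ≤ 2 * sparseNorm s Γ * (η * m) := by gcongr
    refine (abs_add_le _ _).trans ?_
    linarith [b1, b2, mul_comm m η ▸ b2]
  have h2 : sparseNorm s (offDiag P - A) ≤ κ₂ * sparseNorm s Γ := by
    refine sparseNorm_le_of_schur (W := Matrix.of fun a b => κ₂ * Γ a b ^ 2) ?_ ?_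
      (mul_nonneg hκ (sparseNorm_nonneg _ _)) fun S hS a _ => ?_
    · ext a b
      simp only [Matrix.transpose_apply, Matrix.of_apply]
      rw [show Γ b a = Γ a b from congrFun (congrFun hΓ a) b]
    · intro a b
      rw [Matrix.sub_apply, Matrix.of_apply]
      simp only [hA, Matrix.of_apply]
      by_cases h : a = b
      · subst h
        rw [offDiag_apply_self, offDiag_apply_self]
        simp only [mul_zero, sub_zero, abs_zero]; positivity
      · rw [offDiag_apply_ne _ h, offDiag_apply_ne _ h]; exact hP a b h
    · simp only [Matrix.of_apply]
      rw [← Finset.mul_sum]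
      gcongr
      exact sum_row_sq_le_of_posSemidef hΓ hpos hd hS a
  rw [hsplit]
  refine (sparseNorm_add_le _ _ _).trans ((add_le_add h1 h2).trans (le_of_eq (by ring)))

/-- The error of an entrywise inverse with a rank-one leading factor. -/
theorem sparseNorm_error_le {s : ℕ} (hs : 1 ≤ s) {Γ D E H : Matrix ι ι ℝ} {d : ι → ℝ}
    {r κ τ ω δ : ℝ} (hΓ : Γ.IsSymm) (hpos : ∀ v : ι → ℝ, 0 ≤ v ⬝ᵥ Γ.mulVec v)
    (hd : ∀ a, Γ a a = 1) (hD : D.IsSymm) (hr : 0 ≤ r) (hκ : 0 ≤ κ) (hτ : 0 ≤ τ) (hω : 0 ≤ ω)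
    (hDδ : sparseNorm s (offDiag D) ≤ δ)
    (hE : ∀ a b, a ≠ b → |E a b - H a b * D a b| ≤ τ * D a b ^ 2)
    (hh : ∀ a b, a ≠ b → |H a b - d a * d b| ≤ κ * |Γ a b|) (hdr : ∀ a, d a ^ 2 ≤ r)
    (hEd : ∀ a, |E a a| ≤ ω) :
    sparseNorm s E ≤ ω + (r + κ * sparseNorm s Γ) * δ + τ * δ ^ 2 := by
  have hδ : 0 ≤ δ := (sparseNorm_nonneg _ _).trans hDδ
  set E₁ : Matrix ι ι ℝ := Matrix.diagonal fun a => E a a with hE₁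
  set E₂ : Matrix ι ι ℝ := Matrix.of fun a b => d a * d b * offDiag D a b with hE₂
  -- The diagonal, the rank-one rescaling of D, and a remainder bounded entrywise by κ|Γ_ab D_ab| +
  -- τ D_ab².
  have hsplit : E = E₁ + E₂ + (E - E₁ - E₂) := by abel
  have h1 : sparseNorm s E₁ ≤ ω := sparseNorm_le_of_diag hω
    (fun a b h => Matrix.diagonal_apply_ne _ h) fun a => by
      rw [hE₁, Matrix.diagonal_apply_eq]; exact hEd a
  have h2 : sparseNorm s E₂ ≤ r * δ := by
    refine sparseNorm_le fun v hv hvs => ?_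
    have e1 : v ⬝ᵥ E₂.mulVec v
        = (fun a => d a * v a) ⬝ᵥ (offDiag D).mulVec (fun a => d a * v a) := by
      rw [dotProduct_mulVec_eq_sum, dotProduct_mulVec_eq_sum]
      refine Finset.sum_congr rfl fun a _ => Finset.sum_congr rfl fun b _ => ?_
      simp only [hE₂, Matrix.of_apply]; ring
    rw [e1]
    have h3 := abs_form_le (offDiag D) (s := s) (v := fun a => d a * v a)
      (hvs.mono fun a ha => by simp [ha])
    have h4 : ∑ a, (d a * v a) ^ 2 ≤ r := by
      have := sum_mul_sq_le (w := d) (t := √r) hv fun a => Real.abs_le_sqrt (hdr a)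
      rwa [Real.sq_sqrt hr] at this
    calc _ ≤ sparseNorm s (offDiag D) * ∑ a, (d a * v a) ^ 2 := h3
      _ ≤ δ * r := by
        gcongr
      _ = r * δ := mul_comm _ _
  have h3 : sparseNorm s (E - E₁ - E₂) ≤ κ * sparseNorm s Γ * δ + τ * δ ^ 2 := by
    refine sparseNorm_le_of_schur
      (W := Matrix.of fun a b => κ * (|Γ a b| * |offDiag D a b|) + τ * offDiag D a b ^ 2) ?_ ?_
      (by have := sparseNorm_nonneg s Γ; positivity) fun S hS a haS => ?_
    · ext a b
      simp only [Matrix.transpose_apply, Matrix.of_apply]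
      rw [show Γ b a = Γ a b from congrFun (congrFun hΓ a) b,
        show offDiag D b a = offDiag D a b from
          congrFun (congrFun (isSymm_offDiag hD) a) b]
    · intro a b
      rw [Matrix.sub_apply, Matrix.sub_apply, Matrix.of_apply]
      simp only [hE₁, hE₂, Matrix.of_apply]
      by_cases h : a = b
      · subst h
        rw [offDiag_apply_self, Matrix.diagonal_apply_eq]
        simp
      · rw [offDiag_apply_ne _ h, Matrix.diagonal_apply_ne _ h, sub_zero]
        rw [show E a b - d a * d b * D a b
          = (H a b - d a * d b) * D a b + (E a b - H a b * D a b) by ring]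
        refine (abs_add_le _ _).trans (add_le_add ?_ (hE a b h))
        rw [abs_mul, ← mul_assoc]
        exact mul_le_mul_of_nonneg_right (hh a b h) (abs_nonneg _)
    · simp only [Matrix.of_apply]
      rw [Finset.sum_add_distrib, ← Finset.mul_sum, ← Finset.mul_sum]
      have hrow : ∑ b ∈ S, offDiag D a b ^ 2 ≤ δ ^ 2 :=
        (sum_row_sq_le (isSymm_offDiag hD) hS haS).trans
          (pow_le_pow_left₀ (sparseNorm_nonneg _ _) hDδ 2)
      have hΓrow := sum_row_sq_le_of_posSemidef hΓ hpos hd hS a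
      -- Cauchy–Schwarz yields the square root of the seminorm of Γ, which may be replaced by the
      -- seminorm itself once that is at least 1.
      have hΓ1 : 1 ≤ sparseNorm s Γ := by
        have := abs_diag_le hs Γ a
        rwa [hd, abs_one] at this
      have hcs : ∑ b ∈ S, |Γ a b| * |offDiag D a b| ≤ sparseNorm s Γ * δ := by
        refine (Real.sum_mul_le_sqrt_mul_sqrt S _ _).trans ?_
        simp only [sq_abs]
        refine mul_le_mul ?_ ?_ (Real.sqrt_nonneg _) (sparseNorm_nonneg _ _)
        · exact Real.sqrt_le_iff.2 ⟨sparseNorm_nonneg _ _, hΓrow.trans (by nlinarith)⟩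
        · exact Real.sqrt_le_iff.2 ⟨hδ, hrow⟩
      have := mul_le_mul_of_nonneg_left hcs hκ
      have := mul_le_mul_of_nonneg_left hrow hτ
      linarith
  rw [hsplit]
  have := sparseNorm_add_le s (E₁ + E₂) (E - E₁ - E₂)
  have := sparseNorm_add_le s E₁ E₂
  linarith

end

section

variable {p q : PMF ℕ}

/-! ## The autocovariance link function near one -/

/-- Only the pairs of equal levels are kept; they carry the singularity as the correlation tends to
1. -/
theorem ofReal_linkDeriv_self_ge (hp : SecondMoment p) {v : ℝ} (hv : |v| < 1) :
    levelSum p (fun x => biPDF v x x) ≤ ENNReal.ofReal (linkDeriv p p v) := by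
  rw [linkDeriv, ENNReal.ofReal_tsum_of_nonneg (pairDensity_nonneg p p hv)
    (hasSum_pairDensity hp hp hv).summable, levelSum]
  have hinj : Function.Injective fun n : ℕ => (n, n) := fun a b h => congrArg Prod.fst h
  refine le_trans (ENNReal.tsum_le_tsum fun n => ?_) (ENNReal.tsum_comp_le_tsum_of_injective hinj _)
  rw [pairDensity]
  split_ifs with h1 h2 h2
  · exact le_rfl
  · exact absurd ⟨h1, h1⟩ h2
  · exact bot_le
  · simp

/-- On the diagonal the density is a multiple of exp(-x²/(1+v))/√(1 - v²). Its prefactor blows up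
like (1 - v)^(-1/2), and (1 + v)(1 + h) ≥ 2 bounds the exponent uniformly for v above 1 - h. -/
theorem linkDeriv_self_ge (hp : SecondMoment p) {h v : ℝ} (h1 : h ≤ 1) (hv : v ∈ Set.Ioo (1 - h) 1) :
    (2 * √Real.pi)⁻¹ * realMoment p 0 (1 / (1 + h)) / √(1 - v) ≤ linkDeriv p p v := by
  have hvpos : 0 < v := by linarith [hv.1]
  have hv1 : |v| < 1 := by rw [abs_of_pos hvpos]; exact hv.2
  have hh : 0 < 1 + h := by linarith [hv.1, hv.2]
  have hpos : 0 < 1 - v := by linarith [hv.2]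
  have key : levelSum p (fun x => ((2 * √Real.pi)⁻¹ / √(1 - v))
      * (Real.exp (-(x ^ 2) / (2 * (1 / (1 + h)))) * |x| ^ 0 / √(2 * Real.pi)))
      ≤ levelSum p (fun x => biPDF v x x) := by
    refine levelSum_mono fun x => ?_
    rw [biPDF_eq hv1]
    have e1 : Real.exp (-(x ^ 2) / (2 * (1 / (1 + h))))
        ≤ Real.exp (-(x ^ 2 - 2 * v * x * x + x ^ 2) / (2 * (1 - v ^ 2))) := by
      rw [Real.exp_le_exp]
      have a1 : -(x ^ 2 - 2 * v * x * x + x ^ 2) / (2 * (1 - v ^ 2)) = -(x ^ 2 * (1 / (1 + v))) := by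
        have : (1 - v ^ 2) = (1 - v) * (1 + v) := by ring
        rw [this]; field_simp; ring
      have a2 : -(x ^ 2) / (2 * (1 / (1 + h))) = -(x ^ 2 * ((1 + h) / 2)) := by field_simp
      rw [a1, a2, neg_le_neg_iff]
      refine mul_le_mul_of_nonneg_left ?_ (sq_nonneg x)
      rw [div_le_div_iff₀ (by linarith) two_pos]
      nlinarith [hv.1]
    have e2 : (2 * √Real.pi)⁻¹ / √(1 - v) / √(2 * Real.pi) ≤ (√(1 - v ^ 2))⁻¹ * (2 * Real.pi)⁻¹ := by
      have b1 : √(1 - v ^ 2) ≤ √2 * √(1 - v) := by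
        rw [← Real.sqrt_mul two_pos.le]
        exact Real.sqrt_le_sqrt (by nlinarith)
      have b2 : (2 * √Real.pi)⁻¹ / √(1 - v) / √(2 * Real.pi)
          = (√2 * √(1 - v))⁻¹ * (2 * Real.pi)⁻¹ := by
        rw [Real.sqrt_mul two_pos.le]
        have : √Real.pi ^ 2 = Real.pi := Real.sq_sqrt Real.pi_pos.le
        rw [show (2 * Real.pi)⁻¹ = (2 * √Real.pi ^ 2)⁻¹ by rw [this]]
        field_simp
      rw [b2]
      have := one_sub_sq_pos hv1
      gcongr
    calc _ = ((2 * √Real.pi)⁻¹ / √(1 - v) / √(2 * Real.pi))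
          * Real.exp (-(x ^ 2) / (2 * (1 / (1 + h)))) := by rw [pow_zero]; ring
      _ ≤ _ := by gcongr
  rw [levelSum_const_mul (by positivity)] at key
  have := ENNReal.toReal_mono ENNReal.ofReal_ne_top (key.trans (ofReal_linkDeriv_self_ge hp hv1))
  rw [ENNReal.toReal_mul, ENNReal.toReal_ofReal (by positivity),
    ENNReal.toReal_ofReal (linkDeriv_nonneg p p hv1)] at this
  rw [mul_div_right_comm]; exact this

/-- Integration of the singular lower bound for the derivative over [1 - h, 1], phrased as
monotonicity of the link function plus 2a√(1 - v). Near 1 this square root is stronger than any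
linear bound. -/
theorem link_one_sub_ge (hp : SecondMoment p) {h : ℝ} (h0 : 0 ≤ h) (h1 : h ≤ 1) :
    √h * realMoment p 0 (1 / (1 + h)) ≤ 2 * (link p p 1 - link p p (1 - h)) := by
  set a := (2 * √Real.pi)⁻¹ * realMoment p 0 (1 / (1 + h)) with ha
  have hm : MonotoneOn (fun v => link p p v + 2 * a * √(1 - v)) (Set.Icc (1 - h) 1) := by
    refine monotoneOn_of_hasDerivWithinAt_nonneg (convex_Icc _ _)
      (f' := fun v => linkDeriv p p v - a / √(1 - v)) ?_ ?_ ?_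
    · exact ((continuousOn_link hp hp).mono (Set.Icc_subset_Icc (by linarith) le_rfl)).add
        (by fun_prop)
    · intro v hv
      rw [interior_Icc] at hv
      have hv1 : |v| < 1 := by rw [abs_lt]; constructor <;> linarith [hv.1, hv.2]
      have hpos : 0 < 1 - v := by linarith [hv.2]
      have hd : HasDerivAt (fun v : ℝ => 1 - v) (-1) v := by
        simpa using (hasDerivAt_id v).const_sub 1
      have := (hasDerivAt_link hp hp hv1).add ((hd.sqrt hpos.ne').const_mul (2 * a))
      refine (this.congr_deriv ?_).hasDerivWithinAt
      have := (Real.sqrt_pos.2 hpos).ne'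
      field_simp; ring
    · intro v hv
      rw [interior_Icc] at hv
      have := linkDeriv_self_ge hp h1 hv
      linarith
  have h2 := hm ⟨le_rfl, by linarith⟩ ⟨by linarith, le_rfl⟩ (by linarith)
  simp only [sub_self, Real.sqrt_zero, mul_zero, add_zero, sub_sub_cancel] at h2
  have hpi : √Real.pi ≤ 2 := by
    rw [Real.sqrt_le_left two_pos.le]; linarith [Real.pi_lt_four]
  have h3 : (1 / 4 : ℝ) ≤ (2 * √Real.pi)⁻¹ := by
    rw [one_div]; gcongr; linarith
  have h4 : 1 / 4 * realMoment p 0 (1 / (1 + h)) ≤ a :=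
    mul_le_mul_of_nonneg_right h3 (realMoment_nonneg _ _ _)
  nlinarith [Real.sqrt_nonneg h, mul_le_mul_of_nonneg_right h4 (Real.sqrt_nonneg h)]

/-! ## Comparison of the moments of the levels -/

theorem realMoment_mono (hp : SecondMoment p) {x y : ℝ} (hx : 0 < x) (hxy : x ≤ y) (hy : y ≤ 1) :
    realMoment p 0 x ≤ realMoment p 0 y :=
  ENNReal.toReal_mono (levelMoment_ne_top hp (hx.trans_le hxy) hy) (levelMoment_mono p 0 hx hxy)

theorem realMoment_one (hp : SecondMoment p) : realMoment p 0 1 = hermiteCoeff p 1 := by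
  have h0 : 0 ≤ hermiteCoeff p 1 := by
    rw [← (hasSum_lcoef hp 0).tsum_eq]
    refine tsum_nonneg fun n => ?_
    rw [lcoef]; split_ifs
    · rw [He_zero, one_mul]; exact (stdPDF_pos _).le
    · exact le_rfl
  rw [realMoment, levelMoment_zero_one hp, ENNReal.toReal_ofReal h0]

theorem sq_realMoment_one_le (hp : SecondMoment p) : realMoment p 0 1 ^ 2 ≤ link p p 1 := by
  rw [realMoment_one hp, link_self_one hp, ← tsum_hermiteCoeff_sq hp]
  have := (summable_hermiteCoeff_sq hp).sum_le_tsum (Finset.range 2) fun j _ => by positivity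
  simp [Finset.sum_range_succ, hermiteCoeff_zero] at this
  linarith

/-- From exp(-tx²/2) ≥ 1 - tx²/2 at each level; useful when t is small compared with the ratio of
the moments of orders 0 and 2. -/
theorem realMoment_ge_linear (hp : SecondMoment p) (h2 : levelMoment p 2 1 ≠ ∞) {t : ℝ}
    (h0 : 0 ≤ t) : realMoment p 0 1 - t * realMoment p 2 1 ≤ realMoment p 0 (1 / (1 + t)) := by
  have h : levelMoment p 0 1
      ≤ levelMoment p 0 (1 / (1 + t)) + ENNReal.ofReal t * levelMoment p 2 1 := by
    rw [levelMoment, levelMoment, levelMoment, ← levelSum_const_mul h0,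
      ← levelSum_add (fun _ => by positivity) (fun _ => by positivity)]
    refine levelSum_mono fun x => ?_
    rw [← mul_div_assoc t, ← add_div]
    gcongr ?_ / _
    rw [pow_zero, mul_one, mul_one, sq_abs]
    have e : -(x ^ 2) / (2 * (1 / (1 + t))) = -(x ^ 2) / (2 * 1) + -(t * x ^ 2 / 2) := by
      field_simp; ring
    rw [e, Real.exp_add]
    have h1 := Real.add_one_le_exp (-(t * x ^ 2 / 2))
    have h3 := Real.exp_pos (-(x ^ 2) / (2 * 1))
    have h4 : 0 ≤ t * x ^ 2 := by positivity
    nlinarith [mul_le_mul_of_nonneg_left h1 h3.le, mul_nonneg h3.le h4]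
  have hfin := levelMoment_ne_top hp (x := 1 / (1 + t)) (by positivity)
    (by rw [div_le_one (by positivity)]; linarith)
  have := ENNReal.toReal_mono (by finiteness) h
  rw [ENNReal.toReal_add hfin (by finiteness), ENNReal.toReal_mul, ENNReal.toReal_ofReal h0] at this
  simp only [realMoment]; linarith

/-- Each term exp(-x²) is at most the full sum U, so raising it to the power (1+t)/2 ≤ 1 loses at
most a factor U^(-(1-t)/2). This comparison of sums of powers needs no second moment of the levels.
-/
theorem realMoment_ge_rpow (hp : SecondMoment p) {t : ℝ} (h0 : 0 ≤ t) (h1 : t ≤ 1)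
    (hpos : 0 < realMoment p 0 (1 / 2)) :
    (√(2 * Real.pi) * realMoment p 0 (1 / 2)) ^ ((1 + t) / 2)
      ≤ √(2 * Real.pi) * realMoment p 0 (1 / (1 + t)) := by
  set U := √(2 * Real.pi) * realMoment p 0 (1 / 2) with hU
  have hU0 : 0 < U := by positivity
  have hfin := levelMoment_ne_top hp (x := 1 / 2) (by norm_num) (by norm_num)
  have hle : ∀ n, IsLevel p n → Real.exp (-(level p n ^ 2)) ≤ U := by
    intro n hn
    have h : ENNReal.ofReal (Real.exp (-(level p n ^ 2)) / √(2 * Real.pi)) ≤ levelMoment p 0 (1 / 2) := by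
      classical
      refine le_trans (le_of_eq ?_) (ENNReal.le_tsum n)
      simp only [if_pos hn]; norm_num
    have := ENNReal.toReal_mono hfin h
    rw [ENNReal.toReal_ofReal (by positivity), div_le_iff₀ (by positivity)] at this
    rw [hU, mul_comm]; exact this
  have key : ENNReal.ofReal (U ^ (-((1 - t) / 2))) * levelMoment p 0 (1 / 2)
      ≤ levelMoment p 0 (1 / (1 + t)) := by
    rw [levelMoment, ← levelSum_const_mul (by positivity)]
    refine ENNReal.tsum_le_tsum fun n => ?_
    split_ifs with hn
    · refine ENNReal.ofReal_le_ofReal ?_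
      have hx := hle n hn
      set x := level p n
      beta_reduce
      rw [← mul_div_assoc (U ^ _)]
      gcongr ?_ / _
      rw [pow_zero, mul_one, mul_one]
      have e1 : -(x ^ 2) / (2 * (1 / (1 + t))) = -(x ^ 2) * ((1 + t) / 2) := by field_simp
      have e2 : -(x ^ 2) / (2 * (1 / 2)) = -(x ^ 2) := by norm_num
      rw [e1, e2, Real.exp_mul]
      have hE := Real.exp_pos (-(x ^ 2))
      have e3 : Real.exp (-(x ^ 2)) ^ ((1 + t) / 2)
          = Real.exp (-(x ^ 2)) ^ (-((1 - t) / 2)) * Real.exp (-(x ^ 2)) := by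
        rw [← Real.rpow_add_one hE.ne']; congr 1; ring
      rw [e3]
      exact mul_le_mul_of_nonneg_right
        (Real.rpow_le_rpow_of_nonpos hE hx (by linarith : -((1 - t) / 2) ≤ 0)) hE.le
    · simp
  have hfin2 := levelMoment_ne_top hp (x := 1 / (1 + t)) (by positivity)
    (by rw [div_le_one (by positivity)]; linarith)
  have := ENNReal.toReal_mono hfin2 key
  rw [ENNReal.toReal_mul, ENNReal.toReal_ofReal (by positivity)] at this
  calc U ^ ((1 + t) / 2) = U ^ (-((1 - t) / 2)) * U := by
        rw [← Real.rpow_add_one hU0.ne']; congr 1; ring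
    _ = √(2 * Real.pi) * (U ^ (-((1 - t) / 2)) * realMoment p 0 (1 / 2)) := by rw [hU]; ring
    _ ≤ _ := by gcongr; exact this

/-! ## Means and variances as sums over the distribution function -/

theorem hasSum_countMean (hp : SecondMoment p) :
    HasSum (fun n => 1 - countCDF p n) (countMean p) := by
  have h := hasSum_integral_exceed hp (fun _ => (1 : ℝ)) (memLp_const 1)
  simp only [mul_one] at h
  refine h.congr_fun fun n => ?_
  rw [integral_indicator_const _ (measurableSet_exceed p n), measureReal_exceed]; simp

theorem hasSum_sqMoment (hp : SecondMoment p) :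
    HasSum (fun n : ℕ => (2 * (n : ℝ) + 1) * (1 - countCDF p n)) (sqMoment p) := by
  have hn : ∀ n : ℕ, 0 ≤ (2 * (n : ℝ) + 1) * (1 - countCDF p n) := fun n =>
    mul_nonneg (by positivity) (sub_nonneg.2 (countCDF_le_one p n))
  have h1 : ENNReal.ofReal (sqMoment p)
      = ∑' n : ℕ, ENNReal.ofReal ((2 * (n : ℝ) + 1) * (1 - countCDF p n)) := by
    rw [sqMoment, ofReal_integral_eq_lintegral_ofReal hp.integrable_sq
      (Filter.Eventually.of_forall fun _ => sq_nonneg _)]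
    have e : ∀ z, ENNReal.ofReal (transform p z ^ 2)
        = ∑' n : ℕ, Set.indicator (exceed p n) (fun _ => ENNReal.ofReal (2 * (n : ℝ) + 1)) z := by
      intro z
      have h := hasSum_layer p (fun n => (n : ℝ) ^ 2) z
      have h' : transform p z ^ 2 = ((countQuantile p (stdCDF z) : ℕ) : ℝ) ^ 2 - ((0 : ℕ) : ℝ) ^ 2 := by
        simp [transform]
      rw [h', ← h.tsum_eq, ENNReal.ofReal_tsum_of_nonneg _ h.summable]
      · congr 1; ext n
        by_cases hz : z ∈ exceed p n
        · rw [Set.indicator_of_mem hz, Set.indicator_of_mem hz]; congr 1; push_cast; ring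
        · rw [Set.indicator_of_notMem hz, Set.indicator_of_notMem hz, ENNReal.ofReal_zero]
      · intro n
        refine Set.indicator_nonneg (fun _ _ => ?_) z
        push_cast; nlinarith [n.cast_nonneg (α := ℝ)]
    simp_rw [e]
    rw [lintegral_tsum fun n => (measurable_const.indicator (measurableSet_exceed p n)).aemeasurable]
    congr 1; ext n
    rw [lintegral_indicator_const (measurableSet_exceed p n), ← measureReal_exceed,
      ENNReal.ofReal_mul (by positivity), ofReal_measureReal]
  have h2 : ∑' n : ℕ, ENNReal.ofReal ((2 * (n : ℝ) + 1) * (1 - countCDF p n)) ≠ ∞ := by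
    rw [← h1]; exact ENNReal.ofReal_ne_top
  have h3 := ENNReal.hasSum_toReal h2
  rw [← ENNReal.tsum_toReal_eq fun _ => ENNReal.ofReal_ne_top, ← h1,
    ENNReal.toReal_ofReal (sqMoment_nonneg p)] at h3
  exact h3.congr_fun fun n => (ENNReal.toReal_ofReal (hn n)).symm

/-- The increase of the variance, in terms of the increments of the distribution function. -/
theorem variance_sub_le (hp : SecondMoment p) (hq : SecondMoment q) {K : ℝ}
    (hK : ∀ A : Finset ℕ,
      ∑ k ∈ A, (2 * (countMean p - k) - 1) * (countCDF q k - countCDF p k) ≤ K) :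
    link q q 1 - link p p 1 ≤ K := by
  -- The series is the change of the second moment minus twice the mean of p times the change of the
  -- mean. The change of the variance is smaller by the square of the change of the mean.
  have h : HasSum (fun k : ℕ => (2 * (countMean p - k) - 1) * (countCDF q k - countCDF p k))
      ((sqMoment q - sqMoment p) - 2 * countMean p * (countMean q - countMean p)) := by
    refine (((hasSum_sqMoment hq).sub (hasSum_sqMoment hp)).sub
      (((hasSum_countMean hq).sub (hasSum_countMean hp)).mul_left (2 * countMean p))).congr_fun
      fun k => ?_
    ring
  have := hasSum_le_of_sum_le h hK
  rw [link_self_one hp, link_self_one hq]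
  nlinarith [sq_nonneg (countMean q - countMean p)]

theorem variance_eq_integral (hp : SecondMoment p) :
    link p p 1 = ∫ z, (transform p z - countMean p) ^ 2 ∂γ₁ := by
  rw [link_self_one hp]
  have i1 : Integrable (fun z => transform p z ^ 2) γ₁ := hp.integrable_sq
  have i2 : Integrable (transform p) γ₁ := hp.integrable (by norm_num)
  have e : ∀ z, (transform p z - countMean p) ^ 2
      = transform p z ^ 2 - (2 * countMean p * transform p z - countMean p ^ 2) := fun z => by ring
  simp_rw [e]
  have i3 : Integrable (fun z => 2 * countMean p * transform p z - countMean p ^ 2) γ₁ :=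
    (i2.const_mul _).sub (integrable_const _)
  rw [integral_sub i1 i3, integral_sub (i2.const_mul _) (integrable_const _), integral_const_mul]
  simp only [integral_const, probReal_univ, smul_eq_mul, one_mul]
  rw [← countMean, ← sqMoment]; ring

theorem transform_le_of_notMem_exceed {n : ℕ} {z : ℝ} (h : z ∉ exceed p n) : transform p z ≤ n := by
  have : ¬ n < countQuantile p (stdCDF z) := fun h' =>
    h ((lt_countQuantile_stdCDF_iff p z n).1 h')
  rw [transform]; exact_mod_cast not_lt.1 this

theorem measureReal_compl_exceed (p : PMF ℕ) (n : ℕ) : (γ₁).real (exceed p n)ᶜ = countCDF p n := by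
  rw [probReal_compl_eq_one_sub (measurableSet_exceed p n), measureReal_exceed]; ring

theorem countMean_nonneg (p : PMF ℕ) : 0 ≤ countMean p :=
  integral_nonneg fun z => transform_nonneg p z

/-- Chebyshev's inequality below the mean. -/
theorem countCDF_half_mean_le (hp : SecondMoment p) :
    countCDF p ⌊countMean p / 2⌋₊ * countMean p ^ 2 / 4 ≤ link p p 1 := by
  set n := ⌊countMean p / 2⌋₊
  have he := countMean_nonneg p
  have hn : (n : ℝ) ≤ countMean p / 2 := Nat.floor_le (by positivity)
  have hsub : (exceed p n)ᶜ ⊆ {z | countMean p ^ 2 / 4 ≤ (transform p z - countMean p) ^ 2} := by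
    intro z hz
    have := transform_le_of_notMem_exceed hz
    rw [Set.mem_ofPred_eq]
    nlinarith
  have hi : Integrable (fun z => (transform p z - countMean p) ^ 2) γ₁ :=
    (hp.sub (memLp_const _)).integrable_sq
  have h1 := mul_meas_ge_le_integral_of_nonneg (μ := γ₁)
    (Filter.Eventually.of_forall fun z => sq_nonneg (transform p z - countMean p)) hi
    (countMean p ^ 2 / 4)
  rw [← variance_eq_integral hp] at h1
  have h2 := measureReal_mono (μ := γ₁) hsub
  rw [measureReal_compl_exceed] at h2
  have h3 : 0 ≤ countMean p ^ 2 / 4 := by positivity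
  calc _ = countMean p ^ 2 / 4 * countCDF p n := by ring
    _ ≤ _ := (mul_le_mul_of_nonneg_left h2 h3).trans h1

end

section

/-! ## The error of the inverted link function on the diagonal -/

/-- A bounded sequence with a small first moment has a small sum. -/
theorem sq_sum_le_of_bounded {x : ℕ → ℝ} {c w z : ℝ} (K : ℕ) (hx0 : ∀ k, 0 ≤ x k)
    (hxc : ∀ k < K, x k ≤ c) (hw : ∑ k ∈ Finset.range K, x k ≤ w) (hw0 : 0 ≤ w) (hc : 0 ≤ c)
    (hz : ∑ k ∈ Finset.range K, (k : ℝ) * x k ≤ z) :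
    (∑ k ∈ Finset.range K, x k) ^ 2 ≤ c * (4 * w + 8 * z) := by
  set W := ∑ k ∈ Finset.range K, x k with hW
  have hW0 : 0 ≤ W := Finset.sum_nonneg fun k _ => hx0 k
  have hz0 : 0 ≤ z := (Finset.sum_nonneg fun k _ => mul_nonneg k.cast_nonneg (hx0 k)).trans hz
  rcases le_or_gt W (4 * c) with h | h
  · nlinarith [mul_nonneg hc hz0]
  rcases hc.eq_or_lt with rfl | hc
  · exfalso
    have : W ≤ 0 := Finset.sum_nonpos fun k hk => hxc k (Finset.mem_range.1 hk)
    linarith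
  -- Weighting with J - k shows that the first moment is at least JW - J²c, and J is about half of
  -- W/c so that at least JW/2 remains. The case W ≤ 4c is settled above because rounding would
  -- spoil this.
  set J := ⌊W / (2 * c)⌋₊ with hJ
  have hJ1 : (J : ℝ) ≤ W / (2 * c) := Nat.floor_le (by positivity)
  have hJ2 : W / (2 * c) < J + 1 := Nat.lt_floor_add_one _
  rw [le_div_iff₀ (by positivity)] at hJ1
  rw [div_lt_iff₀ (by positivity)] at hJ2
  have hsum : ∑ k ∈ Finset.range K, ((J : ℝ) - k) * x k ≤ J * (J * c) := by
    calc ∑ k ∈ Finset.range K, ((J : ℝ) - k) * x k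
        ≤ ∑ k ∈ Finset.range K, if k < J then (J : ℝ) * c else 0 := by
          refine Finset.sum_le_sum fun k hk => ?_
          have h1 := hx0 k
          have h2 := hxc k (Finset.mem_range.1 hk)
          split_ifs with hkJ
          · exact mul_le_mul (by linarith [k.cast_nonneg (α := ℝ)]) h2 h1 J.cast_nonneg
          · have : (J : ℝ) ≤ k := by exact_mod_cast not_lt.1 hkJ
            exact mul_nonpos_of_nonpos_of_nonneg (by linarith) h1
      _ = ((Finset.range K).filter (· < J)).card * ((J : ℝ) * c) := by
          rw [← Finset.sum_filter, Finset.sum_const, nsmul_eq_mul]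
      _ ≤ J * (J * c) := by
          gcongr
          calc ((Finset.range K).filter (· < J)).card ≤ (Finset.range J).card :=
                Finset.card_le_card fun k hk => by simp at hk ⊢; exact hk.2
            _ = J := Finset.card_range J
  have hsplit : ∑ k ∈ Finset.range K, ((J : ℝ) - k) * x k
      = J * W - ∑ k ∈ Finset.range K, (k : ℝ) * x k := by
    rw [hW, Finset.mul_sum, ← Finset.sum_sub_distrib]
    exact Finset.sum_congr rfl fun k _ => by ring
  rw [hsplit] at hsum
  have hJ0 : (0 : ℝ) ≤ J := J.cast_nonneg
  have h1 : J * W / 2 ≤ z := by nlinarith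
  have h2 : W ≤ 4 * c * J := by nlinarith
  nlinarith [mul_nonneg hc.le hw0]

/-- The positive increments of a distribution function well below the mean: either their sum is
controlled by the first moment of the increments, or they are small. -/
theorem sum_pos_increments {C C' : ℕ → ℝ} (hC : Monotone C) (hC' : Monotone C') (hC0 : ∀ k, 0 ≤ C k)
    {e w z : ℝ} (he : 16 ≤ e)
    (hw : ∀ A : Finset ℕ, ∑ k ∈ A, |C' k - C k| ≤ w)
    (hz : ∀ A : Finset ℕ, ∑ k ∈ A, (k : ℝ) * |C' k - C k| ≤ z) :
    e * (∑ k ∈ Finset.range ⌈e / 4⌉₊, max (C' k - C k) 0) ≤ 14 * z ∨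
      (∑ k ∈ Finset.range ⌈e / 4⌉₊, max (C' k - C k) 0) ^ 2 ≤ C ⌊e / 2⌋₊ * (8 * w + 16 * z) := by
  set K := ⌈e / 4⌉₊ with hK
  have hK1 : (K : ℝ) < e / 4 + 1 := Nat.ceil_lt_add_one (by linarith)
  have hK2 : e / 4 ≤ K := Nat.le_ceil _
  have hKpos : 0 < K := by
    have : (0 : ℝ) < K := by linarith
    exact_mod_cast this
  set η := C ⌊e / 2⌋₊ with hη
  have hη0 : 0 ≤ η := hC0 _
  set x : ℕ → ℝ := fun k => max (C' k - C k) 0 with hx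
  have hx0 : ∀ k, 0 ≤ x k := fun k => le_max_right _ _
  have hxabs : ∀ k, x k ≤ |C' k - C k| := fun k => max_le (le_abs_self _) (abs_nonneg _)
  have hw0 : 0 ≤ w := by simpa using hw ∅
  obtain ⟨k₀, hk₀, hmax⟩ := Finset.exists_max_image (Finset.range K) x ⟨0, Finset.mem_range.2 hKpos⟩
  rw [Finset.mem_range] at hk₀
  rcases le_or_gt (x k₀) (2 * η) with h | h
  · right
    have := sq_sum_le_of_bounded (x := x) (c := 2 * η) (w := w) (z := z) K hx0
      (fun k hk => (hmax k (Finset.mem_range.2 hk)).trans h)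
      ((Finset.sum_le_sum fun k _ => hxabs k).trans (hw _)) hw0 (by positivity)
      ((Finset.sum_le_sum fun k _ => mul_le_mul_of_nonneg_left (hxabs k) k.cast_nonneg).trans (hz _))
    linarith
  · left
    set X := x k₀ with hX
    have hXpos : 0 < X := by linarith
    have hXeq : X = C' k₀ - C k₀ := by
      rcases max_choice (C' k₀ - C k₀) 0 with h1 | h1
      · exact h1
      · exfalso; rw [hX, hx] at hXpos; simp only [h1] at hXpos; exact lt_irrefl _ hXpos
    have hW : ∑ k ∈ Finset.range K, x k ≤ K * X := by
      refine (Finset.sum_le_sum hmax).trans (le_of_eq ?_)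
      rw [Finset.sum_const, Finset.card_range, nsmul_eq_mul]
    -- If the largest increment X exceeds 2η, then C' stays above X from k₀ on while C stays below η
    -- up to e/2. The gap of at least X/2 persists over about e/4 indices, each of weight at least
    -- K; e ≥ 16 absorbs the rounding.
    have hlow : ∀ k ∈ Finset.Icc K ⌊e / 2⌋₊, (K : ℝ) * (X / 2) ≤ (k : ℝ) * |C' k - C k| := by
      intro k hk
      rw [Finset.mem_Icc] at hk
      have h1 : C' k₀ ≤ C' k := hC' (hk₀.le.trans hk.1)
      have h2 : C k ≤ η := hC hk.2
      have h3 := hC0 k₀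
      have h4 : X / 2 ≤ |C' k - C k| := le_trans (by linarith) (le_abs_self _)
      have h5 : (K : ℝ) ≤ k := by exact_mod_cast hk.1
      gcongr
    have hcard : e / 4 - 1 ≤ (Finset.Icc K ⌊e / 2⌋₊).card := by
      rw [Nat.card_Icc]
      have h1 : e / 2 < ⌊e / 2⌋₊ + 1 := Nat.lt_floor_add_one _
      have h2 : (⌊e / 2⌋₊ + 1 : ℝ) - K ≤ ((⌊e / 2⌋₊ + 1 - K : ℕ) : ℝ) := by
        have : (⌊e / 2⌋₊ + 1 : ℕ) ≤ (⌊e / 2⌋₊ + 1 - K) + K := by omega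
        have : ((⌊e / 2⌋₊ + 1 : ℕ) : ℝ) ≤ ((⌊e / 2⌋₊ + 1 - K : ℕ) : ℝ) + K := by exact_mod_cast this
        push_cast at this; linarith
      linarith
    have hz' : (e / 4 - 1) * (K * (X / 2)) ≤ z := by
      refine le_trans ?_ (hz (Finset.Icc K ⌊e / 2⌋₊))
      refine le_trans ?_ (Finset.card_nsmul_le_sum _ _ _ hlow)
      rw [nsmul_eq_mul]; gcongr
    have h6 : e * ∑ k ∈ Finset.range K, x k ≤ e * (K * X) := by gcongr
    have h7 : 0 < K * X := by positivity
    nlinarith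

/-- The algebra behind the bound for the diagonal entries, when the variance increases by a bounded
multiple of simple quantities. -/
theorem le_budget_of_simple {V h dv m μ w z b Q K : ℝ} (hm : 0 < m) (hμ : 0 < μ)
    (hVm : m ^ 2 ≤ V) (hVμ : μ / 2 ≤ V) (hw : 0 ≤ w) (hz : 0 ≤ z) (hb : 0 ≤ b) (hQ : 1 ≤ Q)
    (hK : 0 ≤ K) (hdv : dv ≤ K * (z + w + b)) (hF : V * h ≤ dv) :
    h ≤ 2 * K * (z / μ + w / m + w * Q ^ 2 / m ^ 3 + w * m / μ + b / μ) := by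
  have hV : 0 < V := by linarith [half_pos hμ]
  have h1 : h ≤ K * (z / V + w / V + b / V) := by
    rw [← add_div, ← add_div, mul_div_assoc', le_div_iff₀ hV]; linarith
  have hz1 : z / V ≤ 2 * (z / μ) := by
    rw [div_le_iff₀ hV]
    calc z = 2 * (z / μ) * (μ / 2) := by field_simp
      _ ≤ _ := by gcongr
  have hb1 : b / V ≤ 2 * (b / μ) := by
    rw [div_le_iff₀ hV]
    calc b = 2 * (b / μ) * (μ / 2) := by field_simp
      _ ≤ _ := by gcongr
  have hw1 : w / V ≤ w / m ^ 2 := by gcongr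
  have hw2 : w / m ^ 2 ≤ w / m + w * Q ^ 2 / m ^ 3 := by
    have : w / m + w / m ^ 3 - w / m ^ 2 = w / m ^ 3 * (m ^ 2 + 1 - m) := by field_simp
    have h2 : 0 ≤ w / m ^ 3 * (m ^ 2 + 1 - m) := mul_nonneg (by positivity) (by nlinarith)
    have h3 : w / m ^ 3 ≤ w * Q ^ 2 / m ^ 3 := by
      gcongr; exact le_mul_of_one_le_right hw (one_le_pow₀ hQ)
    linarith
  have hz2 : 0 ≤ z / μ := by positivity
  have hb2 : 0 ≤ b / μ := by positivity
  have hw3 : 0 ≤ w * m / μ := by positivity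
  have hw4 : 0 ≤ w / m := by positivity
  have hw5 : 0 ≤ w * Q ^ 2 / m ^ 3 := by positivity
  refine h1.trans ?_
  rw [mul_comm 2 K, mul_assoc]
  gcongr
  linarith

/-- From log x ≥ 1 - 1/x one gets x log x ≥ -1, and e < 3. -/
theorem mul_self_rpow_ge {x : ℝ} (hx : 0 < x) : (1 : ℝ) / 3 ≤ x ^ x := by
  rw [Real.rpow_def_of_pos hx]
  have h1 : -1 ≤ Real.log x * x := by
    have := Real.one_sub_inv_le_log_of_pos hx
    have h2 : (1 - x⁻¹) * x ≤ Real.log x * x := by gcongr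
    have h3 : (1 - x⁻¹) * x = x - 1 := by field_simp
    linarith
  have h2 : (1 : ℝ) / 3 ≤ Real.exp (-1) := by
    rw [Real.exp_neg, one_div]
    gcongr
    exact Real.exp_one_lt_three.le
  exact h2.trans (Real.exp_le_exp.2 h1)

end

/-! ### Case analysis for the diagonal error -/

section

theorem sqrt_two_pi_le : √(2 * Real.pi) ≤ 3 := by
  rw [Real.sqrt_le_left (by norm_num)]; nlinarith [Real.pi_lt_four, Real.pi_lt_d2]

theorem one_le_sqrt_two_pi : 1 ≤ √(2 * Real.pi) := by
  rw [Real.one_le_sqrt]; linarith [Real.pi_gt_three]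

/-- The case where the increments of the variance are small and the first moment dominates. -/
theorem le_div_of_small_scale {h dv μ z s : ℝ} {A : ℝ → ℝ} (hμ : 0 < μ) (hz : 0 ≤ z)
    (hs0 : 0 ≤ s) (hs1 : s ≤ 1) (h0 : 0 ≤ h) (h12 : h ≤ 1 / 2)
    (hA : μ ≤ A h) (hpow : (√(2 * Real.pi) * μ) ^ ((1 + h) / 2) ≤ √(2 * Real.pi) * A h)
    (hF : √h * A h ≤ 2 * dv) (hdv : dv ^ 2 ≤ 2048 * z * s ^ 2) (hF1 : s ^ 2 * h ≤ 4 * dv) :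
    h ≤ 221184 * (z / μ) := by
  set c := √(2 * Real.pi) with hc
  have hc3 : c ≤ 3 := sqrt_two_pi_le
  have hc1 : 1 ≤ c := one_le_sqrt_two_pi
  have hs2 : s ^ 2 ≤ 1 := pow_le_one₀ hs0 hs1
  have hF' : h * A h ^ 2 ≤ 8192 * z * s ^ 2 := by
    have : (√h * A h) ^ 2 ≤ (2 * dv) ^ 2 := by
      have := hμ.le.trans hA
      gcongr
    rw [mul_pow, Real.sq_sqrt h0] at this
    nlinarith
  set U := c * μ with hU
  have hU0 : 0 < U := by positivity
  suffices h * μ ≤ 221184 * z by rwa [mul_div_assoc', le_div_iff₀ hμ]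
  have hzs : z * s ^ 2 ≤ z := mul_le_of_le_one_right hz hs2
  rcases le_or_gt 1 U with h1 | h1
  · have h2 : 1 ≤ 3 * μ := h1.trans (by rw [hU]; gcongr)
    have h3 : h * (μ * μ) ≤ h * A h ^ 2 := by
      rw [← sq]; gcongr
    have h4 : h * μ ≤ 3 * (h * (μ * μ)) := by nlinarith [mul_nonneg h0 hμ.le]
    linarith
  -- For U < 1 the lower bound on A(h) becomes r^(1+h). The threshold h = r is natural: for h ≤ r
  -- the loss r^h is at least r^r ≥ 1/3, while for h > r the bound h ≤ 1/2 still leaves r^(3/2).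
  set r := √U with hr
  have hr0 : 0 < r := Real.sqrt_pos.2 hU0
  have hr2 : r ^ 2 = U := Real.sq_sqrt hU0.le
  have hr1 : r < 1 := by rw [hr, Real.sqrt_lt' one_pos]; simpa using h1
  have hrpow : U ^ ((1 + h) / 2) = r ^ (1 + h) := by
    rw [← hr2, ← Real.rpow_natCast, ← Real.rpow_mul hr0.le]; congr 1; push_cast; ring
  have hA0 : 0 < A h := hμ.trans_le hA
  have hcA : (c * A h) ^ 2 ≤ 9 * A h ^ 2 := by
    rw [mul_pow]; gcongr; nlinarith
  rcases le_or_gt h r with h2 | h2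
  · have h3 : r / 3 ≤ c * A h := by
      refine le_trans ?_ hpow
      rw [hrpow, Real.rpow_add hr0, Real.rpow_one, div_eq_mul_one_div]
      gcongr
      exact (mul_self_rpow_ge hr0).trans (Real.rpow_le_rpow_of_exponent_ge hr0 hr1.le h2)
    have h4 : U / 9 ≤ c * (c * A h ^ 2) := by
      have : (r / 3) ^ 2 ≤ (c * A h) ^ 2 := by gcongr
      rw [div_pow, hr2] at this
      nlinarith
    have h5 : μ / 9 ≤ 3 * A h ^ 2 := by
      have : c * (μ / 9) ≤ c * (c * A h ^ 2) := by rw [← mul_div_assoc]; exact h4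
      have := le_of_mul_le_mul_left this (by linarith)
      exact this.trans (by gcongr)
    have h6 : h * (μ / 9) ≤ h * (3 * A h ^ 2) := by gcongr
    linarith
  · have h3 : U * r ≤ (c * A h) ^ 2 := by
      have h4 : r ^ (3 / 2 : ℝ) ≤ c * A h := by
        refine le_trans ?_ hpow
        rw [hrpow]
        exact Real.rpow_le_rpow_of_exponent_ge hr0 hr1.le (by linarith)
      have h5 : (r ^ (3 / 2 : ℝ)) ^ 2 = U * r := by
        rw [← Real.rpow_natCast, ← Real.rpow_mul hr0.le, ← hr2, ← pow_succ, ← Real.rpow_natCast]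
        congr 1; norm_num
      rw [← h5]; gcongr
    have h4 : h * (U * r) ≤ 9 * (8192 * z * s ^ 2) := by
      calc h * (U * r) ≤ h * (9 * A h ^ 2) := by exact mul_le_mul_of_nonneg_left (h3.trans hcA) h0
        _ = 9 * (h * A h ^ 2) := by ring
        _ ≤ _ := by gcongr
    have hμU : μ ≤ U := le_mul_of_one_le_left hμ.le hc1
    suffices h * U ≤ 221184 * z from (by gcongr : h * μ ≤ h * U).trans this
    -- If s² ≤ r, the factor s² on the right cancels the extra r. Otherwise the chord bound on s²h
    -- yields s²h² of order z, and hU = hr² < h²s².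
    rcases le_or_gt (s ^ 2) r with h5 | h5
    · have : h * U * r ≤ 9 * (8192 * z) * r := by
        calc h * U * r = h * (U * r) := by ring
          _ ≤ 9 * (8192 * z * s ^ 2) := h4
          _ = 9 * (8192 * z) * s ^ 2 := by ring
          _ ≤ _ := by gcongr
      have := le_of_mul_le_mul_right this hr0
      linarith
    · have hs2pos : 0 < s ^ 2 := hr0.trans h5
      have h6 : s ^ 2 * h ^ 2 ≤ 32768 * z := by
        have : (s ^ 2 * h) ^ 2 ≤ (4 * dv) ^ 2 := by gcongr
        have h7 : s ^ 2 * (s ^ 2 * h ^ 2) ≤ s ^ 2 * (32768 * z) := by nlinarith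
        exact le_of_mul_le_mul_left h7 hs2pos
      calc h * U = h * r * r := by rw [mul_assoc, ← sq, hr2]
        _ ≤ h * h * s ^ 2 := by gcongr
        _ = s ^ 2 * h ^ 2 := by ring
        _ ≤ 32768 * z := h6
        _ ≤ _ := by linarith

/-- The algebra behind the bound for the diagonal entries: `h` is the error of the inverted link
function, `w` and `z` are the total variation distance and the first moment distance of the laws,
`b` is the error of the sample variance, and `A t` is the moment of the estimated law at
`1 / (1 + t)`. -/
theorem diagonal_budget {V V' h w z b e W η m μ m₂ c : ℝ} {A : ℝ → ℝ} (hm : 0 < m) (hμ : 0 < μ)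
    (hμm : μ ≤ m) (hm₂ : 0 ≤ m₂) (hw : 0 ≤ w) (hz : 0 ≤ z) (hb : 0 ≤ b) (hc : 1 ≤ c)
    (hW0 : 0 ≤ W) (hWw : W ≤ w) (hη : 0 ≤ η)
    (hVm : m ^ 2 ≤ V') (hVμ : μ / 2 ≤ V') (h0 : 0 ≤ h) (h12 : h ≤ 1 / 2)
    (hdv : V' - V ≤ 6 * z + 2 * w + 2 * (e * W))
    (hW : 16 ≤ e → e * W ≤ 14 * z ∨ W ^ 2 ≤ η * (8 * w + 16 * z))
    (hηV : η * e ^ 2 / 4 ≤ V) (hηc : V < e ^ 2 / 16 → √η * e ^ 2 ≤ c)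
    (hF1 : V' * h ≤ max (V' - V) 0 + b)
    (hF2 : ∀ t, 0 ≤ t → t ≤ h → √t * A t ≤ 2 * (max (V' - V) 0 + b))
    (hA : ∀ t, 0 ≤ t → t ≤ 1 → μ ≤ A t) (hlin : ∀ t, 0 ≤ t → m - t * m₂ ≤ A t)
    (hpow : ∀ t, 0 ≤ t → t ≤ 1 →
      (√(2 * Real.pi) * μ) ^ ((1 + t) / 2) ≤ √(2 * Real.pi) * A t) :
    h ≤ 221184 * (c * (z / μ + w / m + w * (1 + m₂ / m) ^ 2 / m ^ 3 + w * m / μ) + b / μ) := by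
  set Q := 1 + m₂ / m with hQ
  have hQ1 : 1 ≤ Q := by rw [hQ]; linarith [div_nonneg hm₂ hm.le]
  set dv := max (V' - V) 0 + b with hdv'
  have hdv0 : 0 ≤ dv := add_nonneg (le_max_right _ _) hb
  have hz2 : 0 ≤ z / μ := by positivity
  have hb2 : 0 ≤ b / μ := by positivity
  have hw3 : 0 ≤ w * m / μ := by positivity
  have hw4 : 0 ≤ w / m := by positivity
  have hw5 : 0 ≤ w * Q ^ 2 / m ^ 3 := by positivity
  set B := z / μ + w / m + w * Q ^ 2 / m ^ 3 + w * m / μ with hB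
  have hB0 : 0 ≤ B := by positivity
  have hcB : B ≤ c * B := le_mul_of_one_le_left hB0 hc
  have hwB : w ≤ B := by
    have : w ≤ w * m / μ := by rw [mul_div_assoc]; exact le_mul_of_one_le_right hw ((one_le_div hμ).2 hμm)
    linarith
  -- Whenever the variance increases by no more than the distances themselves, the linear chord
  -- bound suffices. The factor of the order of the mean e must be dealt with in all remaining
  -- cases.
  have simple : dv ≤ 34 * (z + w + b) → h ≤ 221184 * (c * B + b / μ) := fun hs => by
    have := le_budget_of_simple hm hμ hVm hVμ hw hz hb hQ1 (by norm_num) hs hF1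
    linarith
  rcases le_or_gt V' V with hVV | hVV
  · refine simple ?_
    rw [hdv', max_eq_right (by linarith)]; linarith
  have hdve : dv = V' - V + b := by rw [hdv', max_eq_left (by linarith)]
  rcases lt_or_ge e 16 with he16 | he16
  · refine simple ?_
    have : e * W ≤ 16 * w := by gcongr
    linarith
  rcases le_or_gt (e * W) (z + w + b) with h1 | h1
  · exact simple (by linarith)
  rcases hW he16 with h2 | h2
  · exact simple (by linarith)
  have hdve2 : dv ≤ 8 * (e * W) := by linarith
  have he0 : 0 < e := by linarith
  -- A standard deviation comparable to the mean makes the chord bound strong: e²h is of order ew,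
  -- which with e ≥ 16 is enough.
  rcases le_or_gt (e ^ 2 / 16) V with h3 | h3
  · have h4 : e ^ 2 / 16 * h ≤ 8 * (e * w) := by
      calc e ^ 2 / 16 * h ≤ V' * h := by gcongr; linarith
        _ ≤ dv := hF1
        _ ≤ _ := hdve2.trans (by gcongr)
    have h5 : e * (e * h) ≤ e * (128 * w) := by linarith
    have h6 := le_of_mul_le_mul_left h5 he0
    have h7 : 16 * h ≤ e * h := by gcongr
    linarith
  have hce := hηc h3
  set ρ := √η with hρ
  have hρ0 : 0 ≤ ρ := Real.sqrt_nonneg _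
  have hρ2 : ρ ^ 2 = η := Real.sq_sqrt hη
  -- By Chebyshev's inequality s²/4 is a lower bound for the variance, so the chord bound controls
  -- s²h. At the same time dv² is of order (w + z)s².
  set s := e * ρ with hs
  have hs0 : 0 ≤ s := by positivity
  have hs2 : s ^ 2 = η * e ^ 2 := by rw [hs, mul_pow, hρ2]; ring
  have hF1s : s ^ 2 * h ≤ 4 * dv := by
    have : s ^ 2 / 4 * h ≤ V' * h := by rw [hs2]; gcongr; linarith
    linarith
  -- For s ≥ 1 one has e ≤ es = √η e² ≤ c; this is where the bound forced by the concentration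
  -- hypothesis enters.
  rcases le_or_gt 1 s with h4 | h4
  · have h5 : s ^ 2 * h ≤ s ^ 2 * (32 * w * c) := by
      calc s ^ 2 * h ≤ 4 * (8 * (e * w)) := hF1s.trans (by
            have : e * W ≤ e * w := by gcongr
            linarith)
        _ = 32 * w * (e * 1) := by ring
        _ ≤ 32 * w * (e * s) := by gcongr
        _ = 32 * w * (ρ * e ^ 2) := by rw [hs]; ring
        _ ≤ 32 * w * c := by gcongr
        _ ≤ _ := le_mul_of_one_le_left (by positivity) (one_le_pow₀ h4)
    have h6 := le_of_mul_le_mul_left h5 (by positivity)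
    have h7 : w * c ≤ c * B := by rw [mul_comm]; gcongr
    linarith [mul_nonneg hw (zero_le_one.trans hc)]
  have hdvsq : dv ^ 2 ≤ 1024 * (w + z) * s ^ 2 := by
    calc dv ^ 2 ≤ (8 * (e * W)) ^ 2 := by gcongr
      _ = 64 * e ^ 2 * W ^ 2 := by ring
      _ ≤ 64 * e ^ 2 * (η * (8 * w + 16 * z)) := by gcongr
      _ = 64 * (8 * w + 16 * z) * s ^ 2 := by rw [hs2]; ring
      _ ≤ _ := mul_le_mul_of_nonneg_right (by linarith) (sq_nonneg s)
  rcases le_or_gt z w with h5 | h5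
  · have hdvw : dv ^ 2 ≤ 2048 * w := by
      refine hdvsq.trans ?_
      have : 1024 * (w + z) * s ^ 2 ≤ 1024 * (w + z) * 1 := by
        gcongr; exact pow_le_one₀ hs0 h4.le
      linarith
    -- The truncation keeps t m₂ below m/2, so A(t) ≥ m/2 and the square-root bound gives t of order
    -- w/m². Undoing the truncation costs 2Q, because h ≤ 1/2.
    set t := min h (1 / (2 * Q)) with ht
    have ht0 : 0 ≤ t := le_min h0 (by positivity)
    have htm : m / 2 ≤ A t := by
      refine le_trans ?_ (hlin t ht0)
      have : t * m₂ ≤ 1 / (2 * Q) * (m * Q) := by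
        gcongr
        · exact min_le_right _ _
        · rw [hQ, mul_add, mul_div_cancel₀ _ hm.ne']; linarith
      have h6 : 1 / (2 * Q) * (m * Q) = m / 2 := by field_simp
      linarith
    have h6 : t * m ^ 2 ≤ 32768 * w := by
      have h7 : √t * (m / 2) ≤ 2 * dv :=
        (by gcongr : √t * (m / 2) ≤ √t * A t).trans (hF2 t ht0 (min_le_left _ _))
      have : (√t * (m / 2)) ^ 2 ≤ (2 * dv) ^ 2 := by gcongr
      rw [mul_pow, Real.sq_sqrt ht0] at this
      linarith only [this, hdvw]
    have h7 : h ≤ 2 * Q * t := by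
      rcases min_choice h (1 / (2 * Q)) with h8 | h8
      · rw [ht, h8]; exact le_mul_of_one_le_left h0 (by linarith only [hQ1])
      · rw [ht, h8, mul_one_div_cancel (by positivity)]; linarith only [h12]
    have h8 : t ≤ 32768 * w / m ^ 2 := by rwa [le_div_iff₀ (by positivity)]
    have h9 : h ≤ 65536 * (w * Q / m ^ 2) := by
      calc h ≤ 2 * Q * t := h7
        _ ≤ 2 * Q * (32768 * w / m ^ 2) := by gcongr
        _ = _ := by ring
    have h10 : w * Q / m ^ 2 ≤ w / m + w * Q ^ 2 / m ^ 3 := by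
      have e1 : w / m + w * Q ^ 2 / m ^ 3 - w * Q / m ^ 2 = w / m * ((Q / m) ^ 2 - Q / m + 1) := by
        field_simp
        ring
      have e2 : 0 ≤ w / m * ((Q / m) ^ 2 - Q / m + 1) :=
        mul_nonneg hw4 (by nlinarith only [sq_nonneg (Q / m - 1)])
      linarith
    linarith
  · have := le_div_of_small_scale (A := A) hμ hz hs0 h4.le h0 h12 (hA h h0 (by linarith))
      (hpow h h0 (by linarith)) (hF2 h h0 le_rfl) (hdvsq.trans
        (mul_le_mul_of_nonneg_right (by linarith) (sq_nonneg s))) hF1s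
    calc h ≤ 221184 * (z / μ) := this
      _ ≤ 221184 * B := by gcongr; linarith
      _ ≤ _ := by linarith

end

/-! ### The diagonal error in terms of two count laws -/

section

variable {p q : PMF ℕ}

/-- For k ≥ e/4 the coefficient 2(e - k) - 1 is of order k + 1 and is charged to z and w. Only
positive increments below e/4 can cost a full factor e. -/
theorem variance_sub_le_of_sums (hp : SecondMoment p) (hq : SecondMoment q) {w z : ℝ}
    (hw : ∀ A : Finset ℕ, ∑ k ∈ A, |countCDF q k - countCDF p k| ≤ w)
    (hz : ∀ A : Finset ℕ, ∑ k ∈ A, (k : ℝ) * |countCDF q k - countCDF p k| ≤ z) :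
    link q q 1 - link p p 1 ≤ 6 * z + 2 * w + 2 * (countMean p *
      ∑ k ∈ Finset.range ⌈countMean p / 4⌉₊, max (countCDF q k - countCDF p k) 0) := by
  set e := countMean p with he
  have he0 : 0 ≤ e := countMean_nonneg p
  refine variance_sub_le hp hq fun A => ?_
  set D : ℕ → ℝ := fun k => countCDF q k - countCDF p k with hD
  have hterm : ∀ k : ℕ, (2 * (e - k) - 1) * D k ≤ 6 * ((k : ℝ) * |D k|) + 2 * |D k|
      + 2 * e * (if k ∈ Finset.range ⌈e / 4⌉₊ then max (D k) 0 else 0) := by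
    intro k
    have h1 := le_abs_self (D k)
    have h2 := neg_abs_le (D k)
    have h3 : (0 : ℝ) ≤ k := k.cast_nonneg
    have h4 := abs_nonneg (D k)
    split_ifs with hk
    · have h5 : e * D k ≤ e * max (D k) 0 := by gcongr; exact le_max_left _ _
      have h6 : -(2 * (k : ℝ) + 1) * D k ≤ (2 * k + 1) * |D k| := by nlinarith
      nlinarith
    · rw [Finset.mem_range, not_lt, Nat.ceil_le] at hk
      have h5 : |2 * (e - k) - 1| ≤ 6 * k + 2 := by rw [abs_le]; constructor <;> linarith
      calc (2 * (e - k) - 1) * D k ≤ |2 * (e - k) - 1| * |D k| := by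
            rw [← abs_mul]; exact le_abs_self _
        _ ≤ (6 * k + 2) * |D k| := by gcongr
        _ = _ := by ring
  refine (Finset.sum_le_sum fun k _ => hterm k).trans ?_
  rw [Finset.sum_add_distrib, Finset.sum_add_distrib, ← Finset.mul_sum, ← Finset.mul_sum,
    ← Finset.mul_sum]
  have h3 : ∑ k ∈ A, (if k ∈ Finset.range ⌈e / 4⌉₊ then max (D k) 0 else 0)
      ≤ ∑ k ∈ Finset.range ⌈e / 4⌉₊, max (D k) 0 := by
    rw [← Finset.sum_filter]
    refine Finset.sum_le_sum_of_subset_of_nonneg ?_ fun _ _ _ => le_max_right _ _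
    intro k hk; exact (Finset.mem_filter.1 hk).2
  have h1 := hz A
  have h2 := hw A
  have h4 : 2 * e * ∑ k ∈ A, (if k ∈ Finset.range ⌈e / 4⌉₊ then max (D k) 0 else 0)
      ≤ 2 * e * ∑ k ∈ Finset.range ⌈e / 4⌉₊, max (D k) 0 := by gcongr
  linarith

/-- The error of the inverted link function at the sample variance. -/
theorem abs_linkInv_self_sub_one_le (hp : SecondMoment p) (hq : SecondMoment q)
    (hpos : 0 < realMoment q 0 (1 / 2)) (h2 : levelMoment q 2 1 ≠ ∞) {w z c y : ℝ} (hc : 1 ≤ c)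
    (hw : ∀ A : Finset ℕ, ∑ k ∈ A, |countCDF q k - countCDF p k| ≤ w)
    (hz : ∀ A : Finset ℕ, ∑ k ∈ A, (k : ℝ) * |countCDF q k - countCDF p k| ≤ z)
    (hηc : link p p 1 < countMean p ^ 2 / 16 →
      √(countCDF p ⌊countMean p / 2⌋₊) * countMean p ^ 2 ≤ c) :
    |linkInv q q y - 1| ≤ 884736 * (c * (z / realMoment q 0 (1 / 2) + w / realMoment q 0 1
      + w * (1 + realMoment q 2 1 / realMoment q 0 1) ^ 2 / realMoment q 0 1 ^ 3
      + w * realMoment q 0 1 / realMoment q 0 (1 / 2))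
      + |y - link p p 1| / realMoment q 0 (1 / 2)) := by
  set μ := realMoment q 0 (1 / 2) with hμ
  set m := realMoment q 0 1 with hm
  set m₂ := realMoment q 2 1 with hm2
  set e := countMean p with he
  set V := link p p 1 with hV
  set V' := link q q 1 with hV'
  set b := |y - V| with hb
  have hμm : μ ≤ m := realMoment_mono hq (by norm_num) (by norm_num) le_rfl
  have hm0 : 0 < m := hpos.trans_le hμm
  have hw0 : 0 ≤ w := by simpa using hw ∅
  have hz0 : 0 ≤ z := by simpa using hz ∅
  have hb0 : 0 ≤ b := abs_nonneg _
  have he0 : 0 ≤ e := countMean_nonneg p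
  have hm20 : 0 ≤ m₂ := realMoment_nonneg _ _ _
  obtain ⟨hu1, hu2⟩ := linkInv_mem_Icc q q y
  set u := linkInv q q y with hu
  have hη0 : 0 ≤ countCDF p ⌊e / 2⌋₊ := (countCDF_mem_Icc p _).1
  rcases hu2.eq_or_lt with h1 | h1
  · rw [h1, sub_self, abs_zero]
    positivity
  have hy : y ≤ link q q u := le_link_linkInv hq hq h1
  -- Since 1 - u ≤ 2, capping at 1/2 loses a factor 4 at most; this turns 221184 into 884736.
  set h := min (1 - u) (1 / 2) with hh
  have hh0 : 0 ≤ h := le_min (by linarith) (by norm_num)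
  have hh12 : h ≤ 1 / 2 := min_le_right _ _
  have hh4 : 1 - u ≤ 4 * h := by
    rcases min_choice (1 - u) (1 / 2) with h3 | h3 <;> rw [hh, h3] <;> linarith
  have hmono := monotoneOn_link hq hq
  have hdrop : ∀ t, 0 ≤ t → t ≤ h → V' - link q q (1 - t) ≤ max (V' - V) 0 + b := by
    intro t ht0 hth
    have h3 : t ≤ 1 - u := hth.trans (min_le_left _ _)
    have h4 : link q q u ≤ link q q (1 - t) :=
      hmono ⟨hu1, hu2⟩ ⟨by linarith, by linarith⟩ (by linarith)
    have h5 : -b ≤ y - V := neg_abs_le _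
    have h6 := le_max_left (V' - V) 0
    linarith
  have hF2 : ∀ t, 0 ≤ t → t ≤ h → √t * realMoment q 0 (1 / (1 + t)) ≤ 2 * (max (V' - V) 0 + b) :=
    fun t ht0 hth => (link_one_sub_ge hq ht0 (by linarith)).trans (by linarith [hdrop t ht0 hth])
  have hF1 : V' * h ≤ max (V' - V) 0 + b := by
    have h3 := link_self_le hq (u := 1 - h) (by linarith) (by linarith)
    have h4 := hdrop h hh0 le_rfl
    rw [← hV'] at h3
    linarith
  -- The square-root bound with h = 1, that is, between the correlations 0 and 1.
  have hVμ : μ / 2 ≤ V' := by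
    have h3 := link_one_sub_ge hq zero_le_one le_rfl
    rw [Real.sqrt_one, one_mul, sub_self, link_zero, sub_zero] at h3
    norm_num at h3
    have : realMoment q 0 (1 / 2) ≤ 2 * link q q 1 := by simpa using h3
    linarith
  have key := diagonal_budget (A := fun t => realMoment q 0 (1 / (1 + t))) hm0 hpos hμm hm20 hw0 hz0
    hb0 hc (Finset.sum_nonneg fun k (_ : k ∈ Finset.range ⌈e / 4⌉₊) =>
      le_max_right (countCDF q k - countCDF p k) 0)
    ((Finset.sum_le_sum fun k _ => max_le (le_abs_self _) (abs_nonneg _)).trans (hw _)) hη0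
    (sq_realMoment_one_le hq) hVμ hh0 hh12 (variance_sub_le_of_sums hp hq hw hz)
    (fun h16 => sum_pos_increments (countCDF_mono p) (countCDF_mono q)
      (fun k => (countCDF_mem_Icc p k).1) h16 hw hz)
    (countCDF_half_mean_le hp) hηc hF1 hF2
    (fun t ht0 ht1 => realMoment_mono hq (by norm_num)
      (one_div_le_one_div_of_le (by linarith) (by linarith))
      (by rw [div_le_one (by linarith)]; linarith))
    (fun t ht0 => realMoment_ge_linear hq h2 ht0)
    (fun t ht0 ht1 => realMoment_ge_rpow hq ht0 ht1 hpos)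
  rw [abs_sub_comm, abs_of_nonneg (by linarith)]
  linarith

end

section

/-! ## Sums over a Gaussian process -/

theorem He_neg (n : ℕ) (x : ℝ) : He n (-x) = (-1) ^ n * He n x := by
  induction n using Nat.strong_induction_on with
  | _ n ih =>
    rcases n with _ | n
    · simp [He_zero]
    · rw [He_succ, He_succ, ih n (by omega)]
      rcases n with _ | n
      · simp
      · rw [Nat.add_sub_cancel, ih n (by omega)]; ring

theorem measurePreserving_neg_gaussian : MeasurePreserving (fun x : ℝ => -x) γ₁ γ₁ :=
  ⟨measurable_neg, by rw [gaussianReal_map_neg, neg_zero]⟩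

theorem hcoeff_neg (F : ℝ → ℝ) (j : ℕ) : hcoeff (fun x => F (-x)) j = (-1) ^ j * hcoeff F j := by
  have h := measurePreserving_neg_gaussian.integral_comp
    (MeasurableEquiv.neg ℝ).measurableEmbedding (fun x => F x * He j x)
  rw [hcoeff, hcoeff, ← h, ← integral_const_mul]
  refine integral_congr_ae (Filter.Eventually.of_forall fun x => ?_)
  beta_reduce
  have hs : ((-1 : ℝ) ^ j) * (-1) ^ j = 1 := by rw [← mul_pow]; simp
  rw [He_neg]
  linear_combination (-(F (-x) * He j x)) * hs

/-- The even part of a function. -/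
noncomputable def evenPart (F : ℝ → ℝ) (x : ℝ) : ℝ := (F x + F (-x)) / 2

theorem memLp_evenPart {F : ℝ → ℝ} (hF : MemLp F 2 γ₁) : MemLp (evenPart F) 2 γ₁ := by
  have h := (hF.add (hF.comp_measurePreserving measurePreserving_neg_gaussian)).const_mul (1 / 2)
  refine h.ae_eq (Filter.Eventually.of_forall fun x => ?_)
  simp [evenPart]; ring

theorem hcoeff_evenPart {F : ℝ → ℝ} (hF : MemLp F 2 γ₁) (j : ℕ) :
    hcoeff (evenPart F) j = (1 + (-1) ^ j) / 2 * hcoeff F j := by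
  have h1 := integrable_mul_of_memLp hF (memLp_He j)
  have h2 : Integrable (fun x => F (-x) * He j x) γ₁ := integrable_mul_of_memLp
    (hF.comp_measurePreserving measurePreserving_neg_gaussian) (memLp_He j)
  have h3 : hcoeff (evenPart F) j = (hcoeff F j + hcoeff (fun x => F (-x)) j) / 2 := by
    rw [hcoeff, hcoeff, hcoeff, ← integral_add h1 h2, ← integral_div]
    refine integral_congr_ae (Filter.Eventually.of_forall fun x => ?_)
    simp only [evenPart]; ring
  rw [h3, hcoeff_neg]; ring

theorem integral_evenPart_mul {F : ℝ → ℝ} (hF : MemLp F 2 γ₁) :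
    ∫ x, evenPart F x * F x ∂γ₁ = ∫ x, evenPart F x ^ 2 ∂γ₁ := by
  have hE := memLp_evenPart hF
  have h := measurePreserving_neg_gaussian.integral_comp
    (MeasurableEquiv.neg ℝ).measurableEmbedding (fun x => evenPart F x * F x)
  have h1 := integrable_mul_of_memLp hE hF
  have h2 : Integrable (fun x => evenPart F (-x) * F (-x)) γ₁ :=
    measurePreserving_neg_gaussian.integrable_comp_of_integrable h1
  have h3 : ∫ x, evenPart F x ^ 2 ∂γ₁
      = (∫ x, evenPart F x * F x ∂γ₁ + ∫ x, evenPart F (-x) * F (-x) ∂γ₁) / 2 := by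
    rw [← integral_add h1 h2, ← integral_div]
    refine integral_congr_ae (Filter.Eventually.of_forall fun x => ?_)
    simp only [evenPart, neg_neg]; ring
  rw [h3, h]; ring

/-- The second moment of a sum over a Gaussian process is at least the sum of the second moments of
the even parts. -/
theorem card_mul_integral_evenPart_le {τ Ω : Type*} [MeasurableSpace Ω] {P : Measure Ω}
    {Z : τ → Ω → ℝ} (hZ : IsGaussianProcess Z P) (h0 : ∀ t, ∫ ω, Z t ω ∂P = 0)
    (h1 : ∀ t, ∫ ω, Z t ω ^ 2 ∂P = 1) (hu : ∀ s t, s ≠ t → |∫ ω, Z s ω * Z t ω ∂P| < 1)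
    {F : ℝ → ℝ} (hFm : Measurable F) (hF : MemLp F 2 γ₁) (I : Finset τ) :
    I.card * ∫ x, evenPart F x ^ 2 ∂γ₁ ≤ ∫ ω, (∑ t ∈ I, F (Z t ω)) ^ 2 ∂P := by
  classical
  have hE := memLp_evenPart hF
  have hEm : Measurable (evenPart F) := (hFm.add (hFm.comp measurable_neg)).div_const 2
  have hlaw : ∀ t, P.map (Z t) = γ₁ := fun t =>
    map_eq_std_of_hasGaussianLaw (hZ.hasGaussianLaw_eval t) (h0 t) (h1 t)
  have hcomp : ∀ {G : ℝ → ℝ}, Measurable G → MemLp G 2 γ₁ → ∀ t,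
      MemLp (fun ω => G (Z t ω)) 2 P := fun {G} hGm hG t => by
    have := (memLp_map_measure_iff (μ := P) (f := Z t) (g := G) (p := 2)
      hGm.aestronglyMeasurable (hZ.aemeasurable t)).1 (by rw [hlaw t]; exact hG)
    exact this
  -- The mixed moment of two even parts is a power series with nonnegative coefficients in even
  -- powers of the correlation, hence nonnegative whatever the sign of the correlation. Odd parts
  -- could cancel, so they are discarded by parity of the Hermite coefficients.
  have hcov : ∀ s t, (if s = t then ∫ x, evenPart F x ^ 2 ∂γ₁ else 0)
        ≤ ∫ ω, evenPart F (Z s ω) * F (Z t ω) ∂P ∧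
      ∫ ω, evenPart F (Z s ω) * F (Z t ω) ∂P
        = ∫ ω, evenPart F (Z s ω) * evenPart F (Z t ω) ∂P := by
    intro s t
    by_cases hst : s = t
    · subst hst
      have e1 : ∫ ω, evenPart F (Z s ω) * F (Z s ω) ∂P = ∫ x, evenPart F x ^ 2 ∂γ₁ := by
        rw [← integral_evenPart_mul hF, ← hlaw s]
        exact (integral_map (hZ.aemeasurable s) (hEm.mul hFm).aestronglyMeasurable).symm
      have e2 : ∫ ω, evenPart F (Z s ω) * evenPart F (Z s ω) ∂P = ∫ x, evenPart F x ^ 2 ∂γ₁ := by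
        rw [← hlaw s, integral_map (hZ.aemeasurable s) (hEm.pow_const 2).aestronglyMeasurable]
        simp only [sq]
      rw [if_pos rfl, e1, e2]
      exact ⟨le_rfl, rfl⟩
    · have hG := hZ.hasGaussianLaw_prodMk (s := s) (t := t)
      have hs1 := hasSum_integral_of_hasGaussianLaw hG (h0 s) (h0 t) (h1 s) (h1 t) (hu s t hst) rfl
        hEm hFm hE hF
      have hs2 := hasSum_integral_of_hasGaussianLaw hG (h0 s) (h0 t) (h1 s) (h1 t) (hu s t hst) rfl
        hEm hEm hE hE
      have hterm : ∀ j, hcoeff (evenPart F) j * hcoeff F j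
          = hcoeff (evenPart F) j * hcoeff (evenPart F) j := by
        intro j
        rw [hcoeff_evenPart hF]
        rcases Nat.even_or_odd j with hj | hj
        · rw [hj.neg_one_pow]; ring
        · rw [hj.neg_one_pow]; ring
      have heq : ∫ ω, evenPart F (Z s ω) * F (Z t ω) ∂P
          = ∫ ω, evenPart F (Z s ω) * evenPart F (Z t ω) ∂P := by
        refine hs1.unique ?_
        simpa only [hterm] using hs2
      refine ⟨?_, heq⟩
      rw [if_neg hst]
      refine hs1.nonneg fun j => ?_
      rw [hterm]
      rcases Nat.even_or_odd j with hj | hj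
      · exact div_nonneg (mul_nonneg (mul_self_nonneg _) (hj.pow_nonneg _)) (by positivity)
      · rw [hcoeff_evenPart hF, hj.neg_one_pow]; simp
  have hSE : MemLp (fun ω => ∑ t ∈ I, evenPart F (Z t ω)) 2 P :=
    memLp_finsetSum I fun t _ => hcomp hEm hE t
  have hSF : MemLp (fun ω => ∑ t ∈ I, F (Z t ω)) 2 P :=
    memLp_finsetSum I fun t _ => hcomp hFm hF t
  have hint : ∀ {G : ℝ → ℝ}, Measurable G → MemLp G 2 γ₁ →
      ∫ ω, (∑ t ∈ I, evenPart F (Z t ω)) * ∑ t ∈ I, G (Z t ω) ∂P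
        = ∑ s ∈ I, ∑ t ∈ I, ∫ ω, evenPart F (Z s ω) * G (Z t ω) ∂P := by
    intro G hGm hG
    simp_rw [Finset.sum_mul_sum]
    rw [integral_finsetSum _ fun s _ => integrable_finsetSum _ fun t _ =>
      integrable_mul_of_memLp (hcomp hEm hE s) (hcomp hGm hG t)]
    exact Finset.sum_congr rfl fun s _ => integral_finsetSum _ fun t _ =>
      integrable_mul_of_memLp (hcomp hEm hE s) (hcomp hGm hG t)
  have hEF : ∫ ω, (∑ t ∈ I, evenPart F (Z t ω)) * ∑ t ∈ I, F (Z t ω) ∂P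
      = ∫ ω, (∑ t ∈ I, evenPart F (Z t ω)) * ∑ t ∈ I, evenPart F (Z t ω) ∂P := by
    rw [hint hFm hF, hint hEm hE]
    exact Finset.sum_congr rfl fun s _ => Finset.sum_congr rfl fun t _ => (hcov s t).2
  have hlow : I.card * ∫ x, evenPart F x ^ 2 ∂γ₁
      ≤ ∫ ω, (∑ t ∈ I, evenPart F (Z t ω)) * ∑ t ∈ I, F (Z t ω) ∂P := by
    rw [hint hFm hF]
    refine le_trans (le_of_eq ?_)
      (Finset.sum_le_sum fun s _ => Finset.sum_le_sum fun t _ => (hcov s t).1)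
    simp
  have hi1 := integrable_mul_of_memLp hSE hSF
  have hi2 := integrable_mul_of_memLp hSE hSE
  -- From (E - S)² ≥ 0 for the sum E of the even parts and the full sum S, together with the
  -- equality of the integrals of ES and E².
  have hmono : ∫ ω, (2 * ((∑ t ∈ I, evenPart F (Z t ω)) * ∑ t ∈ I, F (Z t ω))
        - (∑ t ∈ I, evenPart F (Z t ω)) * ∑ t ∈ I, evenPart F (Z t ω)) ∂P
      ≤ ∫ ω, (∑ t ∈ I, F (Z t ω)) ^ 2 ∂P := by
    refine integral_mono ((hi1.const_mul 2).sub hi2) hSF.integrable_sq fun ω => ?_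
    simp only
    nlinarith [sq_nonneg ((∑ t ∈ I, evenPart F (Z t ω)) - ∑ t ∈ I, F (Z t ω))]
  rw [integral_sub (hi1.const_mul 2) hi2, integral_const_mul, ← hEF] at hmono
  linarith

/-- The second moment of a variable with mixed subgaussian and subexponential tails. -/
theorem lintegral_sq_le_of_tail {Ω : Type*} [MeasurableSpace Ω] {P : Measure Ω}
    [IsProbabilityMeasure P] {B : Ω → ℝ} (hB : AEMeasurable B P) {c a₁ a₂ N : ℝ} (hc : 0 < c)
    (ha₁ : 0 < a₁) (ha₂ : 0 < a₂) (hN : 1 ≤ N)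
    (h : ∀ x : ℝ, 0 < x → P.real {ω | c * x < |B ω|} ≤ a₁ * Real.exp (-a₂ * N * min x (x ^ 2))) :
    ∫⁻ ω, ENNReal.ofReal (B ω ^ 2) ∂P
      ≤ ENNReal.ofReal (c ^ 2 * (a₁ * (2 / a₂ ^ 2 + 1 / a₂) / N)) := by
  have hN0 : 0 < N := by linarith
  have hb : 0 < a₂ * N := by positivity
  have hint1 := integrableOn_rpow_mul_exp_neg_mul_rpow (s := 1) (p := 1) (b := a₂ * N)
    (by norm_num) one_pos hb
  have hint2 := integrableOn_rpow_mul_exp_neg_mul_rpow (s := 1) (p := 2) (b := a₂ * N)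
    (by norm_num) two_pos hb
  have hval1 := integral_rpow_mul_exp_neg_mul_rpow (q := 1) (p := 1) (b := a₂ * N)
    one_pos (by norm_num) hb
  have hval2 := integral_rpow_mul_exp_neg_mul_rpow (q := 1) (p := 2) (b := a₂ * N)
    two_pos (by norm_num) hb
  have e1 : (-(1 + 1) / 1 : ℝ) = -2 := by norm_num
  have e2 : (-(1 + 1) / 2 : ℝ) = -1 := by norm_num
  have e3 : ((1 + 1) / 1 : ℝ) = 1 + 1 := by norm_num
  have e4 : ((1 + 1) / 2 : ℝ) = 1 := by norm_num
  rw [e1, e3, Real.Gamma_add_one one_ne_zero, Real.Gamma_one, Real.rpow_neg hb.le,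
    Real.rpow_two] at hval1
  rw [e2, e4, Real.Gamma_one, Real.rpow_neg hb.le, Real.rpow_one] at hval2
  have key := lintegral_rpow_eq_lintegral_meas_lt_mul P (f := fun ω => |B ω| / c)
    (Filter.Eventually.of_forall fun ω => by positivity) (hB.abs.div_const c) two_pos
  have hscale : ∫⁻ ω, ENNReal.ofReal (B ω ^ 2) ∂P
      = ENNReal.ofReal (c ^ 2) * ∫⁻ ω, ENNReal.ofReal ((|B ω| / c) ^ (2 : ℝ)) ∂P := by
    rw [← lintegral_const_mul'' _ (by fun_prop)]
    refine lintegral_congr fun ω => ?_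
    rw [← ENNReal.ofReal_mul (by positivity), Real.rpow_two, div_pow, sq_abs]
    congr 1; field_simp
  have hbound : ∫⁻ t in Set.Ioi (0 : ℝ), P {ω | t < |B ω| / c} * ENNReal.ofReal (t ^ ((2 : ℝ) - 1))
      ≤ ∫⁻ t in Set.Ioi (0 : ℝ), ENNReal.ofReal (a₁ *
        (t ^ (1 : ℝ) * Real.exp (-(a₂ * N) * t ^ (1 : ℝ))
          + t ^ (1 : ℝ) * Real.exp (-(a₂ * N) * t ^ (2 : ℝ)))) := by
    refine setLIntegral_mono' measurableSet_Ioi fun t ht => ?_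
    have ht0 : (0 : ℝ) < t := ht
    have hset : {ω | t < |B ω| / c} = {ω | c * t < |B ω|} := by
      ext ω; simp only [Set.mem_ofPred_eq]; rw [lt_div_iff₀ hc, mul_comm]
    have hP : P {ω | t < |B ω| / c} ≤ ENNReal.ofReal (a₁ * Real.exp (-a₂ * N * min t (t ^ 2))) := by
      rw [hset, ← ofReal_measureReal]
      exact ENNReal.ofReal_le_ofReal (h t ht0)
    refine (mul_le_mul_left hP _).trans ?_
    rw [← ENNReal.ofReal_mul (by positivity)]
    refine ENNReal.ofReal_le_ofReal ?_
    rw [show (2 : ℝ) - 1 = 1 by norm_num, Real.rpow_one, Real.rpow_two]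
    -- The two tail regimes are added instead of splitting the integral at 1.
    have : Real.exp (-a₂ * N * min t (t ^ 2))
        ≤ Real.exp (-(a₂ * N) * t) + Real.exp (-(a₂ * N) * t ^ 2) := by
      rcases min_choice t (t ^ 2) with h3 | h3 <;> rw [h3, neg_mul a₂ N]
      · linarith [Real.exp_pos (-(a₂ * N) * t ^ 2)]
      · linarith [Real.exp_pos (-(a₂ * N) * t)]
    calc a₁ * Real.exp (-a₂ * N * min t (t ^ 2)) * t
        ≤ a₁ * (Real.exp (-(a₂ * N) * t) + Real.exp (-(a₂ * N) * t ^ 2)) * t := by gcongr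
      _ = _ := by ring
  have hint3 : IntegrableOn (fun t : ℝ => a₁ * (t ^ (1 : ℝ) * Real.exp (-(a₂ * N) * t ^ (1 : ℝ))
      + t ^ (1 : ℝ) * Real.exp (-(a₂ * N) * t ^ (2 : ℝ)))) (Set.Ioi 0) :=
    (hint1.add hint2).const_mul a₁
  rw [← ofReal_integral_eq_lintegral_ofReal hint3
    ((ae_restrict_iff' measurableSet_Ioi).2 (Filter.Eventually.of_forall fun t ht => by
      have : (0 : ℝ) < t := ht
      simp only [Pi.zero_apply]; positivity)), integral_const_mul, integral_add hint1 hint2, hval1,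
    hval2] at hbound
  rw [hscale, key]
  refine (mul_le_mul_right (mul_le_mul_right hbound _) _).trans ?_
  rw [← ENNReal.ofReal_mul (by norm_num), ← ENNReal.ofReal_mul (by positivity)]
  refine ENNReal.ofReal_le_ofReal ?_
  refine mul_le_mul_of_nonneg_left ?_ (by positivity)
  -- The exponential regime gives 1/N², reduced to the common rate 1/N by N ≥ 1.
  have h5 : ((a₂ * N) ^ 2)⁻¹ ≤ 1 / a₂ ^ 2 / N := by
    rw [div_div, one_div]
    gcongr
    rw [mul_pow]; gcongr; nlinarith
  have h6 : (a₂ * N)⁻¹ = 1 / a₂ / N := by rw [div_div, one_div]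
  rw [h6]
  have h7 : a₁ * (2 / a₂ ^ 2 + 1 / a₂) / N
      = 2 * (a₁ * (1 / a₂ ^ 2 / N + 1 / a₂ / N * (1 / 2))) := by field_simp
  rw [h7]
  refine mul_le_mul_of_nonneg_left (mul_le_mul_of_nonneg_left ?_ ha₁.le) two_pos.le
  linarith

end

section

variable {Ω : Type u} [MeasurableSpace Ω] {μ : Measure Ω}

namespace Model

variable (M : Model μ)

/-! ## Covariances of the latent and of the observed series -/

/-- The true marginal distribution. -/
def trueLaw (i : Fin M.d) : PMF ℕ := M.law i (M.param i)

theorem gaussian_pair (s t : ℤ) (i j : Fin M.d) :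
    HasGaussianLaw (fun ω => (M.Z s i ω, M.Z t j ω)) μ :=
  M.gaussian.hasGaussianLaw_prodMk (s := (s, i)) (t := (t, j))

theorem aemeasurable_Z (t : ℤ) (i : Fin M.d) : AEMeasurable (M.Z t i) μ :=
  M.gaussian.aemeasurable (t, i)

theorem map_Z (t : ℤ) (i : Fin M.d) : μ.map (M.Z t i) = γ₁ :=
  map_eq_std_of_hasGaussianLaw (M.gaussian.hasGaussianLaw_eval (t, i)) (M.mean_eq_zero t i)
    (M.variance_eq_one t i)

theorem integral_Z_mul_Z (s t : ℤ) (i j : Fin M.d) :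
    ∫ ω, M.Z s i ω * M.Z t j ω ∂μ = M.acvfZ (s - t) i j := by
  have := M.stationary t (s - t) i j
  rwa [add_sub_cancel] at this

theorem integral_comp_Z {G : ℝ → ℝ} (hG : Measurable G) (t : ℤ) (i : Fin M.d) :
    ∫ ω, G (M.Z t i ω) ∂μ = ∫ z, G z ∂γ₁ := by
  rw [← M.map_Z t i]
  exact (integral_map (M.aemeasurable_Z t i) hG.aestronglyMeasurable).symm

theorem memLp_comp_Z_iff {G : ℝ → ℝ} (hG : Measurable G) (t : ℤ) (i : Fin M.d) :
    MemLp (fun ω => G (M.Z t i ω)) 2 μ ↔ MemLp G 2 γ₁ := by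
  rw [← M.map_Z t i]
  exact (memLp_map_measure_iff hG.aestronglyMeasurable (M.aemeasurable_Z t i)).symm

theorem memLp_Z (t : ℤ) (i : Fin M.d) : MemLp (M.Z t i) 2 μ :=
  (M.gaussian.hasGaussianLaw_eval (t, i)).memLp_two

theorem bigZ_eq_integral (L : ℕ) (a b : Fin L × Fin M.d) :
    M.bigZ L a b = ∫ ω, M.Z (-(a.1 : ℤ)) a.2 ω * M.Z (-(b.1 : ℤ)) b.2 ω ∂μ := by
  rw [integral_Z_mul_Z, bigZ, Matrix.of_apply]; congr 1; ring

theorem isSymm_bigZ (L : ℕ) : (M.bigZ L).IsSymm := by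
  ext a b
  rw [Matrix.transpose_apply, bigZ_eq_integral, bigZ_eq_integral]
  simp only [mul_comm]

theorem bigZ_self (L : ℕ) (a : Fin L × Fin M.d) : M.bigZ L a a = 1 := by
  rw [bigZ_eq_integral, ← M.variance_eq_one (-(a.1 : ℤ)) a.2]
  simp only [sq]

theorem bigZ_form_nonneg (L : ℕ) (v : Fin L × Fin M.d → ℝ) : 0 ≤ v ⬝ᵥ (M.bigZ L).mulVec v := by
  have hi : ∀ a b : Fin L × Fin M.d,
      Integrable (fun ω => v a * (M.Z (-(a.1 : ℤ)) a.2 ω * M.Z (-(b.1 : ℤ)) b.2 ω) * v b) μ :=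
    fun a b => ((integrable_mul_of_memLp (M.memLp_Z _ _) (M.memLp_Z _ _)).const_mul _).mul_const _
  have : v ⬝ᵥ (M.bigZ L).mulVec v = ∫ ω, (∑ a, v a * M.Z (-(a.1 : ℤ)) a.2 ω) ^ 2 ∂μ := by
    rw [dotProduct_mulVec_eq_sum]
    simp_rw [sq, Finset.sum_mul_sum, bigZ_eq_integral]
    have e : ∀ ω (a b : Fin L × Fin M.d), v a * M.Z (-(a.1 : ℤ)) a.2 ω
        * (v b * M.Z (-(b.1 : ℤ)) b.2 ω)
        = v a * (M.Z (-(a.1 : ℤ)) a.2 ω * M.Z (-(b.1 : ℤ)) b.2 ω) * v b := fun ω a b => by ring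
    simp_rw [e]
    rw [integral_finsetSum _ fun a _ => integrable_finsetSum _ fun b _ => hi a b]
    refine Finset.sum_congr rfl fun a _ => ?_
    rw [integral_finsetSum _ fun b _ => hi a b]
    refine Finset.sum_congr rfl fun b _ => ?_
    rw [integral_mul_const, integral_const_mul]
  rw [this]
  exact integral_nonneg fun ω => sq_nonneg _

variable {M}

theorem BoundedCorrelations.abs_bigZ_lt {cZ : ℝ} (h : M.BoundedCorrelations cZ) {L : ℕ}
    {a b : Fin L × Fin M.d} (hab : a ≠ b) : |M.bigZ L a b| < cZ := by
  rw [bigZ, Matrix.of_apply]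
  by_cases h1 : a.1 = b.1
  · have h2 : a.2 ≠ b.2 := fun h2 => hab (Prod.ext h1 h2)
    rw [h1, sub_self]
    exact h.2.2.2 _ _ h2
  · refine h.2.2.1 _ _ _ fun h3 => h1 ?_
    have : (a.1 : ℕ) = b.1 := by omega
    exact Fin.ext this

theorem FiniteMoments.secondMoment (h : M.FiniteMoments) {i : Fin M.d} {ϑ : Fin (M.K i) → ℝ}
    (hϑ : ϑ ∈ M.paramSet i) : SecondMoment (M.law i ϑ) := by
  obtain ⟨S, -, -, hS, r, hr, hfin⟩ := h i ϑ hϑ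
  exact secondMoment_of_moment hr (lt_of_le_of_lt
    (le_iSup₂ (f := fun ϑ' (_ : ϑ' ∈ S) => ∑' n : ℕ, M.law i ϑ' n * ENNReal.ofReal ((n : ℝ) ^ r))
      ϑ hS) hfin)

theorem memLp_X (hM : ∀ i, SecondMoment (M.trueLaw i)) (t : ℤ) (i : Fin M.d) : MemLp (M.X t i) 2 μ :=
  (M.memLp_comp_Z_iff (measurable_transform _) t i).2 (hM i)

theorem integral_X (t : ℤ) (i : Fin M.d) : ∫ ω, M.X t i ω ∂μ = countMean (M.trueLaw i) := by
  rw [countMean]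
  exact M.integral_comp_Z (measurable_transform _) t i

theorem acvfX_eq_link [IsProbabilityMeasure μ]
    (hM : ∀ i, SecondMoment (M.trueLaw i)) {h : ℤ} {i j : Fin M.d} (hu : |M.acvfZ h i j| < 1) :
    M.acvfX h i j = link (M.trueLaw i) (M.trueLaw j) (M.acvfZ h i j) := by
  rw [acvfX, covariance_eq_sub (memLp_X hM h i) (memLp_X hM 0 j), integral_X, integral_X]
  have := integral_transform_mul_of_hasGaussianLaw (M.gaussian_pair h 0 i j)
    (M.mean_eq_zero h i) (M.mean_eq_zero 0 j) (M.variance_eq_one h i) (M.variance_eq_one 0 j) hu rfl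
    (hM i) (hM j)
  have h2 : ∫ ω, (M.X h i * M.X 0 j) ω ∂μ = countMean (M.trueLaw i) * countMean (M.trueLaw j)
      + link (M.trueLaw i) (M.trueLaw j) (M.acvfZ h i j) := this
  rw [h2]; ring

theorem acvfX_zero_self [IsProbabilityMeasure μ]
    (hM : ∀ i, SecondMoment (M.trueLaw i)) (i : Fin M.d) :
    M.acvfX 0 i i = link (M.trueLaw i) (M.trueLaw i) 1 := by
  rw [acvfX, covariance_self (memLp_X hM 0 i).aemeasurable,
    ProbabilityTheory.variance_eq_integral (memLp_X hM 0 i).aemeasurable,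
    LatentCount.variance_eq_integral (hM i), integral_X]
  exact M.integral_comp_Z (G := fun z => (transform (M.trueLaw i) z - countMean (M.trueLaw i)) ^ 2)
    (((measurable_transform _).sub_const _).pow_const 2) 0 i

theorem bigX_eq_link [IsProbabilityMeasure μ]
    (hM : ∀ i, SecondMoment (M.trueLaw i)) {cZ : ℝ} (hc : M.BoundedCorrelations cZ) {L : ℕ}
    {a b : Fin L × Fin M.d} (hab : a ≠ b) :
    M.bigX L a b = link (M.trueLaw a.2) (M.trueLaw b.2) (M.bigZ L a b) :=
  acvfX_eq_link hM ((hc.abs_bigZ_lt hab).trans hc.2.1)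

theorem bigX_self [IsProbabilityMeasure μ]
    (hM : ∀ i, SecondMoment (M.trueLaw i)) {L : ℕ} (a : Fin L × Fin M.d) :
    M.bigX L a a = link (M.trueLaw a.2) (M.trueLaw a.2) 1 := by
  rw [bigX, Matrix.of_apply, sub_self]
  exact acvfX_zero_self hM a.2

theorem isSymm_bigX [IsProbabilityMeasure μ]
    (hM : ∀ i, SecondMoment (M.trueLaw i)) {cZ : ℝ} (hc : M.BoundedCorrelations cZ) (L : ℕ) :
    (M.bigX L).IsSymm := by
  ext a b
  rw [Matrix.transpose_apply]
  rcases eq_or_ne a b with rfl | hab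
  · rfl
  · rw [bigX_eq_link hM hc hab, bigX_eq_link hM hc hab.symm, link_comm,
      (M.isSymm_bigZ L).apply]

theorem isSymm_bigXHat (L T : ℕ) (ω : Ω) : (M.bigXHat L T ω).IsSymm := by
  ext a b
  simp only [Matrix.transpose_apply, bigXHat, Matrix.of_apply, mul_comm]

theorem centeredX_eq (t : ℤ) (i : Fin M.d) (ω : Ω) :
    M.centeredX t i ω = transform (M.trueLaw i) (M.Z t i ω) - countMean (M.trueLaw i) := by
  rw [centeredX, integral_X]; rfl

/-- The constant `c₀` of the concentration inequality cannot be much smaller than the fourth moment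
caused by small values of the counts. -/
theorem ConcentrationX.le_mul [IsProbabilityMeasure μ]
    (hM : ∀ i, SecondMoment (M.trueLaw i)) {cZ : ℝ} (hc : M.BoundedCorrelations cZ)
    {L T s : ℕ} {c₀ a₁ a₂ : ℝ} (ha₁ : 0 < a₁) (ha₂ : 0 < a₂) (hLT : L < T) (hs : 1 ≤ s)
    (hX : M.ConcentrationX L T s c₀ a₁ a₂) (a : Fin L × Fin M.d)
    (hV : link (M.trueLaw a.2) (M.trueLaw a.2) 1 < countMean (M.trueLaw a.2) ^ 2 / 16) :
    √(countCDF (M.trueLaw a.2) ⌊countMean (M.trueLaw a.2) / 2⌋₊) * countMean (M.trueLaw a.2) ^ 2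
      ≤ 16 * √(a₁ * (2 / a₂ ^ 2 + 1 / a₂)) * c₀ := by
  obtain ⟨hc₀, hX⟩ := hX
  set p := M.trueLaw a.2 with hp
  set e := countMean p with he
  set V := link p p 1 with hVdef
  set I := Finset.Ico (L : ℤ) (T : ℤ) with hI
  have hcard : I.card = T - L := by rw [hI, Int.card_Ico]; omega
  set N : ℝ := ((T - L : ℕ) : ℝ) with hN
  have hN1 : 1 ≤ N := by rw [hN]; exact_mod_cast (by omega : 1 ≤ T - L)
  have hN0 : 0 < N := by linarith
  set F : ℝ → ℝ := fun z => (transform p z - e) ^ 2 with hF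
  have hFm : Measurable F := ((measurable_transform p).sub_const _).pow_const 2
  have hF0 : ∀ z, 0 ≤ F z := fun z => sq_nonneg _
  have hV0 : 0 ≤ V := by
    rw [hVdef, LatentCount.variance_eq_integral (hM a.2)]
    exact integral_nonneg fun z => sq_nonneg _
  set Y : ℤ → Ω → ℝ := fun t => M.Z (t - (a.1 : ℤ)) a.2 with hY
  set B : Ω → ℝ := fun ω => (M.bigXHat L T ω - M.bigX L) a a with hB
  have hBeq : ∀ ω, N * B ω = ∑ t ∈ I, (F (Y t ω) - V) := by
    intro ω
    simp only [hB, Matrix.sub_apply]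
    rw [bigX_self hM, bigXHat, Matrix.of_apply, Finset.sum_sub_distrib, Finset.sum_const, hcard,
      nsmul_eq_mul, mul_sub, ← mul_assoc, mul_inv_cancel₀ hN0.ne', one_mul]
    congr 1
    refine Finset.sum_congr rfl fun t _ => ?_
    rw [centeredX_eq, ← sq]
  have hBeq' : B = fun ω => N⁻¹ * ∑ t ∈ I, (F (Y t ω) - V) := by
    ext ω; rw [← hBeq, ← mul_assoc, inv_mul_cancel₀ hN0.ne', one_mul]
  have hYm : ∀ t, AEMeasurable (Y t) μ := fun t => M.aemeasurable_Z _ _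
  have hBm : AEMeasurable B μ := by
    rw [hBeq']
    exact (Finset.aemeasurable_fun_sum I fun t _ =>
      (hFm.comp_aemeasurable (hYm t)).sub_const V).const_mul _
  set Cst := a₁ * (2 / a₂ ^ 2 + 1 / a₂) with hCst
  have hCst0 : 0 < Cst := by positivity
  -- The concentration hypothesis at a unit vector, which is admissible because s ≥ 1, concerns a
  -- single sample variance.
  have htail := lintegral_sq_le_of_tail hBm (by linarith : 0 < c₀) ha₁ ha₂ hN1 fun x hx => by
    have := hX (Pi.single a 1) (by simp [Pi.single_apply]) (isSparse_single hs a 1) x hx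
    simpa only [single_dotProduct, Matrix.mulVec_single_one, Matrix.col_apply, one_mul] using this
  have hBint : Integrable (fun ω => B ω ^ 2) μ :=
    ⟨(hBm.pow_const 2).aestronglyMeasurable, by
      rw [hasFiniteIntegral_iff_ofReal (Filter.Eventually.of_forall fun ω => sq_nonneg _)]
      exact htail.trans_lt ENNReal.ofReal_lt_top⟩
  have hBL : MemLp B 2 μ := (memLp_two_iff_integrable_sq hBm.aestronglyMeasurable).2 hBint
  have hBle : ∫ ω, B ω ^ 2 ∂μ ≤ c₀ ^ 2 * (Cst / N) := by
    rw [integral_eq_lintegral_of_nonneg_ae (Filter.Eventually.of_forall fun ω => sq_nonneg _)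
      hBint.aestronglyMeasurable]
    exact ENNReal.toReal_le_of_le_ofReal (by positivity) htail
  -- Square integrability of (X - EX)² is a consequence: one summand is at most the sum of all,
  -- which is N(B + V), and B is square integrable by the tail bound.
  have hFL : MemLp F 2 γ₁ := by
    have hmem : (L : ℤ) ∈ I := Finset.mem_Ico.2 ⟨le_rfl, by exact_mod_cast hLT⟩
    refine (M.memLp_comp_Z_iff hFm ((L : ℤ) - (a.1 : ℤ)) a.2).1 ?_
    refine MemLp.of_le ((hBL.const_mul N).add (memLp_const (N * V)))
      (hFm.comp_aemeasurable (hYm L)).aestronglyMeasurable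
      (Filter.Eventually.of_forall fun ω => ?_)
    have h1 : F (Y L ω) ≤ ∑ t ∈ I, F (Y t ω) :=
      Finset.single_le_sum (f := fun t => F (Y t ω)) (fun t _ => hF0 _) hmem
    have h2 := hBeq ω
    rw [Finset.sum_sub_distrib, Finset.sum_const, hcard, nsmul_eq_mul] at h2
    rw [Real.norm_of_nonneg (hF0 _)]
    refine le_trans ?_ (le_abs_self _)
    simp only [Pi.add_apply]
    change F (Y L ω) ≤ _
    linarith
  set ψ : ℝ → ℝ := fun z => F z - V with hψ
  have hψm : Measurable ψ := hFm.sub_const V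
  have hψL : MemLp ψ 2 γ₁ := hFL.sub (memLp_const V)
  have hG : IsGaussianProcess Y μ :=
    M.gaussian.comp_right (fun t : ℤ => (t - (a.1 : ℤ), a.2))
  have hcov := card_mul_integral_evenPart_le hG (fun t => M.mean_eq_zero _ _)
    (fun t => M.variance_eq_one _ _) (fun t t' htt => by
      rw [M.integral_Z_mul_Z]
      refine (hc.2.2.1 _ _ _ ?_).trans hc.2.1
      intro h; apply htt; omega) hψm hψL I
  have hsum : ∫ ω, (∑ t ∈ I, ψ (Y t ω)) ^ 2 ∂μ = N ^ 2 * ∫ ω, B ω ^ 2 ∂μ := by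
    rw [← integral_const_mul]
    refine integral_congr_ae (Filter.Eventually.of_forall fun ω => ?_)
    simp only [hψ]
    rw [← hBeq, mul_pow]
  set η := countCDF p ⌊e / 2⌋₊ with hη
  have hη0 : 0 ≤ η := countCDF_nonneg _ _
  have he0 : 0 ≤ e := countMean_nonneg p
  have hEL := memLp_evenPart hψL
  -- Where the count is at most e/2, F is at least e²/4. Averaging with F(-z) ≥ 0 halves this, and
  -- subtracting V < e²/16 leaves e²/16.
  have hlow : η * (e ^ 2 / 16) ^ 2 ≤ ∫ z, evenPart ψ z ^ 2 ∂γ₁ := by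
    set A := (exceed p ⌊e / 2⌋₊)ᶜ with hA
    have hAm : MeasurableSet A := (measurableSet_exceed _ _).compl
    refine le_trans ?_ (setIntegral_le_integral (s := A) hEL.integrable_sq
      (Filter.Eventually.of_forall fun z => sq_nonneg _))
    have : η * (e ^ 2 / 16) ^ 2 = ∫ z in A, (e ^ 2 / 16) ^ 2 ∂γ₁ := by
      rw [setIntegral_const, smul_eq_mul, hA, measureReal_compl_exceed]
    rw [this]
    refine setIntegral_mono_on (integrable_const _).integrableOn hEL.integrable_sq.integrableOn hAm
      fun z hz => ?_
    have h1 : transform p z ≤ e / 2 :=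
      (transform_le_of_notMem_exceed hz).trans (Nat.floor_le (by positivity))
    have h2 : e ^ 2 / 4 ≤ F z := by simp only [hF]; nlinarith
    have h3 : e ^ 2 / 16 ≤ evenPart ψ z := by
      simp only [evenPart, hψ]
      linarith [hF0 (-z)]
    gcongr
  rw [hcard] at hcov
  have h1 : N * (η * (e ^ 2 / 16) ^ 2) ≤ N * (c₀ ^ 2 * Cst) := by
    calc N * (η * (e ^ 2 / 16) ^ 2) ≤ N * ∫ z, evenPart ψ z ^ 2 ∂γ₁ := by gcongr
      _ ≤ N ^ 2 * ∫ ω, B ω ^ 2 ∂μ := hcov.trans hsum.le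
      _ ≤ N ^ 2 * (c₀ ^ 2 * (Cst / N)) := by gcongr
      _ = _ := by field_simp
  have h2 := le_of_mul_le_mul_left h1 hN0
  have h3 : (√η * (e ^ 2 / 16)) ^ 2 ≤ (√Cst * c₀) ^ 2 := by
    rw [mul_pow, mul_pow, Real.sq_sqrt hη0, Real.sq_sqrt hCst0.le]; linarith
  have h4 := (pow_le_pow_iff_left₀ (by positivity) (by positivity) two_ne_zero).1 h3
  linarith

end Model

end

section

/-! ## Nets and a union bound over sparse vectors -/

/-- The unit ball of a `k`-dimensional space has a `1/2`-net with at most `5 ^ k` points. -/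
theorem exists_half_net (E : Type*) [NormedAddCommGroup E] [NormedSpace ℝ E]
    [FiniteDimensional ℝ E] :
    ∃ 𝒩 : Finset E, 𝒩.card ≤ 5 ^ Module.finrank ℝ E ∧ (∀ u ∈ 𝒩, ‖u‖ ≤ 1) ∧
      ∀ x : E, ‖x‖ ≤ 1 → ∃ u ∈ 𝒩, ‖x - u‖ ≤ 1 / 2 := by
  classical
  -- After doubling, the points lie in the ball of radius 2 and are at mutual distance at least 1,
  -- the normalization of the volume bound 5^k.
  have hbound : ∀ 𝒩 : Finset E, (∀ u ∈ 𝒩, ‖u‖ ≤ 1) →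
      (∀ u ∈ 𝒩, ∀ w ∈ 𝒩, u ≠ w → 1 / 2 ≤ ‖u - w‖) → 𝒩.card ≤ 5 ^ Module.finrank ℝ E := by
    intro 𝒩 h1 h2
    have hinj : Function.Injective fun u : E => (2 : ℝ) • u :=
      smul_right_injective E (two_ne_zero' ℝ)
    rw [← Finset.card_image_of_injective 𝒩 hinj]
    refine Besicovitch.card_le_of_separated _ ?_ ?_
    · intro c hc
      obtain ⟨u, hu, rfl⟩ := Finset.mem_image.1 hc
      rw [norm_smul, Real.norm_of_nonneg zero_le_two]; linarith [h1 u hu]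
    · intro c hc d hd hcd
      obtain ⟨u, hu, rfl⟩ := Finset.mem_image.1 hc
      obtain ⟨w, hw, rfl⟩ := Finset.mem_image.1 hd
      rw [← smul_sub, norm_smul, Real.norm_of_nonneg zero_le_two]
      linarith [h2 u hu w hw fun h => hcd (by rw [h])]
  -- A separated set of maximal cardinality is a net: a point far from all its elements could be
  -- added.
  set A : Set ℕ := {n | ∃ 𝒩 : Finset E, 𝒩.card = n ∧ (∀ u ∈ 𝒩, ‖u‖ ≤ 1) ∧
    ∀ u ∈ 𝒩, ∀ w ∈ 𝒩, u ≠ w → 1 / 2 ≤ ‖u - w‖} with hA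
  have hbdd : BddAbove A := ⟨5 ^ Module.finrank ℝ E, by
    rintro n ⟨𝒩, rfl, h1, h2⟩; exact hbound 𝒩 h1 h2⟩
  obtain ⟨𝒩, hcard, h1, h2⟩ := Nat.sSup_mem (s := A) ⟨0, ∅, by simp⟩ hbdd
  refine ⟨𝒩, hbound 𝒩 h1 h2, h1, fun x hx => ?_⟩
  by_contra! hcon
  have hx𝒩 : x ∉ 𝒩 := fun h => by have := hcon x h; norm_num at this
  have hmem : (insert x 𝒩).card ∈ A := by
    refine ⟨_, rfl, ?_, ?_⟩
    · intro u hu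
      rcases Finset.mem_insert.1 hu with rfl | hu
      exacts [hx, h1 u hu]
    · intro u hu w hw huw
      rcases Finset.mem_insert.1 hu with h3 | h3 <;> rcases Finset.mem_insert.1 hw with h4 | h4
      · exact absurd (h3.trans h4.symm) huw
      · rw [h3]; exact (hcon w h4).le
      · rw [h4, norm_sub_rev]; exact (hcon u h3).le
      · exact h2 u h3 w h4 huw
  have := le_csSup hbdd hmem
  rw [Finset.card_insert_of_notMem hx𝒩, hcard] at this
  omega

/-- Approximation by the net in one argument loses a factor 2, as the error is half the norm being
bounded; two arguments give 4. -/
theorem norm_bilin_le_of_net {E : Type*} [NormedAddCommGroup E] [NormedSpace ℝ E]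
    (b : E →L[ℝ] E →L[ℝ] ℝ) {𝒩 : Finset E} (h𝒩 : ∀ x : E, ‖x‖ ≤ 1 → ∃ u ∈ 𝒩, ‖x - u‖ ≤ 1 / 2)
    {m : ℝ} (hm0 : 0 ≤ m) (hm : ∀ u ∈ 𝒩, ∀ w ∈ 𝒩, |b u w| ≤ m) : ‖b‖ ≤ 4 * m := by
  have h1 : ∀ u ∈ 𝒩, ‖b u‖ ≤ 2 * m := by
    intro u hu
    have : ‖b u‖ ≤ m + ‖b u‖ / 2 := by
      refine ContinuousLinearMap.opNorm_le_of_unit_norm (by positivity) fun y hy => ?_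
      obtain ⟨w, hw, hyw⟩ := h𝒩 y hy.le
      have e : b u y = b u w + b u (y - w) := by rw [map_sub]; ring
      rw [e]
      refine (norm_add_le _ _).trans (add_le_add (hm u hu w hw) ?_)
      refine ((b u).le_opNorm _).trans ?_
      rw [div_eq_mul_one_div]; gcongr
    linarith
  have : ‖b‖ ≤ 2 * m + ‖b‖ / 2 := by
    refine ContinuousLinearMap.opNorm_le_of_unit_norm (by positivity) fun x hx => ?_
    obtain ⟨u, hu, hxu⟩ := h𝒩 x hx.le
    have e : b x = b u + b (x - u) := by rw [map_sub]; abel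
    rw [e]
    refine (norm_add_le _ _).trans (add_le_add (h1 u hu) ?_)
    refine (b.le_opNorm _).trans ?_
    rw [div_eq_mul_one_div]; gcongr
  linarith

variable {ι : Type}

open Classical in
/-- Extension of a vector by zero. -/
noncomputable def extendVec (S : Finset ι) : EuclideanSpace ℝ S →ₗ[ℝ] ι → ℝ where
  toFun x a := if h : a ∈ S then x ⟨a, h⟩ else 0
  map_add' x y := by ext a; by_cases h : a ∈ S <;> simp [h]
  map_smul' c x := by ext a; by_cases h : a ∈ S <;> simp [h]

theorem extendVec_of_notMem {S : Finset ι} (x : EuclideanSpace ℝ S) {a : ι} (h : a ∉ S) :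
    extendVec S x a = 0 := by simp [extendVec, h]

theorem extendVec_restrict {S : Finset ι} {v : ι → ℝ} (hv : ∀ a ∉ S, v a = 0) :
    extendVec S (WithLp.toLp 2 fun a : S => v a) = v := by
  ext a
  by_cases h : a ∈ S
  · simp [extendVec, h]
  · rw [extendVec_of_notMem _ h, hv a h]

theorem isSparse_extendVec {S : Finset ι} {s : ℕ} (hS : S.card ≤ 2 * s) (x : EuclideanSpace ℝ S) :
    IsSparse s (extendVec S x) := by
  refine le_trans ?_ hS
  rw [← Set.ncard_coe_finset]
  refine Set.ncard_le_ncard (fun a ha => ?_) S.finite_toSet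
  by_contra h
  exact ha (extendVec_of_notMem x h)

variable [Fintype ι]

theorem sum_extendVec_sq (S : Finset ι) (x : EuclideanSpace ℝ S) :
    ∑ a, extendVec S x a ^ 2 = ‖x‖ ^ 2 := by
  rw [EuclideanSpace.real_norm_sq_eq, ← Finset.sum_subset (Finset.subset_univ S)
    (fun a _ ha => by rw [extendVec_of_notMem x ha]; simp), ← Finset.sum_coe_sort S]
  exact Finset.sum_congr rfl fun a _ => by simp [extendVec]

/-- A finite set of sparse test vectors in the unit ball controls the sparse norm. -/
theorem exists_sparse_net [DecidableEq ι] (s : ℕ) :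
    ∃ 𝒱 : Finset (ι → ℝ),
      𝒱.card ≤ 2 * (25 * Fintype.card ι) ^ min (2 * s) (Fintype.card ι) ∧
      (∀ v ∈ 𝒱, ∑ a, v a ^ 2 ≤ 1 ∧ IsSparse s v) ∧
      ∀ A : Matrix ι ι ℝ, A.IsSymm → ∀ t : ℝ, 0 ≤ t → (∀ v ∈ 𝒱, |v ⬝ᵥ A.mulVec v| ≤ t) →
        sparseNorm s A ≤ 8 * t := by
  classical
  set n := Fintype.card ι with hn
  -- Supports are enlarged to a common size k, so that only sets of exactly k elements are counted.
  set k := min (2 * s) n with hk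
  choose 𝒩 hcard hunit hnet using fun S : Finset ι => exists_half_net (EuclideanSpace ℝ S)
  -- The hypothesis controls only quadratic forms. The test vectors (u ± w)/2 stay in the unit ball
  -- and recover the bilinear form at net points by polarization; this makes the constant 4 · 2 = 8.
  set half : (S : Finset ι) → EuclideanSpace ℝ S × EuclideanSpace ℝ S × Bool → ι → ℝ :=
    fun S p => extendVec S ((1 / 2 : ℝ) • (if p.2.2 then p.1 + p.2.1 else p.1 - p.2.1)) with hhalf
  refine ⟨(Finset.powersetCard k Finset.univ).biUnion fun S =>
    (𝒩 S ×ˢ 𝒩 S ×ˢ Finset.univ).image (half S), ?_, ?_, ?_⟩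
  · refine Finset.card_biUnion_le.trans ?_
    calc ∑ S ∈ Finset.powersetCard k (Finset.univ : Finset ι),
          ((𝒩 S ×ˢ 𝒩 S ×ˢ (Finset.univ : Finset Bool)).image (half S)).card
        ≤ ∑ S ∈ Finset.powersetCard k (Finset.univ : Finset ι), 2 * 25 ^ k := by
          refine Finset.sum_le_sum fun S hS => Finset.card_image_le.trans ?_
          have hSk : S.card = k := (Finset.mem_powersetCard.1 hS).2
          have h5 := hcard S
          rw [finrank_euclideanSpace, Fintype.card_coe, hSk] at h5
          rw [Finset.card_product, Finset.card_product, Finset.card_univ, Fintype.card_bool]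
          calc (𝒩 S).card * ((𝒩 S).card * 2) ≤ 5 ^ k * (5 ^ k * 2) := by gcongr
            _ = 2 * 25 ^ k := by
              rw [← mul_assoc, ← mul_pow, mul_comm]; norm_num
      _ = n.choose k * (2 * 25 ^ k) := by
          rw [Finset.sum_const, Finset.card_powersetCard, Finset.card_univ, smul_eq_mul]
      _ ≤ n ^ k * (2 * 25 ^ k) := by gcongr; exact Nat.choose_le_pow n k
      _ = _ := by rw [mul_pow]; ring
  · intro v hv
    obtain ⟨S, hS, hv⟩ := Finset.mem_biUnion.1 hv
    obtain ⟨⟨u, w, c⟩, hp, rfl⟩ := Finset.mem_image.1 hv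
    have hSk : S.card = k := (Finset.mem_powersetCard.1 hS).2
    rw [Finset.mem_product, Finset.mem_product] at hp
    have hu := hunit S u hp.1
    have hw := hunit S w hp.2.1
    refine ⟨?_, isSparse_extendVec (by rw [hSk]; exact min_le_left _ _) _⟩
    simp only [hhalf]
    rw [sum_extendVec_sq, norm_smul, Real.norm_of_nonneg (by norm_num)]
    have : ‖(if c = true then u + w else u - w)‖ ≤ 2 := by
      split_ifs
      · exact (norm_add_le _ _).trans (by linarith)
      · exact (norm_sub_le _ _).trans (by linarith)
    refine pow_le_one₀ (by positivity) (by linarith)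
  · intro A hA t ht hv
    refine sparseNorm_le fun v hv1 hvs => ?_
    set S₀ : Finset ι := Finset.univ.filter fun a => v a ≠ 0 with hS₀
    have hS₀card : S₀.card ≤ k := by
      refine le_min ?_ (Finset.card_le_univ _)
      have : ({a | v a ≠ 0} : Set ι) = S₀ := by ext a; simp [hS₀]
      rw [IsSparse, this, Set.ncard_coe_finset] at hvs
      exact hvs
    obtain ⟨S, hS₀S, -, hSk⟩ := Finset.exists_subsuperset_card_eq (Finset.subset_univ S₀) hS₀card
      (by rw [Finset.card_univ]; exact min_le_right _ _)
    have hvS : ∀ a ∉ S, v a = 0 := fun a ha => by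
      by_contra h; exact ha (hS₀S (by simp [hS₀, h]))
    set b : EuclideanSpace ℝ S →L[ℝ] EuclideanSpace ℝ S →L[ℝ] ℝ :=
      ((Matrix.toLinearMap₂' ℝ A).compl₁₂ (extendVec S) (extendVec S)).toContinuousBilinearMap
      with hb
    have hbapp : ∀ x y, b x y = extendVec S x ⬝ᵥ A.mulVec (extendVec S y) := fun x y => by
      rw [hb, LinearMap.toContinuousBilinearMap_apply, LinearMap.compl₁₂_apply,
        Matrix.toLinearMap₂'_apply']
    have hcomm : ∀ x y, b x y = b y x := fun x y => by
      rw [hbapp, hbapp, Matrix.dotProduct_mulVec, ← Matrix.mulVec_transpose, hA.eq, dotProduct_comm]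
    have hbn : ‖b‖ ≤ 4 * (2 * t) := by
      refine norm_bilin_le_of_net b (hnet S) (by positivity) fun u hu w hw => ?_
      have hpol : b u w = b ((1 / 2 : ℝ) • (u + w)) ((1 / 2 : ℝ) • (u + w))
          - b ((1 / 2 : ℝ) • (u - w)) ((1 / 2 : ℝ) • (u - w)) := by
        simp only [map_smul, map_add, map_sub, smul_apply, add_apply, sub_apply, smul_eq_mul]
        rw [hcomm w u]; ring
      have hmem : ∀ c : Bool, |half S (u, w, c) ⬝ᵥ A.mulVec (half S (u, w, c))| ≤ t := fun c =>
        hv _ (Finset.mem_biUnion.2 ⟨S, Finset.mem_powersetCard.2 ⟨Finset.subset_univ _, hSk⟩,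
          Finset.mem_image_of_mem _ (Finset.mem_product.2 ⟨hu, Finset.mem_product.2
            ⟨hw, Finset.mem_univ _⟩⟩)⟩)
      have h1 := hmem true
      have h2 := hmem false
      simp only [hhalf, if_true, Bool.false_eq_true, if_false] at h1 h2
      rw [hpol, hbapp, hbapp]
      exact (abs_sub _ _).trans (by linarith)
    set x : EuclideanSpace ℝ S := WithLp.toLp 2 fun a : S => v a with hx
    have hxv : extendVec S x = v := extendVec_restrict hvS
    have hx1 : ‖x‖ ≤ 1 := by
      have := sum_extendVec_sq S x
      rw [hxv] at this
      have h3 : ‖x‖ ^ 2 ≤ 1 := this ▸ hv1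
      exact (sq_le_one_iff₀ (norm_nonneg _)).1 h3
    have := b.le_opNorm₂ x x
    rw [hbapp, hxv, Real.norm_eq_abs] at this
    refine this.trans ?_
    calc ‖b‖ * ‖x‖ * ‖x‖ ≤ 4 * (2 * t) * 1 * 1 := by gcongr
      _ = 8 * t := by ring

theorem measureReal_sparseNorm_gt_le [DecidableEq ι] {Ω : Type*} [MeasurableSpace Ω]
    {P : Measure Ω} [IsFiniteMeasure P] {B : Ω → Matrix ι ι ℝ} (hB : ∀ ω, (B ω).IsSymm) {s : ℕ}
    {t r : ℝ} (ht : 0 ≤ t)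
    (h : ∀ v : ι → ℝ, ∑ a, v a ^ 2 ≤ 1 → IsSparse s v →
      P.real {ω | t < |v ⬝ᵥ (B ω).mulVec v|} ≤ r) (hr : 0 ≤ r) :
    P.real {ω | 8 * t < sparseNorm s (B ω)}
      ≤ 2 * (25 * Fintype.card ι) ^ min (2 * s) (Fintype.card ι) * r := by
  obtain ⟨𝒱, hcard, h𝒱, hnorm⟩ := exists_sparse_net (ι := ι) s
  have hsub : {ω | 8 * t < sparseNorm s (B ω)}
      ⊆ ⋃ v ∈ 𝒱, {ω | t < |v ⬝ᵥ (B ω).mulVec v|} := by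
    intro ω hω
    by_contra hcon
    simp only [Set.mem_iUnion, Set.mem_ofPred_eq, not_exists, not_lt] at hcon
    exact absurd (hnorm (B ω) (hB ω) t ht hcon) (not_le.2 hω)
  calc P.real {ω | 8 * t < sparseNorm s (B ω)}
      ≤ P.real (⋃ v ∈ 𝒱, {ω | t < |v ⬝ᵥ (B ω).mulVec v|}) := measureReal_mono hsub (measure_ne_top _ _)
    _ ≤ ∑ v ∈ 𝒱, P.real {ω | t < |v ⬝ᵥ (B ω).mulVec v|} := measureReal_biUnion_finset_le _ _
    _ ≤ ∑ v ∈ 𝒱, r := Finset.sum_le_sum fun v hv => h v (h𝒱 v hv).1 (h𝒱 v hv).2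
    _ = 𝒱.card * r := by rw [Finset.sum_const, nsmul_eq_mul]
    _ ≤ _ := by
      refine mul_le_mul_of_nonneg_right ?_ hr
      exact_mod_cast hcard

end

section

variable {Ω : Type u} [MeasurableSpace Ω] {μ : Measure Ω}

namespace Model

variable {M : Model μ}

/-! ## Finiteness of the constants -/

theorem moment_eq (i : Fin M.d) (ϑ : Fin (M.K i) → ℝ) (k : ℕ) (x : ℝ) :
    M.moment i ϑ k x = levelMoment (M.law i ϑ) k x := by
  refine tsum_congr fun n => ?_
  by_cases h : 0 < countCDF (M.law i ϑ) n ∧ countCDF (M.law i ϑ) n < 1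
  · rw [if_pos (show IsLevel _ n from h)]
    exact if_pos h
  · rw [if_neg (show ¬ IsLevel _ n from h)]
    exact if_neg h

theorem gradMoment_eq (i : Fin M.d) (ϑ : Fin (M.K i) → ℝ) (k : ℕ) (x : ℝ) :
    M.gradMoment i ϑ k x = gradSum (M.law i) ϑ k x := by
  refine tsum_congr fun n => ?_
  by_cases h : 0 < countCDF (M.law i ϑ) n ∧ countCDF (M.law i ϑ) n < 1
  · rw [if_pos (show IsLevel _ n from h)]
    exact if_pos h
  · rw [if_neg (show ¬ IsLevel _ n from h)]
    exact if_neg h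

variable {i : Fin M.d} {ϑ : Fin (M.K i) → ℝ} {c ε : ℝ}

theorem le_supM1 (hϑ : ϑ ∈ M.ball i ε) (c : ℝ) :
    1 / levelMoment (M.law i ϑ) 0 (1 - c) ^ 2 ≤ M.supM1 c ε := by
  rw [← moment_eq]
  exact le_iSup_of_le i (le_iSup₂ (f := fun ϑ (_ : ϑ ∈ M.ball i ε) =>
    1 / M.moment i ϑ 0 (1 - c) ^ 2) ϑ hϑ)

theorem le_supM2 (hϑ : ϑ ∈ M.ball i ε) (c : ℝ) :
    max (levelMoment (M.law i ϑ) 0 (1 / (1 - c)) ^ 2 / levelMoment (M.law i ϑ) 0 (1 - c) ^ 4)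
      (levelMoment (M.law i ϑ) 2 (1 / (1 - c)) ^ 2 / levelMoment (M.law i ϑ) 0 (1 - c) ^ 4)
      ≤ M.supM2 c ε := by
  simp only [← moment_eq]
  exact le_iSup_of_le i (le_iSup₂ (f := fun ϑ (_ : ϑ ∈ M.ball i ε) =>
    max (M.moment i ϑ 0 (1 / (1 - c)) ^ 2 / M.moment i ϑ 0 (1 - c) ^ 4)
      (M.moment i ϑ 2 (1 / (1 - c)) ^ 2 / M.moment i ϑ 0 (1 - c) ^ 4)) ϑ hϑ)

theorem le_supM (hϑ : ϑ ∈ M.ball i ε) (c : ℝ) :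
    max (levelMoment (M.law i ϑ) 0 (1 + c)) (levelMoment (M.law i ϑ) 3 (1 + c)) ≤ M.supM c ε := by
  simp only [← moment_eq]
  exact le_iSup_of_le i (le_iSup₂ (f := fun ϑ (_ : ϑ ∈ M.ball i ε) =>
    max (M.moment i ϑ 0 (1 + c)) (M.moment i ϑ 3 (1 + c))) ϑ hϑ)

theorem gradSup_le_supMu (i : Fin M.d) (c ε : ℝ) :
    gradSup (M.law i) (M.ball i ε) (1 + c) ≤ 2 * M.supMu c ε := by
  refine iSup₂_le fun ϑ hϑ => ?_
  have h : max (M.gradMoment i ϑ 0 (1 + c)) (M.gradMoment i ϑ 3 (1 + c)) ≤ M.supMu c ε :=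
    le_iSup_of_le i (le_iSup₂ (f := fun ϑ (_ : ϑ ∈ M.ball i ε) =>
      max (M.gradMoment i ϑ 0 (1 + c)) (M.gradMoment i ϑ 3 (1 + c))) ϑ hϑ)
  rw [gradMoment_eq, gradMoment_eq] at h
  rw [two_mul]
  exact add_le_add ((le_max_left _ _).trans h) ((le_max_right _ _).trans h)

theorem levelMoment_ne_zero_of_le {p : PMF ℕ} {x y : ℝ} (hx : 0 < x) (hxy : x ≤ y)
    (h : levelMoment p 0 x ≠ 0) : levelMoment p 0 y ≠ 0 :=
  fun h0 => h (le_antisymm (h0 ▸ levelMoment_mono p 0 hx hxy) bot_le)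

theorem levelMoment_ne_zero_of_supM1 (hϑ : ϑ ∈ M.ball i ε) (h : M.supM1 c ε ≠ ∞) :
    levelMoment (M.law i ϑ) 0 (1 - c) ≠ 0 := fun h0 => by
  have := le_supM1 hϑ c
  rw [h0] at this
  simp at this
  exact h this

theorem realMoment_pos {p : PMF ℕ} (hp : SecondMoment p) {x : ℝ} (h0 : 0 < x) (h1 : x ≤ 1)
    (h : levelMoment p 0 x ≠ 0) : 0 < realMoment p 0 x :=
  ENNReal.toReal_pos h (levelMoment_ne_top hp h0 h1)

theorem one_le_supM1_mul (hϑ : ϑ ∈ M.ball i ε) (hp : SecondMoment (M.law i ϑ)) (h0 : 0 ≤ c)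
    (h1 : c < 1) (h : M.supM1 c ε ≠ ∞) :
    1 ≤ (M.supM1 c ε).toReal * realMoment (M.law i ϑ) 0 (1 - c) ^ 2 := by
  have hpos := realMoment_pos hp (by linarith) (by linarith) (levelMoment_ne_zero_of_supM1 hϑ h)
  have := ENNReal.toReal_mono h (le_supM1 hϑ c)
  rw [ENNReal.toReal_div, ENNReal.toReal_one, ENNReal.toReal_pow] at this
  exact (div_le_iff₀ (pow_pos hpos 2)).1 this

theorem supM1_ne_zero (hϑ : ϑ ∈ M.ball i ε) (hp : SecondMoment (M.law i ϑ)) (h0 : 0 ≤ c)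
    (h1 : c < 1) : M.supM1 c ε ≠ 0 := fun h => by
  have := le_supM1 hϑ c
  rw [h, nonpos_iff_eq_zero, ENNReal.div_eq_zero_iff] at this
  have hfin := levelMoment_ne_top hp (x := 1 - c) (by linarith) (by linarith)
  rcases this with h2 | h2
  · exact one_ne_zero h2
  · exact (ENNReal.pow_ne_top hfin) h2

theorem one_le_inv_one_sub (h0 : 0 ≤ c) (h1 : c < 1) : 1 ≤ 1 / (1 - c) := by
  rw [le_div_iff₀ (by linarith)]; linarith

theorem supM2_ne_zero (hϑ : ϑ ∈ M.ball i ε) (hp : SecondMoment (M.law i ϑ)) (h0 : 0 ≤ c)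
    (h1 : c < 1) (hpos : levelMoment (M.law i ϑ) 0 (1 / 2) ≠ 0) : M.supM2 c ε ≠ 0 := fun h => by
  have := (le_max_left _ _).trans (le_supM2 hϑ c)
  have hone := one_le_inv_one_sub h0 h1
  rw [h, nonpos_iff_eq_zero, ENNReal.div_eq_zero_iff] at this
  have hfin := levelMoment_ne_top hp (x := 1 - c) (by linarith) (by linarith)
  rcases this with h2 | h2
  · exact levelMoment_ne_zero_of_le (by norm_num) (by linarith) hpos (pow_eq_zero_iff two_ne_zero |>.1 h2)
  · exact (ENNReal.pow_ne_top hfin) h2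

theorem momentBound_of_supM2 (hϑ : ϑ ∈ M.ball i ε) (hp : SecondMoment (M.law i ϑ)) (h0 : 0 ≤ c)
    (h1 : c < 1) (h : M.supM2 c ε ≠ ∞) {r₁ : ℝ}
    (hr : 1 ≤ r₁ * realMoment (M.law i ϑ) 0 (1 - c) ^ 2) :
    MomentBound (M.law i ϑ) c r₁ (M.supM2 c ε).toReal := by
  have hfin := levelMoment_ne_top hp (x := 1 - c) (by linarith) (by linarith)
  have hAnn := realMoment_nonneg (M.law i ϑ) 0 (1 - c)
  have hA : 0 < realMoment (M.law i ϑ) 0 (1 - c) := by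
    rcases hAnn.eq_or_lt with h2 | h2
    · rw [← h2] at hr; norm_num at hr
    · exact h2
  have hA0 : levelMoment (M.law i ϑ) 0 (1 - c) ≠ 0 := fun h2 => by
    rw [realMoment, h2] at hA; simp at hA
  have key : ∀ {B : ℝ≥0∞}, B ^ 2 / levelMoment (M.law i ϑ) 0 (1 - c) ^ 4 ≤ M.supM2 c ε →
      B ≠ ∞ ∧ B.toReal ^ 2 ≤ (M.supM2 c ε).toReal * realMoment (M.law i ϑ) 0 (1 - c) ^ 4 := by
    intro B hB
    constructor
    · rintro rfl
      rw [ENNReal.top_pow two_ne_zero, ENNReal.top_div_of_ne_top (ENNReal.pow_ne_top hfin)] at hB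
      exact h (top_le_iff.1 hB)
    · have := ENNReal.toReal_mono h hB
      rw [ENNReal.toReal_div, ENNReal.toReal_pow, ENNReal.toReal_pow] at this
      exact (div_le_iff₀ (pow_pos hA 4)).1 this
  have hk0 := key ((le_max_left _ _).trans (le_supM2 hϑ c))
  have hk2 := key ((le_max_right _ _).trans (le_supM2 hϑ c))
  exact ⟨hp, hA, hk0.1, hk2.1, hr, hk0.2, hk2.2⟩

/-! ## The constants as real numbers -/

/-- The situation in which the error bound is not trivial: the factor in the error bound is finite
and there are entries to estimate. -/
structure Regular (M : Model μ) (L s : ℕ) (cZ ε c₁ c₂ : ℝ) : Prop where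
  nonempty : Nonempty (Fin L × Fin M.d)
  one_le_sparsity : 1 ≤ s
  cZ_pos : 0 < cZ
  cZ_lt_one : cZ < 1
  c₁_pos : 0 < c₁
  c₁_lt_one : c₁ < 1
  radius_nonneg : 0 ≤ ε
  ball_subset : ∀ i, M.ball i ε ⊆ M.paramSet i
  finiteMoments : M.FiniteMoments
  smoothMarginals : M.SmoothMarginals
  constQ_ne_top : M.constQ L s cZ ε c₁ c₂ ≠ ∞

variable {L s : ℕ} {cZ c₁ c₂ : ℝ}

namespace Regular

theorem mem_ball (h : M.Regular L s cZ ε c₁ c₂) (i : Fin M.d) : M.param i ∈ M.ball i ε :=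
  Metric.mem_closedBall_self h.radius_nonneg

theorem secondMoment (h : M.Regular L s cZ ε c₁ c₂) (hϑ : ϑ ∈ M.ball i ε) :
    SecondMoment (M.law i ϑ) :=
  h.finiteMoments.secondMoment (h.ball_subset i hϑ)

theorem one_le_norm (h : M.Regular L s cZ ε c₁ c₂) : 1 ≤ sparseNorm s (M.bigZ L) := by
  obtain ⟨a⟩ := h.nonempty
  have := abs_diag_le h.one_le_sparsity (M.bigZ L) a
  rwa [bigZ_self, abs_one] at this

theorem constD_ne_zero (h : M.Regular L s cZ ε c₁ c₂) : M.constD ε ≠ 0 := by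
  obtain ⟨a⟩ := h.nonempty
  have := supM1_ne_zero (h.mem_ball a.2) (h.secondMoment (h.mem_ball a.2)) (c := 1 / 2)
    (by norm_num) (by norm_num)
  rw [constD]
  refine mul_ne_zero (mul_ne_zero ?_ two_ne_zero) ?_
  · rw [Ne, ENNReal.rpow_eq_zero_iff_of_pos (by norm_num)]
    exact this
  · exact ne_of_gt (lt_of_lt_of_le one_pos (le_max_right _ _))

/-- In [0, ∞] the product 0 · ∞ is 0, so finiteness of a product gives finiteness of its factors
only when the other ones are nonzero. Here the maximum in Q is nonzero because D is, and the second
maximum is at least 1. -/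
theorem max_ne_top (h : M.Regular L s cZ ε c₁ c₂) :
    M.constD ε ≠ ∞ ∧ M.constR L s cZ ε ≠ ∞ ∧ M.constT c₁ ε ≠ ∞ ∧ M.constS L s cZ ε ≠ ∞ := by
  have hD := h.constD_ne_zero
  have hq := h.constQ_ne_top
  rw [constQ] at hq
  set A := max (max (M.constD ε) (4 * M.constR L s cZ ε))
    (max (2 * M.constT c₂ ε) (M.constT c₁ ε)) with hA
  set E := max (M.constS L s cZ ε ^ 2) 1 with hE
  have hDA : M.constD ε ≤ A := (le_max_left _ _).trans (le_max_left _ _)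
  have hRA : 4 * M.constR L s cZ ε ≤ A := (le_max_right _ _).trans (le_max_left _ _)
  have hTA : M.constT c₁ ε ≤ A := (le_max_right _ _).trans (le_max_right _ _)
  have hA0 : A ≠ 0 := fun h0 => hD (le_antisymm (h0 ▸ hDA) bot_le)
  have hE0 : E ≠ 0 := ne_of_gt (lt_of_lt_of_le one_pos (le_max_right _ _))
  have h4A : (4 * A : ℝ≥0∞) ≠ 0 := mul_ne_zero (by norm_num) hA0
  have hAtop : A ≠ ∞ := fun ht => hq (by
    rw [ht, ENNReal.mul_top (by norm_num), ENNReal.top_mul hE0])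
  have hEtop : E ≠ ∞ := fun ht => hq (by rw [ht, ENNReal.mul_top h4A])
  refine ⟨ne_top_of_le_ne_top hAtop hDA, fun ht => ?_, ne_top_of_le_ne_top hAtop hTA, fun ht => ?_⟩
  · rw [ht, ENNReal.mul_top (by norm_num)] at hRA
    exact hAtop (top_le_iff.1 hRA)
  · have : M.constS L s cZ ε ^ 2 ≤ E := le_max_left _ _
    rw [ht, ENNReal.top_pow two_ne_zero] at this
    exact hEtop (top_le_iff.1 this)

/-- The factor in the error bound dominates the products of the constants. -/
theorem le_constQ (h : M.Regular L s cZ ε c₁ c₂) :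
    4 * ((M.constD ε).toReal * max ((M.constS L s cZ ε).toReal ^ 2) 1)
        ≤ (M.constQ L s cZ ε c₁ c₂).toReal ∧
      16 * ((M.constR L s cZ ε).toReal * max ((M.constS L s cZ ε).toReal ^ 2) 1)
        ≤ (M.constQ L s cZ ε c₁ c₂).toReal ∧
      4 * ((M.constT c₁ ε).toReal * max ((M.constS L s cZ ε).toReal ^ 2) 1)
        ≤ (M.constQ L s cZ ε c₁ c₂).toReal := by
  obtain ⟨hD, hR, hT, hS⟩ := h.max_ne_top
  have hE : (max (M.constS L s cZ ε ^ 2) 1).toReal = max ((M.constS L s cZ ε).toReal ^ 2) 1 := by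
    rw [ENNReal.toReal_max (ENNReal.pow_ne_top hS) ENNReal.one_ne_top, ENNReal.toReal_pow,
      ENNReal.toReal_one]
  have key : ∀ {x : ℝ≥0∞}, x ≤ max (max (M.constD ε) (4 * M.constR L s cZ ε))
      (max (2 * M.constT c₂ ε) (M.constT c₁ ε)) →
      4 * (x.toReal * max ((M.constS L s cZ ε).toReal ^ 2) 1)
        ≤ (M.constQ L s cZ ε c₁ c₂).toReal := by
    intro x hx
    have : 4 * x * max (M.constS L s cZ ε ^ 2) 1 ≤ M.constQ L s cZ ε c₁ c₂ := by
      rw [constQ]; gcongr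
    have := ENNReal.toReal_mono h.constQ_ne_top this
    rw [ENNReal.toReal_mul, ENNReal.toReal_mul, hE] at this
    norm_num at this
    linarith
  refine ⟨key ((le_max_left _ _).trans (le_max_left _ _)), ?_,
    key ((le_max_right _ _).trans (le_max_right _ _))⟩
  have := key ((le_max_right _ _).trans (le_max_left _ _))
  rw [ENNReal.toReal_mul] at this
  norm_num at this
  linarith

theorem supM1_half_ne_top (h : M.Regular L s cZ ε c₁ c₂) : M.supM1 (1 / 2) ε ≠ ∞ := fun ht => by
  refine h.max_ne_top.1 ?_
  rw [constD, ht, ENNReal.top_rpow_of_pos (by norm_num), ENNReal.top_mul two_ne_zero,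
    ENNReal.top_mul (ne_of_gt (lt_of_lt_of_le one_pos (le_max_right _ _)))]

theorem levelMoment_half_ne_zero (h : M.Regular L s cZ ε c₁ c₂) (hϑ : ϑ ∈ M.ball i ε) :
    levelMoment (M.law i ϑ) 0 (1 / 2) ≠ 0 := by
  have := levelMoment_ne_zero_of_supM1 hϑ h.supM1_half_ne_top
  norm_num at this ⊢
  exact this

theorem realMoment_half_pos (h : M.Regular L s cZ ε c₁ c₂) (hϑ : ϑ ∈ M.ball i ε) :
    0 < realMoment (M.law i ϑ) 0 (1 / 2) :=
  realMoment_pos (h.secondMoment hϑ) (by norm_num) (by norm_num) (h.levelMoment_half_ne_zero hϑ)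

theorem realMoment_one_pos (h : M.Regular L s cZ ε c₁ c₂) (hϑ : ϑ ∈ M.ball i ε) :
    0 < realMoment (M.law i ϑ) 0 1 :=
  realMoment_pos (h.secondMoment hϑ) (by norm_num) (by norm_num)
    (levelMoment_ne_zero_of_le (by norm_num) (by norm_num) (h.levelMoment_half_ne_zero hϑ))

theorem supDelta_ne_top (h : M.Regular L s cZ ε c₁ c₂) : M.supDelta ε ≠ ∞ := fun ht => by
  obtain ⟨a⟩ := h.nonempty
  have := supM1_ne_zero (h.mem_ball a.2) (h.secondMoment (h.mem_ball a.2)) (c := 1 / 2)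
    (by norm_num) (by norm_num)
  refine h.max_ne_top.1 ?_
  rw [constD, ht, ENNReal.mul_top (by norm_num), max_eq_left le_top, ENNReal.mul_top]
  refine mul_ne_zero ?_ two_ne_zero
  rw [Ne, ENNReal.rpow_eq_zero_iff_of_pos (by norm_num)]
  exact this

theorem constD_bounds (h : M.Regular L s cZ ε c₁ c₂) (hϑ : ϑ ∈ M.ball i ε) :
    2 / realMoment (M.law i ϑ) 0 (1 / 2) ≤ (M.constD ε).toReal ∧
      6 * (M.supDelta ε).toReal / realMoment (M.law i ϑ) 0 (1 / 2) ≤ (M.constD ε).toReal := by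
  have hpos := h.realMoment_half_pos hϑ
  have h1 := one_le_supM1_mul hϑ (h.secondMoment hϑ) (c := 1 / 2) (by norm_num) (by norm_num)
    h.supM1_half_ne_top
  rw [show (1 : ℝ) - 1 / 2 = 1 / 2 by norm_num] at h1
  set A := realMoment (M.law i ϑ) 0 (1 / 2) with hA
  set r := (M.supM1 (1 / 2) ε).toReal with hr
  have hr0 : 0 ≤ r := ENNReal.toReal_nonneg
  have hD : (M.constD ε).toReal = √r * 2 * max (3 * (M.supDelta ε).toReal) 1 := by
    rw [constD, ENNReal.toReal_mul, ENNReal.toReal_mul,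
      ENNReal.toReal_max (ENNReal.mul_ne_top (by norm_num) h.supDelta_ne_top) ENNReal.one_ne_top,
      ENNReal.toReal_mul, ← ENNReal.toReal_rpow, ← Real.sqrt_eq_rpow]
    norm_num [hr]
  have h2 : 1 ≤ √r * A := by
    have : √(r * A ^ 2) = √r * A := by rw [Real.sqrt_mul hr0, Real.sqrt_sq hpos.le]
    rw [← this]; exact Real.one_le_sqrt.2 h1
  have hs := Real.sqrt_nonneg r
  have hΔ : 0 ≤ (M.supDelta ε).toReal := ENNReal.toReal_nonneg
  rw [hD]
  constructor
  · rw [div_le_iff₀ hpos]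
    calc (2 : ℝ) = 1 * 2 * 1 := by ring
      _ ≤ √r * A * 2 * max (3 * (M.supDelta ε).toReal) 1 := by gcongr; exact le_max_right _ _
      _ = _ := by ring
  · rw [div_le_iff₀ hpos]
    calc 6 * (M.supDelta ε).toReal = 1 * 2 * (3 * (M.supDelta ε).toReal) := by ring
      _ ≤ √r * A * 2 * max (3 * (M.supDelta ε).toReal) 1 := by gcongr; exact le_max_left _ _
      _ = _ := by ring

theorem norm_pos (h : M.Regular L s cZ ε c₁ c₂) :
    ENNReal.ofReal (sparseNorm s (M.bigZ L)) ≠ 0 := by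
  rw [Ne, ENNReal.ofReal_eq_zero, not_le]
  exact zero_lt_one.trans_le h.one_le_norm

theorem supM_zero_ne_top (h : M.Regular L s cZ ε c₁ c₂) :
    M.supM1 0 ε ≠ ∞ ∧ M.supM2 cZ ε ≠ ∞ := by
  have hR := h.max_ne_top.2.1
  rw [constR] at hR
  have hsum : ENNReal.ofReal (8 * Real.pi) * M.supM1 0 ε
      + ENNReal.ofReal (24 * Real.pi * (1 / (1 - cZ ^ 2) ^ 2)) * M.supM2 cZ ε ≠ ∞ := fun ht =>
    hR (by rw [ht, ENNReal.top_mul h.norm_pos])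
  rw [ENNReal.add_ne_top] at hsum
  have hc : 0 < 1 - cZ ^ 2 := by nlinarith [h.cZ_pos, h.cZ_lt_one]
  constructor
  · intro ht
    refine hsum.1 ?_
    rw [ht, ENNReal.mul_top]
    rw [Ne, ENNReal.ofReal_eq_zero, not_le]; positivity
  · intro ht
    refine hsum.2 ?_
    rw [ht, ENNReal.mul_top]
    rw [Ne, ENNReal.ofReal_eq_zero, not_le]; positivity

theorem constR_eq (h : M.Regular L s cZ ε c₁ c₂) :
    (M.constR L s cZ ε).toReal = (8 * Real.pi * (M.supM1 0 ε).toReal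
      + 24 * Real.pi * (1 / (1 - cZ ^ 2) ^ 2) * (M.supM2 cZ ε).toReal)
      * sparseNorm s (M.bigZ L) := by
  have hc : 0 < 1 - cZ ^ 2 := by nlinarith [h.cZ_pos, h.cZ_lt_one]
  have h1 := h.supM_zero_ne_top
  rw [constR, ENNReal.toReal_mul, ENNReal.toReal_add (ENNReal.mul_ne_top ENNReal.ofReal_ne_top h1.1)
    (ENNReal.mul_ne_top ENNReal.ofReal_ne_top h1.2), ENNReal.toReal_mul, ENNReal.toReal_mul,
    ENNReal.toReal_ofReal (by positivity), ENNReal.toReal_ofReal (by positivity),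
    ENNReal.toReal_ofReal (by linarith [h.one_le_norm])]

theorem one_le_supM1_zero (h : M.Regular L s cZ ε c₁ c₂) (hϑ : ϑ ∈ M.ball i ε) :
    1 ≤ (M.supM1 0 ε).toReal * realMoment (M.law i ϑ) 0 1 ^ 2 := by
  have := one_le_supM1_mul hϑ (h.secondMoment hϑ) (c := 0) le_rfl one_pos h.supM_zero_ne_top.1
  rwa [sub_zero] at this

theorem supM_c₁_ne_top (h : M.Regular L s cZ ε c₁ c₂) :
    M.supM1 c₁ ε ≠ ∞ ∧ M.supM2 c₁ ε ≠ ∞ := by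
  obtain ⟨a⟩ := h.nonempty
  have hT := h.max_ne_top.2.2.1
  have hsm := h.secondMoment (h.mem_ball a.2)
  have h1 := supM1_ne_zero (h.mem_ball a.2) hsm h.c₁_pos.le h.c₁_lt_one
  have h2 := supM2_ne_zero (h.mem_ball a.2) hsm h.c₁_pos.le h.c₁_lt_one
    (h.levelMoment_half_ne_zero (h.mem_ball a.2))
  have hc : 0 < 1 - c₁ ^ 2 := by nlinarith [h.c₁_pos, h.c₁_lt_one]
  have h0 : ENNReal.ofReal (6 / (1 - c₁ ^ 2)) ≠ 0 := by
    rw [Ne, ENNReal.ofReal_eq_zero, not_le]; positivity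
  rw [constT] at hT
  constructor
  · intro ht; exact hT (by rw [ht, ENNReal.mul_top h0, ENNReal.top_mul h2])
  · intro ht; exact hT (by rw [ht, ENNReal.mul_top (mul_ne_zero h0 h1)])

theorem constT_eq (h : M.Regular L s cZ ε c₁ c₂) :
    (M.constT c₁ ε).toReal
      = 6 / (1 - c₁ ^ 2) * (M.supM1 c₁ ε).toReal * (M.supM2 c₁ ε).toReal := by
  have hc : 0 < 1 - c₁ ^ 2 := by nlinarith [h.c₁_pos, h.c₁_lt_one]
  rw [constT, ENNReal.toReal_mul, ENNReal.toReal_mul, ENNReal.toReal_ofReal (by positivity)]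

theorem momentBound_c₁ (h : M.Regular L s cZ ε c₁ c₂) (hϑ : ϑ ∈ M.ball i ε) :
    MomentBound (M.law i ϑ) c₁ (M.supM1 c₁ ε).toReal (M.supM2 c₁ ε).toReal :=
  momentBound_of_supM2 hϑ (h.secondMoment hϑ) h.c₁_pos.le h.c₁_lt_one
    h.supM_c₁_ne_top.2
    (one_le_supM1_mul hϑ (h.secondMoment hϑ) h.c₁_pos.le h.c₁_lt_one h.supM_c₁_ne_top.1)

theorem supM_mul_supMu_ne_top (h : M.Regular L s cZ ε c₁ c₂) :
    M.supM cZ ε * M.supMu cZ ε ≠ ∞ := fun ht => by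
  have hc : 0 < 1 - cZ ^ 2 := by nlinarith [h.cZ_pos, h.cZ_lt_one]
  have h0 : ENNReal.ofReal (12 / (1 - cZ ^ 2) ^ (7 / 2 : ℝ)) ≠ 0 := by
    rw [Ne, ENNReal.ofReal_eq_zero, not_le]; positivity
  refine h.max_ne_top.2.2.2 ?_
  rw [constS, mul_assoc (ENNReal.ofReal (12 / _)), ht, ENNReal.mul_top h0,
    ENNReal.top_mul h.norm_pos]

/-- Needed to conclude that the supremum of the gradient moments is finite from finiteness of its
product with this one. -/
theorem supM_ne_zero (h : M.Regular L s cZ ε c₁ c₂) : M.supM cZ ε ≠ 0 := fun h0 => by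
  obtain ⟨a⟩ := h.nonempty
  have := (le_max_left _ _).trans (le_supM (h.mem_ball a.2) cZ)
  rw [h0] at this
  exact levelMoment_ne_zero_of_le (by norm_num) (by linarith [h.cZ_pos])
    (h.levelMoment_half_ne_zero (h.mem_ball a.2)) (le_antisymm this bot_le)

theorem supMu_ne_top (h : M.Regular L s cZ ε c₁ c₂) : M.supMu cZ ε ≠ ∞ := fun ht =>
  h.supM_mul_supMu_ne_top (by rw [ht, ENNReal.mul_top h.supM_ne_zero])

theorem constS_eq (h : M.Regular L s cZ ε c₁ c₂) :
    (M.constS L s cZ ε).toReal = 12 / (1 - cZ ^ 2) ^ (7 / 2 : ℝ)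
      * (M.supM cZ ε * M.supMu cZ ε).toReal * sparseNorm s (M.bigZ L) := by
  have hc : 0 < 1 - cZ ^ 2 := by nlinarith [h.cZ_pos, h.cZ_lt_one]
  rw [constS, mul_assoc (ENNReal.ofReal (12 / _)), ENNReal.toReal_mul, ENNReal.toReal_mul,
    ENNReal.toReal_ofReal (by positivity), ENNReal.toReal_ofReal (by linarith [h.one_le_norm])]

end Regular

end Model

end

section

variable {Ω : Type u} [MeasurableSpace Ω] {μ : Measure Ω}

theorem MomentBound.mono {p : PMF ℕ} {c r₁ r₁' r₂ : ℝ} (h : MomentBound p c r₁ r₂) (hr : r₁ ≤ r₁') :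
    MomentBound p c r₁' r₂ :=
  ⟨h.secondMoment, h.pos, h.ne_top_zero, h.ne_top_two,
    h.one_le.trans (mul_le_mul_of_nonneg_right hr (sq_nonneg _)), h.sq_le_zero, h.sq_le_two⟩

namespace Model

variable {M : Model μ} {L s : ℕ} {cZ c₁ c₂ ε y : ℝ} {i j : Fin M.d} {ϑ ϑ' : Fin (M.K i) → ℝ}
  {ϑ₂ : Fin (M.K j) → ℝ}

/-! ## Perturbation of the parameters -/

/-- The gradient of C_n is the normal density at Q_n times the gradient of Q_n, and widening the
Gaussian weight from 1 to 1 + c only increases it. Levels 0 and 1 have zero gradient. -/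
theorem tsum_gradNorm_C_le (hd : ∀ n, DifferentiableAt ℝ (M.C i n) ϑ) {c : ℝ} (hc : 0 ≤ c) :
    ∑' n, ENNReal.ofReal (gradNorm (M.C i n) ϑ) ≤ M.gradMoment i ϑ 0 (1 + c) := by
  refine ENNReal.tsum_le_tsum fun n => ?_
  by_cases h : IsLevel (M.law i ϑ) n
  · rw [if_pos (show 0 < M.C i n ϑ ∧ M.C i n ϑ < 1 from h)]
    refine ENNReal.ofReal_le_ofReal ?_
    have h1 := gradNorm_level (law := M.law i) (hd n) h
    have h2 : gradNorm (M.Q i n) ϑ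
        = (stdPDF (M.Q i n ϑ))⁻¹ * gradNorm (M.C i n) ϑ := h1
    have hpos := stdPDF_pos (M.Q i n ϑ)
    have h3 : gradNorm (M.C i n) ϑ = stdPDF (M.Q i n ϑ) * gradNorm (M.Q i n) ϑ := by
      rw [h2, ← mul_assoc, mul_inv_cancel₀ hpos.ne', one_mul]
    rw [h3, stdPDF_eq, pow_zero, mul_one, div_eq_mul_inv]
    have := exp_neg_div_le hc (M.Q i n ϑ)
    have hg := gradNorm_nonneg (M.Q i n) ϑ
    calc (√(2 * Real.pi))⁻¹ * Real.exp (-M.Q i n ϑ ^ 2 / 2) * gradNorm (M.Q i n) ϑ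
        ≤ (√(2 * Real.pi))⁻¹ * Real.exp (-(M.Q i n ϑ ^ 2) / (2 * (1 + c)))
          * gradNorm (M.Q i n) ϑ := by gcongr
      _ = _ := by ring
  · have h0 : gradNorm (M.C i n) ϑ = 0 := by
      have := fderiv_eq_zero_of_not_isLevel (law := M.law i) h
      change ∑ j, |fderiv ℝ (fun ϑ => countCDF (M.law i ϑ) n) ϑ (Pi.single j 1)| = 0
      simp [this]
    rw [h0]; simp

theorem sum_le_toReal_of_tsum_le {f : ℕ → ℝ} (hf : ∀ n, 0 ≤ f n) {K : ℝ≥0∞} (hK : K ≠ ∞)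
    (h : ∑' n, ENNReal.ofReal (f n) ≤ K) (A : Finset ℕ) : ∑ n ∈ A, f n ≤ K.toReal := by
  have h1 : ENNReal.ofReal (∑ n ∈ A, f n) ≤ K := by
    rw [ENNReal.ofReal_sum_of_nonneg fun n _ => hf n]
    exact (ENNReal.sum_le_tsum A).trans h
  exact (ENNReal.ofReal_le_iff_le_toReal hK).1 h1

namespace Regular

theorem differentiableAt (h : M.Regular L s cZ ε c₁ c₂) (n : ℕ) (ϑ : Fin (M.K i) → ℝ)
    (hϑ : ϑ ∈ M.ball i ε) : DifferentiableAt ℝ (fun ϑ => countCDF (M.law i ϑ) n) ϑ :=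
  h.smoothMarginals i ϑ (h.ball_subset i hϑ) n

theorem sum_abs_countCDF_sub_le (h : M.Regular L s cZ ε c₁ c₂) (hϑ : ϑ ∈ M.ball i ε)
    (hy : ‖ϑ - M.param i‖ ≤ y) (A : Finset ℕ) :
    ∑ k ∈ A, |countCDF (M.law i ϑ) k - countCDF (M.law i (M.param i)) k|
      ≤ y * (M.supMu cZ ε).toReal := by
  have hy0 := (norm_nonneg _).trans hy
  have h1 := tsum_abs_countCDF_sub_le (law := M.law i) (convex_closedBall (M.param i) ε)
    h.differentiableAt (w := fun _ => 1) (fun _ => zero_le_one) (h.mem_ball i) hϑ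
  simp only [one_mul] at h1
  have h2 : (⨆ ϑ ∈ M.ball i ε,
      ∑' n, ENNReal.ofReal (gradNorm (fun ϑ => countCDF (M.law i ϑ) n) ϑ)) ≤ M.supMu cZ ε :=
    iSup₂_le fun ϑ hϑ => (tsum_gradNorm_C_le (fun n => h.differentiableAt n ϑ hϑ)
      h.cZ_pos.le).trans ((le_max_left _ _).trans (le_iSup_of_le i (le_iSup₂
        (f := fun ϑ (_ : ϑ ∈ M.ball i ε) =>
          max (M.gradMoment i ϑ 0 (1 + cZ)) (M.gradMoment i ϑ 3 (1 + cZ))) ϑ hϑ)))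
  have h3 := sum_le_toReal_of_tsum_le (fun n => abs_nonneg _)
    (ENNReal.mul_ne_top ENNReal.ofReal_ne_top h.supMu_ne_top)
    (h1.trans (mul_le_mul' (ENNReal.ofReal_le_ofReal hy) h2)) A
  rwa [ENNReal.toReal_mul, ENNReal.toReal_ofReal hy0] at h3

theorem sum_mul_abs_countCDF_sub_le (h : M.Regular L s cZ ε c₁ c₂) (hϑ : ϑ ∈ M.ball i ε)
    (hy : ‖ϑ - M.param i‖ ≤ y) (A : Finset ℕ) :
    ∑ k ∈ A, (k : ℝ) * |countCDF (M.law i ϑ) k - countCDF (M.law i (M.param i)) k|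
      ≤ y * (M.supDelta ε).toReal := by
  have hy0 := (norm_nonneg _).trans hy
  have h1 := tsum_abs_countCDF_sub_le (law := M.law i) (convex_closedBall (M.param i) ε)
    h.differentiableAt (w := fun n => (n : ℝ)) (fun n => n.cast_nonneg) (h.mem_ball i) hϑ
  have h2 : (⨆ ϑ ∈ M.ball i ε,
      ∑' n : ℕ, ENNReal.ofReal (n * gradNorm (fun ϑ => countCDF (M.law i ϑ) n) ϑ))
      ≤ M.supDelta ε :=
    le_iSup_of_le (f := fun i => ⨆ ϑ ∈ M.ball i ε, M.diagMoment i ϑ) i le_rfl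
  have h3 := sum_le_toReal_of_tsum_le (fun n => mul_nonneg n.cast_nonneg (abs_nonneg _))
    (ENNReal.mul_ne_top ENNReal.ofReal_ne_top h.supDelta_ne_top)
    (h1.trans (mul_le_mul' (ENNReal.ofReal_le_ofReal hy) h2)) A
  rwa [ENNReal.toReal_mul, ENNReal.toReal_ofReal hy0] at h3

theorem realMoment_mul_supMu_le (h : M.Regular L s cZ ε c₁ c₂) (hϑ : ϑ ∈ M.ball i ε) :
    realMoment (M.law i ϑ) 0 1 * (M.supMu cZ ε).toReal
      ≤ (M.supM cZ ε * M.supMu cZ ε).toReal := by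
  rw [realMoment, ← ENNReal.toReal_mul]
  refine ENNReal.toReal_mono h.supM_mul_supMu_ne_top ?_
  gcongr
  exact (levelMoment_mono _ 0 one_pos (by linarith [h.cZ_pos])).trans
    ((le_max_left _ _).trans (le_supM hϑ cZ))

theorem hermiteCoeff_one (h : M.Regular L s cZ ε c₁ c₂) (hϑ : ϑ ∈ M.ball i ε) :
    hermiteCoeff (M.law i ϑ) 1 = realMoment (M.law i ϑ) 0 1 :=
  (realMoment_one (h.secondMoment hϑ)).symm

theorem ofReal_abs_hermiteCoeff_sub_le (h : M.Regular L s cZ ε c₁ c₂) (hϑ : ϑ ∈ M.ball i ε)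
    (hy : ‖ϑ - M.param i‖ ≤ y) :
    ENNReal.ofReal |hermiteCoeff (M.law i ϑ) 1 - hermiteCoeff (M.law i (M.param i)) 1|
      ≤ ENNReal.ofReal (2 * y) * M.supMu cZ ε := by
  have hy0 := (norm_nonneg _).trans hy
  have h1 := ofReal_abs_hermiteCoeff_one_sub_le (law := M.law i)
    (convex_closedBall (M.param i) ε) h.differentiableAt (fun ϑ hϑ => h.secondMoment hϑ)
    h.cZ_pos.le (h.mem_ball i) hϑ
  refine h1.trans ?_
  calc ENNReal.ofReal ‖ϑ - M.param i‖ * gradSup (M.law i) (M.ball i ε) (1 + cZ)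
      ≤ ENNReal.ofReal y * (2 * M.supMu cZ ε) := by
        gcongr; exact gradSup_le_supMu i cZ ε
    _ = _ := by
      rw [ENNReal.ofReal_mul zero_le_two, ENNReal.ofReal_ofNat, ← mul_assoc, mul_comm _ 2]

/-- Uniform bounds for the first Hermite coefficients and for their errors. -/
theorem exists_hermiteCoeff_bounds (h : M.Regular L s cZ ε c₁ c₂) (hy0 : 0 ≤ y)
    {θ : ∀ i, Fin (M.K i) → ℝ} (hθ : ∀ i, θ i ∈ M.ball i ε) (hy : ∀ i, ‖θ i - M.param i‖ ≤ y) :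
    ∃ η m : ℝ, 0 ≤ η ∧ 0 ≤ m ∧ η * m ≤ 2 * y * (M.supM cZ ε * M.supMu cZ ε).toReal ∧
      ∀ i, |hermiteCoeff (M.law i (θ i)) 1 - hermiteCoeff (M.law i (M.param i)) 1| ≤ η ∧
        |hermiteCoeff (M.law i (θ i)) 1| ≤ m ∧ |hermiteCoeff (M.law i (M.param i)) 1| ≤ m := by
  have hμ := h.supMu_ne_top
  have hη : ∀ i, |hermiteCoeff (M.law i (θ i)) 1 - hermiteCoeff (M.law i (M.param i)) 1|
      ≤ 2 * y * (M.supMu cZ ε).toReal := by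
    intro i
    have h1 := h.ofReal_abs_hermiteCoeff_sub_le (hθ i) (hy i)
    have h2 := (ENNReal.ofReal_le_iff_le_toReal (ENNReal.mul_ne_top ENNReal.ofReal_ne_top hμ)).1 h1
    rwa [ENNReal.toReal_mul, ENNReal.toReal_ofReal (by positivity)] at h2
  refine ⟨2 * y * (M.supMu cZ ε).toReal, ?_⟩
  -- Only the product with the gradient supremum is known to be finite. If this factor is infinite
  -- the other one is 0, the coefficients do not vary over the ball, and any finite bound m will do.
  by_cases hM : M.supM cZ ε = ∞
  · have hμ0 : M.supMu cZ ε = 0 := by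
      by_contra h0
      exact h.supM_mul_supMu_ne_top (by rw [hM, ENNReal.top_mul h0])
    refine ⟨∑ i, (|hermiteCoeff (M.law i (θ i)) 1| + |hermiteCoeff (M.law i (M.param i)) 1|),
      by positivity, by positivity, ?_, fun i => ⟨hη i, ?_, ?_⟩⟩
    · rw [hμ0]; simp
    · refine (le_add_of_nonneg_right (abs_nonneg _)).trans (Finset.single_le_sum
        (f := fun i => |hermiteCoeff (M.law i (θ i)) 1| + |hermiteCoeff (M.law i (M.param i)) 1|)
        (fun i _ => by positivity) (Finset.mem_univ i))
    · refine (le_add_of_nonneg_left (abs_nonneg _)).trans (Finset.single_le_sum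
        (f := fun i => |hermiteCoeff (M.law i (θ i)) 1| + |hermiteCoeff (M.law i (M.param i)) 1|)
        (fun i _ => by positivity) (Finset.mem_univ i))
  · have hm : ∀ i, ∀ ϑ ∈ M.ball i ε, |hermiteCoeff (M.law i ϑ) 1| ≤ (M.supM cZ ε).toReal := by
      intro i ϑ hϑ
      rw [h.hermiteCoeff_one hϑ, abs_of_nonneg (realMoment_nonneg _ _ _)]
      exact ENNReal.toReal_mono hM ((levelMoment_mono _ 0 one_pos (by linarith [h.cZ_pos])).trans
        ((le_max_left _ _).trans (le_supM hϑ cZ)))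
    refine ⟨(M.supM cZ ε).toReal, by positivity, ENNReal.toReal_nonneg, ?_, fun i =>
      ⟨hη i, hm i _ (hθ i), hm i _ (h.mem_ball i)⟩⟩
    rw [ENNReal.toReal_mul]
    linarith

theorem abs_linkDeriv2_sub_le_of_left (h : M.Regular L s cZ ε c₁ c₂) (hϑ : ϑ ∈ M.ball i ε)
    (hϑ' : ϑ₂ ∈ M.ball j ε) (hy : ‖ϑ - M.param i‖ ≤ y) {v : ℝ} (hv : |v| ≤ cZ) :
    |linkDeriv2 (M.law i ϑ) (M.law j ϑ₂) v - linkDeriv2 (M.law i (M.param i)) (M.law j ϑ₂) v|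
      ≤ 56 / (1 - cZ ^ 2) ^ (7 / 2 : ℝ) * y * (M.supM cZ ε * M.supMu cZ ε).toReal := by
  have hy0 := (norm_nonneg _).trans hy
  have hc : 0 < 1 - cZ ^ 2 := by nlinarith [h.cZ_pos, h.cZ_lt_one]
  have h1 := ofReal_abs_linkDeriv2_sub_le (law := M.law i)
    (convex_closedBall (M.param i) ε) h.differentiableAt (fun ϑ hϑ => h.secondMoment hϑ)
    (h.secondMoment hϑ') h.cZ_lt_one hv (h.mem_ball i) hϑ
  have hpow : (√(1 - v ^ 2))⁻¹ ^ 7 ≤ 1 / (1 - cZ ^ 2) ^ (7 / 2 : ℝ) := by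
    have e1 : ∀ x : ℝ, 0 ≤ x → x ^ (7 / 2 : ℝ) = √x ^ 7 := fun x hx => by
      rw [Real.sqrt_eq_rpow, ← Real.rpow_natCast, ← Real.rpow_mul hx]; norm_num
    rw [e1 _ hc.le, one_div, inv_pow]
    have h2 : v ^ 2 ≤ cZ ^ 2 := by rw [← sq_abs v]; gcongr
    gcongr
  have h2 : levelMoment (M.law j ϑ₂) 0 (1 + cZ) + levelMoment (M.law j ϑ₂) 3 (1 + cZ)
      ≤ 2 * M.supM cZ ε := by
    rw [two_mul]
    exact add_le_add ((le_max_left _ _).trans (le_supM hϑ' cZ))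
      ((le_max_right _ _).trans (le_supM hϑ' cZ))
  -- Each of the two sums of moments of orders 0 and 3 is at most twice a supremum, whence 56 = 14 ·
  -- 4.
  have h3 := h1.trans (mul_le_mul' (ENNReal.ofReal_le_ofReal
    (show 14 * (√(1 - v ^ 2))⁻¹ ^ 7 * ‖ϑ - M.param i‖
      ≤ 14 * (1 / (1 - cZ ^ 2) ^ (7 / 2 : ℝ)) * y by gcongr))
    (mul_le_mul' (gradSup_le_supMu i cZ ε) h2))
  have e2 : 2 * M.supMu cZ ε * (2 * M.supM cZ ε) = 4 * (M.supM cZ ε * M.supMu cZ ε) := by ring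
  rw [e2] at h3
  have h4 := (ENNReal.ofReal_le_iff_le_toReal (ENNReal.mul_ne_top ENNReal.ofReal_ne_top
    (ENNReal.mul_ne_top (by norm_num) h.supM_mul_supMu_ne_top))).1 h3
  rw [ENNReal.toReal_mul, ENNReal.toReal_ofReal (by positivity), ENNReal.toReal_mul] at h4
  refine h4.trans (le_of_eq ?_)
  norm_num
  ring

/-- The parameters of the two components are changed one after the other, which doubles the
constant. -/
theorem abs_linkDeriv2_sub_le (h : M.Regular L s cZ ε c₁ c₂) (hϑ : ϑ ∈ M.ball i ε)
    (hϑ' : ϑ₂ ∈ M.ball j ε) (hy : ‖ϑ - M.param i‖ ≤ y) (hy' : ‖ϑ₂ - M.param j‖ ≤ y) {v : ℝ}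
    (hv : |v| ≤ cZ) :
    |linkDeriv2 (M.law i ϑ) (M.law j ϑ₂) v
        - linkDeriv2 (M.law i (M.param i)) (M.law j (M.param j)) v|
      ≤ 112 / (1 - cZ ^ 2) ^ (7 / 2 : ℝ) * y * (M.supM cZ ε * M.supMu cZ ε).toReal := by
  have h1 := h.abs_linkDeriv2_sub_le_of_left hϑ hϑ' hy hv
  have h2 := h.abs_linkDeriv2_sub_le_of_left hϑ' (h.mem_ball i) hy' hv
  rw [linkDeriv2_comm, linkDeriv2_comm (M.law j (M.param j))] at h2
  have e : 112 / (1 - cZ ^ 2) ^ (7 / 2 : ℝ) * y * (M.supM cZ ε * M.supMu cZ ε).toReal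
      = 56 / (1 - cZ ^ 2) ^ (7 / 2 : ℝ) * y * (M.supM cZ ε * M.supMu cZ ε).toReal
        + 56 / (1 - cZ ^ 2) ^ (7 / 2 : ℝ) * y * (M.supM cZ ε * M.supMu cZ ε).toReal := by ring
  rw [e]
  exact (abs_sub_le _ (linkDeriv2 (M.law i (M.param i)) (M.law j ϑ₂) v) _).trans (add_le_add h1 h2)

end Regular

/-- A function with a bounded second derivative is close to its linearization at `0`. -/
theorem _root_.LatentCount.abs_sub_linear_le {f f' f'' : ℝ → ℝ} {c K u : ℝ} (hu : |u| ≤ c)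
    (hf : ∀ v, |v| ≤ c → HasDerivAt f (f' v) v) (hf' : ∀ v, |v| ≤ c → HasDerivAt f' (f'' v) v)
    (hK : ∀ v, |v| ≤ c → |f'' v| ≤ K) (h0 : f 0 = 0) : |f u - f' 0 * u| ≤ K * u ^ 2 := by
  have hseg : ∀ v ∈ Set.uIcc 0 u, |v| ≤ |u| := fun v hv => by
    have := Set.abs_sub_left_of_mem_uIcc hv
    simpa using this
  have hconv : Convex ℝ (Set.uIcc 0 u) := convex_uIcc 0 u
  have h1 : ∀ v ∈ Set.uIcc 0 u, |f' v - f' 0| ≤ K * |u| := by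
    intro v hv
    have := Convex.norm_image_sub_le_of_norm_hasDerivWithin_le (f := f') (f' := f'')
      (s := Set.uIcc 0 u) (C := K)
      (fun w hw => (hf' w ((hseg w hw).trans hu)).hasDerivWithinAt)
      (fun w hw => hK w ((hseg w hw).trans hu)) hconv Set.left_mem_uIcc hv
    rw [sub_zero, Real.norm_eq_abs, Real.norm_eq_abs] at this
    refine this.trans (mul_le_mul_of_nonneg_left (hseg v hv) ?_)
    exact (abs_nonneg _).trans (hK 0 (by simpa using (abs_nonneg u).trans hu))
  have h2 := Convex.norm_image_sub_le_of_norm_hasDerivWithin_le (f := fun v => f v - f' 0 * v)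
    (f' := fun v => f' v - f' 0) (s := Set.uIcc 0 u) (C := K * |u|)
    (fun w hw => ((hf w ((hseg w hw).trans hu)).sub (by
      simpa using (hasDerivAt_id w).const_mul (f' 0))).hasDerivWithinAt)
    h1 hconv Set.left_mem_uIcc Set.right_mem_uIcc
  simp only [h0, mul_zero, sub_zero, Real.norm_eq_abs] at h2
  calc |f u - f' 0 * u| ≤ K * |u| * |u| := h2
    _ = K * u ^ 2 := by rw [mul_assoc, ← sq, sq_abs]

/-- The term with (1 + m₂/m)² in the diagonal budget is thereby dominated by the same product of M₁
and M₂ as the second-order constant T. -/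
theorem _root_.LatentCount.sq_div_pow_four_le {m m₂ r₁ r₂ : ℝ} (hm : 0 < m) (h₁ : 1 / m ^ 2 ≤ r₁)
    (hr₂ : 0 ≤ r₂) (h₂ : m ^ 2 ≤ r₂ * m ^ 4) (h₃ : m₂ ^ 2 ≤ r₂ * m ^ 4) :
    (1 + m₂ / m) ^ 2 / m ^ 4 ≤ 4 * (r₁ * r₂) := by
  have h4 : (1 + m₂ / m) ^ 2 ≤ 2 * (m ^ 2 + m₂ ^ 2) / m ^ 2 := by
    rw [le_div_iff₀ (by positivity), ← mul_pow, add_mul, one_mul, div_mul_cancel₀ _ hm.ne']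
    nlinarith [sq_nonneg (m - m₂)]
  calc (1 + m₂ / m) ^ 2 / m ^ 4 ≤ 2 * (m ^ 2 + m₂ ^ 2) / m ^ 2 / m ^ 4 := by gcongr
    _ ≤ 2 * (r₂ * m ^ 4 + r₂ * m ^ 4) / m ^ 2 / m ^ 4 := by gcongr
    _ = 4 * (1 / m ^ 2 * r₂) := by field_simp; ring
    _ ≤ _ := by gcongr

namespace Regular

/-- The difference of the two link functions vanishes at 0, and its slope there is the difference of
two rank-one products. The error beyond this slope is quadratic in the latent correlation, hence
summable along rows. -/
theorem abs_link_sub_le (h : M.Regular L s cZ ε c₁ c₂) (hϑ : ϑ ∈ M.ball i ε)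
    (hϑ' : ϑ₂ ∈ M.ball j ε) (hy : ‖ϑ - M.param i‖ ≤ y) (hy' : ‖ϑ₂ - M.param j‖ ≤ y) {u : ℝ}
    (hu : |u| ≤ cZ) :
    |link (M.law i ϑ) (M.law j ϑ₂) u - link (M.law i (M.param i)) (M.law j (M.param j)) u
        - (hermiteCoeff (M.law i ϑ) 1 * hermiteCoeff (M.law j ϑ₂) 1
          - hermiteCoeff (M.law i (M.param i)) 1 * hermiteCoeff (M.law j (M.param j)) 1) * u|
      ≤ 112 / (1 - cZ ^ 2) ^ (7 / 2 : ℝ) * y * (M.supM cZ ε * M.supMu cZ ε).toReal * u ^ 2 := by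
  have hc := h.cZ_lt_one
  have s1 := h.secondMoment hϑ
  have s2 := h.secondMoment hϑ'
  have s3 := h.secondMoment (h.mem_ball i)
  have s4 := h.secondMoment (h.mem_ball j)
  have := abs_sub_linear_le (f := fun v => link (M.law i ϑ) (M.law j ϑ₂) v
      - link (M.law i (M.param i)) (M.law j (M.param j)) v)
    (f' := fun v => linkDeriv (M.law i ϑ) (M.law j ϑ₂) v
      - linkDeriv (M.law i (M.param i)) (M.law j (M.param j)) v) hu
    (fun v hv => (hasDerivAt_link s1 s2 (hv.trans_lt hc)).sub (hasDerivAt_link s3 s4 (hv.trans_lt hc)))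
    (fun v hv => (hasDerivAt_linkDeriv s1 s2 (hv.trans_lt hc)).sub
      (hasDerivAt_linkDeriv s3 s4 (hv.trans_lt hc)))
    (fun v hv => h.abs_linkDeriv2_sub_le hϑ hϑ' hy hy' hv) (by simp [link_zero])
  simp only [linkDeriv_zero s1 s2, linkDeriv_zero s3 s4] at this
  exact this

/-- The constant r₁ plays no part in the bound on the reciprocal derivative, so it is chosen
separately for each law. -/
theorem exists_momentBound (h : M.Regular L s cZ ε c₁ c₂) (hϑ : ϑ ∈ M.ball i ε) :
    ∃ r₁, MomentBound (M.law i ϑ) cZ r₁ (M.supM2 cZ ε).toReal := by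
  have hp := h.secondMoment hϑ
  have hfin := levelMoment_ne_top hp (x := 1 - cZ) (by linarith [h.cZ_lt_one])
    (by linarith [h.cZ_pos])
  have hone := one_le_inv_one_sub h.cZ_pos.le h.cZ_lt_one
  have hB : levelMoment (M.law i ϑ) 0 (1 / (1 - cZ)) ≠ 0 :=
    levelMoment_ne_zero_of_le (by norm_num) (by linarith) (h.levelMoment_half_ne_zero hϑ)
  have hA : levelMoment (M.law i ϑ) 0 (1 - cZ) ≠ 0 := fun h0 => by
    have h1 := (le_max_left _ _).trans (le_supM2 hϑ cZ)
    rw [h0, zero_pow four_ne_zero, ENNReal.div_zero (pow_ne_zero 2 hB)] at h1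
    exact h.supM_zero_ne_top.2 (top_le_iff.1 h1)
  have hpos : 0 < realMoment (M.law i ϑ) 0 (1 - cZ) := ENNReal.toReal_pos hA hfin
  exact ⟨(realMoment (M.law i ϑ) 0 (1 - cZ) ^ 2)⁻¹, momentBound_of_supM2 hϑ hp h.cZ_pos.le
    h.cZ_lt_one h.supM_zero_ne_top.2 (by rw [inv_mul_cancel₀ (by positivity)])⟩

theorem abs_inv_linkDeriv_sub_le (h : M.Regular L s cZ ε c₁ c₂) (hϑ : ϑ ∈ M.ball i ε)
    (hϑ' : ϑ₂ ∈ M.ball j ε) {u : ℝ} (hu : |u| ≤ cZ) :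
    |(linkDeriv (M.law i ϑ) (M.law j ϑ₂) u)⁻¹
        - (hermiteCoeff (M.law i ϑ) 1)⁻¹ * (hermiteCoeff (M.law j ϑ₂) 1)⁻¹|
      ≤ 6 * (M.supM2 cZ ε).toReal / (1 - cZ ^ 2) ^ 2 * |u| := by
  obtain ⟨r, hr⟩ := h.exists_momentBound hϑ
  obtain ⟨r', hr'⟩ := h.exists_momentBound hϑ'
  have := (hr.mono (le_max_left r r')).abs_inv_linkDeriv_sub_le (hr'.mono (le_max_right r r'))
    h.cZ_lt_one hu
  rwa [linkDeriv_zero (h.secondMoment hϑ) (h.secondMoment hϑ'), mul_inv] at this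

set_option maxHeartbeats 1000000 in
/-- The parts of the budget for the diagonal entries. -/
theorem budget_le (h : M.Regular L s cZ ε c₁ c₂) (hϑ : ϑ ∈ M.ball i ε) (hy : 0 ≤ y) :
    y * (M.supDelta ε).toReal / realMoment (M.law i ϑ) 0 (1 / 2)
      + y * (M.supMu cZ ε).toReal / realMoment (M.law i ϑ) 0 1
      + y * (M.supMu cZ ε).toReal
        * (1 + realMoment (M.law i ϑ) 2 1 / realMoment (M.law i ϑ) 0 1) ^ 2
        / realMoment (M.law i ϑ) 0 1 ^ 3
      + y * (M.supMu cZ ε).toReal * realMoment (M.law i ϑ) 0 1 / realMoment (M.law i ϑ) 0 (1 / 2)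
      ≤ y * (M.constQ L s cZ ε c₁ c₂).toReal := by
  obtain ⟨hD, hR, hT⟩ := h.le_constQ
  have hS := h.constS_eq
  obtain ⟨hD1, hD2⟩ := h.constD_bounds hϑ
  have hRe := h.constR_eq
  have hTe := h.constT_eq
  have hW := h.realMoment_mul_supMu_le hϑ
  have hm1 := h.one_le_supM1_zero hϑ
  have hmb := h.momentBound_c₁ hϑ
  have hG := h.one_le_norm
  have hm := h.realMoment_one_pos hϑ
  have hμ := h.realMoment_half_pos hϑ
  have hcZ : 0 < 1 - cZ ^ 2 := by nlinarith [h.cZ_pos, h.cZ_lt_one]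
  have hc₁ : 0 < 1 - c₁ ^ 2 := by nlinarith [h.c₁_pos, h.c₁_lt_one]
  have hx0 : (0 : ℝ) < 1 - c₁ := by linarith [h.c₁_lt_one]
  have hone := one_le_inv_one_sub h.c₁_pos.le h.c₁_lt_one
  have hmA : realMoment (M.law i ϑ) 0 (1 - c₁) ≤ realMoment (M.law i ϑ) 0 1 :=
    realMoment_mono (h.secondMoment hϑ) hx0 (by linarith [h.c₁_pos]) le_rfl
  have hmB : realMoment (M.law i ϑ) 0 1 ≤ realMoment (M.law i ϑ) 0 (1 / (1 - c₁)) :=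
    ENNReal.toReal_mono hmb.ne_top_zero (levelMoment_mono _ 0 one_pos hone)
  have hm2B : realMoment (M.law i ϑ) 2 1 ≤ realMoment (M.law i ϑ) 2 (1 / (1 - c₁)) :=
    ENNReal.toReal_mono hmb.ne_top_two (levelMoment_mono _ 2 one_pos hone)
  have hm2 := realMoment_nonneg (M.law i ϑ) 2 1
  set m := realMoment (M.law i ϑ) 0 1 with hm_def
  set m2 := realMoment (M.law i ϑ) 2 1 with hm2_def
  set ν := realMoment (M.law i ϑ) 0 (1 / 2) with hν_def
  set A := realMoment (M.law i ϑ) 0 (1 - c₁) with hA_def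
  set U := (M.supMu cZ ε).toReal with hU_def
  set W := (M.supM cZ ε * M.supMu cZ ε).toReal with hW_def
  set G := sparseNorm s (M.bigZ L) with hG_def
  set D := (M.constD ε).toReal with hD_def
  set R := (M.constR L s cZ ε).toReal with hR_def
  set S := (M.constS L s cZ ε).toReal with hS_def
  set T := (M.constT c₁ ε).toReal with hT_def
  set r₁ := (M.supM1 c₁ ε).toReal with hr₁_def
  set r₂ := (M.supM2 c₁ ε).toReal with hr₂_def
  set Q := (M.constQ L s cZ ε c₁ c₂).toReal with hQ_def
  have hU : 0 ≤ U := ENNReal.toReal_nonneg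
  have hW0 : 0 ≤ W := ENNReal.toReal_nonneg
  have hD0 : 0 ≤ D := ENNReal.toReal_nonneg
  have hR0 : 0 ≤ R := ENNReal.toReal_nonneg
  have hT0 : 0 ≤ T := ENNReal.toReal_nonneg
  have hS0 : 0 ≤ S := ENNReal.toReal_nonneg
  have hA0 : 0 < A := hmb.pos
  have hr₁ : 0 < r₁ := hmb.pos_one
  have hr₂ : 0 ≤ r₂ := hmb.nonneg
  set S' := max (S ^ 2) 1 with hS'_def
  have hS1 : 1 ≤ S' := le_max_right _ _
  have hSS : S ≤ S' := by
    rcases le_or_gt S 1 with h1 | h1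
    · exact h1.trans hS1
    · exact le_trans (by nlinarith) (le_max_left (S ^ 2) 1)
  -- In every term with w = yU a factor mU is split off and charged to max(S², 1). The remaining
  -- factors are charged to R, T and D respectively.
  have hmU : m * U ≤ S' := by
    refine hW.trans (le_trans ?_ hSS)
    rw [hS]
    have h1 : 1 ≤ 12 / (1 - cZ ^ 2) ^ (7 / 2 : ℝ) := by
      rw [le_div_iff₀ (by positivity), one_mul]
      exact (Real.rpow_le_one hcZ.le (by nlinarith [h.cZ_pos]) (by norm_num)).trans (by norm_num)
    calc W = 1 * W * 1 := by ring
      _ ≤ _ := by gcongr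
  have t1 : y * (M.supDelta ε).toReal / ν ≤ y * (Q / 24) := by
    rw [mul_div_assoc]
    refine mul_le_mul_of_nonneg_left ?_ hy
    have e1 : D * 1 ≤ D * S' := by gcongr
    have e2 : 6 * (M.supDelta ε).toReal / ν = 6 * ((M.supDelta ε).toReal / ν) := by ring
    linarith
  have t4 : y * U * m / ν ≤ y * (Q / 8) := by
    have e1 : 1 / ν ≤ D / 2 := by
      have : 2 / ν = 2 * (1 / ν) := by ring
      linarith
    calc y * U * m / ν = y * (m * U * (1 / ν)) := by ring
      _ ≤ y * (S' * (D / 2)) := by gcongr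
      _ ≤ _ := by gcongr; linarith
  have t2 : y * U / m ≤ y * (Q / 16) := by
    have e1 : 1 / m ^ 2 ≤ R := by
      have e2 : 1 / m ^ 2 ≤ (M.supM1 0 ε).toReal := by
        rw [div_le_iff₀ (by positivity)]; exact hm1
      have e3 : 0 ≤ (M.supM1 0 ε).toReal := ENNReal.toReal_nonneg
      have e4 : 0 ≤ (M.supM2 cZ ε).toReal := ENNReal.toReal_nonneg
      refine e2.trans ?_
      rw [hRe]
      calc (M.supM1 0 ε).toReal = 1 * (M.supM1 0 ε).toReal * 1 := by ring
        _ ≤ 8 * Real.pi * (M.supM1 0 ε).toReal * G := by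
          gcongr; linarith [Real.pi_gt_three]
        _ ≤ _ := by
          gcongr
          exact le_add_of_nonneg_right (by positivity)
    calc y * U / m = y * (m * U * (1 / m ^ 2)) := by field_simp
      _ ≤ y * (S' * R) := by gcongr
      _ ≤ _ := by gcongr; linarith
  have t3 : y * U * (1 + m2 / m) ^ 2 / m ^ 3 ≤ y * (Q / 4) := by
    -- The moment bounds at c₁ are moved to the argument 1, which lies between 1 - c₁ and 1/(1 -
    -- c₁).
    have e1 : (1 + m2 / m) ^ 2 / m ^ 4 ≤ T := by
      have f1 : 1 / m ^ 2 ≤ r₁ := by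
        rw [div_le_iff₀ (by positivity)]
        exact hmb.one_le.trans (by gcongr)
      have hAm : r₂ * A ^ 4 ≤ r₂ * m ^ 4 := by gcongr
      have f2 : m ^ 2 ≤ r₂ * m ^ 4 :=
        (pow_le_pow_left₀ hm.le hmB 2).trans (hmb.sq_le_zero.trans hAm)
      have f3 : m2 ^ 2 ≤ r₂ * m ^ 4 :=
        (pow_le_pow_left₀ hm2 hm2B 2).trans (hmb.sq_le_two.trans hAm)
      have f4 := sq_div_pow_four_le hm f1 hr₂ f2 f3
      refine f4.trans ?_
      rw [hTe]
      have f6 : 6 ≤ 6 / (1 - c₁ ^ 2) := by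
        rw [le_div_iff₀ hc₁]; nlinarith [sq_nonneg c₁]
      calc 4 * (r₁ * r₂) ≤ 6 * (r₁ * r₂) := by gcongr; norm_num
        _ ≤ 6 / (1 - c₁ ^ 2) * (r₁ * r₂) := by gcongr
        _ = _ := by ring
    calc y * U * (1 + m2 / m) ^ 2 / m ^ 3 = y * (m * U * ((1 + m2 / m) ^ 2 / m ^ 4)) := by
          field_simp
      _ ≤ y * (S' * T) := by gcongr
      _ ≤ _ := by gcongr; linarith
  have hQ0 : 0 ≤ y * Q := mul_nonneg hy ENNReal.toReal_nonneg
  linarith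

end Regular

end Model

end

/-! ### The deterministic error bound for the plug-in estimator -/

section

variable {Ω : Type u} [MeasurableSpace Ω] {μ : Measure Ω}

/-- Closeness in the seminorm keeps each sample autocovariance within the range in which the inverse
link functions are bounded by c₁. -/
theorem abs_apply_le_sparseNorm {ι : Type} [Fintype ι] [DecidableEq ι] {s : ℕ} (hs : 1 ≤ s)
    {A : Matrix ι ι ℝ} (hA : A.IsSymm) (a b : ι) : |A a b| ≤ sparseNorm s A := by
  have hcard : ({a, b} : Finset ι).card ≤ 2 * s := Finset.card_le_two.trans (by omega)
  have h1 := sum_row_sq_le hA hcard (a := a) (by simp)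
  have h2 : A a b ^ 2 ≤ ∑ c ∈ ({a, b} : Finset ι), A a c ^ 2 :=
    Finset.single_le_sum (f := fun c => A a c ^ 2) (fun c _ => sq_nonneg _) (by simp)
  exact abs_le_of_sq_le_sq (h2.trans h1) (sparseNorm_nonneg s A)

theorem offDiag_sub {ι : Type} [Fintype ι] [DecidableEq ι] (A B : Matrix ι ι ℝ) :
    offDiag (A - B) = offDiag A - offDiag B := by
  ext a b
  rcases eq_or_ne a b with rfl | hab
  · simp [offDiag_apply_self]
  · simp [offDiag_apply_ne, hab]

/-- The arithmetic that combines the bounds for the diagonal and the off-diagonal errors. -/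
theorem combine_errors {Q D R S T C c₀ α ν y β : ℝ} (hD : 4 * (D * max (S ^ 2) 1) ≤ Q)
    (hR : 16 * (R * max (S ^ 2) 1) ≤ Q) (hT : 4 * (T * max (S ^ 2) 1) ≤ Q) (hD0 : 0 ≤ D)
    (hR0 : 0 ≤ R) (hS0 : 0 ≤ S) (hT0 : 0 ≤ T) (hC : 1 ≤ C) (hc₀ : 1 ≤ c₀) (hα0 : 0 ≤ α)
    (hα1 : α ≤ 1) (hν : 0 ≤ ν) (hy : y ≤ α * ν) (hy2 : y ^ 2 ≤ α ^ 2 * ν)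
    (hβ : β ≤ α * c₀ * ν) (hβ2 : β ^ 2 ≤ α ^ 2 * c₀ * ν) :
    884736 * (C * c₀ * (y * Q) + β * D / 2) + R * (2 * β + 11 * (y * S))
        + T / 2 * (2 * β + 11 * (y * S)) ^ 2 ≤ 1000000 * C * α * (Q * (c₀ * ν)) := by
  set S' := max (S ^ 2) 1 with hS'
  have hS1 : 1 ≤ S' := le_max_right _ _
  have hS2 : S ^ 2 ≤ S' := le_max_left _ _
  have hSS : S ≤ S' := by
    rcases le_or_gt S 1 with h1 | h1
    · exact h1.trans hS1
    · exact le_trans (by nlinarith) hS2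
  have hQ0 : 0 ≤ Q := le_trans (by positivity) hD
  have hc0 : 0 ≤ c₀ := by linarith
  -- The common scale: y, β and their squares are all at most Y. For the squares this is the purpose
  -- of the hypotheses with α² and of α ≤ 1.
  set Y := α * (c₀ * ν) with hY
  have hY0 : 0 ≤ Y := by positivity
  have hβY : β ≤ Y := by rw [hY]; linarith
  have hyY : y ≤ Y := by
    refine hy.trans ?_
    rw [hY]
    exact mul_le_mul_of_nonneg_left (le_mul_of_one_le_left hν hc₀) hα0
  have hβ2Y : β ^ 2 ≤ Y := by
    calc β ^ 2 ≤ α * (α * (c₀ * ν)) := by rw [hY] at *; linarith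
      _ ≤ 1 * (α * (c₀ * ν)) := by gcongr
      _ = Y := by rw [one_mul]
  have hy2Y : y ^ 2 ≤ Y := by
    calc y ^ 2 ≤ α * (α * (1 * ν)) := by linarith
      _ ≤ 1 * (α * (c₀ * ν)) := by gcongr
      _ = Y := by rw [one_mul]
  have hQY : 0 ≤ Q * Y := mul_nonneg hQ0 hY0
  have t1 : C * c₀ * (y * Q) ≤ C * (Q * Y) := by
    calc C * c₀ * (y * Q) ≤ C * c₀ * (α * ν * Q) := by gcongr
      _ = _ := by rw [hY]; ring
  have t2 : β * D / 2 ≤ C * (Q * Y) / 8 := by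
    have h1 : D ≤ Q / 4 := by
      have : D * 1 ≤ D * S' := by gcongr
      linarith
    have h2 : β * D ≤ Y * (Q / 4) := by gcongr
    have h3 : Q * Y ≤ C * (Q * Y) := le_mul_of_one_le_left hQY hC
    linarith
  have t3 : R * (2 * β + 11 * (y * S)) ≤ Q * Y := by
    have h1 : 2 * β + 11 * (y * S) ≤ 13 * Y * S' := by
      have e1 : β * 1 ≤ Y * S' := by gcongr
      have e2 : y * S ≤ Y * S' := by gcongr
      linarith
    calc R * (2 * β + 11 * (y * S)) ≤ R * (13 * Y * S') := by gcongr
      _ = 13 * (R * S') * Y := by ring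
      _ ≤ Q * Y := by gcongr; linarith
  have t4 : T / 2 * (2 * β + 11 * (y * S)) ^ 2 ≤ 32 * (Q * Y) := by
    have h1 : (2 * β + 11 * (y * S)) ^ 2 ≤ 250 * Y * S' := by
      have e1 : β ^ 2 * 1 ≤ Y * S' := by gcongr
      have e2 : y ^ 2 * S ^ 2 ≤ Y * S' := by gcongr
      have e3 : (2 * β + 11 * (y * S)) ^ 2 ≤ 8 * β ^ 2 + 242 * (y ^ 2 * S ^ 2) := by
        nlinarith only [sq_nonneg (2 * β - 11 * (y * S))]
      linarith
    calc T / 2 * (2 * β + 11 * (y * S)) ^ 2 ≤ T / 2 * (250 * Y * S') := by gcongr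
      _ = 125 * (T * S') * Y := by ring
      _ ≤ 32 * Q * Y := mul_le_mul_of_nonneg_right (by linarith) hY0
      _ = _ := by ring
  have h3 : Q * Y ≤ C * (Q * Y) := le_mul_of_one_le_left hQY hC
  calc _ ≤ 1000000 * (C * (Q * Y)) := by linarith
    _ = _ := by rw [hY]; ring

namespace Model

variable {M : Model μ} {L T s : ℕ} {cZ c₀ c₁ c₂ ε δ' a₁ a₂ α ν y : ℝ}

theorem Regular.exists_isLevel (h : M.Regular L s cZ ε c₁ c₂) {i : Fin M.d}
    {ϑ : Fin (M.K i) → ℝ} (hϑ : ϑ ∈ M.ball i ε) : ∃ n, IsLevel (M.law i ϑ) n :=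
  LatentCount.exists_isLevel (h.levelMoment_half_ne_zero hϑ)

/-- The error of the diagonal entries. -/
theorem Regular.abs_bigZHat_self_sub_le [IsProbabilityMeasure μ] (h : M.Regular L s cZ ε c₁ c₂)
    (hc : M.BoundedCorrelations cZ) (ha₁ : 0 < a₁) (ha₂ : 0 < a₂) (hLT : L < T)
    (hX : M.ConcentrationX L T s c₀ a₁ a₂) {θ : ∀ i, Fin (M.K i) → ℝ}
    (hθ : ∀ i, θ i ∈ M.ball i ε) (hy : ∀ i, ‖θ i - M.param i‖ ≤ y) (ω : Ω)
    (a : Fin L × Fin M.d) :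
    |(M.bigZHat L T θ ω - M.bigZ L) a a|
      ≤ 884736 * (max 1 (16 * √(a₁ * (2 / a₂ ^ 2 + 1 / a₂))) * c₀
        * (y * (M.constQ L s cZ ε c₁ c₂).toReal)
        + sparseNorm s (M.bigXHat L T ω - M.bigX L) * (M.constD ε).toReal / 2) := by
  have hy0 : 0 ≤ y := (norm_nonneg _).trans (hy a.2)
  set C := max 1 (16 * √(a₁ * (2 / a₂ ^ 2 + 1 / a₂))) with hC
  have hC1 : 1 ≤ C := le_max_left _ _
  have hc₀ : 1 ≤ c₀ := hX.1
  set p := M.trueLaw a.2 with hp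
  set q := M.law a.2 (θ a.2) with hq
  have hsm : ∀ i, SecondMoment (M.trueLaw i) := fun i => h.secondMoment (h.mem_ball i)
  have hμ : 0 < realMoment q 0 (1 / 2) := h.realMoment_half_pos (hθ a.2)
  have hone := one_le_inv_one_sub h.c₁_pos.le h.c₁_lt_one
  have h2 : levelMoment q 2 1 ≠ ∞ := ne_top_of_le_ne_top (h.momentBound_c₁ (hθ a.2)).ne_top_two
    (levelMoment_mono _ 2 one_pos hone)
  -- The constant of the diagonal bound is C c₀, by the fourth-moment consequence of the
  -- concentration hypothesis; this is one reason for the factor c₀ in the final bound.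
  have key := abs_linkInv_self_sub_one_le (p := p) (q := q) (c := C * c₀)
    (y := M.bigXHat L T ω a a) (hsm a.2) (h.secondMoment (hθ a.2)) hμ h2
    (by nlinarith)
    (h.sum_abs_countCDF_sub_le (hθ a.2) (hy a.2))
    (h.sum_mul_abs_countCDF_sub_le (hθ a.2) (hy a.2))
    (fun hV => (hX.le_mul hsm hc ha₁ ha₂ hLT h.one_le_sparsity a hV).trans
      (mul_le_mul_of_nonneg_right (le_max_right _ _) (by linarith)))
  have hb := h.budget_le (hθ a.2) hy0
  rw [Matrix.sub_apply, bigZ_self]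
  refine key.trans ?_
  refine mul_le_mul_of_nonneg_left (add_le_add (mul_le_mul_of_nonneg_left hb (by positivity)) ?_)
    (by norm_num)
  have hB : |M.bigXHat L T ω a a - link p p 1| ≤ sparseNorm s (M.bigXHat L T ω - M.bigX L) := by
    have := abs_diag_le h.one_le_sparsity (M.bigXHat L T ω - M.bigX L) a
    rwa [Matrix.sub_apply, bigX_self hsm] at this
  have hD : 1 / realMoment q 0 (1 / 2) ≤ (M.constD ε).toReal / 2 := by
    have := (h.constD_bounds (hθ a.2)).1
    rw [div_le_iff₀ hμ] at this ⊢
    linarith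
  have hn := sparseNorm_nonneg s (M.bigXHat L T ω - M.bigX L)
  calc |M.bigXHat L T ω a a - link p p 1| / realMoment q 0 (1 / 2)
      = |M.bigXHat L T ω a a - link p p 1| * (1 / realMoment q 0 (1 / 2)) := by ring
    _ ≤ sparseNorm s (M.bigXHat L T ω - M.bigX L) * ((M.constD ε).toReal / 2) := by gcongr
    _ = _ := by ring

/-- The change of the covariance matrix of the counts when the parameters are perturbed. -/
theorem Regular.sparseNorm_offDiag_link_sub_le (h : M.Regular L s cZ ε c₁ c₂)
    (hc : M.BoundedCorrelations cZ) (hy0 : 0 ≤ y) {θ : ∀ i, Fin (M.K i) → ℝ}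
    (hθ : ∀ i, θ i ∈ M.ball i ε) (hy : ∀ i, ‖θ i - M.param i‖ ≤ y) :
    sparseNorm s (offDiag (Matrix.of fun a b =>
        link (M.law a.2 (θ a.2)) (M.law b.2 (θ b.2)) (M.bigZ L a b)
          - link (M.law a.2 (M.param a.2)) (M.law b.2 (M.param b.2)) (M.bigZ L a b)))
      ≤ 11 * (y * (M.constS L s cZ ε).toReal) := by
  obtain ⟨η, m, hη, hm, hηm, hbd⟩ := h.exists_hermiteCoeff_bounds hy0 hθ hy
  have hcZ : 0 < 1 - cZ ^ 2 := by nlinarith [h.cZ_pos, h.cZ_lt_one]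
  have hG := h.one_le_norm
  set W := (M.supM cZ ε * M.supMu cZ ε).toReal with hW
  have hW0 : 0 ≤ W := ENNReal.toReal_nonneg
  set G := sparseNorm s (M.bigZ L) with hGdef
  have h1 := sparseNorm_offDiag_perturbation_le (s := s) h.one_le_sparsity
    (Γ := M.bigZ L) (P := Matrix.of fun a b =>
        link (M.law a.2 (θ a.2)) (M.law b.2 (θ b.2)) (M.bigZ L a b)
          - link (M.law a.2 (M.param a.2)) (M.law b.2 (M.param b.2)) (M.bigZ L a b))
    (e := fun a => hermiteCoeff (M.law a.2 (θ a.2)) 1)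
    (f := fun a => hermiteCoeff (M.law a.2 (M.param a.2)) 1)
    (κ₂ := 112 / (1 - cZ ^ 2) ^ (7 / 2 : ℝ) * y * W) (η := η) (m := m)
    (M.isSymm_bigZ L) (M.bigZ_form_nonneg L) (M.bigZ_self L) (by positivity) hη hm
    (fun a b hab => h.abs_link_sub_le (hθ a.2) (hθ b.2) (hy a.2) (hy b.2)
      (hc.abs_bigZ_lt hab).le)
    (fun a => (hbd a.2).1) (fun a => (hbd a.2).2.1) (fun a => (hbd a.2).2.2)
  refine h1.trans ?_
  rw [h.constS_eq, ← hW, ← hGdef]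
  have h2 : 1 ≤ 1 / (1 - cZ ^ 2) ^ (7 / 2 : ℝ) := by
    rw [le_div_iff₀ (by positivity), one_mul]
    exact Real.rpow_le_one hcZ.le (by nlinarith [h.cZ_pos]) (by norm_num)
  set k := 1 / (1 - cZ ^ 2) ^ (7 / 2 : ℝ) with hk
  have e1 : ∀ t : ℝ, t / (1 - cZ ^ 2) ^ (7 / 2 : ℝ) = t * k := fun t => by rw [hk]; ring
  rw [e1, e1]
  -- The rank-one part contributes 8yW and the quadratic part 112 k y W; 132 = 11 · 12 matches the
  -- factor 12 in S.
  have h3 : 4 * (η * m) + 112 * k * y * W ≤ 132 * (k * (y * W)) := by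
    have h4 : 1 * (y * W) ≤ k * (y * W) := by gcongr
    have h5 : 0 ≤ k * (y * W) := by positivity
    linarith only [h4, h5, hηm]
  calc (4 * (η * m) + 112 * k * y * W) * G ≤ 132 * (k * (y * W)) * G := by gcongr
    _ = _ := by ring

/-- The error of the plug-in estimator when the sample autocovariances and the estimated parameters
are close to the true ones. -/
theorem Regular.sparseNorm_bigZHat_sub_le [IsProbabilityMeasure μ]
    (h : M.Regular L s cZ ε c₁ c₂) (hc : M.BoundedCorrelations cZ) (ha₁ : 0 < a₁) (ha₂ : 0 < a₂)
    (hLT : L < T) (hX : M.ConcentrationX L T s c₀ a₁ a₂)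
    (hinv : M.IsInverseBound L ε (ENNReal.ofReal (c₀ * δ')) c₁) {θ : ∀ i, Fin (M.K i) → ℝ}
    (hα0 : 0 ≤ α) (hα1 : α ≤ 1) (hν : 0 ≤ ν) (hνδ : ν ≤ δ') (hy0 : 0 ≤ y)
    (hθ : ‖θ - M.param‖ ≤ y) (hyε : y ≤ ε) (hyν : y ≤ α * ν) (hy2 : y ^ 2 ≤ α ^ 2 * ν) (ω : Ω)
    (hβ : sparseNorm s (M.bigXHat L T ω - M.bigX L) ≤ α * c₀ * ν)
    (hβ2 : sparseNorm s (M.bigXHat L T ω - M.bigX L) ^ 2 ≤ α ^ 2 * c₀ * ν) :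
    sparseNorm s (M.bigZHat L T θ ω - M.bigZ L)
      ≤ 1000000 * max 1 (16 * √(a₁ * (2 / a₂ ^ 2 + 1 / a₂))) * α
        * ((M.constQ L s cZ ε c₁ c₂).toReal * (c₀ * ν)) := by
  have hsm : ∀ i, SecondMoment (M.trueLaw i) := fun i => h.secondMoment (h.mem_ball i)
  have hyi : ∀ i, ‖θ i - M.param i‖ ≤ y := fun i => (norm_le_pi_norm (θ - M.param) i).trans hθ
  have hball : ∀ i, θ i ∈ M.ball i ε := fun i => by
    rw [ball, Metric.mem_closedBall, dist_eq_norm]; exact (hyi i).trans hyε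
  set B := M.bigXHat L T ω - M.bigX L with hB
  have hBs : B.IsSymm := (isSymm_bigXHat L T ω).sub (isSymm_bigX hsm hc L)
  set β := sparseNorm s B with hβdef
  have hβ0 : 0 ≤ β := sparseNorm_nonneg s B
  have hc₀ : 1 ≤ c₀ := hX.1
  have hc₁2 : 0 < 1 - c₁ ^ 2 := by nlinarith [h.c₁_pos, h.c₁_lt_one]
  have hcZ : 0 < 1 - cZ ^ 2 := by nlinarith [h.cZ_pos, h.cZ_lt_one]
  have hGone := h.one_le_norm
  set P : BlockMatrix L M.d := Matrix.of fun a b =>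
        link (M.law a.2 (θ a.2)) (M.law b.2 (θ b.2)) (M.bigZ L a b)
          - link (M.law a.2 (M.param a.2)) (M.law b.2 (M.param b.2)) (M.bigZ L a b) with hP
  have hPs : P.IsSymm := by
    ext a b
    simp only [hP, Matrix.transpose_apply, Matrix.of_apply]
    rw [(M.isSymm_bigZ L).apply, link_comm, link_comm (M.law b.2 (M.param b.2))]
  have hPn : sparseNorm s (offDiag P) ≤ 11 * (y * (M.constS L s cZ ε).toReal) :=
    h.sparseNorm_offDiag_link_sub_le hc hy0 hball hyi
  have hDn : sparseNorm s (offDiag (B - P)) ≤ 2 * β + 11 * (y * (M.constS L s cZ ε).toReal) := by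
    rw [offDiag_sub]
    exact (sparseNorm_sub_le _ _ _).trans
      (add_le_add (sparseNorm_offDiag_le h.one_le_sparsity B) hPn)
  -- The true latent correlation is the inverse link function at the true parameters and the exact
  -- autocovariance, so c₁ bounds it too.
  have hu : ∀ a b : Fin L × Fin M.d, a ≠ b → |M.bigZ L a b| ≤ c₁ := by
    intro a b hab
    have h1 := hinv.2.2 a b hab M.param h.mem_ball (M.bigX L a b) (by simp)
    obtain ⟨n, hn⟩ := h.exists_isLevel (h.mem_ball a.2)
    obtain ⟨n', hn'⟩ := h.exists_isLevel (h.mem_ball b.2)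
    have hlt := (hc.abs_bigZ_lt hab).trans hc.2.1
    have h2 := linkInv_link (M.law a.2 (M.param a.2)) (M.law b.2 (M.param b.2))
      (strictMonoOn_link (hsm a.2) (hsm b.2) hn hn') (M.bigZ L a b) (abs_le.1 hlt.le)
    rw [bigX_eq_link hsm hc hab] at h1
    exact h2 ▸ h1
  have hu' : ∀ a b : Fin L × Fin M.d, a ≠ b →
      |linkInv (M.law a.2 (θ a.2)) (M.law b.2 (θ b.2)) (M.bigXHat L T ω a b)| ≤ c₁ := by
    intro a b hab
    refine hinv.2.2 a b hab θ hball _ ?_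
    have h1 : |M.bigXHat L T ω a b - M.bigX L a b| ≤ β :=
      abs_apply_le_sparseNorm h.one_le_sparsity hBs a b
    rw [← ENNReal.ofReal_ofNat 2, ← ENNReal.ofReal_mul (by norm_num)]
    refine ENNReal.ofReal_le_ofReal (h1.trans (hβ.trans ?_))
    have hc0 : 0 ≤ c₀ := by linarith
    calc α * c₀ * ν ≤ 1 * c₀ * δ' := by gcongr
      _ ≤ _ := by
        have : 0 ≤ c₀ * δ' := mul_nonneg hc0 (hν.trans hνδ)
        linarith
  have hE := sparseNorm_error_le (s := s) h.one_le_sparsity (Γ := M.bigZ L) (D := B - P)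
    (E := M.bigZHat L T θ ω - M.bigZ L)
    (H := Matrix.of fun a b =>
      (linkDeriv (M.law a.2 (θ a.2)) (M.law b.2 (θ b.2)) (M.bigZ L a b))⁻¹)
    (d := fun a => (hermiteCoeff (M.law a.2 (θ a.2)) 1)⁻¹)
    (r := (M.supM1 0 ε).toReal) (κ := 6 * (M.supM2 cZ ε).toReal / (1 - cZ ^ 2) ^ 2)
    (τ := (M.constT c₁ ε).toReal / 2)
    (ω := 884736 * (max 1 (16 * √(a₁ * (2 / a₂ ^ 2 + 1 / a₂))) * c₀
        * (y * (M.constQ L s cZ ε c₁ c₂).toReal) + β * (M.constD ε).toReal / 2))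
    (M.isSymm_bigZ L) (M.bigZ_form_nonneg L) (M.bigZ_self L) (hBs.sub hPs)
    ENNReal.toReal_nonneg (by positivity) (by positivity) (by positivity) hDn
    (fun a b hab => by
      have h1 := (h.momentBound_c₁ (hball a.2)).abs_linkInv_sub_le (h.momentBound_c₁ (hball b.2))
        h.c₁_lt_one (hu a b hab) (hu' a b hab)
      have h2 : M.bigXHat L T ω a b
          - link (M.law a.2 (θ a.2)) (M.law b.2 (θ b.2)) (M.bigZ L a b) = (B - P) a b := by
        simp only [hB, hP, Matrix.sub_apply, Matrix.of_apply]
        rw [bigX_eq_link hsm hc hab]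
        simp only [trueLaw]
        ring
      rw [h2] at h1
      refine h1.trans (le_of_eq ?_)
      rw [h.constT_eq]; ring)
    (fun a b hab => h.abs_inv_linkDeriv_sub_le (hball a.2) (hball b.2) (hc.abs_bigZ_lt hab).le)
    (fun a => by
      have h1 := h.one_le_supM1_zero (hball a.2)
      have h2 := h.realMoment_one_pos (hball a.2)
      rw [h.hermiteCoeff_one (hball a.2), inv_pow, inv_eq_one_div, div_le_iff₀ (by positivity)]
      exact h1)
    (fun a => h.abs_bigZHat_self_sub_le hc ha₁ ha₂ hLT hX hball hyi ω a)
  obtain ⟨hDQ, hRQ, hTQ⟩ := h.le_constQ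
  -- The coefficient of the first-order error is at most R; the first summand may be multiplied by
  -- the seminorm of Γ because that is at least 1.
  have hRle : (M.supM1 0 ε).toReal
      + 6 * (M.supM2 cZ ε).toReal / (1 - cZ ^ 2) ^ 2 * sparseNorm s (M.bigZ L)
      ≤ (M.constR L s cZ ε).toReal := by
    rw [h.constR_eq]
    have e1 : 0 ≤ (M.supM1 0 ε).toReal := ENNReal.toReal_nonneg
    have e2 : 0 ≤ (M.supM2 cZ ε).toReal := ENNReal.toReal_nonneg
    have e3 : (M.supM1 0 ε).toReal * 1 * 1
        ≤ (M.supM1 0 ε).toReal * sparseNorm s (M.bigZ L) * (8 * Real.pi) := by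
      gcongr; linarith [Real.pi_gt_three]
    have e4 : (M.supM2 cZ ε).toReal / (1 - cZ ^ 2) ^ 2 * sparseNorm s (M.bigZ L) * 6
        ≤ (M.supM2 cZ ε).toReal / (1 - cZ ^ 2) ^ 2 * sparseNorm s (M.bigZ L)
          * (24 * Real.pi) := by
      gcongr; linarith [Real.pi_gt_three]
    have e5 : 24 * Real.pi * (1 / (1 - cZ ^ 2) ^ 2) * (M.supM2 cZ ε).toReal
        = (M.supM2 cZ ε).toReal / (1 - cZ ^ 2) ^ 2 * (24 * Real.pi) := by ring
    have e6 : 6 * (M.supM2 cZ ε).toReal / (1 - cZ ^ 2) ^ 2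
        = (M.supM2 cZ ε).toReal / (1 - cZ ^ 2) ^ 2 * 6 := by ring
    rw [e5, e6]
    linarith
  refine hE.trans (le_trans ?_ (combine_errors hDQ hRQ hTQ ENNReal.toReal_nonneg
    ENNReal.toReal_nonneg ENNReal.toReal_nonneg ENNReal.toReal_nonneg (le_max_left _ _) hc₀ hα0 hα1
    hν hyν hy2 hβ hβ2))
  have : 0 ≤ 2 * β + 11 * (y * (M.constS L s cZ ε).toReal) := by positivity
  gcongr

end Model

end

/-! ### The probability of a large error -/

section

variable {Ω : Type u} [MeasurableSpace Ω] {μ : Measure Ω}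

theorem sparseNorm_eq_zero_of_sparsity_zero {ι : Type} [Fintype ι] (A : Matrix ι ι ℝ) :
    sparseNorm 0 A = 0 := by
  refine le_antisymm (sparseNorm_le fun v _ hv => ?_) (sparseNorm_nonneg 0 A)
  have h1 : {a | v a ≠ 0}.ncard = 0 := Nat.le_zero.1 (by simpa [IsSparse] using hv)
  rw [Set.ncard_eq_zero (Set.toFinite _)] at h1
  have h2 : v = 0 := by
    ext a
    by_contra h
    have : a ∈ {a | v a ≠ 0} := h
    rw [h1] at this
    exact this
  simp [h2]

theorem sparseNorm_eq_zero_of_isEmpty {ι : Type} [Fintype ι] [IsEmpty ι] (s : ℕ)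
    (A : Matrix ι ι ℝ) : sparseNorm s A = 0 := by
  refine le_antisymm (sparseNorm_le fun v _ _ => ?_) (sparseNorm_nonneg s A)
  simp [dotProduct]

/-- The cardinality of the net is absorbed by an exponential rate. -/
theorem absorb_net {P a β E : ℝ} {n s : ℕ} (hn : 1 ≤ n) (ha : 0 ≤ a) (hβ : 0 ≤ β) (hE : 0 ≤ E)
    (hP1 : P ≤ 1) (hP : P ≤ 2 * (25 * (n : ℝ)) ^ min (2 * s) n * (a * Real.exp (-(β * E)))) :
    P ≤ max 1 (50 * a) * Real.exp (-(β / 7) * E + 2 * s * Real.log n) := by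
  have hβE : 0 ≤ β * E := mul_nonneg hβ hE
  have hlog : 0 ≤ Real.log n := Real.log_natCast_nonneg n
  set G := 2 * s * Real.log n with hG
  have hG0 : 0 ≤ G := by positivity
  -- If the exponent does not dominate the entropy term, the right-hand side is at least 1 and there
  -- is nothing to prove.
  rcases le_or_gt (β * E / 7) G with h | h
  · have h1 : 1 ≤ Real.exp (-(β / 7) * E + G) := Real.one_le_exp (by linarith)
    exact hP1.trans (one_le_mul_of_one_le_of_one_le (le_max_left _ _) h1)
  have hexp : Real.exp (-(β * E / 7)) ≤ Real.exp (-(β / 7) * E + G) :=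
    Real.exp_le_exp.2 (by linarith)
  rcases hn.eq_or_lt with rfl | hn2
  · have h1 : (25 * ((1 : ℕ) : ℝ)) ^ min (2 * s) 1 ≤ 25 ^ 1 := by
      rw [Nat.cast_one, mul_one]
      exact pow_le_pow_right₀ (by norm_num) (min_le_right _ _)
    calc P ≤ 2 * 25 ^ 1 * (a * Real.exp (-(β * E / 7))) := by
          refine hP.trans ?_
          gcongr
          linarith
      _ = 50 * a * Real.exp (-(β * E / 7)) := by ring
      _ ≤ _ := by gcongr; exact le_max_right _ _
  · have hn2' : (2 : ℝ) ≤ n := by exact_mod_cast hn2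
    have hn1 : (1 : ℝ) ≤ n := by linarith
    have h1 : (25 * (n : ℝ)) ^ min (2 * s) n ≤ Real.exp (6 * G) := by
      -- For n ≥ 2 the constant 25 becomes a power of n, so the net costs exp(6G); six sevenths of
      -- the exponent pay for it, and one seventh remains. For n = 1, where log n = 0, the constant
      -- 25 goes into the prefactor instead.
      have h25 : 25 * (n : ℝ) ≤ (n : ℝ) ^ 6 := by
        have : (2 : ℝ) ^ 5 ≤ (n : ℝ) ^ 5 := by gcongr
        calc 25 * (n : ℝ) ≤ (n : ℝ) ^ 5 * n := by gcongr; linarith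
          _ = _ := by ring
      calc (25 * (n : ℝ)) ^ min (2 * s) n ≤ ((n : ℝ) ^ 6) ^ (2 * s) :=
            (pow_le_pow_left₀ (by positivity) h25 _).trans
              (pow_le_pow_right₀ (one_le_pow₀ hn1) (min_le_left _ _))
        _ = Real.exp (Real.log n) ^ (6 * (2 * s)) := by
            rw [Real.exp_log (by linarith), ← pow_mul]
        _ = _ := by
            rw [← Real.exp_nat_mul, hG]; push_cast; ring_nf
    have h2 : Real.exp (6 * G) * Real.exp (-(β * E)) ≤ Real.exp (-(β * E / 7)) := by
      rw [← Real.exp_add]; exact Real.exp_le_exp.2 (by linarith)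
    calc P ≤ 2 * Real.exp (6 * G) * (a * Real.exp (-(β * E))) := by
          refine hP.trans ?_
          gcongr
      _ = 2 * a * (Real.exp (6 * G) * Real.exp (-(β * E))) := by ring
      _ ≤ 2 * a * Real.exp (-(β * E / 7)) := by gcongr
      _ ≤ max 1 (50 * a) * Real.exp (-(β * E / 7)) := by
          gcongr; exact le_trans (by linarith) (le_max_right _ _)
      _ ≤ _ := by gcongr

namespace Model

variable {M : Model μ} {L T s : ℕ} {cZ c₀ c₁ c₂ δ δ' ε ε' a₁ a₂ b₁ b₂ α ν x y : ℝ}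
  {θhat : Ω → ∀ i, Fin (M.K i) → ℝ}

theorem errorProb_eq_zero_of_sparseNorm (h : ∀ A : BlockMatrix L M.d, sparseNorm s A = 0) :
    M.errorProb L T s θhat cZ c₀ δ ε c₁ c₂ = 0 := by
  simp [errorProb, h]

theorem errorProb_eq_zero_of_constQ (h : M.constQ L s cZ ε c₁ c₂ = ∞) (hδ : 0 < c₀ * δ) :
    M.errorProb L T s θhat cZ c₀ δ ε c₁ c₂ = 0 := by
  have h1 : ENNReal.ofReal (c₀ * δ) ≠ 0 := by simpa using hδ
  simp [errorProb, h, ENNReal.top_mul h1]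

/-- If Q is infinite the event is empty, and if there are no entries or no nonzero sparse vectors
the seminorm is 0. Otherwise the constants can be treated as real numbers. -/
theorem errorProb_eq_zero_or_regular (h : M.Admissible L T s cZ c₀ θhat a₁ a₂ b₁ b₂)
    (hr : M.Radii L s cZ c₀ δ' ε ε' c₁ c₂) (hε : 0 ≤ ε) (hδ : 0 < δ) :
    M.errorProb L T s θhat cZ c₀ δ ε c₁ c₂ = 0 ∨ M.Regular L s cZ ε c₁ c₂ := by
  by_cases hQ : M.constQ L s cZ ε c₁ c₂ = ∞
  · exact .inl (errorProb_eq_zero_of_constQ hQ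
      (mul_pos (one_pos.trans_le h.concentrationX.1) hδ))
  rcases isEmpty_or_nonempty (Fin L × Fin M.d) with he | he
  · exact .inl (errorProb_eq_zero_of_sparseNorm fun A => sparseNorm_eq_zero_of_isEmpty s A)
  rcases Nat.eq_zero_or_pos s with rfl | hs
  · exact .inl (errorProb_eq_zero_of_sparseNorm fun A => sparseNorm_eq_zero_of_sparsity_zero A)
  exact .inr ⟨he, hs, h.boundedCorrelations.1, h.boundedCorrelations.2.1, hr.2.1.1, hr.2.1.2.1, hε,
    hr.1, h.finiteMoments, h.smoothMarginals, hQ⟩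

/-- Off two exceptional events the deterministic bound applies, with α normalized so that its
constant is 1. The condition x² ≤ ν/c₀ makes the quadratic error (c₀x)² at most c₀ν; for the
parameters the radius min(1, ν) plays this role. -/
theorem Regular.errorProb_le [IsProbabilityMeasure μ] (h : M.Regular L s cZ ε c₁ c₂)
    (hA : M.Admissible L T s cZ c₀ θhat a₁ a₂ b₁ b₂) (ha₁ : 0 < a₁) (ha₂ : 0 < a₂)
    (hr : M.Radii L s cZ c₀ δ' ε ε' c₁ c₂) (hα0 : 0 < α)
    (hα : 1000000 * max 1 (16 * √(a₁ * (2 / a₂ ^ 2 + 1 / a₂))) * α = 1) (hν : 0 < ν)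
    (hνδ : ν ≤ δ) (hνδ' : ν ≤ δ') (hνε : ν ≤ ε) (hxν : x ≤ ν)
    (hx2 : x ^ 2 ≤ ν / c₀) :
    M.errorProb L T s θhat cZ c₀ δ ε c₁ c₂
      ≤ μ.real {ω | α * c₀ * x < sparseNorm s (M.bigXHat L T ω - M.bigX L)}
        + μ.real {ω | α * min 1 ν < ‖θhat ω - M.param‖} := by
  have hc₀ : 1 ≤ c₀ := hA.concentrationX.1
  have hc0 : 0 < c₀ := by linarith
  have hα1 : α ≤ 1 := by
    have : 1 ≤ max 1 (16 * √(a₁ * (2 / a₂ ^ 2 + 1 / a₂))) := le_max_left _ _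
    nlinarith
  have hm0 : 0 ≤ min 1 ν := le_min zero_le_one hν.le
  refine (measureReal_mono ?_ (measure_ne_top _ _)).trans (measureReal_union_le _ _)
  intro ω hω
  by_contra hn
  rw [Set.mem_union, not_or] at hn
  obtain ⟨hB, hθ⟩ := hn
  rw [Set.mem_ofPred_eq, not_lt] at hB hθ
  rw [Set.mem_ofPred_eq] at hω
  have hx2' : c₀ * x ^ 2 ≤ ν := by rwa [le_div_iff₀ hc0, mul_comm] at hx2
  have hαc : 0 ≤ α * c₀ := by positivity
  have hb2 : sparseNorm s (M.bigXHat L T ω - M.bigX L) ^ 2 ≤ α ^ 2 * c₀ * ν := by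
    calc _ ≤ (α * c₀ * x) ^ 2 := pow_le_pow_left₀ (sparseNorm_nonneg _ _) hB 2
      _ = α ^ 2 * c₀ * (c₀ * x ^ 2) := by ring
      _ ≤ _ := by gcongr
  have hmn : (min 1 ν) ^ 2 ≤ ν := by
    rw [sq]
    calc min 1 ν * min 1 ν ≤ 1 * ν := by
          gcongr
          · exact min_le_left _ _
          · exact min_le_right _ _
      _ = ν := one_mul ν
  have key := h.sparseNorm_bigZHat_sub_le hA.boundedCorrelations ha₁ ha₂ hA.lag_lt
    hA.concentrationX hr.2.1 hα0.le hα1 hν.le hνδ' (mul_nonneg hα0.le hm0) hθ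
    (le_trans (by nlinarith [min_le_right 1 ν]) hνε)
    (mul_le_mul_of_nonneg_left (min_le_right _ _) hα0.le)
    (by rw [mul_pow]; gcongr) ω
    (hB.trans (mul_le_mul_of_nonneg_left hxν hαc)) hb2
  rw [hα, one_mul] at key
  rw [← ENNReal.ofReal_toReal h.constQ_ne_top, ← ENNReal.ofReal_mul ENNReal.toReal_nonneg,
    ENNReal.ofReal_lt_ofReal_iff_of_nonneg (by
      have : 0 ≤ δ := hν.le.trans hνδ
      positivity)] at hω
  refine absurd (hω.trans_le key) (not_lt.2 ?_)
  gcongr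

theorem Regular.measureReal_sparseNorm_le [IsProbabilityMeasure μ]
    (h : M.Regular L s cZ ε c₁ c₂) (hc : M.BoundedCorrelations cZ)
    (hX : M.ConcentrationX L T s c₀ a₁ a₂) (ha₁ : 0 < a₁) (ha₂ : 0 < a₂) (hα0 : 0 < α)
    (hα1 : α ≤ 1) (hx0 : 0 < x) (hx1 : x ≤ 1) :
    μ.real {ω | α * c₀ * x < sparseNorm s (M.bigXHat L T ω - M.bigX L)}
      ≤ max 1 (50 * a₁) * Real.exp (-(a₂ * α ^ 2 / 64 / 7) * (((T - L : ℕ) : ℝ) * x ^ 2)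
        + 2 * s * Real.log ((L * M.d : ℕ) : ℝ)) := by
  have hsm : ∀ i, SecondMoment (M.trueLaw i) := fun i => h.secondMoment (h.mem_ball i)
  have hc₀ : 1 ≤ c₀ := hX.1
  have hne := h.nonempty
  have hcard : Fintype.card (Fin L × Fin M.d) = L * M.d := by simp
  -- The net loses a factor 8; as z ≤ 1, the minimum of z and z² is z².
  set z := α * x / 8 with hz
  have hz0 : 0 < z := by positivity
  have hz1 : z ≤ 1 := by nlinarith
  have hmin : min z (z ^ 2) = α ^ 2 / 64 * x ^ 2 := by
    rw [min_eq_right (by nlinarith), hz]; ring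
  have h1 := measureReal_sparseNorm_gt_le (P := μ) (s := s)
    (B := fun ω => M.bigXHat L T ω - M.bigX L)
    (fun ω => (isSymm_bigXHat L T ω).sub (isSymm_bigX hsm hc L)) (t := c₀ * z)
    (r := a₁ * Real.exp (-a₂ * ((T - L : ℕ) : ℝ) * min z (z ^ 2))) (by positivity)
    (fun v hv hs => hX.2 v hv hs z hz0) (by positivity)
  have e : 8 * (c₀ * z) = α * c₀ * x := by rw [hz]; ring
  rw [e, hcard, hmin] at h1
  refine absorb_net (hcard ▸ Fintype.card_pos) ha₁.le (by positivity) (by positivity)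
    measureReal_le_one (h1.trans (le_of_eq ?_))
  congr 3
  ring

/-- The exponential bound for the plug-in estimator, with explicit constants. -/
theorem Admissible.errorProb_le [IsProbabilityMeasure μ]
    (hA : M.Admissible L T s cZ c₀ θhat a₁ a₂ b₁ b₂) (ha₁ : 0 < a₁) (ha₂ : 0 < a₂) (hb₁ : 0 < b₁)
    (hα0 : 0 < α)
    (hα : 1000000 * max 1 (16 * √(a₁ * (2 / a₂ ^ 2 + 1 / a₂))) * α = 1) (hδ : 0 < δ)
    (hδ' : 0 < δ') (hε : 0 < ε) (hε' : 0 < ε') (hr : M.Radii L s cZ c₀ δ' ε ε' c₁ c₂)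
    (hν : ν = min (min δ δ') (min ε ε')) :
    M.errorProb L T s θhat cZ c₀ δ ε c₁ c₂
      ≤ max 1 (50 * a₁) * Real.exp (-(a₂ * α ^ 2 / 64 / 7) * ((T - L : ℕ) : ℝ)
          * min 1 (min (ν ^ 2) (ν / c₀)) + 2 * s * Real.log (L * M.d))
        + b₁ * M.d * M.maxK * Real.exp (-(b₂ * α ^ 2) * T * min 1 (ν ^ 2)) := by
  have hc₀ : 1 ≤ c₀ := hA.concentrationX.1
  have hν0 : 0 < ν := by rw [hν]; exact lt_min (lt_min hδ hδ') (lt_min hε hε')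
  have hα1 : α ≤ 1 := by
    have : 1 ≤ max 1 (16 * √(a₁ * (2 / a₂ ^ 2 + 1 / a₂))) := le_max_left _ _
    nlinarith
  rcases errorProb_eq_zero_or_regular hA hr hε.le hδ with h0 | h
  · rw [h0]; positivity
  -- The radius √m is the largest one allowed by x ≤ 1, x ≤ ν and x² ≤ ν/c₀, which is how the
  -- minimum in the exponent arises.
  set m := min 1 (min (ν ^ 2) (ν / c₀)) with hm
  have hm0 : 0 < m := lt_min one_pos (lt_min (by positivity) (by positivity))
  have hxm : √m ^ 2 = m := Real.sq_sqrt hm0.le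
  have hx1 : √m ≤ 1 := Real.sqrt_le_one.2 (min_le_left _ _)
  have hxν : √m ≤ ν := Real.sqrt_le_iff.2 ⟨hν0.le, (min_le_right _ _).trans (min_le_left _ _)⟩
  have hxc : √m ^ 2 ≤ ν / c₀ := hxm.le.trans ((min_le_right _ _).trans (min_le_right _ _))
  refine (h.errorProb_le hA ha₁ ha₂ hr hα0 hα hν0
    (hν ▸ (min_le_left _ _).trans (min_le_left _ _))
    (hν ▸ (min_le_left _ _).trans (min_le_right _ _))
    (hν ▸ (min_le_right _ _).trans (min_le_left _ _)) hxν hxc).trans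
    (add_le_add ?_ ?_)
  · refine (h.measureReal_sparseNorm_le hA.boundedCorrelations hA.concentrationX ha₁ ha₂ hα0 hα1
      (Real.sqrt_pos.2 hm0) hx1).trans (le_of_eq ?_)
    rw [hxm, Nat.cast_mul, mul_assoc (-(a₂ * α ^ 2 / 64 / 7))]
  · have hw0 : 0 < min 1 ν := lt_min one_pos hν0
    have hw1 : min 1 ν ≤ 1 := min_le_left _ _
    have hw2 : (min 1 ν) ^ 2 = min 1 (ν ^ 2) := by
      rcases le_total 1 ν with h1 | h1
      · rw [min_eq_left h1, min_eq_left (one_le_pow₀ h1), one_pow]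
      · rw [min_eq_right h1, min_eq_right (pow_le_one₀ hν0.le h1)]
    have hz1 : α * min 1 ν ≤ 1 := mul_le_one₀ hα1 hw0.le hw1
    have hz0 : 0 < α * min 1 ν := by positivity
    refine (hA.concentrationParam (α * min 1 ν) hz0).trans (le_of_eq ?_)
    rw [min_eq_right (a := α * min 1 ν) (by nlinarith), mul_pow, hw2]
    congr 2
    ring

end Model

end

/-! ### The rate at a radius of order √(s log q / N) -/

section

variable {Ω : Type u} [MeasurableSpace Ω] {μ : Measure Ω}

/-- The exponents of the bound at the radius `C₀ √(G / N)`. -/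
theorem exponents_le {A B D E κ C₀ G N T c₀ η H W lq : ℝ} (hA : 0 ≤ A) (hB : 0 < B) (hD : 0 ≤ D)
    (hE : 0 < E) (hκ : 0 < κ) (hC₀ : C₀ = 1 + 3 / B + 3 * √κ / B + (κ + 1) / E) (hG : 0 < G)
    (hN : 0 < N) (hNT : N ≤ T) (hc₀ : 1 ≤ c₀) (h1 : C₀ ^ 2 * G ≤ N) (h2 : c₀ ^ 2 * G ≤ κ * N)
    (hη : η = C₀ * √(G / N)) (hH : H ≤ 2 * G) (hW : W ≤ Real.exp (κ * G))
    (hlq : lq ≤ G) :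
    A * Real.exp (-B * N * min 1 (min (η ^ 2) (η / c₀)) + H)
      + D * W * Real.exp (-E * T * min 1 (η ^ 2)) ≤ (A + D) * Real.exp (-lq) := by
  have hk : 0 < √κ := Real.sqrt_pos.2 hκ
  have p1 : 0 < 3 / B := by positivity
  have p2 : 0 < 3 * √κ / B := by positivity
  have p3 : 0 < (κ + 1) / E := by positivity
  have hC1 : 1 ≤ C₀ := by linarith
  have hCsq : C₀ ≤ C₀ ^ 2 := by nlinarith
  have hη2 : N * η ^ 2 = C₀ ^ 2 * G := by
    rw [hη, mul_pow, Real.sq_sqrt (by positivity)]; field_simp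
  have hη0 : 0 < η := by rw [hη]; positivity
  have hη1 : η ^ 2 ≤ 1 := by
    rw [← mul_le_mul_iff_of_pos_left hN, hη2, mul_one]; exact h1
  have hc0 : 0 < c₀ := by linarith
  -- The condition on c₀² G, with G = s log q, keeps η/c₀ comparable to η², so that the linear part
  -- of the exponent is no obstacle.
  have hcη : c₀ * η ≤ C₀ * √κ := by
    refine abs_le_of_sq_le_sq' ?_ (by positivity) |>.2
    rw [← mul_le_mul_iff_of_pos_left hN]
    calc N * (c₀ * η) ^ 2 = C₀ ^ 2 * (c₀ ^ 2 * G) := by rw [mul_pow]; linarith [congrArg (c₀ ^ 2 * ·) hη2]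
      _ ≤ C₀ ^ 2 * (κ * N) := by gcongr
      _ = N * (C₀ * √κ) ^ 2 := by rw [mul_pow, Real.sq_sqrt hκ.le]; ring
  have hBC1 : 3 ≤ B * C₀ := by
    have : B * (3 / B) = 3 := by field_simp
    nlinarith
  have hBC2 : 3 * √κ ≤ B * C₀ := by
    have : B * (3 * √κ / B) = 3 * √κ := by field_simp
    nlinarith
  have hEC : κ + 1 ≤ E * C₀ ^ 2 := by
    have : E * ((κ + 1) / E) = κ + 1 := by field_simp
    nlinarith
  have e1 : 3 * G ≤ B * N * (η ^ 2) := by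
    calc 3 * G ≤ B * C₀ * G := by gcongr
      _ ≤ B * C₀ ^ 2 * G := by gcongr
      _ = _ := by rw [mul_assoc, ← hη2]; ring
  have e2 : 3 * G ≤ B * N * (η / c₀) := by
    have : 3 * G * (c₀ * η) ≤ B * N * (η ^ 2) := by
      calc 3 * G * (c₀ * η) ≤ 3 * G * (C₀ * √κ) := by gcongr
        _ = 3 * √κ * (C₀ * G) := by ring
        _ ≤ B * C₀ * (C₀ * G) := by gcongr
        _ = B * (N * η ^ 2) := by rw [hη2]; ring
        _ = _ := by ring
    rw [← mul_div_assoc, le_div_iff₀ hc0]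
    refine le_of_mul_le_mul_right ?_ hη0
    linarith
  -- Of the 3G, two pay for the entropy 2s log(Ld) ≤ 2G and one gives the factor 1/q.
  have e3 : 3 * G ≤ B * N * min 1 (min (η ^ 2) (η / c₀)) := by
    rcases min_choice (η ^ 2) (η / c₀) with h | h
    · rw [h, min_eq_right hη1]; exact e1
    · rw [h, min_eq_right (h ▸ (min_le_left _ _).trans hη1)]; exact e2
  -- Here κG pays for the prefactor dK, and G is left over for 1/q.
  have e4 : (κ + 1) * G ≤ E * T * min 1 (η ^ 2) := by
    rw [min_eq_right hη1]
    calc (κ + 1) * G ≤ E * C₀ ^ 2 * G := by gcongr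
      _ = E * N * η ^ 2 := by rw [mul_assoc, ← hη2]; ring
      _ ≤ _ := by gcongr
  have f1 : Real.exp (-B * N * min 1 (min (η ^ 2) (η / c₀)) + H) ≤ Real.exp (-lq) :=
    Real.exp_le_exp.2 (by linarith)
  have f2 : W * Real.exp (-E * T * min 1 (η ^ 2)) ≤ Real.exp (-lq) := by
    calc _ ≤ Real.exp (κ * G) * Real.exp (-E * T * min 1 (η ^ 2)) := by gcongr
      _ ≤ _ := by rw [← Real.exp_add]; exact Real.exp_le_exp.2 (by linarith)
  rw [mul_assoc D, add_mul]
  gcongr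

namespace Model

variable {M : Model μ} {L T s : ℕ} {cZ c₀ c₁ c₂ η q κ C₀ A B D E a₁ a₂ b₁ b₂ : ℝ}
  {θhat : Ω → ∀ i, Fin (M.K i) → ℝ}

theorem Admissible.errorProb_le_rpow [IsProbabilityMeasure μ]
    (hA : M.Admissible L T s cZ c₀ θhat a₁ a₂ b₁ b₂) (hA0 : 0 < A) (hB0 : 0 < B) (hD0 : 0 < D)
    (hE0 : 0 < E)
    (hbound : 0 < η → M.errorProb L T s θhat cZ c₀ η η c₁ c₂
      ≤ A * Real.exp (-B * ((T - L : ℕ) : ℝ) * min 1 (min (η ^ 2) (η / c₀))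
          + 2 * s * Real.log (L * M.d))
        + D * M.d * M.maxK * Real.exp (-E * T * min 1 (η ^ 2)))
    (hκ : 0 < κ) (hC₀ : C₀ = 1 + 3 / B + 3 * √κ / B + (κ + 1) / E) (hq : q = L * (M.d : ℝ) ^ 2)
    (h1 : C₀ ^ 2 * (s * Real.log q) ≤ ((T - L : ℕ) : ℝ))
    (h2 : c₀ ^ 2 * (s * Real.log q) ≤ κ * ((T - L : ℕ) : ℝ))
    (h3 : Real.log (M.d * M.maxK) ≤ κ * (s * Real.log q))
    (hη : η = C₀ * √(s * Real.log q / ((T - L : ℕ) : ℝ))) :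
    M.errorProb L T s θhat cZ c₀ η η c₁ c₂ ≤ (A + D + 1) * q ^ (-1 : ℝ) := by
  have hq0 : 0 ≤ q := by rw [hq]; positivity
  have hR : 0 ≤ (A + D + 1) * q ^ (-1 : ℝ) := by positivity
  rcases isEmpty_or_nonempty (Fin L × Fin M.d) with he | he
  · rw [errorProb_eq_zero_of_sparseNorm fun A => sparseNorm_eq_zero_of_isEmpty s A]
    exact hR
  rcases Nat.eq_zero_or_pos s with rfl | hs
  · rw [errorProb_eq_zero_of_sparseNorm fun A => sparseNorm_eq_zero_of_sparsity_zero A]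
    exact hR
  obtain ⟨a⟩ := he
  have hL1 : (1 : ℝ) ≤ L := by exact_mod_cast a.1.pos
  have hd1 : (1 : ℝ) ≤ M.d := by exact_mod_cast a.2.pos
  have hs1 : (1 : ℝ) ≤ s := by exact_mod_cast hs
  have hLd : (L : ℝ) * M.d ≤ q := by
    rw [hq]
    have : (M.d : ℝ) ≤ (M.d : ℝ) ^ 2 := by nlinarith
    gcongr
  have hLd1 : 1 ≤ (L : ℝ) * M.d := one_le_mul_of_one_le_of_one_le hL1 hd1
  have hq1 : 1 ≤ q := hLd1.trans hLd
  -- For q = 1 the radius η is 0 and the first claim does not apply, but the bound then exceeds 1.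
  rcases hq1.eq_or_lt with rfl | hq2
  · rw [Real.one_rpow, mul_one]
    exact measureReal_le_one.trans (by linarith)
  have hlq : 0 < Real.log q := Real.log_pos hq2
  have hG : 0 < s * Real.log q := by positivity
  have hN : (0 : ℝ) < ((T - L : ℕ) : ℝ) := by
    have := hA.lag_lt
    exact_mod_cast (by omega : 0 < T - L)
  have hη0 : 0 < η := by
    have : 0 < C₀ := by rw [hC₀]; positivity
    rw [hη]; positivity
  have hW : (M.d : ℝ) * M.maxK ≤ Real.exp (κ * (s * Real.log q)) := by
    rcases (by positivity : (0 : ℝ) ≤ (M.d : ℝ) * M.maxK).eq_or_lt with h | h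
    · rw [← h]; exact (Real.exp_pos _).le
    · exact (Real.log_le_iff_le_exp h).1 h3
  have hH : 2 * s * Real.log (L * M.d) ≤ 2 * (s * Real.log q) := by
    rw [mul_assoc]
    gcongr
  have key := exponents_le (lq := Real.log q) hA0.le hB0 hD0.le hE0 hκ hC₀ hG hN
    (Nat.cast_le.2 (Nat.sub_le T L)) hA.concentrationX.1 h1 h2 hη hH hW
    (le_mul_of_one_le_left hlq.le hs1)
  rw [Real.rpow_def_of_pos (by linarith)]
  refine (hbound hη0).trans ?_
  rw [mul_assoc D]
  refine key.trans ?_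
  rw [mul_neg_one]
  exact mul_le_mul_of_nonneg_right (by linarith) (Real.exp_pos _).le

end Model

end

end LatentCount

theorem corollary3p2 (a₁ a₂ b₁ b₂ : ℝ) (ha₁ : 0 < a₁) (ha₂ : 0 < a₂) (hb₁ : 0 < b₁) (hb₂ : 0 < b₂) :
    (∃ c₁₁ c₁₂ c₂₁ c₂₂ : ℝ, 0 < c₁₁ ∧ 0 < c₁₂ ∧ 0 < c₂₁ ∧ 0 < c₂₂ ∧
      ∀ (Ω : Type u) [MeasurableSpace Ω] (μ : Measure Ω) [IsProbabilityMeasure μ]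
        (M : LatentCount.Model μ) (L T s : ℕ) (cZ c₀ : ℝ) (θhat : Ω → ∀ i, Fin (M.K i) → ℝ),
        M.Admissible L T s cZ c₀ θhat a₁ a₂ b₁ b₂ →
        ∀ δ δ' ε ε' c₁ c₂ ν : ℝ, 0 < δ → 0 < δ' → 0 < ε → 0 < ε' →
          M.Radii L s cZ c₀ δ' ε ε' c₁ c₂ →
          ν = min (min δ δ') (min ε ε') →
          M.errorProb L T s θhat cZ c₀ δ ε c₁ c₂
            ≤ c₁₁ * Real.exp (-c₁₂ * ((T - L : ℕ) : ℝ) * min 1 (min (ν ^ 2) (ν / c₀))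
                + 2 * s * Real.log (L * M.d))
              + c₂₁ * M.d * M.maxK * Real.exp (-c₂₂ * T * min 1 (ν ^ 2))) ∧
    (∀ κ : ℝ, 0 < κ → ∃ C₀ C₁ c c' : ℝ, 0 < C₀ ∧ 0 < C₁ ∧ 0 < c ∧ 0 < c' ∧
      ∀ (Ω : Type u) [MeasurableSpace Ω] (μ : Measure Ω) [IsProbabilityMeasure μ]
        (M : LatentCount.Model μ) (L T s : ℕ) (cZ c₀ : ℝ) (θhat : Ω → ∀ i, Fin (M.K i) → ℝ),
        M.Admissible L T s cZ c₀ θhat a₁ a₂ b₁ b₂ →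
        ∀ q η c₁ c₂ : ℝ, q = L * (M.d : ℝ) ^ 2 →
          C₁ * (s * Real.log q) ≤ ((T - L : ℕ) : ℝ) →
          c₀ ^ 2 * (s * Real.log q) ≤ κ * ((T - L : ℕ) : ℝ) →
          Real.log (M.d * M.maxK) ≤ κ * (s * Real.log q) →
          η = C₀ * √(s * Real.log q / ((T - L : ℕ) : ℝ)) →
          M.Radii L s cZ c₀ η η η c₁ c₂ →
          M.errorProb L T s θhat cZ c₀ η η c₁ c₂ ≤ c * q ^ (-c')) := by
  -- This constant comes from the fourth-moment bound for the diagonal; α is its reciprocal up to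
  -- the factor 10⁶ of the deterministic estimate, and so depends on a₁ and a₂ only.
  set C := max 1 (16 * √(a₁ * (2 / a₂ ^ 2 + 1 / a₂))) with hC
  have hC1 : 1 ≤ C := le_max_left _ _
  set α := 1 / (1000000 * C) with hα
  have hα0 : 0 < α := by positivity
  have hαC : 1000000 * C * α = 1 := by rw [hα]; field_simp
  have hB : 0 < a₂ * α ^ 2 / 64 / 7 := by positivity
  have hA : 0 < max 1 (50 * a₁) := by positivity
  have hE : 0 < b₂ * α ^ 2 := by positivity
  -- The factor 64 = 8² is due to the net and 7 to the absorption of its cardinality. In the second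
  -- claim C₁ = C₀² ensures η ≤ 1, and c' = 1.
  refine ⟨⟨max 1 (50 * a₁), a₂ * α ^ 2 / 64 / 7, b₁, b₂ * α ^ 2, hA, hB, hb₁, hE, ?_⟩,
    fun κ hκ => ⟨1 + 3 / (a₂ * α ^ 2 / 64 / 7) + 3 * √κ / (a₂ * α ^ 2 / 64 / 7)
      + (κ + 1) / (b₂ * α ^ 2), (1 + 3 / (a₂ * α ^ 2 / 64 / 7) + 3 * √κ / (a₂ * α ^ 2 / 64 / 7)
      + (κ + 1) / (b₂ * α ^ 2)) ^ 2, max 1 (50 * a₁) + b₁ + 1, 1, by positivity, by positivity,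
      by positivity, one_pos, ?_⟩⟩
  · intro Ω _ μ _ M L T s cZ c₀ θhat hM δ δ' ε ε' c₁ c₂ ν hδ hδ' hε hε' hr hν
    exact hM.errorProb_le ha₁ ha₂ hb₁ hα0 hαC hδ hδ' hε hε' hr hν
  · intro Ω _ μ _ M L T s cZ c₀ θhat hM q η c₁ c₂ hq h1 h2 h3 hη hr
    exact hM.errorProb_le_rpow hA hB hb₁ hE
      (fun h0 => hM.errorProb_le ha₁ ha₂ hb₁ hα0 hαC h0 h0 h0 h0 hr (by simp))
      hκ rfl hq h1 h2 h3 hη
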